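/- Let $T[1..n]$ be a text over an integer alphabet with a non-empty prefix $R=T[1..\ell]$, and let the relative Lempel–Ziv (RLZ) parse of $T[\ell+1..n]$ with respect to $R$ be given: the greedy parse into $z'$ longest possible phrases that occur in $R$, each stored as its length and the position of its leftmost occurrence in $R$. Call a position $b$ of $T$ an RLZ phrase boundary if a phrase of the LZ77 parse of $R$ or one of these $z'$ phrases ends at $b$. (The LZ77 parse of $R$ is the partition in which each phrase $R[i..j]$ does not occur in $R[1..j-1]$, except possibly the last phrase, while its longest proper prefix $R[i..j-1]$ is empty or occurs in $R[1..j-2]$.) For a prime $p$ and $x\in\{0,\dots,p-1\}$ let $h_{p,x}(U)=\sum_{j=1}^{|U|}U[j]\,x^{|U|-j} \bmod p$ be the Karp–Rabin hash of a string $U$. There are constants $k, C$ and two fixed word-RAM programs, for building and for querying, such that the following holds for all such $T$, $R$ and RLZ parses, every prime $p\ge n$ that exceeds all characters, and every word length $w$ with $p^{C}\le 2^{w}$ (so that $w=\Theta(\log n)$ is allowed if $p=n^{O(1)}$). (1) For every base $x\in\{0,\dots,p-1\}$, given $R$, the RLZ parse of $T[\ell+1..n]$, $p$ and $x$, the first program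 builds an index in at most $(\ell+z')\cdot C(\lfloor\log_2 n\rfloor+1)^{C}=(\ell+z')\,\mathrm{polylog}(n)$ time. Its whole writable memory, which is also the index that it leaves, consists of $k$ arrays of $C(\ell+z')$ words, that is, $O(\ell+z')$ words of workspace and of index space. (2) Let $P[1..m]$ be any pattern with characters below $p$ and $m<2^w$, split into $P[1..i]$ and $P[i+1..m]$, $0\le i\le m$. Suppose that the query program is given read-only random access to the index, to $m$, $i$ and $P$, and to the Karp–Rabin hashes (with the same $p$, $x$) of $P[1..i]$ and $P[i+1..m]$ and of their prefixes. Then, for every $x$, it halts in at most $C(\lfloor\log_2 n\rfloor+1)^{C}=\mathrm{polylog}(n)$ time, and for all but at most $C n^{C}$ of the $p$ bases $x$ (hence with probability at least $1-Cn^{C}/p$ over a uniformly random $x$, which is high probability if $p$ is a sufficiently large power of $n$) it reports the leftmost starting position $s$ of an occurrence of $P$ in $T$ for which $s+i-1$ is an RLZ phrase boundary, i.e. which an RLZ phrase boundary splits into $P[1..i]$ and $P[i+1..m]$, or correctly reports that no such occurrence exists. -/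

import Mathlib

namespace RLZ

/-! ## Strings, occurrences, parses

Strings are lists of natural numbers (an integer alphabet); positions are counted from `1`. -/

/-- The substring `V[i..j]` (empty if `j < i`). -/
def factor (V : List ℕ) (i j : ℕ) : List ℕ :=
  (V.take j).drop (i - 1)

/-- `U` occurs in `V` with starting position `s`. -/
def OccursAt (V U : List ℕ) (s : ℕ) : Prop :=
  1 ≤ s ∧ s + U.length ≤ V.length + 1 ∧ factor V s (s + U.length - 1) = U

/-- `U` occurs in `V`. -/
def Occurs (V U : List ℕ) : Prop :=
  ∃ s, OccursAt V U s

/-- `R[i..j]` is the LZ77 phrase of `R` starting at position `i`: it does not occur in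
`R[1..j-1]`, but its longest proper prefix is empty or occurs in `R[1..j-2]` (overlaps with the
phrase are allowed).  As usual only the last phrase of the parse may fail to be a new string,
because the text ends. -/
def IsLZ77Phrase (R : List ℕ) (i j : ℕ) : Prop :=
  1 ≤ i ∧ i ≤ j ∧ j ≤ R.length ∧
    (i < j → Occurs (factor R 1 (j - 2)) (factor R i (j - 1))) ∧
    (¬ Occurs (factor R 1 (j - 1)) (factor R i j) ∨ j = R.length)

/-- The starting positions of the phrases of the LZ77 parse of `R` (and `|R| + 1`, where the
parse is complete). -/
inductive LZ77Start (R : List ℕ) : ℕ → Prop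
  | first : LZ77Start R 1
  | next {i j : ℕ} : LZ77Start R i → IsLZ77Phrase R i j → LZ77Start R (j + 1)

/-- Some phrase of the LZ77 parse of `R` ends at position `b`. -/
def LZ77End (R : List ℕ) (b : ℕ) : Prop :=
  ∃ i, LZ77Start R i ∧ IsLZ77Phrase R i b

/-- `Z` is the relative Lempel-Ziv parse of the given string with respect to `R`: a greedy parse
into longest possible phrases that occur in `R`, each stored as its length and the position of
its leftmost occurrence in `R`. -/
def IsRLZParse (R : List ℕ) : List ℕ → List (ℕ × ℕ) → Prop
  | S, [] => S = []
  | S, (len, pos) :: Z =>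
      1 ≤ len ∧ len ≤ S.length ∧ IsLeast {s | OccursAt R (S.take len) s} pos ∧
        (len = S.length ∨ ¬ Occurs R (S.take (len + 1))) ∧
        IsRLZParse R (S.drop len) Z

/-- `b` is the end of a phrase of the combined parse of the whole text: the LZ77 parse of `R`
followed by the relative Lempel-Ziv parse `Z` of the rest. -/
def IsBoundary (R : List ℕ) (Z : List (ℕ × ℕ)) (b : ℕ) : Prop :=
  LZ77End R b ∨
    ∃ k, 1 ≤ k ∧ k ≤ Z.length ∧ b = R.length + ((Z.take k).map Prod.fst).sum

/-- `P` occurs in `T` at position `s`, and a phrase boundary splits this occurrence into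
`P[1..i]` and `P[i+1..m]`. -/
def SplitOccursAt (R S : List ℕ) (Z : List (ℕ × ℕ)) (P : List ℕ) (i s : ℕ) : Prop :=
  OccursAt (R ++ S) P s ∧ IsBoundary R Z (s + i - 1)

/-- `out` is the leftmost position of an occurrence of `P` split after `i` characters by a phrase
boundary; `out = 0` reports that there is none. -/
def IsAnswer (R S : List ℕ) (Z : List (ℕ × ℕ)) (P : List ℕ) (i out : ℕ) : Prop :=
  (out = 0 ∧ ∀ s, ¬ SplitOccursAt R S Z P i s) ∨
    IsLeast {s | SplitOccursAt R S Z P i s} out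

/-- The Karp-Rabin hash `(∑ j, U[j] * x ^ (|U| - j)) mod p`. -/
def krHash (p x : ℕ) (U : List ℕ) : ℕ :=
  U.foldl (fun h c => (h * x + c) % p) 0

/-- The Karp-Rabin hashes of all prefixes of `U`, from the empty one to `U` itself. -/
def krPrefixHashes (p x : ℕ) (U : List ℕ) : List ℕ :=
  (List.range (U.length + 1)).map fun j => krHash p x (U.take j)

/-! ## A word RAM

Programs are fixed finite while-programs over word registers, read-only input arrays and writable
memory arrays; the names of registers and arrays are literals of the program, so a program
uses constantly many of them.  A word is a number below `2 ^ w`. -/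

/-- The word operations, each of unit cost. -/
inductive BinOp
  | add | sub | mul | div | mod | lt | eq | and | or | xor | shl | shr

def BinOp.eval (w : ℕ) : BinOp → ℕ → ℕ → ℕ
  | .add, a, b => (a + b) % 2 ^ w
  | .sub, a, b => (a + (2 ^ w - b % 2 ^ w)) % 2 ^ w
  | .mul, a, b => (a * b) % 2 ^ w
  | .div, a, b => a / b
  | .mod, a, b => a % b
  | .lt, a, b => if a < b then 1 else 0
  | .eq, a, b => if a = b then 1 else 0
  | .and, a, b => a &&& b
  | .or, a, b => a ||| b
  | .xor, a, b => a ^^^ b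
  | .shl, a, b => (a <<< b) % 2 ^ w
  | .shr, a, b => a >>> b

inductive Expr
  | const (c : ℕ)
  | reg (r : ℕ)
  /-- a cell of a read-only input array -/
  | input (a : ℕ) (e : Expr)
  /-- a cell of a writable memory array -/
  | mem (a : ℕ) (e : Expr)
  | bin (o : BinOp) (e₁ e₂ : Expr)

inductive Cmd
  | skip
  | assign (r : ℕ) (e : Expr)
  | store (a : ℕ) (e₁ e₂ : Expr)
  | seq (c₁ c₂ : Cmd)
  | ite (e : Expr) (c₁ c₂ : Cmd)
  | while (e : Expr) (c : Cmd)

/-- The word length, the read-only inputs, and the available writable memory: `arrays` arrays of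
`cells` words each. -/
structure Machine where
  w : ℕ
  input : ℕ → List ℕ
  arrays : ℕ
  cells : ℕ

structure State where
  reg : ℕ → ℕ
  mem : ℕ → ℕ → ℕ

/-- All registers and the writable memory are zero. -/
def State.init : State :=
  ⟨fun _ => 0, fun _ _ => 0⟩

def State.setReg (s : State) (r v : ℕ) : State :=
  ⟨Function.update s.reg r v, s.mem⟩

def State.setMem (s : State) (a i v : ℕ) : State :=
  ⟨s.reg, Function.update s.mem a (Function.update (s.mem a) i v)⟩

/-- The value of an expression; there is none if it accesses a cell that does not exist. -/
def Expr.eval (M : Machine) (s : State) : Expr → Option ℕ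
  | .const c => some (c % 2 ^ M.w)
  | .reg r => some (s.reg r)
  | .input a e => (e.eval M s).bind fun i => (M.input a)[i]?
  | .mem a e => (e.eval M s).bind fun i =>
      if a < M.arrays ∧ i < M.cells then some (s.mem a i) else none
  | .bin o e₁ e₂ => (e₁.eval M s).bind fun v₁ => (e₂.eval M s).map fun v₂ => o.eval M.w v₁ v₂

/-- The evaluation time of an expression: the number of its operations. -/
def Expr.cost : Expr → ℕ
  | .const _ => 1
  | .reg _ => 1
  | .input _ e => e.cost + 1
  | .mem _ e => e.cost + 1
  | .bin _ e₁ e₂ => e₁.cost + e₂.cost + 1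

/-- `Exec M c s t s'`: started in state `s` on machine `M`, the program `c` halts after `t` steps
in state `s'`, without ever accessing a cell that does not exist. -/
inductive Exec (M : Machine) : Cmd → State → ℕ → State → Prop
  | skip (s : State) : Exec M .skip s 1 s
  | assign {r : ℕ} {e : Expr} {s : State} {v : ℕ} :
      e.eval M s = some v → Exec M (.assign r e) s (e.cost + 1) (s.setReg r v)
  | store {a : ℕ} {e₁ e₂ : Expr} {s : State} {i v : ℕ} :
      e₁.eval M s = some i → e₂.eval M s = some v → a < M.arrays → i < M.cells →
      Exec M (.store a e₁ e₂) s (e₁.cost + e₂.cost + 1) (s.setMem a i v)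
  | seq {c₁ c₂ : Cmd} {s s' s'' : State} {t₁ t₂ : ℕ} :
      Exec M c₁ s t₁ s' → Exec M c₂ s' t₂ s'' → Exec M (.seq c₁ c₂) s (t₁ + t₂ + 1) s''
  | iteTrue {e : Expr} {c₁ c₂ : Cmd} {s s' : State} {v t : ℕ} :
      e.eval M s = some v → v ≠ 0 → Exec M c₁ s t s' →
      Exec M (.ite e c₁ c₂) s (e.cost + t + 1) s'
  | iteFalse {e : Expr} {c₁ c₂ : Cmd} {s s' : State} {t : ℕ} :
      e.eval M s = some 0 → Exec M c₂ s t s' →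
      Exec M (.ite e c₁ c₂) s (e.cost + t + 1) s'
  | whileTrue {e : Expr} {c : Cmd} {s s' s'' : State} {v t₁ t₂ : ℕ} :
      e.eval M s = some v → v ≠ 0 → Exec M c s t₁ s' → Exec M (.while e c) s' t₂ s'' →
      Exec M (.while e c) s (e.cost + t₁ + t₂ + 1) s''
  | whileFalse {e : Expr} {c : Cmd} {s : State} :
      e.eval M s = some 0 → Exec M (.while e c) s (e.cost + 1) s

/-! ## Building and querying an index -/

/-- The whole writable memory of `M`, as a family of arrays. -/
def State.dump (M : Machine) (s : State) (a : ℕ) : List ℕ :=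
  if a < M.arrays then (List.range M.cells).map (s.mem a) else []

/-- The program `c` halts on `M` after `t` steps and leaves the memory contents `I`. -/
def Builds (M : Machine) (c : Cmd) (t : ℕ) (I : ℕ → List ℕ) : Prop :=
  ∃ s, Exec M c State.init t s ∧ I = s.dump M

/-- The program `c` halts on `M` after `t` steps with `out` in register `0`. -/
def Returns (M : Machine) (c : Cmd) (t out : ℕ) : Prop :=
  ∃ s, Exec M c State.init t s ∧ s.reg 0 = out

/-- The input of the construction: `ℓ`, `z'`, the parameters `p`, `x` of the Karp-Rabin hash
function, the reference `R`, and the lengths and positions of the phrases. -/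
def buildInput (R : List ℕ) (Z : List (ℕ × ℕ)) (p x : ℕ) : ℕ → List ℕ
  | 0 => [R.length, Z.length, p, x]
  | 1 => R
  | 2 => Z.map Prod.fst
  | 3 => Z.map Prod.snd
  | _ => []

/-- The input of a query: the index `I` (read-only), the pattern `P` with the split point `i`, the
Karp-Rabin hashes of `P[1..i]` and `P[i+1..m]`, and those of the prefixes of these two parts. -/
def queryInput (I : ℕ → List ℕ) (P : List ℕ) (i p x : ℕ) : ℕ → List ℕ
  | 0 => [P.length, i, krHash p x (P.take i), krHash p x (P.drop i)]
  | 1 => P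
  | 2 => krPrefixHashes p x (P.take i)
  | 3 => krPrefixHashes p x (P.drop i)
  | a + 4 => I a

/-- The function `C * (log n) ^ C`; `1` is added to the logarithm so that it is positive. -/
def polylog (C n : ℕ) : ℕ :=
  C * (Nat.log 2 n + 1) ^ C

end RLZ

set_option linter.unusedSimpArgs false
set_option linter.unusedVariables false

namespace RLZ

/-! ## A program logic for the word RAM -/

/-! Take as items the positions `0, …, ℓ` of the reference together with the ends of the `z'` RLZ
phrases. There are `N = ℓ + z' + 1` items, so linear space means constantly many words per item.
Between an item and the next one, the text is a copy of a piece of `R` (`Env.WF.src_eq`). Hence the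
hash of any prefix of `T` follows from three stored hashes (`krHash_take_of_sub_eq`), once a binary
search has found the last item before its end. Substring hashes, longest common prefixes, and
comparisons of suffixes and of reversed prefixes then take polylogarithmic time.

The items are sorted by the suffixes that start there (direction `0`) and by the reversed prefixes
that end there (direction `1`). The suffix order also yields the LZ77 parse of `R`: the longest
earlier match of a position is attained at one of its two neighbours in suffix order among the
smaller items. Deleting the items from a doubly linked list, largest first, exposes these neighbours
(`IsNext.unlink`, `Clean.le_lpf_iff`), and greedy jumps give the phrase ends (`lz77End_iff`).

Every item becomes a grid point: its rank among reversed prefixes, its rank among suffixes, and as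
value its own number if it is a boundary, or `N` otherwise. The items matching `P[1..i]` to the left
and `P[i+1..m]` to the right form a rectangle (`Clean.rect_iff`), found by binary searches.
Positions increase with item numbers, so the least value in the rectangle is the leftmost answer
(`Clean.isAnswer`).

Rectangle minima come from a wavelet tree in linear space. A level stores sampled counts of zeros,
its bits packed into words by blocks of logarithmic length, and a segment tree over the block
minima. Inside a block the values are not stored; each is recovered by a descent to the bottom
level.

The programs are specified by what the hashes say (`Env.lcp`, `Env.le`, `Env.below`), never by the
strings. So halting, time and legal memory access hold for every base. The meaning of the answer
needs `Clean`: equal hashes identify equal strings among those compared. Two different strings of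
the same length collide only at roots of a nonzero polynomial of at most that degree, so summing
over all pairs, lengths and directions bounds the exceptional bases (`ncard_not_clean_le`).

Time is bounded statically. Each loop is granted `I` (logarithmic) iterations, or `max I J` (linear)
ones if marked as long. The construction never nests two long loops, and a query is run with `J =
I`. -/

def Machine.cap (M : Machine) : ℕ := 2 ^ M.w

theorem Machine.cap_eq (M : Machine) : M.cap = 2 ^ M.w := rfl

/-- The exact arithmetic meaning of an operation, without reduction modulo the word size. -/
def BinOp.sem : BinOp → ℕ → ℕ → ℕ
  | .add, a, b => a + b
  | .sub, a, b => a - b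
  | .mul, a, b => a * b
  | .div, a, b => a / b
  | .mod, a, b => a % b
  | .lt, a, b => if a < b then 1 else 0
  | .eq, a, b => if a = b then 1 else 0
  | .and, a, b => a &&& b
  | .or, a, b => a ||| b
  | .xor, a, b => a ^^^ b
  | .shl, a, b => a * 2 ^ b
  | .shr, a, b => a / 2 ^ b

/-- The condition under which an operation on words is exact. -/
def BinOp.Safe (W : ℕ) : BinOp → ℕ → ℕ → Prop
  | .add, a, b => a + b < W
  | .sub, a, b => b ≤ a ∧ a < W
  | .mul, a, b => a * b < W
  | .shl, a, b => a * 2 ^ b < W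
  | _, _, _ => True

theorem BinOp.eval_eq_sem {w : ℕ} {o : BinOp} {a b : ℕ} (h : o.Safe (2 ^ w) a b) :
    o.eval w a b = o.sem a b := by
  cases o <;> simp only [BinOp.eval, BinOp.sem, BinOp.Safe] at h ⊢
  · exact Nat.mod_eq_of_lt h
  · rw [Nat.mod_eq_of_lt (lt_of_le_of_lt h.1 h.2)]
    have : a + (2 ^ w - b) = (a - b) + 2 ^ w := by omega
    rw [this, Nat.add_mod_right, Nat.mod_eq_of_lt (by omega)]
  · exact Nat.mod_eq_of_lt h
  · rw [Nat.shiftLeft_eq]; exact Nat.mod_eq_of_lt h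
  · exact Nat.shiftRight_eq_div_pow _ _

/-- The value of an expression in exact arithmetic. -/
def Expr.val (M : Machine) (s : State) : Expr → ℕ
  | .const c => c
  | .reg r => s.reg r
  | .input a e => (M.input a).getD (e.val M s) 0
  | .mem a e => s.mem a (e.val M s)
  | .bin o e₁ e₂ => o.sem (e₁.val M s) (e₂.val M s)

/-- All operations of an expression are exact and all its accesses are legal. -/
def Expr.Ok (M : Machine) (s : State) : Expr → Prop
  | .const c => c < M.cap
  | .reg _ => True
  | .input a e => e.Ok M s ∧ e.val M s < (M.input a).length
  | .mem a e => e.Ok M s ∧ a < M.arrays ∧ e.val M s < M.cells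
  | .bin o e₁ e₂ => e₁.Ok M s ∧ e₂.Ok M s ∧ o.Safe M.cap (e₁.val M s) (e₂.val M s)

theorem Expr.eval_eq {M : Machine} {s : State} {e : Expr} (h : e.Ok M s) :
    e.eval M s = some (e.val M s) := by
  induction e with
  | const c => simp only [Expr.Ok, Machine.cap_eq] at h; simp [Expr.eval, Expr.val, Nat.mod_eq_of_lt h]
  | reg r => rfl
  | input a e ih =>
    simp only [Expr.Ok] at h
    simp [Expr.eval, Expr.val, ih h.1, List.getD, h.2]
  | mem a e ih =>
    simp only [Expr.Ok] at h
    simp [Expr.eval, Expr.val, ih h.1, h.2.1, h.2.2]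
  | bin o e₁ e₂ ih₁ ih₂ =>
    simp only [Expr.Ok, Machine.cap_eq] at h
    simp [Expr.eval, Expr.val, ih₁ h.1, ih₂ h.2.1, BinOp.eval_eq_sem h.2.2]

/-- The expression evaluates legally and exactly to `v`. -/
def Expr.Ev (M : Machine) (s : State) (e : Expr) (v : ℕ) : Prop :=
  e.Ok M s ∧ e.val M s = v

theorem Expr.Ev.eval {M : Machine} {s : State} {e : Expr} {v : ℕ} (h : e.Ev M s v) :
    e.eval M s = some v := by rw [Expr.eval_eq h.1, h.2]

/-! ### Static time bounds -/

/-- Loops that compare with a register from `220` on are the long ones. -/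
def Expr.isBig : Expr → Bool
  | .bin .lt _ (.reg r) => decide (220 ≤ r)
  | _ => false

/-- The number of iterations that is granted to a loop. -/
def iters (I J : ℕ) (e : Expr) : ℕ := if e.isBig then max I J else I

theorem le_iters {I J n : ℕ} {e : Expr} (h : n ≤ I) : n ≤ iters I J e := by
  unfold iters; split <;> omega

/-- A time bound if every loop keeps to its number of iterations. -/
def Cmd.costB (I J : ℕ) : Cmd → ℕ
  | .skip => 1
  | .assign _ e => e.cost + 1
  | .store _ e₁ e₂ => e₁.cost + e₂.cost + 1
  | .seq c₁ c₂ => c₁.costB I J + c₂.costB I J + 1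
  | .ite e c₁ c₂ => e.cost + (c₁.costB I J + c₂.costB I J) + 1
  | .while e c => (iters I J e + 1) * (e.cost + c.costB I J + 1)

/-- Every loop body is counted once, so this depends on the program alone; it is the constant factor
in `Cmd.costB_le`. -/
def Cmd.size : Cmd → ℕ
  | .skip => 1
  | .assign _ e => e.cost + 1
  | .store _ e₁ e₂ => e₁.cost + e₂.cost + 1
  | .seq c₁ c₂ => c₁.size + c₂.size + 1
  | .ite e c₁ c₂ => e.cost + (c₁.size + c₂.size) + 1
  | .while e c => e.cost + c.size + 1

/-- Only short loops count here, long ones count in `Cmd.bigDepth`, so that the two iteration bounds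
get separate exponents. -/
def Cmd.depth : Cmd → ℕ
  | .seq c₁ c₂ => max c₁.depth c₂.depth
  | .ite _ c₁ c₂ => max c₁.depth c₂.depth
  | .while e c => if e.isBig then c.depth else c.depth + 1
  | _ => 0

def Cmd.bigDepth : Cmd → ℕ
  | .seq c₁ c₂ => max c₁.bigDepth c₂.bigDepth
  | .ite _ c₁ c₂ => max c₁.bigDepth c₂.bigDepth
  | .while e c => if e.isBig then c.bigDepth + 1 else c.bigDepth
  | _ => 0

/-- A loop multiplies the bound of its body by `I + 1` or `max I J + 1`; all other constructs add.
For a fixed program the exponents are constants, and `bigDepth = 1` makes the bound linear in `max I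
J + 1`. -/
theorem Cmd.costB_le {I J : ℕ} (c : Cmd) :
    c.costB I J ≤ c.size * ((I + 1) ^ c.depth * (max I J + 1) ^ c.bigDepth) := by
  have pos : ∀ a b : ℕ, 1 ≤ (I + 1) ^ a * (max I J + 1) ^ b := fun a b =>
    Nat.mul_pos (by positivity) (by positivity)
  have mono : ∀ a b a' b' : ℕ, a ≤ a' → b ≤ b' →
      (I + 1) ^ a * (max I J + 1) ^ b ≤ (I + 1) ^ a' * (max I J + 1) ^ b' := fun a b a' b' h h' =>
    Nat.mul_le_mul (Nat.pow_le_pow_right (by omega) h) (Nat.pow_le_pow_right (by omega) h')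
  induction c with
  | skip => simp [costB, size, depth, bigDepth]
  | assign r e => simp [costB, size, depth, bigDepth]
  | store a e₁ e₂ => simp [costB, size, depth, bigDepth]
  | seq c₁ c₂ ih₁ ih₂ =>
    simp only [costB, size, depth, bigDepth]
    have h₁ := ih₁.trans (Nat.mul_le_mul_left _ (mono _ _ _ _ (le_max_left c₁.depth c₂.depth)
      (le_max_left c₁.bigDepth c₂.bigDepth)))
    have h₂ := ih₂.trans (Nat.mul_le_mul_left _ (mono _ _ _ _ (le_max_right c₁.depth c₂.depth)
      (le_max_right c₁.bigDepth c₂.bigDepth)))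
    have h₃ := pos (max c₁.depth c₂.depth) (max c₁.bigDepth c₂.bigDepth)
    rw [add_mul, add_mul]; omega
  | ite e c₁ c₂ ih₁ ih₂ =>
    simp only [costB, size, depth, bigDepth]
    have h₁ := ih₁.trans (Nat.mul_le_mul_left _ (mono _ _ _ _ (le_max_left c₁.depth c₂.depth)
      (le_max_left c₁.bigDepth c₂.bigDepth)))
    have h₂ := ih₂.trans (Nat.mul_le_mul_left _ (mono _ _ _ _ (le_max_right c₁.depth c₂.depth)
      (le_max_right c₁.bigDepth c₂.bigDepth)))
    have h₃ := pos (max c₁.depth c₂.depth) (max c₁.bigDepth c₂.bigDepth)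
    have h₄ := Nat.mul_le_mul_left e.cost h₃
    rw [add_mul, add_mul, add_mul]; omega
  | _ e c ih =>
    simp only [costB, size, depth, bigDepth]
    have h₃ := pos c.depth c.bigDepth
    have h₄ := Nat.mul_le_mul_left e.cost h₃
    have h₅ : e.cost + c.costB I J + 1 ≤
        (e.cost + c.size + 1) * ((I + 1) ^ c.depth * (max I J + 1) ^ c.bigDepth) := by
      rw [add_mul, add_mul]; omega
    by_cases hb : e.isBig
    · simp only [hb, if_true, iters]
      refine (Nat.mul_le_mul_left _ h₅).trans (le_of_eq ?_)
      ring
    · simp only [hb, iters]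
      refine (Nat.mul_le_mul_left _ h₅).trans (le_of_eq ?_)
      simp only [Bool.false_eq_true, if_false]
      ring

/-! ### Frames and proof rules -/

/-- A bound above all registers that a program writes. -/
def Cmd.top : Cmd → ℕ
  | .assign r _ => r + 1
  | .seq c₁ c₂ => max c₁.top c₂.top
  | .ite _ c₁ c₂ => max c₁.top c₂.top
  | .while _ c => c.top
  | _ => 0

/-- The program has no store to the array `a`. -/
def Cmd.keeps (a : ℕ) : Cmd → Bool
  | .store b _ _ => b != a
  | .seq c₁ c₂ => c₁.keeps a && c₂.keeps a
  | .ite _ c₁ c₂ => c₁.keeps a && c₂.keeps a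
  | .while _ c => c.keeps a
  | _ => true

/-- What a program leaves unchanged. -/
structure Frame (c : Cmd) (s s' : State) : Prop where
  reg : ∀ r, c.top ≤ r → s'.reg r = s.reg r
  mem : ∀ a, c.keeps a = true → s'.mem a = s.mem a

/-- Subroutines write low-numbered registers and their callers keep data in higher ones. With this
convention, that other state is untouched is a syntactic computation rather than a clause of every
specification. -/
theorem Exec.frame {M : Machine} {c : Cmd} {s s' : State} {t : ℕ} (h : Exec M c s t s') :
    Frame c s s' := by
  induction h with
  | skip s => exact ⟨fun _ _ => rfl, fun _ _ => rfl⟩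
  | assign he =>
    refine ⟨fun r hr => ?_, fun _ _ => rfl⟩
    simp only [Cmd.top] at hr
    simp only [State.setReg]
    rw [Function.update_of_ne (by omega)]
  | store h₁ h₂ h₃ h₄ =>
    refine ⟨fun r hr => rfl, fun b hb => ?_⟩
    simp only [Cmd.keeps, bne_iff_ne, ne_eq] at hb
    simp only [State.setMem]
    rw [Function.update_of_ne (Ne.symm hb)]
  | seq _ _ ih₁ ih₂ =>
    refine ⟨fun r hr => ?_, fun b hb => ?_⟩
    · simp only [Cmd.top, max_le_iff] at hr
      rw [ih₂.reg r hr.2, ih₁.reg r hr.1]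
    · simp only [Cmd.keeps, Bool.and_eq_true] at hb
      rw [ih₂.mem b hb.2, ih₁.mem b hb.1]
  | iteTrue _ _ _ ih =>
    refine ⟨fun r hr => ?_, fun b hb => ?_⟩
    · simp only [Cmd.top, max_le_iff] at hr
      exact ih.reg r hr.1
    · simp only [Cmd.keeps, Bool.and_eq_true] at hb
      exact ih.mem b hb.1
  | iteFalse _ _ ih =>
    refine ⟨fun r hr => ?_, fun b hb => ?_⟩
    · simp only [Cmd.top, max_le_iff] at hr
      exact ih.reg r hr.2
    · simp only [Cmd.keeps, Bool.and_eq_true] at hb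
      exact ih.mem b hb.2
  | whileTrue _ _ _ _ ih₁ ih₂ =>
    refine ⟨fun r hr => ?_, fun b hb => ?_⟩
    · rw [ih₂.reg r hr]; exact ih₁.reg r hr
    · rw [ih₂.mem b hb]; exact ih₁.mem b hb
  | whileFalse _ => exact ⟨fun _ _ => rfl, fun _ _ => rfl⟩

theorem Frame.trans {c : Cmd} {s s' s'' : State} (h : Frame c s s') (h' : Frame c s' s'') :
    Frame c s s'' :=
  ⟨fun r hr => (h'.reg r hr).trans (h.reg r hr), fun a ha => (h'.mem a ha).trans (h.mem a ha)⟩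

/-- The program halts within its time bound in a state that satisfies `Q`. -/
def Runs (M : Machine) (I J : ℕ) (c : Cmd) (s : State) (Q : State → Prop) : Prop :=
  ∃ t s', Exec M c s t s' ∧ t ≤ c.costB I J ∧ Q s'

section Rules

variable {M : Machine} {I J : ℕ} {s : State} {Q : State → Prop}

/-- The frame is handed to the continuation, so a specification only has to describe what the
program computes. -/
theorem Runs.mono {c : Cmd} {Q' : State → Prop} (h : Runs M I J c s Q')
    (h' : ∀ s', Q' s' → Frame c s s' → Q s') : Runs M I J c s Q := by
  obtain ⟨t, s', h₁, h₂, h₃⟩ := h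
  exact ⟨t, s', h₁, h₂, h' _ h₃ h₁.frame⟩

theorem Runs.skip (h : Q s) : Runs M I J .skip s Q := ⟨1, s, .skip s, le_rfl, h⟩

theorem Runs.assign {r : ℕ} {e : Expr} (v : ℕ) (he : e.Ev M s v) (h : Q (s.setReg r v)) :
    Runs M I J (.assign r e) s Q := ⟨_, _, .assign he.eval, le_rfl, h⟩

theorem Runs.store {a : ℕ} {e₁ e₂ : Expr} (i v : ℕ) (h₁ : e₁.Ev M s i) (h₂ : e₂.Ev M s v)
    (ha : a < M.arrays) (hi : i < M.cells) (h : Q (s.setMem a i v)) :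
    Runs M I J (.store a e₁ e₂) s Q := ⟨_, _, .store h₁.eval h₂.eval ha hi, le_rfl, h⟩

theorem Runs.seq {c₁ c₂ : Cmd} {Q' : State → Prop} (h₁ : Runs M I J c₁ s Q')
    (h₂ : ∀ s', Q' s' → Frame c₁ s s' → Runs M I J c₂ s' Q) : Runs M I J (.seq c₁ c₂) s Q := by
  obtain ⟨t, s', e₁, b₁, q₁⟩ := h₁
  obtain ⟨t', s'', e₂, b₂, q₂⟩ := h₂ _ q₁ e₁.frame
  exact ⟨_, _, .seq e₁ e₂, by simp only [Cmd.costB]; omega, q₂⟩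

theorem Runs.set {r : ℕ} {e : Expr} {c : Cmd} (v : ℕ) (he : e.Ev M s v)
    (h : Runs M I J c (s.setReg r v) Q) : Runs M I J (.seq (.assign r e) c) s Q := by
  refine Runs.seq (Q' := fun s' => s' = s.setReg r v) (Runs.assign v he rfl) ?_
  rintro _ rfl _; exact h

theorem Runs.put {a : ℕ} {e₁ e₂ : Expr} {c : Cmd} (i v : ℕ) (h₁ : e₁.Ev M s i)
    (h₂ : e₂.Ev M s v) (ha : a < M.arrays) (hi : i < M.cells)
    (h : Runs M I J c (s.setMem a i v) Q) : Runs M I J (.seq (.store a e₁ e₂) c) s Q := by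
  refine Runs.seq (Q' := fun s' => s' = s.setMem a i v) (Runs.store i v h₁ h₂ ha hi rfl) ?_
  rintro _ rfl _; exact h

theorem Runs.ite {e : Expr} {c₁ c₂ : Cmd} (ho : e.Ok M s)
    (h₁ : e.val M s ≠ 0 → Runs M I J c₁ s Q) (h₂ : e.val M s = 0 → Runs M I J c₂ s Q) :
    Runs M I J (.ite e c₁ c₂) s Q := by
  by_cases hv : e.val M s = 0
  · obtain ⟨t, s', e₁, b₁, q₁⟩ := h₂ hv
    exact ⟨_, _, .iteFalse (by rw [Expr.eval_eq ho, hv]) e₁, by simp only [Cmd.costB]; omega, q₁⟩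
  · obtain ⟨t, s', e₁, b₁, q₁⟩ := h₁ hv
    exact ⟨_, _, .iteTrue (Expr.eval_eq ho) hv e₁, by simp only [Cmd.costB]; omega, q₁⟩

/-- The number of iterations is fixed in advance and indexes the invariant, so termination and the
time bound come from the same counter. -/
theorem Runs.while {e : Expr} {c : Cmd} (n : ℕ) (hn : n ≤ iters I J e)
    (Inv : ℕ → State → Prop) (h0 : Inv 0 s)
    (hstep : ∀ k < n, ∀ s', Inv k s' → Frame c s s' →
      e.Ok M s' ∧ e.val M s' ≠ 0 ∧ Runs M I J c s' (Inv (k + 1)))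
    (hend : ∀ s', Inv n s' → Frame c s s' → e.Ok M s' ∧ e.val M s' = 0 ∧ Q s') :
    Runs M I J (.while e c) s Q := by
  -- Induction on the number `d` of remaining iterations, with the frame relative to the initial
  -- state carried along.
  have key : ∀ d k, k + d = n → ∀ s', Inv k s' → Frame c s s' →
      ∃ t s'', Exec M (.while e c) s' t s'' ∧ t ≤ (d + 1) * (e.cost + c.costB I J + 1) ∧ Q s'' := by
    intro d
    induction d with
    | zero =>
      intro k hk s' hi hf
      obtain ⟨ho, hv, hq⟩ := hend s' (by rwa [← hk]) hf
      exact ⟨_, _, .whileFalse (by rw [Expr.eval_eq ho, hv]), by omega, hq⟩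
    | succ d ih =>
      intro k hk s' hi hf
      obtain ⟨ho, hv, t, s₁, he, hb, hi'⟩ := hstep k (by omega) s' hi hf
      obtain ⟨t', s₂, he', hb', hq⟩ := ih (k + 1) (by omega) s₁ hi' (hf.trans he.frame)
      refine ⟨_, _, .whileTrue (Expr.eval_eq ho) hv he he', ?_, hq⟩
      rw [add_mul (d + 1), one_mul]; omega
  obtain ⟨t, s', h₁, h₂, h₃⟩ := key n 0 (by omega) s h0 ⟨fun _ _ => rfl, fun _ _ => rfl⟩
  refine ⟨t, s', h₁, h₂.trans ?_, h₃⟩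
  exact Nat.mul_le_mul_right _ (by omega)

end Rules

@[simp] theorem State.setReg_reg (s : State) (r v r' : ℕ) :
    (s.setReg r v).reg r' = if r' = r then v else s.reg r' := by
  simp [State.setReg, Function.update_apply]

@[simp] theorem State.setReg_mem (s : State) (r v : ℕ) : (s.setReg r v).mem = s.mem := rfl

@[simp] theorem State.setMem_reg (s : State) (a i v : ℕ) : (s.setMem a i v).reg = s.reg := rfl

@[simp] theorem State.setMem_mem (s : State) (a i v a' i' : ℕ) :
    (s.setMem a i v).mem a' i' = if a' = a ∧ i' = i then v else s.mem a' i' := by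
  simp only [State.setMem, Function.update_apply]
  split_ifs <;> simp_all

attribute [simp] Expr.Ev Expr.Ok Expr.val BinOp.sem BinOp.Safe

/-! ### Notation for programs -/

instance : Add Expr := ⟨.bin .add⟩
instance : Sub Expr := ⟨.bin .sub⟩
instance : Mul Expr := ⟨.bin .mul⟩
instance : Div Expr := ⟨.bin .div⟩
instance : Mod Expr := ⟨.bin .mod⟩
instance (n : ℕ) : OfNat Expr n := ⟨.const n⟩

@[simp] theorem Expr.add_def (a b : Expr) : a + b = .bin .add a b := rfl
@[simp] theorem Expr.sub_def (a b : Expr) : a - b = .bin .sub a b := rfl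
@[simp] theorem Expr.mul_def (a b : Expr) : a * b = .bin .mul a b := rfl
@[simp] theorem Expr.div_def (a b : Expr) : a / b = .bin .div a b := rfl
@[simp] theorem Expr.mod_def (a b : Expr) : a % b = .bin .mod a b := rfl
@[simp] theorem Expr.ofNat_def (n : ℕ) : (OfNat.ofNat n : Expr) = .const n := rfl

prefix:max "#r" => Expr.reg
infixr:40 " ;; " => Cmd.seq
infix:45 " ≔ " => Cmd.assign
infix:55 " <ᵉ " => Expr.bin BinOp.lt
infix:55 " =ᵉ " => Expr.bin BinOp.eq
infix:60 " <<ᵉ " => Expr.bin BinOp.shl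
infix:60 " >>ᵉ " => Expr.bin BinOp.shr

/-! ### Counting loops and halving loops -/

section Loops

variable {M : Machine} {I J : ℕ} {s : State} {Q : State → Prop}

/-- `for r := 0, 1, …, (register rb) - 1 do body` -/
def forLoop (r rb : ℕ) (body : Cmd) : Cmd :=
  r ≔ 0 ;; .while (#r r <ᵉ #r rb) (body ;; r ≔ #r r + 1)

/-- As the body writes only registers below the counter, the counter and its bound survive, and
every register above the counter keeps its initial value. The invariant is required of the state
whose counter is already incremented. -/
theorem Runs.for {r rb : ℕ} {body : Cmd} (n : ℕ) (hrb : s.reg rb = n) (hr : r < rb)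
    (ht : body.top ≤ r) (hn : n ≤ iters I J (#r r <ᵉ #r rb)) (hcap : n < M.cap)
    (hpos : 1 < M.cap)
    (Inv : ℕ → State → Prop) (h0 : Inv 0 (s.setReg r 0))
    (hstep : ∀ k < n, ∀ s', s'.reg r = k → Inv k s' → (∀ r', r < r' → s'.reg r' = s.reg r') →
      (∀ a, body.keeps a = true → s'.mem a = s.mem a) →
      Runs M I J body s' fun s'' => Inv (k + 1) (s''.setReg r (k + 1)))
    (hend : ∀ s', Inv n s' → s'.reg r = n → (∀ r', r < r' → s'.reg r' = s.reg r') →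
      (∀ a, body.keeps a = true → s'.mem a = s.mem a) → Q s') :
    Runs M I J (forLoop r rb body) s Q := by
  refine Runs.set 0 (by simp; omega) ?_
  have fr : ∀ s', Frame (body ;; r ≔ #r r + 1) (s.setReg r 0) s' →
      (∀ r', r < r' → s'.reg r' = s.reg r') ∧
      (∀ a, body.keeps a = true → s'.mem a = s.mem a) := by
    intro s' hf
    refine ⟨fun r' hr' => ?_, fun a ha => ?_⟩
    · rw [hf.reg r' (by simp [Cmd.top]; omega)]; simp; omega
    · rw [hf.mem a (by simp [Cmd.keeps, ha])]; rfl
  refine Runs.while n hn (fun k s' => s'.reg r = k ∧ Inv k s') ⟨by simp, h0⟩ ?_ ?_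
  · rintro k hk s' ⟨hrk, hi⟩ hf
    obtain ⟨f₁, f₂⟩ := fr s' hf
    refine ⟨by simp, by simp [hrk, f₁ rb hr, hrb, hk], ?_⟩
    refine Runs.seq (hstep k hk s' hrk hi f₁ f₂) ?_
    intro s'' hi' hf'
    have : s''.reg r = k := by rw [hf'.reg r ht, hrk]
    exact Runs.assign (k + 1) (by simp [this]; omega) ⟨by simp, hi'⟩
  · rintro s' ⟨hrk, hi⟩ hf
    obtain ⟨f₁, f₂⟩ := fr s' hf
    exact ⟨by simp, by simp [hrk, f₁ rb hr, hrb], hend s' hi hrk f₁ f₂⟩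

@[simp] theorem forLoop_top (r rb : ℕ) (body : Cmd) :
    (forLoop r rb body).top = max body.top (r + 1) := by
  simp only [forLoop, Cmd.top]; omega

@[simp] theorem forLoop_keeps (r rb a : ℕ) (body : Cmd) :
    (forLoop r rb body).keeps a = body.keeps a := by
  simp [forLoop, Cmd.keeps]

/-- `while (register r) ≠ 0 do body; r := r / 2` -/
def halvingLoop (r : ℕ) (body : Cmd) : Cmd :=
  .while (#r r) (body ;; r ≔ #r r / 2)

@[simp] theorem halvingLoop_top (r : ℕ) (body : Cmd) :
    (halvingLoop r body).top = max body.top (r + 1) := by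
  simp [halvingLoop, Cmd.top]

@[simp] theorem halvingLoop_keeps (r a : ℕ) (body : Cmd) :
    (halvingLoop r body).keeps a = body.keeps a := by
  simp [halvingLoop, Cmd.keeps]

/-- The register runs through `2 ^ K, …, 2, 1` and the loop stops at `1 / 2 = 0`, which makes `K +
1` rounds; `Inv (k + 1)` holds before the round with `2 ^ k`. -/
theorem Runs.halving {r : ℕ} {body : Cmd} (K : ℕ) (hr : s.reg r = 2 ^ K)
    (ht : body.top ≤ r) (hn : K + 1 ≤ I) (hcap : 2 < M.cap)
    (Inv : ℕ → State → Prop) (h0 : Inv (K + 1) s)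
    (hstep : ∀ k ≤ K, ∀ s', s'.reg r = 2 ^ k → Inv (k + 1) s' →
      (∀ r', r < r' → s'.reg r' = s.reg r') →
      (∀ a, body.keeps a = true → s'.mem a = s.mem a) →
      Runs M I J body s' fun s'' => Inv k (s''.setReg r (2 ^ k / 2)))
    (hend : ∀ s', Inv 0 s' → (∀ r', r < r' → s'.reg r' = s.reg r') →
      (∀ a, body.keeps a = true → s'.mem a = s.mem a) → Q s') :
    Runs M I J (halvingLoop r body) s Q := by
  have fr : ∀ s', Frame (body ;; r ≔ #r r / 2) s s' →
      (∀ r', r < r' → s'.reg r' = s.reg r') ∧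
      (∀ a, body.keeps a = true → s'.mem a = s.mem a) := by
    intro s' hf
    refine ⟨fun r' hr' => ?_, fun a ha => ?_⟩
    · rw [hf.reg r' (by simp [Cmd.top]; omega)]
    · rw [hf.mem a (by simp [Cmd.keeps, ha])]
  refine Runs.while (K + 1) (le_iters hn)
    (fun k s' => s'.reg r = 2 ^ K / 2 ^ k ∧ Inv (K + 1 - k) s') ⟨by simp [hr], h0⟩ ?_ ?_
  · rintro k hk s' ⟨hrk, hi⟩ hf
    obtain ⟨f₁, f₂⟩ := fr s' hf
    have e₁ : 2 ^ K / 2 ^ k = 2 ^ (K - k) := Nat.pow_div (by omega) (by omega)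
    rw [e₁] at hrk
    refine ⟨by simp, by simp [hrk], ?_⟩
    have e₂ : K + 1 - k = K - k + 1 := by omega
    rw [e₂] at hi
    refine Runs.seq (hstep (K - k) (by omega) s' hrk hi f₁ f₂) ?_
    intro s'' hi' hf'
    have : s''.reg r = 2 ^ (K - k) := by rw [hf'.reg r ht, hrk]
    refine Runs.assign (2 ^ (K - k) / 2) (by simp [this]; omega) ⟨?_, ?_⟩
    · simp [pow_succ, ← Nat.div_div_eq_div_mul, e₁]
    · rw [Nat.add_sub_add_right]; exact hi'
  · rintro s' ⟨hrk, hi⟩ hf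
    obtain ⟨f₁, f₂⟩ := fr s' hf
    refine ⟨by simp, ?_, hend s' (by simpa using hi) f₁ f₂⟩
    simp [hrk]
    exact Nat.pow_lt_pow_right (by omega) (by omega)

end Loops

end RLZ

namespace RLZ

/-! ## Binary search -/

/-- Binary search with steps `2 ^ (k - 1), …, 2, 1` from `acc`. -/
def bsAux (f : ℕ → Bool) (max : ℕ) : ℕ → ℕ → ℕ
  | 0, acc => acc
  | k + 1, acc =>
      bsAux f max k (if acc + 2 ^ k ≤ max ∧ f (acc + 2 ^ k) = true then acc + 2 ^ k else acc)

/-- Nothing is assumed about the test, so the result is in range even if colliding hashes make the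
test non-monotone. The legality of later memory accesses rests on this. -/
theorem bsAux_le {f : ℕ → Bool} {max : ℕ} (k acc : ℕ) (h : acc ≤ max) :
    bsAux f max k acc ≤ max := by
  induction k generalizing acc with
  | zero => exact h
  | succ k ih =>
    simp only [bsAux]
    split_ifs with h'
    · exact ih _ h'.1
    · exact ih _ h

theorem bsAux_eq {f : ℕ → Bool} {max m : ℕ} (k acc : ℕ) (hm : m ≤ max)
    (hf : ∀ c, 1 ≤ c → c ≤ max → (f c = true ↔ c ≤ m)) (h₁ : acc ≤ m) (h₂ : m < acc + 2 ^ k) :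
    bsAux f max k acc = m := by
  induction k generalizing acc with
  | zero => simp at h₂; simp [bsAux]; omega
  | succ k ih =>
    simp only [bsAux]
    have hp : 1 ≤ 2 ^ k := Nat.one_le_two_pow
    rw [pow_succ] at h₂
    split_ifs with h'
    · exact ih _ ((hf _ (by omega) h'.1).1 h'.2) (by omega)
    · refine ih _ h₁ ?_
      by_contra hc
      exact h' ⟨by omega, (hf _ (by omega) (by omega)).2 (by omega)⟩

/-! ## Karp-Rabin hashes -/

theorem krHash_lt {p x : ℕ} (hp : 0 < p) (U : List ℕ) : krHash p x U < p := by
  induction U using List.reverseRecOn with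
  | nil => exact hp
  | append_singleton U c _ => simp only [krHash, List.foldl_append, List.foldl_cons, List.foldl_nil]
                              exact Nat.mod_lt _ hp

theorem krHash_concat (p x : ℕ) (U : List ℕ) (c : ℕ) :
    krHash p x (U ++ [c]) = (krHash p x U * x + c) % p := by
  simp [krHash]

/-- Horner's rule: appending `V` shifts the hash of `U` by `x ^ V.length`. -/
theorem cast_krHash_append (p x : ℕ) (U V : List ℕ) :
    (krHash p x (U ++ V) : ZMod p) = krHash p x U * x ^ V.length + krHash p x V := by
  induction V using List.reverseRecOn with
  | nil => simp [krHash]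
  | append_singleton V c ih =>
    rw [← List.append_assoc, krHash_concat, krHash_concat]
    simp only [ZMod.natCast_mod, Nat.cast_add, Nat.cast_mul, ih, List.length_append,
      List.length_singleton, pow_succ]
    ring

/-- The substring between the positions `a` and `c`. -/
def sub (T : List ℕ) (a c : ℕ) : List ℕ := (T.take c).drop a

theorem length_sub {T : List ℕ} {a c : ℕ} (hc : c ≤ T.length) : (sub T a c).length = c - a := by
  simp [sub]; omega

theorem take_append_sub {T : List ℕ} {a c : ℕ} (h : a ≤ c) :
    T.take a ++ sub T a c = T.take c := by
  have : T.take a = (T.take c).take a := by rw [List.take_take, min_eq_left h]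
  rw [this, sub, List.take_append_drop]

/-- Hash identities are proved in `ZMod p` and pulled back to residues through this. -/
theorem natCast_eq_iff_of_lt {p a b : ℕ} (ha : a < p) (hb : b < p) :
    (a : ZMod p) = b ↔ a = b := by
  rw [ZMod.natCast_eq_natCast_iff', Nat.mod_eq_of_lt ha, Nat.mod_eq_of_lt hb]

/-- `cast_krHash_append` solved for the second part, with `p - h` as the negative of `h` in natural
numbers. -/
theorem krHash_sub {p x : ℕ} (hp : 0 < p) {T : List ℕ} {a c : ℕ} (h : a ≤ c) (hc : c ≤ T.length) :
    krHash p x (sub T a c) =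
      (krHash p x (T.take c) + (p - krHash p x (T.take a)) * (x ^ (c - a) % p)) % p := by
  rw [← natCast_eq_iff_of_lt (krHash_lt hp _) (Nat.mod_lt _ hp), ← take_append_sub h]
  have := (krHash_lt (x := x) hp (T.take a)).le
  push_cast [ZMod.natCast_mod, Nat.cast_sub this, cast_krHash_append, length_sub hc]
  simp only [CharP.cast_eq_zero]
  ring

/-- Write the hash of the prefix as `h(T[..a]) x^k` plus the hash of the last piece. The piece also
ends the prefix of length `s + k`, so its hash is `h(T[..s+k]) - h(T[..s]) x^k`. -/
theorem krHash_take_of_sub_eq {p x : ℕ} (hp : 0 < p) {T : List ℕ} {a j s k : ℕ} (hj : j ≤ T.length)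
    (ha : a + k = j) (h : sub T a j = sub T s (s + k)) :
    krHash p x (T.take j) = ((krHash p x (T.take a) + (p - krHash p x (T.take s))) * (x ^ k % p)
      + krHash p x (T.take (s + k))) % p := by
  have hl := congrArg List.length h
  rw [length_sub hj] at hl
  have hls : (sub T s (s + k)).length = k := by omega
  rw [← natCast_eq_iff_of_lt (krHash_lt hp _) (Nat.mod_lt _ hp),
    ← take_append_sub (T := T) (a := a) (c := j) (by omega), h,
    ← take_append_sub (T := T) (a := s) (c := s + k) (by omega)]
  have := (krHash_lt (x := x) hp (T.take s)).le
  push_cast [ZMod.natCast_mod, Nat.cast_sub this, cast_krHash_append, hls]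
  simp only [CharP.cast_eq_zero]
  ring

/-! ## The text as a sequence of items

The items are the positions `0, …, ℓ` of the reference and the ends of the RLZ phrases. -/

/-- `pos q` is the number of text characters before the item `q`, `src q` the offset in the
reference from which the text after `q` is copied, and `2 ^ K` the first step of binary searches and
of powering. -/
structure Env where
  T : List ℕ
  p : ℕ
  x : ℕ
  ℓ : ℕ
  N : ℕ
  K : ℕ
  pos : ℕ → ℕ
  src : ℕ → ℕ

/-- The hash of a prefix of the text. -/
def Env.ph (E : Env) (j : ℕ) : ℕ := krHash E.p E.x (E.T.take j)

/-- `src_eq` makes every text position accessible through the reference. `cap` leaves room for the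
product of two residues with a constant factor, so that all arithmetic is exact. -/
structure Env.WF (E : Env) (M : Machine) (I : ℕ) : Prop where
  two_le_p : 2 ≤ E.p
  x_lt : E.x < E.p
  n_le_p : E.T.length ≤ E.p
  cap : 1000 * (E.p * E.p) + 1000 * E.p + 1000 ≤ M.cap
  n_lt : E.T.length + 1 ≤ 2 ^ E.K
  pow_le : 2 ^ E.K ≤ 8 * E.p
  K_lt : E.K + 3 ≤ I
  ℓ_lt : E.ℓ < E.N
  N_le : E.N ≤ E.T.length + 1
  pos_le : ∀ q, E.pos q ≤ E.T.length
  pos_of_le : ∀ q ≤ E.ℓ, E.pos q = q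
  pos_last : E.pos (E.N - 1) = E.T.length
  pos_lt : ∀ q r, q < r → r < E.N → E.pos q < E.pos r
  src_eq : ∀ q j, q < E.N → E.pos q ≤ j → j ≤ E.T.length → (q + 1 < E.N → j ≤ E.pos (q + 1)) →
    E.src q + (j - E.pos q) ≤ E.ℓ ∧
      sub E.T (E.pos q) j = sub E.T (E.src q) (E.src q + (j - E.pos q))

/-- Read access to the array `a` of the index, as memory of the construction or as input of the
query. -/
def rd (q : Bool) (a : ℕ) (e : Expr) : Expr := if q then .input (a + 4) e else .mem a e

def RdOk (q : Bool) (M : Machine) (a i : ℕ) : Prop :=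
  if q then i < (M.input (a + 4)).length else a < M.arrays ∧ i < M.cells

def rdVal (q : Bool) (M : Machine) (s : State) (a i : ℕ) : ℕ :=
  if q then (M.input (a + 4)).getD i 0 else s.mem a i

@[simp] theorem rd_ok {q : Bool} {M : Machine} {s : State} {a : ℕ} {e : Expr} :
    (rd q a e).Ok M s ↔ e.Ok M s ∧ RdOk q M a (e.val M s) := by
  cases q <;> simp [rd, RdOk]

@[simp] theorem rd_val {q : Bool} {M : Machine} {s : State} {a : ℕ} {e : Expr} :
    (rd q a e).val M s = rdVal q M s a (e.val M s) := by
  cases q <;> simp [rd, rdVal]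

/-- The array `a` holds `f 0, …, f (n - 1)`. -/
def Holds (q : Bool) (M : Machine) (s : State) (a n : ℕ) (f : ℕ → ℕ) : Prop :=
  ∀ i < n, RdOk q M a i ∧ rdVal q M s a i = f i

theorem Holds.congr {q : Bool} {M : Machine} {s s' : State} {a n : ℕ} {f : ℕ → ℕ}
    (h : Holds q M s a n f) (hm : s'.mem a = s.mem a) : Holds q M s' a n f := by
  intro i hi
  simpa [rdVal, hm] using h i hi

theorem Holds.ok {q : Bool} {M : Machine} {s : State} {a n : ℕ} {f : ℕ → ℕ}
    (h : Holds q M s a n f) {i : ℕ} (hi : i < n) : RdOk q M a i := (h i hi).1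

theorem Holds.val {q : Bool} {M : Machine} {s : State} {a n : ℕ} {f : ℕ → ℕ}
    (h : Holds q M s a n f) {i : ℕ} (hi : i < n) : rdVal q M s a i = f i := (h i hi).2

@[simp] theorem rdVal_setReg {q : Bool} {M : Machine} {s : State} {r v a i : ℕ} :
    rdVal q M (s.setReg r v) a i = rdVal q M s a i := rfl

/-- The global registers and the arrays that give access to the text. -/
structure Env.At (E : Env) (q : Bool) (M : Machine) (s : State) : Prop where
  rp : s.reg 100 = E.p
  rx : s.reg 101 = E.x
  rn : s.reg 102 = E.T.length
  rK : s.reg 103 = 2 ^ E.K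
  rN : s.reg 105 = E.N
  hpos : Holds q M s 1 E.N E.pos
  hh : Holds q M s 2 E.N fun i => E.ph (E.pos i)
  hsrc : Holds q M s 3 E.N E.src

theorem Env.At.congr {E : Env} {q : Bool} {M : Machine} {s s' : State} (h : E.At q M s)
    (hr : ∀ r, 100 ≤ r → r ≤ 105 → s'.reg r = s.reg r) (hm : ∀ a ≤ 3, s'.mem a = s.mem a) :
    E.At q M s' where
  rp := by rw [hr _ (by omega) (by omega), h.rp]
  rx := by rw [hr _ (by omega) (by omega), h.rx]
  rn := by rw [hr _ (by omega) (by omega), h.rn]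
  rK := by rw [hr _ (by omega) (by omega), h.rK]
  rN := by rw [hr _ (by omega) (by omega), h.rN]
  hpos := h.hpos.congr (hm _ (by omega))
  hh := h.hh.congr (hm _ (by omega))
  hsrc := h.hsrc.congr (hm _ (by omega))

theorem Env.At.setReg {E : Env} {q : Bool} {M : Machine} {s : State} (h : E.At q M s) {r v : ℕ}
    (hr : r < 100) : E.At q M (s.setReg r v) :=
  h.congr (fun r' _ _ => by simp; omega) fun _ _ => rfl

theorem Env.At.frame {E : Env} {q : Bool} {M : Machine} {s s' : State} {c : Cmd} (h : E.At q M s)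
    (hf : Frame c s s') (ht : c.top ≤ 100) (hk : ∀ a, c.keeps a = true) : E.At q M s' :=
  h.congr (fun r hr _ => hf.reg r (by omega)) fun a _ => hf.mem a (hk a)

/-! ### Hashes of prefixes and substrings of the text -/

section Programs

variable {E : Env} {q : Bool} {M : Machine} {I J : ℕ} {s : State} {Q : State → Prop}

/-- `register 10 := x ^ (register 14) mod p` -/
def powCmd : Cmd :=
  10 ≔ 1 ;; 11 ≔ #r 103 ;; halvingLoop 11
    (10 ≔ #r 10 * #r 10 % #r 100 ;;
      .ite (#r 14 / #r 11 % 2) (10 ≔ #r 10 * #r 101 % #r 100) .skip)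

@[simp] theorem powCmd_top : powCmd.top = 12 := by simp [powCmd, Cmd.top]

@[simp] theorem powCmd_keeps (a : ℕ) : powCmd.keeps a = true := by simp [powCmd, Cmd.keeps]

/-- Square and multiply along the digits of `k` from the top: the register holds `x ^ (k / 2 ^ j)`
once the digits from `j` on are read. Only registers are assumed, because the construction needs
powers while it is still filling the arrays. -/
theorem powCmd_runs_of_reg (hE : E.WF M I) (hp : s.reg 100 = E.p) (hx : s.reg 101 = E.x)
    (hK : s.reg 103 = 2 ^ E.K) (k : ℕ) (hk : s.reg 14 = k)
    (hk' : k ≤ E.T.length) (hQ : ∀ s', s'.reg 10 = E.x ^ k % E.p → Q s') :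
    Runs M I J powCmd s Q := by
  have hcap := hE.cap
  have h2 := hE.two_le_p
  have hnl := hE.n_lt
  have hKI := hE.K_lt
  refine Runs.set 1 (by simp; omega) (Runs.set (2 ^ E.K) (by simp [hK]) ?_)
  refine Runs.halving E.K (by simp) (by simp [Cmd.top]) (by omega) (by omega)
    (fun j s' => s'.reg 10 = E.x ^ (k / 2 ^ j) % E.p) ?_ ?_ ?_
  · simp only [State.setReg_reg]
    rw [Nat.div_eq_of_lt (by rw [pow_succ]; omega)]
    simp [Nat.mod_eq_of_lt (show 1 < E.p by omega)]
  · intro j hj s' hr hi hf hm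
    have e0 := hp; have e1 := hx
    have hlt : s'.reg 10 < E.p := by rw [hi]; exact Nat.mod_lt _ (by omega)
    have f100 : s'.reg 100 = E.p := by rw [hf 100 (by omega)]; simp [e0]
    have f101 : s'.reg 101 = E.x := by rw [hf 101 (by omega)]; simp [e1]
    have f14 : s'.reg 14 = k := by rw [hf 14 (by omega)]; simp [hk]
    have hmul := Nat.mul_le_mul hlt.le hlt.le
    have hsq : s'.reg 10 * s'.reg 10 % E.p = E.x ^ (k / 2 ^ (j + 1) * 2) % E.p := by
      rw [hi, pow_mul, sq]
      simp [Nat.mul_mod]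
    have hdiv : k / 2 ^ (j + 1) = k / 2 ^ j / 2 := by rw [pow_succ, Nat.div_div_eq_div_mul]
    have hx := hE.x_lt
    refine Runs.set (s'.reg 10 * s'.reg 10 % E.p) (by simp [f100]; omega) ?_
    have hlt' : s'.reg 10 * s'.reg 10 % E.p < E.p := Nat.mod_lt _ (by omega)
    have hmul' := Nat.mul_le_mul hlt'.le hx.le
    refine Runs.ite (by simp; omega) ?_ ?_
    · intro hv
      simp [f14, hr] at hv
      refine Runs.assign (s'.reg 10 * s'.reg 10 % E.p * E.x % E.p) ?_ ?_
      · simp [f100, f101]; omega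
      · simp only [State.setReg_reg]
        norm_num
        have hk2 : k / 2 ^ j = k / 2 ^ (j + 1) * 2 + 1 := by omega
        rw [hk2, pow_succ]
        exact Nat.ModEq.mul_right E.x hsq
    · intro hv
      simp [f14, hr] at hv
      refine Runs.skip ?_
      simp only [State.setReg_reg]
      norm_num
      have hk2 : k / 2 ^ j = k / 2 ^ (j + 1) * 2 := by omega
      rw [hk2, ← hsq]
  · intro s' hi _ _
    exact hQ s' (by simpa using hi)

theorem powCmd_runs (hE : E.WF M I) (hs : E.At q M s) (k : ℕ) (hk : s.reg 14 = k)
    (hk' : k ≤ E.T.length) (hQ : ∀ s', s'.reg 10 = E.x ^ k % E.p → Q s') :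
    Runs M I J powCmd s Q :=
  powCmd_runs_of_reg hE hs.rp hs.rx hs.rK k hk hk' hQ

/-- Binary search: `register r := max {c ≤ register (r + 3) | …}`, where the test of `c` is done by
`probe`, with `c` in register `r + 1`, and `flag`. -/
def bsCmd (r : ℕ) (probe : Cmd) (flag : Expr) : Cmd :=
  r ≔ 0 ;; r + 2 ≔ #r 103 ;; halvingLoop (r + 2)
    (r + 1 ≔ #r r + #r (r + 2) ;;
      .ite (#r (r + 3) <ᵉ #r (r + 1)) .skip (probe ;; .ite flag (r ≔ #r (r + 1)) .skip))

@[simp] theorem bsCmd_top {r : ℕ} {probe : Cmd} {flag : Expr} :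
    (bsCmd r probe flag).top = max probe.top (r + 3) := by
  simp [bsCmd, Cmd.top]

@[simp] theorem bsCmd_keeps {r a : ℕ} {probe : Cmd} {flag : Expr} :
    (bsCmd r probe flag).keeps a = probe.keeps a := by
  simp [bsCmd, Cmd.keeps]

/-- The outcome is `bsAux` of whatever the probe decides; whether that test is monotone is a
separate question. -/
theorem bsCmd_runs (hE : E.WF M I) (hK : s.reg 103 = 2 ^ E.K) {r : ℕ} {probe : Cmd} {flag : Expr}
    (hr : r < 95) (hp : probe.top ≤ r) (hk : ∀ a, probe.keeps a = true) (mx : ℕ)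
    (hmx : s.reg (r + 3) = mx) (hmx' : mx ≤ E.T.length + 1) (f : ℕ → Bool)
    (hprobe : ∀ c, 1 ≤ c → c ≤ mx → ∀ s', s'.reg (r + 1) = c →
      (∀ r', r + 3 ≤ r' → s'.reg r' = s.reg r') → s'.mem = s.mem →
      Runs M I J probe s' fun s'' => flag.Ok M s'' ∧ (flag.val M s'' ≠ 0 ↔ f c = true))
    (hQ : ∀ s', s'.reg r = bsAux f mx (E.K + 1) 0 → Q s') :
    Runs M I J (bsCmd r probe flag) s Q := by
  have hcap := hE.cap
  have h2 := hE.two_le_p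
  have hKI := hE.K_lt
  have hnp := hE.n_le_p
  have hpl := hE.pow_le
  refine Runs.set 0 (by simp; omega) (Runs.set (2 ^ E.K) ?_ ?_)
  · simp [hK]; omega
  refine Runs.halving E.K (by simp) ?_ (by omega) (by omega)
    (fun j s' => ∃ acc ≤ mx, s'.reg r = acc ∧ bsAux f mx j acc = bsAux f mx (E.K + 1) 0) ?_ ?_ ?_
  · simp [Cmd.top]; omega
  · exact ⟨0, by omega, by simp, rfl⟩
  · rintro j hj s' hst ⟨acc, hacc, hra, hbs⟩ hf hm
    have hmem : s'.mem = s.mem := by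
      funext a; rw [hm a (by simp [Cmd.keeps, hk])]; rfl
    have hpj : 2 ^ j ≤ 2 ^ E.K := Nat.pow_le_pow_right (by omega) hj
    have hf' : ∀ r', r + 3 ≤ r' → s'.reg r' = s.reg r' := fun r' h => by
      rw [hf r' (by omega)]; simp only [State.setReg_reg]
      rw [if_neg (by omega), if_neg (by omega)]
    have hp1 : 1 ≤ 2 ^ j := Nat.one_le_two_pow
    refine Runs.set (acc + 2 ^ j) (by simp [hra, hst]; omega) ?_
    refine Runs.ite (by simp) ?_ ?_
    · intro hv
      simp [hf' (r + 3) le_rfl, hmx] at hv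
      refine Runs.skip ⟨acc, hacc, by simp [hra], ?_⟩
      rw [← hbs]; simp only [bsAux]
      rw [if_neg (by omega)]
    · intro hv
      simp [hf' (r + 3) le_rfl, hmx] at hv
      refine Runs.seq (hprobe (acc + 2 ^ j) (by omega) hv _ (by simp) ?_ ?_) ?_
      · intro r' h; simp [hf' r' h]; omega
      · simp [hmem]
      · rintro s'' ⟨h₁, h₂⟩ hfr
        have g₀ : s''.reg r = acc := by rw [hfr.reg r hp]; simp [hra]
        have g₁ : s''.reg (r + 1) = acc + 2 ^ j := by rw [hfr.reg _ (by omega)]; simp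
        refine Runs.ite h₁ ?_ ?_
        · intro hfl
          refine Runs.assign (acc + 2 ^ j) (by simp [g₁]) ⟨acc + 2 ^ j, hv, by simp, ?_⟩
          rw [← hbs]; simp only [bsAux]
          rw [if_pos ⟨hv, h₂.1 hfl⟩]
        · intro hfl
          refine Runs.skip ⟨acc, hacc, by simp [g₀], ?_⟩
          rw [← hbs]; simp only [bsAux]
          rw [if_neg (by rw [← h₂]; simp [hfl])]
  · rintro s' ⟨acc, _, hra, hbs⟩ _ _
    exact hQ s' (by rw [hra, ← hbs]; rfl)

theorem Env.ph_lt (hE : E.WF M I) (j : ℕ) : E.ph j < E.p :=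
  krHash_lt (by have := hE.two_le_p; omega) _

/-- The positions of the items increase, so the test is monotone, and item `0` at position `0`
always passes it. -/
theorem Env.locate (hE : E.WF M I) {j : ℕ} (hj : j ≤ E.T.length) {c : ℕ}
    (hc : c = bsAux (fun c => decide (E.pos c ≤ j)) (E.N - 1) (E.K + 1) 0) :
    c < E.N ∧ E.pos c ≤ j ∧ (c + 1 < E.N → j < E.pos (c + 1)) := by
  have hℓ := hE.ℓ_lt
  have hN := hE.N_le
  have hn := hE.n_lt
  have h0 : E.pos 0 = 0 := hE.pos_of_le 0 (by omega)
  let m := Nat.findGreatest (fun c => E.pos c ≤ j) (E.N - 1)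
  have hm : m ≤ E.N - 1 := Nat.findGreatest_le _
  have hmj : E.pos m ≤ j :=
    Nat.findGreatest_spec (P := fun c => E.pos c ≤ j) (Nat.zero_le _) (by simp [h0])
  have mono : ∀ a b, a ≤ b → b < E.N → E.pos a ≤ E.pos b := by
    intro a b h h'
    rcases h.eq_or_lt with rfl | h
    · exact le_rfl
    · exact (hE.pos_lt a b h h').le
  have hcm : c = m := by
    rw [hc]
    refine bsAux_eq _ _ hm ?_ (Nat.zero_le _) (by rw [pow_succ]; omega)
    intro c _ hc'
    simp only [decide_eq_true_eq]
    exact ⟨fun h => Nat.le_findGreatest hc' h,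
      fun h => (mono c m h (by omega)).trans hmj⟩
  rw [hcm]
  refine ⟨by omega, hmj, fun h => ?_⟩
  by_contra hcon
  have : m + 1 ≤ m := Nat.le_findGreatest (P := fun c => E.pos c ≤ j) (by omega) (by omega)
  omega

/-- `register 24 := hash of the first (register 25) characters of the text` -/
def prefixCmd (q : Bool) : Cmd :=
  23 ≔ #r 105 - 1 ;; bsCmd 20 .skip (rd q 1 (#r 21) <ᵉ #r 25 + 1) ;;
  14 ≔ #r 25 - rd q 1 (#r 20) ;; powCmd ;;
  24 ≔ ((rd q 2 (#r 20) + (#r 100 - rd q 2 (rd q 3 (#r 20)))) * #r 10 +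
    rd q 2 (rd q 3 (#r 20) + #r 14)) % #r 100

@[simp] theorem prefixCmd_top : (prefixCmd q).top = 25 := by simp [prefixCmd, Cmd.top]

@[simp] theorem prefixCmd_keeps (a : ℕ) : (prefixCmd q).keeps a = true := by
  simp [prefixCmd, Cmd.keeps]

/-- The text from the last item up to `j` is replaced by its copy in the reference. Both ends of the
copy are items with stored hashes, because `pos q = q` for `q ≤ ℓ`. -/
theorem prefixCmd_runs (hE : E.WF M I) (hs : E.At q M s) (j : ℕ) (hj : s.reg 25 = j)
    (hj' : j ≤ E.T.length) (hQ : ∀ s', s'.reg 24 = E.ph j → Q s') :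
    Runs M I J (prefixCmd q) s Q := by
  have hcap := hE.cap
  have h2 := hE.two_le_p
  have hℓ := hE.ℓ_lt
  have hN := hE.N_le
  have hnp := hE.n_le_p
  have rN := hs.rN
  refine Runs.set (E.N - 1) (by simp [rN]; omega) ?_
  have hs := hs.setReg (r := 23) (v := E.N - 1) (by omega)
  refine Runs.seq (bsCmd_runs (Q := fun s' => s'.reg 20 =
    bsAux (fun c => decide (E.pos c ≤ j)) (E.N - 1) (E.K + 1) 0)
    hE hs.rK (by omega) (by simp [Cmd.top]) (by simp [Cmd.keeps]) (E.N - 1) (by simp)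
    (by omega) _ ?_ fun _ h => h) ?_
  · intro c _ hc' s' hr hf hm
    refine Runs.skip ?_
    have hpos := (hs.hpos.congr (s' := s') (by rw [hm]) : Holds q M s' 1 E.N E.pos)
    have g : s'.reg 25 = j := by rw [hf 25 (by omega)]; simp [hj]
    have hc := show c < E.N by omega
    constructor
    · simp [hr, hpos.ok hc, g]
      try omega
    · simp [hr, hpos.val hc, g]
      try omega
  · intro s₁ hr hf
    have hs₁ := hs.frame hf (by simp [Cmd.top]) (by simp [Cmd.keeps])
    have rj : s₁.reg 25 = j := by rw [hf.reg 25 (by simp [Cmd.top])]; simp [hj]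
    obtain ⟨c₁, c₂, c₃⟩ := Env.locate hE hj' hr
    obtain ⟨hseg, heq⟩ := hE.src_eq _ j c₁ c₂ hj' fun h => (c₃ h).le
    generalize hc : s₁.reg 20 = c at c₁ c₂ c₃ hr hseg heq
    have p₁ := hs₁.hpos.ok c₁
    have p₂ := hs₁.hpos.val c₁
    refine Runs.set (j - E.pos c) (by simp [hc, p₁, p₂, rj]; omega) ?_
    refine Runs.seq (powCmd_runs (Q := fun s' => s'.reg 10 = E.x ^ (j - E.pos c) % E.p) hE
      (hs₁.setReg (by omega)) (j - E.pos c) (by simp) (by omega) fun _ h => h) ?_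
    intro s₂ hr₂ hf₂
    have hs₂ := (hs₁.setReg (r := 14) (v := j - E.pos c) (by omega)).frame hf₂
      (by simp [Cmd.top]) (by simp [Cmd.keeps])
    have g₁ : s₂.reg 20 = c := by rw [hf₂.reg _ (by simp [Cmd.top])]; simp [hc]
    have g₂ : s₂.reg 14 = j - E.pos c := by rw [hf₂.reg _ (by simp [Cmd.top])]; simp
    have hsrc : E.src c < E.N := by omega
    have hsrc' : E.src c + (j - E.pos c) < E.N := by omega
    have e₁ : E.pos (E.src c) = E.src c := hE.pos_of_le _ (by omega)
    have e₂ := hE.pos_of_le _ hseg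
    have l₁ := Env.ph_lt hE (E.pos c)
    have l₂ := Env.ph_lt hE (E.src c)
    have l₃ := Env.ph_lt hE (E.src c + (j - E.pos c))
    have l₄ : E.x ^ (j - E.pos c) % E.p < E.p := Nat.mod_lt _ (by omega)
    -- Overflow check: negation as `p - h` makes the first factor at most `2p`.
    have l₅ := Nat.mul_le_mul (show E.ph (E.pos c) + (E.p - E.ph (E.src c)) ≤ 2 * E.p by omega)
      l₄.le
    rw [Nat.mul_assoc] at l₅
    refine Runs.assign (E.ph j) ?_ (hQ _ (by simp))
    have := krHash_take_of_sub_eq (x := E.x) (by omega : 0 < E.p) hj'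
      (show E.pos c + (j - E.pos c) = j by omega) heq
    constructor
    · simp [g₁, g₂, hr₂, hs₂.rp, hs₂.hsrc.ok c₁, hs₂.hsrc.val c₁, hs₂.hh.ok c₁, hs₂.hh.val c₁,
        hs₂.hh.ok hsrc, hs₂.hh.val hsrc, hs₂.hh.ok hsrc', hs₂.hh.val hsrc', e₁, e₂]
      omega
    · simp [g₁, g₂, hr₂, hs₂.rp, hs₂.hsrc.ok c₁, hs₂.hsrc.val c₁, hs₂.hh.ok c₁, hs₂.hh.val c₁,
        hs₂.hh.ok hsrc, hs₂.hh.val hsrc, hs₂.hh.ok hsrc', hs₂.hh.val hsrc', e₁, e₂]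
      exact this.symm

/-- The hash of the substring between `a` and `c`. -/
def Env.sh (E : Env) (a c : ℕ) : ℕ := krHash E.p E.x (sub E.T a c)

/-- `register 31 := hash of the substring between (register 35) and (register 36)` -/
def subCmd (q : Bool) : Cmd :=
  25 ≔ #r 36 ;; prefixCmd q ;; 30 ≔ #r 24 ;; 25 ≔ #r 35 ;; prefixCmd q ;;
  14 ≔ #r 36 - #r 35 ;; powCmd ;;
  31 ≔ (#r 30 + (#r 100 - #r 24) * #r 10) % #r 100

@[simp] theorem subCmd_top : (subCmd q).top = 32 := by simp [subCmd, Cmd.top]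

@[simp] theorem subCmd_keeps (a : ℕ) : (subCmd q).keeps a = true := by simp [subCmd, Cmd.keeps]

theorem subCmd_runs (hE : E.WF M I) (hs : E.At q M s) (a c : ℕ) (ha : s.reg 35 = a)
    (hc : s.reg 36 = c) (hac : a ≤ c) (hcn : c ≤ E.T.length)
    (hQ : ∀ s', s'.reg 31 = E.sh a c → Q s') :
    Runs M I J (subCmd q) s Q := by
  have hcap := hE.cap
  have h2 := hE.two_le_p
  have hnp := hE.n_le_p
  refine Runs.set c (by simp [hc]) ?_
  have hs := hs.setReg (r := 25) (v := c) (by omega)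
  refine Runs.seq (prefixCmd_runs (Q := fun s' => s'.reg 24 = E.ph c) hE hs c (by simp) hcn
    fun _ h => h) ?_
  intro s₁ r₁ f₁
  have hs₁ := hs.frame f₁ (by simp) (by simp)
  refine Runs.set (E.ph c) (by simp [r₁]) (Runs.set a ?_ ?_)
  · simp [f₁.reg 35 (by simp), ha]
  have hs₁ := (hs₁.setReg (r := 30) (v := E.ph c) (by omega)).setReg (r := 25) (v := a) (by omega)
  refine Runs.seq (prefixCmd_runs (Q := fun s' => s'.reg 24 = E.ph a) hE hs₁ a (by simp) (by omega)
    fun _ h => h) ?_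
  intro s₂ r₂ f₂
  have hs₂ := hs₁.frame f₂ (by simp) (by simp)
  have g₁ : s₂.reg 35 = a := by
    rw [f₂.reg 35 (by simp)]; simp [f₁.reg 35 (by simp), ha]
  have g₂ : s₂.reg 36 = c := by
    rw [f₂.reg 36 (by simp)]; simp [f₁.reg 36 (by simp), hc]
  have g₃ : s₂.reg 30 = E.ph c := by rw [f₂.reg 30 (by simp)]; simp
  refine Runs.set (c - a) (by simp [g₁, g₂]; omega) ?_
  have hs₂ := hs₂.setReg (r := 14) (v := c - a) (by omega)
  refine Runs.seq (powCmd_runs (Q := fun s' => s'.reg 10 = E.x ^ (c - a) % E.p) hE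
      hs₂ (c - a) (by simp) (by omega) fun _ h => h) ?_
  intro s₃ r₃ f₃
  have hs₃ := hs₂.frame f₃ (by simp [Cmd.top]) (by simp [Cmd.keeps])
  have k₁ : s₃.reg 30 = E.ph c := by rw [f₃.reg _ (by simp [Cmd.top])]; simp [g₃]
  have k₂ : s₃.reg 24 = E.ph a := by rw [f₃.reg _ (by simp [Cmd.top])]; simp [r₂]
  have l₁ := Env.ph_lt hE c
  have l₂ := Env.ph_lt hE a
  have l₄ : E.x ^ (c - a) % E.p < E.p := Nat.mod_lt _ (by omega)
  have l₅ := Nat.mul_le_mul (show E.p - E.ph a ≤ E.p by omega) l₄.le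
  refine Runs.assign (E.sh a c) ⟨?_, ?_⟩ (hQ _ (by simp))
  · simp [k₁, k₂, r₃, hs₃.rp]; omega
  · simp [k₁, k₂, r₃, hs₃.rp, Env.sh, krHash_sub (by omega : 0 < E.p) hac hcn, Env.ph]

/-- The hash of the first `len` characters of the suffix starting at `b` (`d = 0`) or of the
reversed prefix ending at `b` (`d = 1`), read from left to right in the text. -/
def Env.fh (E : Env) (d b len : ℕ) : ℕ := E.sh (b - d * len) (b - d * len + len)

/-- The length of the suffix starting at `b` or of the prefix ending at `b`. -/
def Env.room (E : Env) (d b : ℕ) : ℕ := if d = 0 then E.T.length - b else b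

/-- `register 31 := E.fh (register 106) (register 41) (register 42)` -/
def fragCmd (q : Bool) : Cmd :=
  35 ≔ #r 41 - #r 106 * #r 42 ;; 36 ≔ #r 35 + #r 42 ;; subCmd q

@[simp] theorem fragCmd_top : (fragCmd q).top = 37 := by simp [fragCmd, Cmd.top]

@[simp] theorem fragCmd_keeps (a : ℕ) : (fragCmd q).keeps a = true := by simp [fragCmd, Cmd.keeps]

theorem fragCmd_runs (hE : E.WF M I) (hs : E.At q M s) (d b len : ℕ) (hd : s.reg 106 = d)
    (hb : s.reg 41 = b) (hl : s.reg 42 = len) (hd' : d ≤ 1) (hb' : b ≤ E.T.length)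
    (hlen : len ≤ E.room d b) (hQ : ∀ s', s'.reg 31 = E.fh d b len → Q s') :
    Runs M I J (fragCmd q) s Q := by
  have hcap := hE.cap
  have hnp := hE.n_le_p
  have : d = 0 ∨ d = 1 := by omega
  have key : d * len ≤ b ∧ b - d * len + len ≤ E.T.length ∧ d * len ≤ E.T.length := by
    rcases this with rfl | rfl <;> simp [Env.room] at hlen ⊢ <;> omega
  refine Runs.set (b - d * len) (by simp [hd, hb, hl]; omega) ?_
  refine Runs.set (b - d * len + len) (by simp [hl]; omega) ?_
  exact subCmd_runs hE ((hs.setReg (by omega)).setReg (by omega)) _ _ (by simp) (by simp)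
    (by omega) (by omega) hQ

end Programs

end RLZ

namespace RLZ

/-! ## Comparing suffixes and reversed prefixes -/

/-- The length of the longest common prefix according to the hashes. -/
def Env.lcp (E : Env) (d b₁ b₂ : ℕ) : ℕ :=
  bsAux (fun len => decide (E.fh d b₁ len = E.fh d b₂ len)) (min (E.room d b₁) (E.room d b₂))
    (E.K + 1) 0

/-- The position after `l` steps from `b` in the direction `d`. -/
def adv (d b l : ℕ) : ℕ := b + l - 2 * d * l

/-- Lexicographic comparison according to the hashes. -/
def Env.le (E : Env) (d b₁ b₂ : ℕ) : Bool :=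
  if E.lcp d b₁ b₂ = E.room d b₁ then true
  else if E.lcp d b₁ b₂ = E.room d b₂ then false
  else decide (E.fh d (adv d b₁ (E.lcp d b₁ b₂)) 1 < E.fh d (adv d b₂ (E.lcp d b₁ b₂)) 1)

theorem Env.room_le (E : Env) {d b : ℕ} (hb : b ≤ E.T.length) : E.room d b ≤ E.T.length := by
  unfold Env.room; split_ifs <;> omega

theorem Env.lcp_le (E : Env) (d b₁ b₂ : ℕ) : E.lcp d b₁ b₂ ≤ min (E.room d b₁) (E.room d b₂) :=
  bsAux_le _ _ (Nat.zero_le _)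

/-- The last bound makes the truncated subtraction in `adv` exact. -/
theorem Env.adv_spec (E : Env) {d b l : ℕ} (hd : d ≤ 1) (hb : b ≤ E.T.length)
    (hl : l < E.room d b) : adv d b l ≤ E.T.length ∧ 1 ≤ E.room d (adv d b l) ∧
      2 * d * l ≤ b + l := by
  have : d = 0 ∨ d = 1 := by omega
  rcases this with rfl | rfl <;> simp [Env.room, adv] at hl ⊢ <;> omega

/-- The direction is `0` or `1`, so multiplying by it replaces a branch; likewise in `advE`. -/
def roomE (r : ℕ) : Expr := (#r 102 - #r r) * (1 - #r 106) + #r r * #r 106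

def advE (r l : ℕ) : Expr := #r r + #r l - 2 * #r 106 * #r l

section Programs

variable {E : Env} {q : Bool} {M : Machine} {I J : ℕ} {s : State} {Q : State → Prop}

theorem roomE_ev (hE : E.WF M I) (hs : E.At q M s) {r d b : ℕ} (hd : s.reg 106 = d) (hd' : d ≤ 1)
    (hb : s.reg r = b) (hb' : b ≤ E.T.length) : (roomE r).Ev M s (E.room d b) := by
  have hcap := hE.cap
  have hnp := hE.n_le_p
  have : d = 0 ∨ d = 1 := by omega
  rcases this with rfl | rfl <;> simp [roomE, hd, hb, hs.rn, Env.room] <;> omega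

theorem advE_ev (hE : E.WF M I) {r l d b lv : ℕ} (hd : s.reg 106 = d) (hd' : d ≤ 1)
    (hb : s.reg r = b) (hb' : b ≤ E.T.length) (hl : s.reg l = lv) (hl' : lv < E.room d b) :
    (advE r l).Ev M s (adv d b lv) := by
  have hcap := hE.cap
  have hnp := hE.n_le_p
  have hr := E.room_le (d := d) hb'
  have h := E.adv_spec hd' hb' hl'
  have : d = 0 ∨ d = 1 := by omega
  rcases this with rfl | rfl <;> simp [advE, hd, hb, hl, adv] at h ⊢ <;> omega

theorem fragCmd_at (hE : E.WF M I) (hs : E.At q M s) (d : ℕ) (hd : s.reg 106 = d) (hd' : d ≤ 1)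
    (hb' : s.reg 41 ≤ E.T.length) (hlen : s.reg 42 ≤ E.room d (s.reg 41)) :
    Runs M I J (fragCmd q) s fun s' => s'.reg 31 = E.fh d (s.reg 41) (s.reg 42) ∧ E.At q M s' ∧
      (∀ r, 37 ≤ r → s'.reg r = s.reg r) ∧ s'.mem = s.mem := by
  refine (fragCmd_runs (Q := fun s' => s'.reg 31 = E.fh d (s.reg 41) (s.reg 42))
    hE hs d _ _ hd rfl rfl hd' hb' hlen fun _ h => h).mono ?_
  intro s' h hf
  exact ⟨h, hs.frame hf (by simp) (by simp), fun r hr => hf.reg r (by simpa using hr),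
    funext fun a => hf.mem a (by simp)⟩

/-- Compares the hashes of the fragments of length `register l` at `register b₁` and
`register b₂`, leaving them in the registers `45` and `31`. -/
def twoFrags (q : Bool) (b₁ b₂ l : Expr) : Cmd :=
  41 ≔ b₁ ;; 42 ≔ l ;; fragCmd q ;; 45 ≔ #r 31 ;; 41 ≔ b₂ ;; 42 ≔ l ;; fragCmd q

theorem twoFrags_runs (hE : E.WF M I) (hs : E.At q M s) {e₁ e₂ el : Expr} (d b₁ b₂ l : ℕ)
    (hd : s.reg 106 = d) (hd' : d ≤ 1)
    (he : ∀ s', (∀ r, 46 ≤ r → s'.reg r = s.reg r) → e₁.Ev M s' b₁ ∧ e₂.Ev M s' b₂ ∧ el.Ev M s' l)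
    (h₁ : b₁ ≤ E.T.length) (h₂ : b₂ ≤ E.T.length) (hl₁ : l ≤ E.room d b₁) (hl₂ : l ≤ E.room d b₂) :
    Runs M I J (twoFrags q e₁ e₂ el) s fun s' =>
      s'.reg 45 = E.fh d b₁ l ∧ s'.reg 31 = E.fh d b₂ l := by
  refine Runs.set b₁ (he s fun _ _ => rfl).1 (Runs.set l (he _ fun r hr => ?_).2.2 ?_)
  · rw [State.setReg_reg, if_neg (by omega)]
  have hs := (hs.setReg (r := 41) (v := b₁) (by omega)).setReg (r := 42) (v := l) (by omega)
  refine Runs.seq (fragCmd_at hE hs d (by simp [hd]) hd' (by simp [h₁]) (by simp [hl₁])) ?_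
  rintro s₁ ⟨r₁, hs₁, f₁, -⟩ -
  have g : ∀ r, 46 ≤ r → s₁.reg r = s.reg r := fun r hr => by
    rw [f₁ r (by omega)]; simp only [State.setReg_reg]; rw [if_neg (by omega), if_neg (by omega)]
  simp at r₁
  refine Runs.set (E.fh d b₁ l) (by simp [r₁]) (Runs.set b₂ (he _ fun r hr => ?_).2.1
    (Runs.set l (he _ fun r hr => ?_).2.2 ?_))
  · rw [State.setReg_reg, if_neg (by omega)]; exact g r hr
  · rw [State.setReg_reg, if_neg (by omega), State.setReg_reg, if_neg (by omega)]; exact g r hr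
  have hs₁ := ((hs₁.setReg (r := 45) (v := E.fh d b₁ l) (by omega)).setReg (r := 41) (v := b₂)
    (by omega)).setReg (r := 42) (v := l) (by omega)
  refine (fragCmd_at hE hs₁ d (by simp [g 106 (by omega), hd]) hd' (by simp [h₂])
    (by simp [hl₂])).mono ?_
  rintro s₂ ⟨r₂, hs₂, f₂, -⟩ -
  exact ⟨by rw [f₂ 45 (by omega)]; simp, by rw [r₂]; simp⟩

@[simp] theorem twoFrags_top (e₁ e₂ el : Expr) : (twoFrags q e₁ e₂ el).top = 46 := by
  simp [twoFrags, Cmd.top]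

@[simp] theorem twoFrags_keeps (e₁ e₂ el : Expr) (a : ℕ) :
    (twoFrags q e₁ e₂ el).keeps a = true := by
  simp [twoFrags, Cmd.keeps]

/-- Compares the items at the positions in the registers `58` and `59` in the direction given by
register `106`: the longest common prefix is left in register `50`, the truth value of `≤` in
register `57`. -/
def cmpCmd (q : Bool) : Cmd :=
  54 ≔ roomE 58 ;; 55 ≔ roomE 59 ;; .ite (#r 54 <ᵉ #r 55) (53 ≔ #r 54) (53 ≔ #r 55) ;;
  bsCmd 50 (twoFrags q (#r 58) (#r 59) (#r 51)) (#r 45 =ᵉ #r 31) ;;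
  .ite (#r 50 =ᵉ #r 54) (57 ≔ 1) (.ite (#r 50 =ᵉ #r 55) (57 ≔ 0)
    (twoFrags q (advE 58 50) (advE 59 50) 1 ;; 57 ≔ #r 45 <ᵉ #r 31))

@[simp] theorem cmpCmd_top : (cmpCmd q).top = 58 := by simp [cmpCmd, Cmd.top]

@[simp] theorem cmpCmd_keeps (a : ℕ) : (cmpCmd q).keeps a = true := by simp [cmpCmd, Cmd.keeps]

/-- The outcome is the comparison according to hashes and so is known for every base. `Env.le_iff`
says when this is the lexicographic order. -/
theorem cmpCmd_runs (hE : E.WF M I) (hs : E.At q M s) (d b₁ b₂ : ℕ) (hd : s.reg 106 = d)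
    (hd' : d ≤ 1) (h₁ : s.reg 58 = b₁) (h₂ : s.reg 59 = b₂) (hb₁ : b₁ ≤ E.T.length)
    (hb₂ : b₂ ≤ E.T.length) :
    Runs M I J (cmpCmd q) s fun s' => s'.reg 50 = E.lcp d b₁ b₂ ∧
      s'.reg 57 = if E.le d b₁ b₂ = true then 1 else 0 := by
  have hcap := hE.cap
  have hm₁ := E.room_le (d := d) hb₁
  have hm₂ := E.room_le (d := d) hb₂
  have hn := hE.n_lt
  have h2 := hE.two_le_p
  refine Runs.set _ (roomE_ev hE hs hd hd' h₁ hb₁) ?_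
  refine Runs.set _ (roomE_ev hE (hs.setReg (by omega)) (d := d) (by simp [hd]) hd'
    (b := b₂) (by simp [h₂]) hb₂) ?_
  have hs := (hs.setReg (r := 54) (v := E.room d b₁) (by omega)).setReg (r := 55)
    (v := E.room d b₂) (by omega)
  refine Runs.seq (Q' := fun s' => s'.reg 53 = min (E.room d b₁) (E.room d b₂))
    (Runs.ite (by simp) ?_ ?_) ?_
  · intro h; simp at h
    exact Runs.assign (E.room d b₁) (by simp) (by simp; omega)
  · intro h; simp at h
    exact Runs.assign (E.room d b₂) (by simp) (by simp; omega)
  intro s₁ r₁ f₁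
  have hs₁ := hs.frame f₁ (by simp [Cmd.top]) (by simp [Cmd.keeps])
  have g : ∀ r, 54 ≤ r → s₁.reg r = (((s.setReg 54 (E.room d b₁)).setReg 55 (E.room d b₂))).reg r :=
    fun r hr => f₁.reg r (by simpa [Cmd.top] using hr)
  refine Runs.seq (bsCmd_runs (Q := fun s' => s'.reg 50 = E.lcp d b₁ b₂) (E := E) hE hs₁.rK
    (by omega) (by simp) (by simp) _ r₁ (by omega) _ ?_ fun _ h => h) ?_
  · intro c _ hc s' hr hf hm
    have hs' := hs₁.congr (s' := s') (fun r h _ => hf r (by omega)) (fun a _ => by rw [hm])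
    refine (twoFrags_runs hE hs' d b₁ b₂ c ?_ hd' ?_ hb₁ hb₂ (by omega) (by omega)).mono ?_
    · rw [hf _ (by omega), g _ (by omega)]; simp [hd]
    · intro s'' h
      have k₁ : s''.reg 58 = b₁ := by
        rw [h _ (by omega), hf _ (by omega), g _ (by omega)]; simp [h₁]
      have k₂ : s''.reg 59 = b₂ := by
        rw [h _ (by omega), hf _ (by omega), g _ (by omega)]; simp [h₂]
      have k₃ : s''.reg 51 = c := by rw [h _ (by omega), hr]
      simp [k₁, k₂, k₃]
    · rintro s'' ⟨e₁, e₂⟩ -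
      simp [e₁, e₂]
  intro s₂ r₂ f₂
  have f₂' : ∀ r, 53 ≤ r → s₂.reg r = s₁.reg r := fun r hr => f₂.reg r (by simpa using hr)
  have hs₂ := hs₁.congr (s' := s₂) (fun r h _ => f₂' r (by omega)) (fun a _ => f₂.mem a (by simp))
  have k₁ : s₂.reg 54 = E.room d b₁ := by rw [f₂' _ (by omega), g _ (by omega)]; simp
  have k₂ : s₂.reg 55 = E.room d b₂ := by rw [f₂' _ (by omega), g _ (by omega)]; simp
  have k₃ : s₂.reg 58 = b₁ := by rw [f₂' _ (by omega), g _ (by omega)]; simp [h₁]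
  have k₄ : s₂.reg 59 = b₂ := by rw [f₂' _ (by omega), g _ (by omega)]; simp [h₂]
  have k₅ : s₂.reg 106 = d := by rw [f₂' _ (by omega), g _ (by omega)]; simp [hd]
  have hle := E.lcp_le d b₁ b₂
  refine Runs.ite (by simp) ?_ ?_
  · intro h; simp [r₂, k₁] at h
    exact Runs.assign 1 (by simp; omega) (by simp [r₂, Env.le, h])
  · intro h; simp [r₂, k₁] at h
    refine Runs.ite (by simp) ?_ ?_
    · intro h'; simp [r₂, k₂] at h'
      exact Runs.assign 0 (by simp; omega) (by simp [r₂, Env.le, h, h']; omega)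
    · intro h'; simp [r₂, k₂] at h'
      obtain ⟨a₁, a₂, -⟩ := E.adv_spec hd' hb₁ (show E.lcp d b₁ b₂ < E.room d b₁ by omega)
      obtain ⟨a₃, a₄, -⟩ := E.adv_spec hd' hb₂ (show E.lcp d b₁ b₂ < E.room d b₂ by omega)
      refine Runs.seq (twoFrags_runs hE hs₂ d _ _ 1 k₅ hd' ?_ a₁ a₃ a₂ a₄) ?_
      · intro s' hf
        refine ⟨advE_ev hE (by rw [hf _ (by omega), k₅]) hd' (by rw [hf _ (by omega), k₃]) hb₁
          (by rw [hf _ (by omega), r₂]) (by omega), advE_ev hE (by rw [hf _ (by omega), k₅]) hd'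
          (by rw [hf _ (by omega), k₄]) hb₂ (by rw [hf _ (by omega), r₂]) (by omega), ?_⟩
        simp; omega
      · rintro s₃ ⟨e₁, e₂⟩ f₃
        have : s₃.reg 50 = E.lcp d b₁ b₂ := by
          rw [f₃.reg _ (by simp), r₂]
        refine Runs.assign _ ⟨by simp, rfl⟩ ⟨by simp [this], ?_⟩
        simp [e₁, e₂, Env.le, h, h']

end Programs

end RLZ

namespace RLZ

/-! ## Bottom-up merge sort -/

section Lists

variable (le : ℕ → ℕ → Bool)

/-- Merges the consecutive pairs of blocks of length `wd`. -/
def mergePass (wd : ℕ) : ℕ → List ℕ → List ℕ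
  | 0, l => l
  | k + 1, l =>
      List.merge (l.take wd) ((l.drop wd).take wd) le ++ mergePass wd k (l.drop (2 * wd))

theorem mergePass_nil (wd k : ℕ) : mergePass le wd k [] = [] := by
  induction k with
  | zero => rfl
  | succ k ih => simp [mergePass, ih]

theorem mergePass_perm (wd k : ℕ) (l : List ℕ) : (mergePass le wd k l).Perm l := by
  induction k generalizing l with
  | zero => exact List.Perm.refl _
  | succ k ih =>
    simp only [mergePass]
    refine ((List.merge_perm_append le).append (ih _)).trans ?_
    rw [two_mul, ← List.drop_drop, List.append_assoc, List.take_append_drop, List.take_append_drop]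

/-- All blocks of length `wd` are sorted. -/
def BlockSorted (wd : ℕ) (l : List ℕ) : Prop :=
  ∀ k, ((l.drop (k * wd)).take wd).Pairwise fun a b => le a b = true

variable {le}

/-- Merging two adjacent sorted blocks gives a sorted block of twice the length. An incomplete pair
can only come last, and what follows it is empty. `F` is fuel, at least the length of the list. -/
theorem BlockSorted.mergePass (htr : ∀ a b c, le a b = true → le b c = true → le a c = true)
    (hto : ∀ a b, (le a b || le b a) = true) {wd : ℕ} (hwd : 0 < wd) (F : ℕ) (l : List ℕ)
    (hl : l.length ≤ F) (h : BlockSorted le wd l) :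
    BlockSorted le (2 * wd) (mergePass le wd F l) := by
  induction F generalizing l with
  | zero =>
    have : l = [] := List.length_eq_zero_iff.1 (by omega)
    subst this
    intro k; simp [RLZ.mergePass]
  | succ F ih =>
    set m := List.merge (l.take wd) ((l.drop wd).take wd) le with hm
    have hml : m.length = min (2 * wd) l.length := by
      rw [hm, List.length_merge]; simp; omega
    have hms : m.Pairwise fun a b => le a b = true := by
      refine List.pairwise_merge (fun a b c => htr a b c) hto _ _ ?_ ?_
      · simpa using h 0
      · simpa using h 1
    have hrest := ih (l.drop (2 * wd)) (by simp; omega) (by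
      intro k
      have := h (k + 2)
      rwa [show (k + 2) * wd = 2 * wd + k * wd by ring, ← List.drop_drop] at this)
    simp only [RLZ.mergePass]
    rw [← hm]
    by_cases hc : 2 * wd ≤ l.length
    · intro k
      rcases k with _ | k
      · rw [Nat.zero_mul, List.drop_zero, List.take_append_of_le_length (by omega),
          List.take_of_length_le (by omega)]
        exact hms
      · rw [show (k + 1) * (2 * wd) = m.length + k * (2 * wd) by rw [hml, min_eq_left hc]; ring,
          ← List.drop_drop, List.drop_left]
        exact hrest k
    · rw [List.drop_eq_nil_of_le (by omega), mergePass_nil, List.append_nil]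
      intro k
      exact hms.sublist ((List.take_sublist _ _).trans (List.drop_sublist _ _))

end Lists

/-- The contents of the first `n` cells. -/
def cells (f : ℕ → ℕ) (n : ℕ) : List ℕ := (List.range n).map f

@[simp] theorem length_cells (f : ℕ → ℕ) (n : ℕ) : (cells f n).length = n := by simp [cells]

theorem cells_succ (f : ℕ → ℕ) (n : ℕ) : cells f (n + 1) = cells f n ++ [f n] := by
  simp [cells, List.range_succ]

theorem cells_congr {f g : ℕ → ℕ} {n : ℕ} (h : ∀ i < n, f i = g i) : cells f n = cells g n :=
  List.map_congr_left fun i hi => h i (List.mem_range.1 hi)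

theorem sub_cells_cons {f : ℕ → ℕ} {n i m : ℕ} (h : i < m) (hm : m ≤ n) :
    sub (cells f n) i m = f i :: sub (cells f n) (i + 1) m := by
  unfold sub
  rw [List.drop_eq_getElem_cons (by simp; omega)]
  simp [cells]

theorem sub_eq_nil (l : List ℕ) {i m : ℕ} (h : m ≤ i) : sub l i m = [] := by
  unfold sub
  rw [List.drop_eq_nil_of_le]; simp; omega

theorem take_drop_eq_sub (l : List ℕ) (a w : ℕ) : (l.drop a).take w = sub l a (min (a + w) l.length) := by
  unfold sub
  rw [List.drop_take, List.take_eq_take_iff]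
  simp; omega

/-! ### The sorting program -/

section Programs

variable {E : Env} {M : Machine} {I J : ℕ} {s : State} {Q : State → Prop}

def minCmd (r : ℕ) (e₁ e₂ : Expr) : Cmd := r ≔ e₁ ;; .ite (e₂ <ᵉ #r r) (r ≔ e₂) .skip

@[simp] theorem minCmd_top (r : ℕ) (e₁ e₂ : Expr) : (minCmd r e₁ e₂).top = r + 1 := by
  simp [minCmd, Cmd.top]

@[simp] theorem minCmd_keeps (r a : ℕ) (e₁ e₂ : Expr) : (minCmd r e₁ e₂).keeps a = true := by
  simp [minCmd, Cmd.keeps]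

theorem minCmd_runs {r : ℕ} {e₁ e₂ : Expr} (v₁ v₂ : ℕ) (h₁ : e₁.Ev M s v₁)
    (h₂ : ∀ v, e₂.Ev M (s.setReg r v) v₂) :
    Runs M I J (minCmd r e₁ e₂) s fun s' => s'.reg r = min v₁ v₂ ∧
      (∀ r', r' ≠ r → s'.reg r' = s.reg r') ∧ s'.mem = s.mem := by
  obtain ⟨o, v⟩ := h₂ v₁
  refine Runs.set v₁ h₁ (Runs.ite (by simp [o]) ?_ ?_)
  · intro h; simp [v] at h
    refine Runs.assign v₂ ⟨o, v⟩ ⟨by simp; omega, fun r' hr' => ?_, rfl⟩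
    simp [hr']
  · intro h; simp [v] at h
    exact Runs.skip ⟨by simp; omega, fun r' hr' => by simp [hr'], rfl⟩

/-- One merging pass over array `10` into array `11`, with blocks of length `register 75`. -/
def mergeCmd : Cmd :=
  60 ≔ 0 ;; 61 ≔ 0 ;; 62 ≔ 0 ;; 63 ≔ 0 ;; forLoop 70 220
    (.ite (#r 70 =ᵉ #r 63)
      (60 ≔ #r 70 ;; minCmd 62 (#r 70 + #r 75) (#r 105) ;; 61 ≔ #r 62 ;;
        minCmd 63 (#r 70 + 2 * #r 75) (#r 105)) .skip ;;
      57 ≔ 0 ;;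
      .ite (#r 60 <ᵉ #r 62) (.ite (#r 61 <ᵉ #r 63)
        (58 ≔ rd false 1 (.mem 10 (#r 60)) ;; 59 ≔ rd false 1 (.mem 10 (#r 61)) ;; cmpCmd false)
          (57 ≔ 1)) .skip ;;
      .ite (#r 57) (.store 11 (#r 70) (.mem 10 (#r 60)) ;; 60 ≔ #r 60 + 1)
        (.store 11 (#r 70) (.mem 10 (#r 61)) ;; 61 ≔ #r 61 + 1))

@[simp] theorem mergeCmd_top : mergeCmd.top = 71 := by simp [mergeCmd, Cmd.top]

@[simp] theorem mergeCmd_keeps (a : ℕ) : mergeCmd.keeps a = (11 != a) := by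
  simp [mergeCmd, Cmd.keeps]

/-- The order of the items. -/
def Env.itemLe (E : Env) (d a b : ℕ) : Bool := E.le d (E.pos a) (E.pos b)

/-- The state of a merging pass that has written `t` cells. -/
structure MergeInv (E : Env) (le : ℕ → ℕ → Bool) (wd : ℕ) (l : List ℕ) (A B : ℕ → ℕ)
    (i j mid hi t : ℕ) : Prop where
  i_le : i ≤ mid
  mid_le : mid ≤ j
  j_le : j ≤ hi
  hi_le : hi ≤ E.N
  t_eq : t + (mid - i) + (hi - j) = hi
  eq : ∃ k, E.N ≤ hi + k ∧ cells B t ++ (List.merge (sub l i mid) (sub l j hi) le ++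
    mergePass le wd k (l.drop hi)) = mergePass le wd E.N l

/-- Both runs are exhausted, so one round of `mergePass` is unfolded. Cutting the bounds off at
`E.N` covers a short or missing second block. -/
theorem MergeInv.reset {le : ℕ → ℕ → Bool} {wd : ℕ} {A B : ℕ → ℕ} {i j mid t : ℕ}
    (h : MergeInv E le wd (cells A E.N) A B i j mid t t) (ht : t < E.N) (hwd : 0 < wd) :
    MergeInv E le wd (cells A E.N) A B t (min (t + wd) E.N) (min (t + wd) E.N)
      (min (t + 2 * wd) E.N) t := by
  obtain ⟨h₁, h₂, h₃, h₄, h₅, k, hk, he⟩ := h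
  refine ⟨by omega, by omega, by omega, by omega, by omega, ?_⟩
  rcases k with _ | k
  · omega
  refine ⟨k, by omega, ?_⟩
  rw [sub_eq_nil _ (by omega), sub_eq_nil _ (by omega)] at he
  simp only [List.merge_right, List.nil_append, mergePass] at he
  rw [← he, List.drop_drop, take_drop_eq_sub, take_drop_eq_sub, List.drop_drop, length_cells,
    add_assoc, ← two_mul]
  congr 2
  · congr 1
    unfold sub
    by_cases hc : t + wd ≤ E.N
    · rw [min_eq_left hc]
    · rw [List.drop_eq_nil_of_le (by simp; omega), List.drop_eq_nil_of_le (by simp; omega)]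
  · by_cases hc : t + 2 * wd ≤ E.N
    · rw [min_eq_left hc]
    · rw [List.drop_eq_nil_of_le (by simp; omega), List.drop_eq_nil_of_le (by simp; omega)]

/-- One step of `List.merge`: the head of the first run is output if the second run is empty or
loses the comparison. -/
theorem MergeInv.left {le : ℕ → ℕ → Bool} {wd : ℕ} {A B B' : ℕ → ℕ} {i j mid hi t : ℕ}
    (h : MergeInv E le wd (cells A E.N) A B i j mid hi t) (hi' : i < mid)
    (hle : j < hi → le (A i) (A j) = true) (hB : ∀ u < t, B' u = B u) (hBt : B' t = A i) :
    MergeInv E le wd (cells A E.N) A B' (i + 1) j mid hi (t + 1) := by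
  obtain ⟨h₁, h₂, h₃, h₄, h₅, k, hk, he⟩ := h
  refine ⟨by omega, by omega, by omega, by omega, by omega, k, hk, ?_⟩
  rw [← he, cells_succ, hBt, cells_congr hB, sub_cells_cons hi' (by omega)]
  by_cases hj : j < hi
  · rw [sub_cells_cons hj (by omega), List.cons_merge_cons, if_pos (hle hj)]
    simp
  · rw [sub_eq_nil _ (show hi ≤ j by omega)]
    simp

theorem MergeInv.right {le : ℕ → ℕ → Bool} {wd : ℕ} {A B B' : ℕ → ℕ} {i j mid hi t : ℕ}
    (h : MergeInv E le wd (cells A E.N) A B i j mid hi t) (hj : j < hi)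
    (hle : i < mid → ¬ le (A i) (A j) = true) (hB : ∀ u < t, B' u = B u) (hBt : B' t = A j) :
    MergeInv E le wd (cells A E.N) A B' i (j + 1) mid hi (t + 1) := by
  obtain ⟨h₁, h₂, h₃, h₄, h₅, k, hk, he⟩ := h
  refine ⟨by omega, by omega, by omega, by omega, by omega, k, hk, ?_⟩
  rw [← he, cells_succ, hBt, cells_congr hB, sub_cells_cons hj (by omega)]
  by_cases hi' : i < mid
  · rw [sub_cells_cons hi' (by omega), List.cons_merge_cons, if_neg (hle hi')]
    simp
  · rw [sub_eq_nil _ (show mid ≤ i by omega)]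
    simp

/-- Invariant: the output so far, the merge of what remains of the two runs, and the passes over the
later pairs together form the final list. Since `mergePass` is just a function here, no property of
the comparison is needed. -/
theorem mergeCmd_runs (hE : E.WF M I) (hs : E.At false M s) (d wd : ℕ) (hd : s.reg 106 = d)
    (hd' : d ≤ 1) (hwd : s.reg 75 = wd) (hwd0 : 0 < wd) (hwd1 : wd < E.N)
    (hN : s.reg 220 = E.N) (hJ : E.N ≤ J)
    (harr : 11 < M.arrays) (hcells : E.N ≤ M.cells) (hA : ∀ u < E.N, s.mem 10 u < E.N) :
    Runs M I J mergeCmd s fun s' =>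
      cells (s'.mem 11) E.N = mergePass (E.itemLe d) wd E.N (cells (s.mem 10) E.N) := by
  have hcap := hE.cap
  have hNn := hE.N_le
  have hnp := hE.n_le_p
  have h2 := hE.two_le_p
  refine Runs.set 0 (by simp; omega) (Runs.set 0 (by simp; omega) (Runs.set 0 (by simp; omega)
    (Runs.set 0 (by simp; omega) ?_)))
  refine Runs.for E.N (by simp [hN]) (by omega) (by simp [Cmd.top])
    (by simp [iters, Expr.isBig]; omega) (by omega) (by omega)
    (fun t s' => ∃ i mid j, s'.reg 60 = i ∧ s'.reg 61 = j ∧ s'.reg 62 = mid ∧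
      MergeInv E (E.itemLe d) wd (cells (s.mem 10) E.N) (s.mem 10) (s'.mem 11) i j mid
        (s'.reg 63) t) ?_ ?_ ?_
  · refine ⟨0, 0, 0, by simp, by simp, by simp, ⟨le_rfl, le_rfl, by simp, by simp, by simp,
      E.N, by simp, ?_⟩⟩
    simp [cells, sub]
  · rintro t ht s' h70 ⟨i, mid, j, h60, h61, h62, hinv⟩ hf hm
    have hm' : ∀ a, a ≠ 11 → s'.mem a = s.mem a := fun a ha => by
      rw [hm a (by simp [Cmd.keeps]; omega)]; rfl
    have hf' : ∀ r, 71 ≤ r → s'.reg r = s.reg r := fun r hr => by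
      rw [hf r (by omega)]; simp only [State.setReg_reg]
      rw [if_neg (by omega), if_neg (by omega), if_neg (by omega), if_neg (by omega)]
    have hs' := hs.congr (s' := s') (fun r h _ => hf' r (by omega)) (fun a _ => hm' a (by omega))
    generalize hhi : s'.reg 63 = hi at hinv
    refine Runs.seq (Q' := fun s₁ => ∃ i mid j hi, s₁.reg 60 = i ∧ s₁.reg 61 = j ∧
      s₁.reg 62 = mid ∧ s₁.reg 63 = hi ∧ t < hi ∧ MergeInv E (E.itemLe d) wd
        (cells (s.mem 10) E.N) (s.mem 10) (s'.mem 11) i j mid hi t)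
      (Runs.ite (by simp) ?_ ?_) ?_
    · intro h; simp [h70, hhi] at h
      subst h
      refine Runs.set t (by simp [h70]) ?_
      refine Runs.seq (minCmd_runs (t + wd) E.N ?_ ?_) ?_
      · simp [h70, hf' 75 (by omega), hwd]; omega
      · intro v; simp [hf' 105 (by omega), hs.rN]
      rintro s₁ ⟨r₁, k₁, m₁⟩ -
      refine Runs.set _ ⟨by simp, r₁⟩ ?_
      refine (minCmd_runs (t + 2 * wd) E.N ?_ ?_).mono ?_
      · simp [k₁, h70, hf' 75 (by omega), hwd]; omega
      · intro v; simp [k₁, hf' 105 (by omega), hs.rN]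
      rintro s₂ ⟨r₂, k₂, m₂⟩ -
      exact ⟨t, _, _, _, by simp [k₁, k₂], by simp [k₁, k₂], by simp [k₁, k₂, r₁], r₂, by omega,
        hinv.reset ht hwd0⟩
    · intro h; simp [h70, hhi] at h
      have := hinv.t_eq
      exact Runs.skip ⟨i, mid, j, hi, h60, h61, h62, hhi, by omega, hinv⟩
    rintro s₁ ⟨i, mid, j, hi, r60, r61, r62, r63, hthi, hinv⟩ f₁
    have g₁ : ∀ r, 65 ≤ r → s₁.reg r = s'.reg r := fun r hr => f₁.reg r (by simp [Cmd.top]; omega)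
    have m₁ : s₁.mem = s'.mem := funext fun a => f₁.mem a (by simp [Cmd.keeps])
    have hs₁ := hs'.congr (s' := s₁) (fun r h _ => g₁ r (by omega)) (fun a _ => by rw [m₁])
    clear hhi h60 h61 h62 f₁
    have j₁ := hinv.i_le
    have j₂ := hinv.mid_le
    have j₃ := hinv.j_le
    have j₄ := hinv.hi_le
    have j₅ := hinv.t_eq
    refine Runs.set 0 (by simp; omega) ?_
    -- Register `57` decides in favour of the first run; items are compared only if both runs are
    -- nonempty.
    refine Runs.seq (Q' := fun s₂ => s₂.reg 57 ≤ 1 ∧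
      (s₂.reg 57 = 1 → i < mid ∧ (j < hi → E.itemLe d (s.mem 10 i) (s.mem 10 j) = true)) ∧
      (s₂.reg 57 = 0 → j < hi ∧ (i < mid → ¬ E.itemLe d (s.mem 10 i) (s.mem 10 j) = true)))
      (Runs.ite (by simp) ?_ ?_) ?_
    · intro h; simp [r60, r62] at h
      refine Runs.ite (by simp) ?_ ?_
      · intro h'; simp [r61, r63] at h'
        have a₁ := hA i (by omega)
        have a₂ := hA j (by omega)
        have b₁ := hs₁.hpos.ok a₁
        have b₂ := hs₁.hpos.ok a₂
        have c₁ := hs₁.hpos.val a₁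
        have c₂ := hs₁.hpos.val a₂
        have e₁ : s₁.mem 10 = s.mem 10 := by rw [m₁, hm' 10 (by omega)]
        refine Runs.set (E.pos (s.mem 10 i)) (by simp [r60, e₁, b₁, c₁]; omega) ?_
        refine Runs.set (E.pos (s.mem 10 j)) (by simp [r61, e₁, b₂, c₂]; omega) ?_
        refine (cmpCmd_runs (E := E) hE (((hs₁.setReg (by omega)).setReg (by omega)).setReg
          (by omega)) d _ _ (by simp [g₁ 106 (by omega), hf' 106 (by omega), hd]) hd'
          (by simp; rfl) (by simp; rfl) (hE.pos_le _) (hE.pos_le _)).mono ?_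
        rintro s₂ ⟨-, r₂⟩ -
        have r₂' : s₂.reg 57 = if E.itemLe d (s.mem 10 i) (s.mem 10 j) = true then 1 else 0 := r₂
        rw [r₂']
        by_cases hc : E.itemLe d (s.mem 10 i) (s.mem 10 j) = true
        · rw [if_pos hc]
          exact ⟨le_rfl, fun _ => ⟨h, fun _ => hc⟩, by simp⟩
        · rw [if_neg hc]
          exact ⟨by simp, by simp, fun _ => ⟨h', fun _ => hc⟩⟩
      · intro h'; simp [r61, r63] at h'
        exact Runs.assign 1 (by simp; omega) (by simp; omega)
    · intro h; simp [r60, r62] at h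
      exact Runs.skip (by simp; omega)
    rintro s₂ ⟨c₀, c₁, c₂⟩ f₂
    have g₂ : ∀ r, 60 ≤ r → s₂.reg r = s₁.reg r := fun r hr => by
      rw [f₂.reg r (by simp [Cmd.top]; omega), State.setReg_reg, if_neg (by omega)]
    have m₂ : s₂.mem = s'.mem := by
      rw [← m₁]; exact funext fun a => f₂.mem a (by simp [Cmd.keeps])
    have e₁₀ : s₂.mem 10 = s.mem 10 := by rw [m₂, hm' 10 (by omega)]
    have k60 : s₂.reg 60 = i := by rw [g₂ _ (by omega), r60]
    have k61 : s₂.reg 61 = j := by rw [g₂ _ (by omega), r61]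
    have k62 : s₂.reg 62 = mid := by rw [g₂ _ (by omega), r62]
    have k63 : s₂.reg 63 = hi := by rw [g₂ _ (by omega), r63]
    have k70 : s₂.reg 70 = t := by rw [g₂ _ (by omega), g₁ _ (by omega), h70]
    refine Runs.ite (by simp) ?_ ?_
    · intro h; simp at h
      obtain ⟨hi', hle⟩ := c₁ (by omega)
      refine Runs.put t (s.mem 10 i) (by simp [k70]) (by simp [k60, e₁₀]; omega) harr (by omega) ?_
      refine Runs.assign (i + 1) (by simp [k60]; omega) ⟨i + 1, mid, j, by simp, by simp [k61],
        by simp [k62], ?_⟩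
      have := hinv.left (B' := (s₂.setMem 11 t (s.mem 10 i)).mem 11) hi' hle
        (fun u hu => by simp [m₂]; omega) (by simp)
      simpa [k63] using this
    · intro h; simp at h
      obtain ⟨hj, hle⟩ := c₂ (by omega)
      refine Runs.put t (s.mem 10 j) (by simp [k70]) (by simp [k61, e₁₀]; omega) harr (by omega) ?_
      refine Runs.assign (j + 1) (by simp [k61]; omega) ⟨i, mid, j + 1, by simp [k60], by simp,
        by simp [k62], ?_⟩
      have := hinv.right (B' := (s₂.setMem 11 t (s.mem 10 j)).mem 11) hj hle
        (fun u hu => by simp [m₂]; omega) (by simp)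
      simpa [k63] using this
  · rintro s' ⟨i, mid, j, -, -, -, h⟩ - - -
    obtain ⟨h₁, h₂, h₃, h₄, h₅, k, hk, he⟩ := h
    rw [sub_eq_nil _ (by omega), sub_eq_nil _ (by omega),
      List.drop_eq_nil_of_le (by simp; omega), mergePass_nil] at he
    simpa using he

/-- `array a := e, for the index in register r up to register rb` -/
def fillLoop (r rb a : ℕ) (e : Expr) : Cmd := forLoop r rb (.store a (#r r) e)

@[simp] theorem fillLoop_top (r rb a : ℕ) (e : Expr) : (fillLoop r rb a e).top = r + 1 := by
  simp [fillLoop, Cmd.top]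

@[simp] theorem fillLoop_keeps (r rb a b : ℕ) (e : Expr) :
    (fillLoop r rb a e).keeps b = (a != b) := by
  simp [fillLoop, Cmd.keeps]

theorem fillLoop_runs {r rb a : ℕ} {e : Expr} (n : ℕ) (f : ℕ → ℕ) (hrb : s.reg rb = n)
    (hr : r < rb) (hn : n ≤ iters I J (#r r <ᵉ #r rb)) (hcap : n < M.cap) (hpos : 1 < M.cap)
    (ha : a < M.arrays) (hc : n ≤ M.cells)
    (he : ∀ k < n, ∀ s', s'.reg r = k → (∀ r', r < r' → s'.reg r' = s.reg r') →
      (∀ b, b ≠ a → s'.mem b = s.mem b) → e.Ev M s' (f k)) :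
    Runs M I J (fillLoop r rb a e) s fun s' => ∀ u < n, s'.mem a u = f u := by
  refine Runs.for n hrb hr (by simp [Cmd.top]) hn hcap hpos
    (fun k s' => ∀ u < k, s'.mem a u = f u) (by simp) ?_ ?_
  · intro k hk s' hrk hi hf hm
    refine Runs.store k (f k) (by simp [hrk]) (he k hk s' hrk hf fun b hb => hm b ?_) ha (by omega) ?_
    · simp [Cmd.keeps]; omega
    · intro u hu
      simp only [State.setReg_mem, State.setMem_mem, true_and]
      split_ifs with h
      · rw [h]
      · exact hi u (by omega)
  · intro s' hi _ _ _
    exact hi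

/-- Sorts the items in the direction given by register `106` into the array `a`. -/
def sortCmd (a : ℕ) : Cmd :=
  fillLoop 70 220 10 (#r 70) ;; 75 ≔ 1 ;;
  .while (#r 75 <ᵉ #r 105) (mergeCmd ;; fillLoop 70 220 10 (.mem 11 (#r 70)) ;; 75 ≔ #r 75 * 2) ;;
  fillLoop 70 220 a (.mem 10 (#r 70))

@[simp] theorem sortCmd_top (a : ℕ) : (sortCmd a).top = 76 := by simp [sortCmd, Cmd.top]

@[simp] theorem sortCmd_keeps (a b : ℕ) :
    (sortCmd a).keeps b = (10 != b && (11 != b && a != b)) := by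
  simp only [sortCmd, Cmd.keeps, fillLoop_keeps, mergeCmd_keeps, Bool.true_and, Bool.and_true]
  generalize (10 != b) = u, (11 != b) = v, (a != b) = w
  cases u <;> cases v <;> cases w <;> rfl

/-- For every base the result is a permutation, which keeps all later accesses legal. That it is
sorted needs the comparison to be a total preorder, which colliding hashes may destroy; hence the
implication. -/
theorem sortCmd_runs (hE : E.WF M I) (hs : E.At false M s) (a d : ℕ) (ha : 3 < a) (ha' : a ≠ 10)
    (hd : s.reg 106 = d) (hd' : d ≤ 1)
    (hN : s.reg 220 = E.N) (hJ : E.N ≤ J)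
    (harr : 11 < M.arrays) (haM : a < M.arrays) (hcells : E.N ≤ M.cells) :
    Runs M I J (sortCmd a) s fun s' =>
      (cells (s'.mem a) E.N).Perm (List.range E.N) ∧
      ((∀ a b c, E.itemLe d a b = true → E.itemLe d b c = true → E.itemLe d a c = true) →
        (∀ a b, (E.itemLe d a b || E.itemLe d b a) = true) →
        (cells (s'.mem a) E.N).Pairwise fun a b => E.itemLe d a b = true) := by
  have hcap := hE.cap
  have hNn := hE.N_le
  have hn := hE.n_lt
  have hpl := hE.pow_le
  have hnp := hE.n_le_p
  have h2 := hE.two_le_p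
  have hKI := hE.K_lt
  have hit : ∀ r, E.N ≤ iters I J (#r r <ᵉ #r 220) := fun r => by
    simp [iters, Expr.isBig]; omega
  refine Runs.seq (fillLoop_runs E.N id hN (by omega) (hit _) (by omega) (by omega) (by omega) hcells
    fun k hk s' hr _ _ => by simp [hr]) ?_
  intro s₁ h₁ f₁
  have g₁ : ∀ r, 71 ≤ r → s₁.reg r = s.reg r := fun r hr => f₁.reg r (by simp; omega)
  have hs₁ := hs.congr (s' := s₁) (fun r h _ => g₁ r (by omega))
    (fun b hb => f₁.mem b (by simp; omega))
  refine Runs.set 1 (by simp; omega) ?_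
  -- The width doubles in each pass, so `Nat.clog 2 E.N` passes reach a single block.
  refine Runs.seq (Runs.while (Nat.clog 2 E.N) (le_iters ?_)
    (fun j s' => s'.reg 75 = 2 ^ j ∧ (cells (s'.mem 10) E.N).Perm (List.range E.N) ∧
      ((∀ a b c, E.itemLe d a b = true → E.itemLe d b c = true → E.itemLe d a c = true) →
        (∀ a b, (E.itemLe d a b || E.itemLe d b a) = true) →
        BlockSorted (E.itemLe d) (2 ^ j) (cells (s'.mem 10) E.N))) ?_ ?_
    (Q := fun s' => (cells (s'.mem 10) E.N).Perm (List.range E.N) ∧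
      ((∀ a b c, E.itemLe d a b = true → E.itemLe d b c = true → E.itemLe d a c = true) →
        (∀ a b, (E.itemLe d a b || E.itemLe d b a) = true) →
        (cells (s'.mem 10) E.N).Pairwise fun a b => E.itemLe d a b = true)) ?_) ?_
  · have : Nat.clog 2 E.N ≤ E.K := Nat.clog_le_of_le_pow (by omega)
    omega
  · have : cells (s₁.mem 10) E.N = List.range E.N := by
      rw [cells_congr (g := id) h₁]; simp [cells]
    refine ⟨by simp, by simp [this], fun _ _ k => ?_⟩
    generalize List.drop (k * 2 ^ 0) (cells _ _) = l
    rw [pow_zero]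
    rcases l with _ | ⟨b, l⟩
    · exact List.Pairwise.nil
    · exact List.pairwise_singleton _ _
  · rintro j hj s' ⟨h75, hperm, hgood⟩ hf
    have hlt : 2 ^ j < E.N := Nat.pow_lt_of_lt_clog hj
    have g : ∀ r, 76 ≤ r → s'.reg r = s₁.reg r := fun r hr => by
      rw [hf.reg r (by simp [Cmd.top]; omega), State.setReg_reg, if_neg (by omega)]
    have hs' := hs₁.congr (s' := s') (fun r h _ => g r (by omega))
      (fun b hb => (hf.mem b (by simp [Cmd.keeps]; omega)).trans rfl)
    refine ⟨by simp, by simp [h75, hs'.rN, hlt], ?_⟩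
    have hA : ∀ u < E.N, s'.mem 10 u < E.N := by
      intro u hu
      have : s'.mem 10 u ∈ cells (s'.mem 10) E.N :=
        List.mem_map.2 ⟨u, List.mem_range.2 hu, rfl⟩
      simpa using hperm.subset this
    refine Runs.seq (mergeCmd_runs hE hs' d (2 ^ j) (by rw [g _ (by omega), g₁ _ (by omega), hd])
      hd' h75 (by positivity) hlt (by rw [g _ (by omega), g₁ _ (by omega), hN]) hJ harr hcells hA) ?_
    intro s₂ h₂ f₂
    have g₂ : ∀ r, 71 ≤ r → s₂.reg r = s'.reg r := fun r hr => f₂.reg r (by simp; omega)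
    refine Runs.seq (fillLoop_runs E.N (s₂.mem 11)
      (by rw [g₂ _ (by omega), g _ (by omega), g₁ _ (by omega), hN]) (by omega) (hit _)
      (by omega) (by omega) (by omega) hcells fun k hk s₃ hr _ hm => ?_) ?_
    · simp [hr, hm 11 (by omega)]; omega
    intro s₃ h₃ f₃
    have h75' : s₃.reg 75 = 2 ^ j := by
      rw [f₃.reg _ (by simp), g₂ _ (by omega), h75]
    have hc : cells (s₃.mem 10) E.N = mergePass (E.itemLe d) (2 ^ j) E.N (cells (s'.mem 10) E.N) := by
      rw [cells_congr h₃, h₂]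
    refine Runs.assign (2 ^ (j + 1)) (by simp [h75', pow_succ]; omega) ⟨by simp, ?_, ?_⟩
    · simp only [State.setReg_mem]
      rw [hc]
      exact (mergePass_perm _ _ _ _).trans hperm
    · intro ht hto
      simp only [State.setReg_mem]
      rw [hc, pow_succ, mul_comm]
      exact (hgood ht hto).mergePass ht hto (by positivity) _ _ (by simp)
  · rintro s' ⟨h75, hperm, hgood⟩ hf
    have hle : E.N ≤ 2 ^ Nat.clog 2 E.N := Nat.le_pow_clog (by omega) _
    have rN : s'.reg 105 = E.N := by
      rw [hf.reg _ (by simp [Cmd.top])]; simp [hs₁.rN]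
    refine ⟨by simp, by simp [h75, rN, hle], hperm, fun ht hto => ?_⟩
    have := hgood ht hto 0
    rwa [Nat.zero_mul, List.drop_zero, List.take_of_length_le (by simpa using hle)] at this
  · rintro s₂ ⟨hperm, hgood⟩ f₂
    refine (fillLoop_runs E.N (s₂.mem 10) ?_ (by omega) (hit _)
      (by omega) (by omega) haM hcells fun k hk s₃ hr _ hm => ?_).mono ?_
    · rw [f₂.reg _ (by simp [Cmd.top]), State.setReg_reg, if_neg (by omega), g₁ _ (by omega), hN]
    · simp [hr, hm 10 (Ne.symm ha')]; omega
    · intro s₃ h₃ _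
      rw [cells_congr h₃]
      exact ⟨hperm, hgood⟩

end Programs

end RLZ

namespace RLZ

/-! ## Ranks and nearest smaller positions -/

/-- `a` lists the numbers below `N`, and `rk` is its inverse. -/
structure PermOn (N : ℕ) (a rk : ℕ → ℕ) : Prop where
  lt : ∀ r < N, a r < N
  rk_lt : ∀ q < N, rk q < N
  rk_a : ∀ r < N, rk (a r) = r
  a_rk : ∀ q < N, a (rk q) = q

theorem PermOn.inj {N : ℕ} {a rk : ℕ → ℕ} (h : PermOn N a rk) {q q' : ℕ} (hq : q < N)
    (hq' : q' < N) (e : rk q = rk q') : q = q' := by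
  rw [← h.a_rk q hq, e, h.a_rk q' hq']

theorem exists_rank {N : ℕ} {f : ℕ → ℕ} (h : (cells f N).Perm (List.range N)) :
    ∃ rk, PermOn N f rk := by
  have hsurj : ∀ q < N, ∃ r < N, f r = q := by
    intro q hq
    have := h.symm.subset (List.mem_range.2 hq)
    obtain ⟨r, hr, e⟩ := List.mem_map.1 this
    exact ⟨r, List.mem_range.1 hr, e⟩
  have hlt : ∀ r < N, f r < N := by
    intro r hr
    have : f r ∈ cells f N := List.mem_map.2 ⟨r, List.mem_range.2 hr, rfl⟩
    simpa using h.subset this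
  have hinj : ∀ r < N, ∀ r' < N, f r = f r' → r = r' := by
    have hnd : (cells f N).Nodup := h.nodup_iff.2 List.nodup_range
    intro r hr r' hr' e
    exact List.inj_on_of_nodup_map hnd (List.mem_range.2 hr) (List.mem_range.2 hr') e
  choose! rk h₁ h₂ using hsurj
  exact ⟨rk, hlt, h₁, fun r hr => hinj _ (h₁ _ (hlt r hr)) _ hr (h₂ _ (hlt r hr)), h₂⟩

/-- Among the items below `m`, the next one after `q` in the order of the ranks is `nx`, or there
is none and `nx = N`. -/
def IsNext (N : ℕ) (rk : ℕ → ℕ) (m q nx : ℕ) : Prop :=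
  (nx = N ∧ ∀ a < m, ¬ rk q < rk a) ∨
    (nx < m ∧ rk q < rk nx ∧ ∀ a < m, rk q < rk a → rk nx ≤ rk a)

theorem IsNext.le {N : ℕ} {rk : ℕ → ℕ} {m q nx : ℕ} (h : IsNext N rk m q nx) (hm : m ≤ N) :
    nx ≤ N := by
  rcases h with ⟨h, _⟩ | ⟨h, _⟩ <;> omega

/-- Removing the item `m` from the linked list. -/
theorem IsNext.unlink {N : ℕ} {rk rk' : ℕ → ℕ} {m p nm q nq : ℕ} (hm : m < N)
    (hinj : ∀ a < N, ∀ b < N, rk a = rk b → a = b)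
    (hrev : ∀ a < N, ∀ b < N, rk' a < rk' b ↔ rk b < rk a)
    (hp : IsNext N rk' (m + 1) m p) (hn : IsNext N rk (m + 1) m nm)
    (hq : q < m) (hnq : IsNext N rk (m + 1) q nq) :
    IsNext N rk m q (if q = p then nm else nq) := by
  have hlt : ∀ a < m, a ≠ m ∧ a < N ∧ a < m + 1 := fun a h => ⟨by omega, by omega, by omega⟩
  have hne : ∀ a < m, rk a ≠ rk m := fun a h e => (hlt a h).1 (hinj a (by omega) m hm e)
  have hle : ∀ a < N, ∀ b < N, rk' a ≤ rk' b ↔ rk b ≤ rk a := fun a ha b hb => by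
    have := hrev b hb a ha; omega
  -- `p` precedes `m`, so it inherits the successor of `m`; every other link stays as it is.
  by_cases hqp : q = p
  · rw [if_pos hqp]
    subst hqp
    rcases hp with ⟨hp, -⟩ | ⟨-, hp, hp'⟩
    · omega
    rw [hrev _ (by omega) _ (by omega)] at hp
    -- No remaining item lies strictly between the predecessor of `m` and `m`.
    have hpm : ∀ a < m, rk q < rk a → rk m < rk a := by
      intro a ha h
      by_contra hc
      have h1 := hne a ha
      have := hp' a (by omega) ((hrev _ (by omega) _ (by omega)).2 (by omega))
      rw [hle _ (by omega) _ (by omega)] at this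
      omega
    rcases hn with ⟨hn, hn'⟩ | ⟨hn, hn', hn''⟩
    · exact Or.inl ⟨hn, fun a ha h => hn' a (by omega) (hpm a ha h)⟩
    · have : nm ≠ m := by rintro rfl; omega
      exact Or.inr ⟨by omega, by omega, fun a ha h => hn'' a (by omega) (hpm a ha h)⟩
  · rw [if_neg hqp]
    rcases hnq with ⟨h, h'⟩ | ⟨h, h', h''⟩
    · exact Or.inl ⟨h, fun a ha => h' a (by omega)⟩
    · refine Or.inr ⟨?_, h', fun a ha => h'' a (by omega)⟩
      -- A link from `q` to `m` would make `q` the predecessor of `m`.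
      by_contra hc
      have hnm : nq = m := by omega
      subst hnm
      apply hqp
      rcases hp with ⟨-, hp⟩ | ⟨hp₀, hp, hp'⟩
      · exact absurd ((hrev _ (by omega) _ (by omega)).2 h') (hp q (by omega))
      · have h1 := hp' q (by omega) ((hrev _ (by omega) _ (by omega)).2 h')
        rw [hle _ (by omega) _ (by omega)] at h1
        rw [hrev _ (by omega) _ (by omega)] at hp
        by_contra hqp'
        have h2 : rk q ≠ rk p := fun e => hqp' (hinj _ (by omega) _ (by omega) e)
        have := h'' p (by omega) (by omega)
        omega

theorem PermOn.isNext {N : ℕ} {a rk : ℕ → ℕ} (h : PermOn N a rk) {r : ℕ} (hr : r < N) :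
    IsNext N rk N (a r) (if r + 1 < N then a (r + 1) else N) := by
  by_cases hc : r + 1 < N
  · rw [if_pos hc]
    refine Or.inr ⟨h.lt _ hc, ?_, fun b hb hlt => ?_⟩
    · rw [h.rk_a _ hr, h.rk_a _ hc]; omega
    · rw [h.rk_a _ hr] at hlt; rw [h.rk_a _ hc]; omega
  · rw [if_neg hc]
    refine Or.inl ⟨rfl, fun b hb hlt => ?_⟩
    rw [h.rk_a _ hr] at hlt
    have := h.rk_lt b hb
    omega

theorem PermOn.isPrev {N : ℕ} {a rk : ℕ → ℕ} (h : PermOn N a rk) {r : ℕ} (hr : r < N) :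
    IsNext N (fun q => N - rk q) N (a r) (if 0 < r then a (r - 1) else N) := by
  by_cases hc : 0 < r
  · rw [if_pos hc]
    refine Or.inr ⟨h.lt _ (by omega), ?_, fun b hb hlt => ?_⟩
    · beta_reduce; rw [h.rk_a _ hr, h.rk_a _ (by omega)]; omega
    · beta_reduce at hlt ⊢; rw [h.rk_a _ hr] at hlt; rw [h.rk_a _ (by omega)]; omega
  · rw [if_neg hc]
    refine Or.inl ⟨rfl, fun b hb hlt => ?_⟩
    beta_reduce at hlt
    rw [h.rk_a _ hr] at hlt
    have := h.rk_lt b hb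
    omega

/-- The longest common prefix of the suffixes at two items, `0` if the second one is missing. -/
def Env.near (E : Env) (c r : ℕ) : ℕ := if r < E.N then E.lcp 0 (E.pos c) (E.pos r) else 0

/-- `v` is the longest match of the suffix at item `c` with one of its two neighbours among the
suffixes at smaller items. -/
def Env.IsLpf (E : Env) (rk : ℕ → ℕ) (c v : ℕ) : Prop :=
  ∃ p nx, IsNext E.N (fun q => E.N - rk q) (c + 1) c p ∧ IsNext E.N rk (c + 1) c nx ∧
    v = max (E.near c p) (E.near c nx)

/-- Bounds the table of longest previous factors for every base, so that the jumps of the parse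
cannot overflow. -/
theorem Env.near_le (E : Env) (hp : ∀ q, E.pos q ≤ E.T.length) (c r : ℕ) :
    E.near c r ≤ E.T.length := by
  unfold Env.near
  split_ifs
  · have := E.lcp_le 0 (E.pos c) (E.pos r)
    have := E.room_le (d := 0) (hp c)
    omega
  · omega

/-! ### Ranks, longest previous factors and phrase ends -/

section Programs

variable {E : Env} {M : Machine} {I J : ℕ} {s : State} {Q : State → Prop}

def rankCmd : Cmd := forLoop 70 220 (.store 12 (.mem 4 (#r 70)) (#r 70))

@[simp] theorem rankCmd_top : rankCmd.top = 71 := by simp [rankCmd, Cmd.top]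

@[simp] theorem rankCmd_keeps (a : ℕ) : rankCmd.keeps a = (12 != a) := by
  simp [rankCmd, Cmd.keeps]

theorem rankCmd_runs (hE : E.WF M I) (hN : s.reg 220 = E.N) (hJ : E.N ≤ J)
    (harr : 21 < M.arrays) (hcells : E.N < M.cells) {rk : ℕ → ℕ} (hp : PermOn E.N (s.mem 4) rk) :
    Runs M I J rankCmd s fun s' => ∀ q < E.N, s'.mem 12 q = rk q := by
  have hcap := hE.cap
  have hNn := hE.N_le
  have hnp := hE.n_le_p
  have h2 := hE.two_le_p
  refine Runs.for E.N hN (by omega) (by simp [Cmd.top]) (by simp [iters, Expr.isBig]; omega)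
    (by omega) (by omega) (fun k s' => ∀ r < k, s'.mem 12 (s.mem 4 r) = r) (by simp) ?_ ?_
  · intro k hk s' hr hi hf hm
    have m4 : s'.mem 4 = s.mem 4 := hm 4 (by simp [Cmd.keeps])
    have := hp.lt k hk
    refine Runs.store (s.mem 4 k) k (by simp [hr, m4]; omega) (by simp [hr]) (by omega)
      (by omega) ?_
    intro r hrk
    simp only [State.setReg_mem, State.setMem_mem, true_and]
    split_ifs with h
    · have := hp.rk_a r (by omega)
      rw [h, hp.rk_a k hk] at this
      exact this
    · exact hi r (by rcases Nat.lt_succ_iff_lt_or_eq.1 hrk with h' | rfl; exacts [h', absurd rfl h])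
  · intro s' hi _ _ _ q hq
    have := hi (rk q) (hp.rk_lt q hq)
    rwa [hp.a_rk q hq] at this

/-- Links the items in the order of their ranks. -/
def linkCmd : Cmd := forLoop 70 220
  (60 ≔ #r 70 + 1 ;; .ite (#r 60 <ᵉ #r 105) (60 ≔ .mem 4 (#r 60)) .skip ;;
    .store 13 (.mem 4 (#r 70)) (#r 60) ;;
    60 ≔ #r 105 ;; .ite (#r 70) (60 ≔ .mem 4 (#r 70 - 1)) .skip ;;
    .store 14 (.mem 4 (#r 70)) (#r 60))

@[simp] theorem linkCmd_top : linkCmd.top = 71 := by simp [linkCmd, Cmd.top]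

theorem linkCmd_keeps {a : ℕ} (h : a ≠ 13) (h' : a ≠ 14) : linkCmd.keeps a = true := by
  simp [linkCmd, Cmd.keeps, h.symm, h'.symm]

theorem linkCmd_runs (hE : E.WF M I) (hs : E.At false M s) (hN : s.reg 220 = E.N) (hJ : E.N ≤ J)
    (harr : 21 < M.arrays) (hcells : E.N < M.cells) {rk : ℕ → ℕ} (hp : PermOn E.N (s.mem 4) rk) :
    Runs M I J linkCmd s fun s' => ∀ q < E.N, IsNext E.N rk E.N q (s'.mem 13 q) ∧
      IsNext E.N (fun q => E.N - rk q) E.N q (s'.mem 14 q) := by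
  have hcap := hE.cap
  have hNn := hE.N_le
  have hnp := hE.n_le_p
  have h2 := hE.two_le_p
  refine Runs.for E.N hN (by omega) (by simp [Cmd.top]) (by simp [iters, Expr.isBig]; omega)
    (by omega) (by omega) (fun k s' => ∀ r < k,
      s'.mem 13 (s.mem 4 r) = (if r + 1 < E.N then s.mem 4 (r + 1) else E.N) ∧
      s'.mem 14 (s.mem 4 r) = (if 0 < r then s.mem 4 (r - 1) else E.N)) (by simp) ?_ ?_
  · intro k hk s' hr hi hf hm
    have m4 : s'.mem 4 = s.mem 4 := hm 4 (by simp [Cmd.keeps])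
    have := hp.lt k hk
    have r105 : s'.reg 105 = E.N := by rw [hf _ (by omega), hs.rN]
    have hne : ∀ r < k, s.mem 4 r ≠ s.mem 4 k := fun r h e => by
      have := hp.rk_a r (by omega); rw [e, hp.rk_a k hk] at this; omega
    refine Runs.set (k + 1) (by simp [hr]; omega) ?_
    refine Runs.seq (Q' := fun s₁ => s₁.reg 60 = (if k + 1 < E.N then s.mem 4 (k + 1) else E.N))
      (Runs.ite (by simp) ?_ ?_) ?_
    · intro h; simp [r105] at h
      exact Runs.assign (s.mem 4 (k + 1)) (by simp [m4]; omega) (by simp [h])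
    · intro h; simp [r105] at h
      exact Runs.skip (by simp [show ¬ k + 1 < E.N by omega]; omega)
    intro s₁ r₁ f₁
    have g₁ : ∀ r, 61 ≤ r → s₁.reg r = s'.reg r := fun r hr => by
      rw [f₁.reg r (by simp [Cmd.top]; omega), State.setReg_reg, if_neg (by omega)]
    have m₁ : s₁.mem = s'.mem := funext fun a => (f₁.mem a (by simp [Cmd.keeps])).trans rfl
    refine Runs.put (s.mem 4 k) _ (by simp [g₁, hr, m₁, m4]; omega) ⟨by simp, r₁⟩ (by omega)
      (by omega) ?_
    refine Runs.set E.N (by simp [g₁, r105]) ?_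
    refine Runs.seq (Q' := fun s₂ => s₂.reg 60 = (if 0 < k then s.mem 4 (k - 1) else E.N))
      (Runs.ite (by simp) ?_ ?_) ?_
    · intro h; simp [g₁, hr] at h
      exact Runs.assign (s.mem 4 (k - 1)) (by simp [g₁, hr, m₁, m4]; omega)
        (by simp [show 0 < k by omega])
    · intro h; simp [g₁, hr] at h
      exact Runs.skip (by simp [h])
    intro s₂ r₂ f₂
    have g₂ : ∀ r, 61 ≤ r → s₂.reg r = s'.reg r := fun r hr => by
      rw [f₂.reg r (by simp [Cmd.top]; omega), State.setReg_reg, if_neg (by omega)]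
      simp [g₁ r hr]
    have m₂ := fun a => f₂.mem a (by simp [Cmd.keeps])
    refine Runs.store (s.mem 4 k) _ (by simp [g₂, hr, m₂, m₁, m4]; omega) ⟨by simp, r₂⟩ (by omega)
      (by omega) ?_
    intro r hr
    simp [m₂, m₁]
    by_cases h : r = k
    · subst h; simp
    · simp [hne r (by omega)]
      exact hi r (by omega)
  · intro s' hi _ _ _ q hq
    obtain ⟨h₁, h₂⟩ := hi (rk q) (hp.rk_lt q hq)
    rw [hp.a_rk q hq] at h₁ h₂
    have h₃ := hp.isNext (hp.rk_lt q hq)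
    have h₄ := hp.isPrev (hp.rk_lt q hq)
    rw [hp.a_rk q hq] at h₃ h₄
    rw [h₁, h₂]
    exact ⟨h₃, h₄⟩

/-- `register r := E.near (register 64) (register o)` -/
def nearCmd (r o : ℕ) : Cmd :=
  .ite (#r o <ᵉ #r 105) (58 ≔ rd false 1 (#r 64) ;; 59 ≔ rd false 1 (#r o) ;; cmpCmd false ;;
    r ≔ #r 50) (r ≔ 0)

@[simp] theorem nearCmd_top (r o : ℕ) : (nearCmd r o).top = max 60 (r + 1) := by
  simp [nearCmd, Cmd.top]; omega

@[simp] theorem nearCmd_keeps (r o a : ℕ) : (nearCmd r o).keeps a = true := by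
  simp [nearCmd, Cmd.keeps]

theorem nearCmd_runs (hE : E.WF M I) (hs : E.At false M s) (r o c b : ℕ) (hd : s.reg 106 = 0)
    (hc : s.reg 64 = c) (hc' : c < E.N) (ho : s.reg o = b) (ho' : 60 ≤ o) :
    Runs M I J (nearCmd r o) s fun s' => s'.reg r = E.near c b := by
  have hcap := hE.cap
  refine Runs.ite (by simp) ?_ ?_
  · intro h; simp [ho, hs.rN] at h
    refine Runs.set (E.pos c) (by simp [hc, hs.hpos.ok hc', hs.hpos.val hc']) ?_
    refine Runs.set (E.pos b) ?_ ?_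
    · simp [show o ≠ 58 by omega, ho, hs.hpos.ok h, hs.hpos.val h]
    refine Runs.seq (cmpCmd_runs (E := E) hE ((hs.setReg (by omega)).setReg (by omega)) 0 _ _
      (by simp [hd]) (by omega) (by simp) (by simp) (hE.pos_le c) (hE.pos_le b)) ?_
    rintro s₁ ⟨h₁, -⟩ -
    exact Runs.assign (E.near c b) (by simp [h₁, Env.near, h]) (by simp)
  · intro h; simp [ho, hs.rN] at h
    exact Runs.assign 0 (by simp; omega) (by simp [Env.near, show ¬ b < E.N by omega])

/-- Removes the items from the largest to the smallest, which yields the longest previous factors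
in array `15`. -/
def lpfCmd : Cmd := forLoop 70 220
  (64 ≔ #r 105 - 1 - #r 70 ;; 62 ≔ .mem 14 (#r 64) ;; 63 ≔ .mem 13 (#r 64) ;;
    nearCmd 61 62 ;; nearCmd 60 63 ;;
    .ite (#r 60 <ᵉ #r 61) (.store 15 (#r 64) (#r 61)) (.store 15 (#r 64) (#r 60)) ;;
    .store 13 (#r 62) (#r 63) ;; .store 14 (#r 63) (#r 62))

@[simp] theorem lpfCmd_top : lpfCmd.top = 71 := by simp [lpfCmd, Cmd.top]

theorem lpfCmd_keeps {a : ℕ} (h : a < 13 ∨ 15 < a) : lpfCmd.keeps a = true := by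
  simp [lpfCmd, Cmd.keeps]; omega

/-- Before round `k` the list contains the items below `E.N - k`. The largest of them sees as
neighbours the nearest smaller items in suffix order, and is then unlinked. A missing neighbour is
`E.N`, and the store to its link goes to a spare cell; hence `E.N < M.cells`. -/
theorem lpfCmd_runs (hE : E.WF M I) (hs : E.At false M s) (hN : s.reg 220 = E.N) (hJ : E.N ≤ J)
    (hd : s.reg 106 = 0) (harr : 21 < M.arrays) (hcells : E.N < M.cells) {rk a : ℕ → ℕ}
    (hp : PermOn E.N a rk)
    (hl : ∀ q < E.N, IsNext E.N rk E.N q (s.mem 13 q) ∧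
      IsNext E.N (fun q => E.N - rk q) E.N q (s.mem 14 q)) :
    Runs M I J lpfCmd s fun s' => ∀ q < E.N, E.IsLpf rk q (s'.mem 15 q) := by
  have hcap := hE.cap
  have hNn := hE.N_le
  have hnp := hE.n_le_p
  have h2 := hE.two_le_p
  have hrev : ∀ a < E.N, ∀ b < E.N, E.N - rk a < E.N - rk b ↔ rk b < rk a := by
    intro a ha b hb
    have := hp.rk_lt a ha; have := hp.rk_lt b hb; omega
  have hrev' : ∀ a < E.N, ∀ b < E.N, rk a < rk b ↔ E.N - rk b < E.N - rk a := by
    intro a ha b hb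
    have := hp.rk_lt a ha; have := hp.rk_lt b hb; omega
  refine Runs.for E.N hN (by omega) (by simp [Cmd.top]) (by simp [iters, Expr.isBig]; omega)
    (by omega) (by omega) (fun k s' => (∀ q, q < E.N → E.N - k ≤ q → E.IsLpf rk q (s'.mem 15 q)) ∧
      ∀ q < E.N - k, IsNext E.N rk (E.N - k) q (s'.mem 13 q) ∧
      IsNext E.N (fun q => E.N - rk q) (E.N - k) q (s'.mem 14 q)) ?_ ?_ ?_
  · refine ⟨fun q h h' => by omega, fun q h => ?_⟩
    exact hl q (by omega)
  · rintro k hk s' hr ⟨hi₁, hi₂⟩ hf hm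
    have hs' := hs.congr (s' := s') (fun r h _ => hf r (by omega))
      (fun b hb => hm b (by simp [Cmd.keeps]; omega))
    obtain ⟨c, hc⟩ : ∃ c, c = E.N - 1 - k := ⟨_, rfl⟩
    have hck : E.N - k = c + 1 := by omega
    have hck' : E.N - (k + 1) = c := by omega
    rw [hck] at hi₁ hi₂
    rw [hck']
    have hcN : c < E.N := by omega
    obtain ⟨hnx, hpv⟩ := hi₂ c (by omega)
    generalize hnx' : s'.mem 13 c = nx at hnx
    generalize hpv' : s'.mem 14 c = pv at hpv
    have lnx := hnx.le hcN
    have lpv := hpv.le hcN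
    refine Runs.set c (by simp [hr, hs'.rN]; omega) (Runs.set pv (by simp [hpv']; omega)
      (Runs.set nx (by simp [hnx']; omega) ?_))
    have hs₀ := ((hs'.setReg (r := 64) (v := c) (by omega)).setReg (r := 62) (v := pv)
      (by omega)).setReg (r := 63) (v := nx) (by omega)
    refine Runs.seq (nearCmd_runs hE hs₀ 61 62 c pv
      (by simp [hf 106, hd]) (by simp) hcN (by simp) (by omega)) ?_
    intro s₁ r₁ f₁
    have g₁ : ∀ r, 62 ≤ r → s₁.reg r = (((s'.setReg 64 c).setReg 62 pv).setReg 63 nx).reg r :=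
      fun r hr => f₁.reg r (by simp; omega)
    have hs₁ := hs₀.frame f₁ (by simp) (by simp)
    refine Runs.seq (nearCmd_runs hE hs₁ 60 63 c nx
      (by rw [g₁ _ (by omega)]; simp [hf 106, hd]) (by rw [g₁ _ (by omega)]; simp) hcN
      (by rw [g₁ _ (by omega)]; simp) (by omega)) ?_
    intro s₂ r₂ f₂
    have g₂ : ∀ r, 61 ≤ r → s₂.reg r = s₁.reg r := fun r hr => f₂.reg r (by simp; omega)
    have m₂ : ∀ a, s₂.mem a = s'.mem a := fun a =>
      (f₂.mem a (by simp)).trans ((f₁.mem a (by simp)).trans rfl)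
    have k61 : s₂.reg 61 = E.near c pv := by rw [g₂ _ (by omega), r₁]
    have k62 : s₂.reg 62 = pv := by rw [g₂ _ (by omega), g₁ _ (by omega)]; simp
    have k63 : s₂.reg 63 = nx := by rw [g₂ _ (by omega), g₁ _ (by omega)]; simp
    have k64 : s₂.reg 64 = c := by rw [g₂ _ (by omega), g₁ _ (by omega)]; simp
    refine Runs.seq (Q' := fun s₃ => s₃ = s₂.setMem 15 c (max (E.near c pv) (E.near c nx)))
      (Runs.ite (by simp) ?_ ?_) ?_
    · intro h; simp [k61, r₂] at h
      refine Runs.store c (E.near c pv) (by simp [k64]) (by simp [k61]) (by omega) (by omega) ?_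
      rw [max_eq_left (by omega)]
    · intro h; simp [k61, r₂] at h
      refine Runs.store c (E.near c nx) (by simp [k64]) (by simp [r₂]) (by omega) (by omega) ?_
      rw [max_eq_right (by omega)]
    rintro _ rfl -
    refine Runs.put pv nx (by simp [k62]) (by simp [k63]) (by omega) (by omega) ?_
    refine Runs.store nx pv (by simp [k63]) (by simp [k62]) (by omega) (by omega) ?_
    constructor
    · intro q hq hq'
      simp [m₂]
      by_cases h : q = c
      · subst h; simp
        exact ⟨pv, nx, hpv, hnx, rfl⟩
      · simp [h]; exact hi₁ q hq (by omega)
    · intro q hq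
      obtain ⟨h₁, h₂⟩ := hi₂ q (by omega)
      constructor
      -- The two directions of the list are the same statement for the ranks and for the reversed
      -- ranks.
      · have := IsNext.unlink hcN (fun a ha b hb e => hp.inj ha hb e) hrev hpv hnx hq h₁
        simpa [m₂] using this
      · have := IsNext.unlink (rk := fun q => E.N - rk q) hcN (fun a ha b hb e => hp.inj ha hb (by
          have := hp.rk_lt a ha; have := hp.rk_lt b hb; change E.N - rk a = E.N - rk b at e; omega)) hrev' hnx hpv hq h₂
        simpa [m₂] using this
  · rintro s' ⟨hi, -⟩ _ _ _ q hq
    exact hi q hq (by omega)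

/-- The start of the next phrase of the LZ77 parse of the reference. -/
def Env.step (E : Env) (lpf : ℕ → ℕ) (a : ℕ) : ℕ := min (a + lpf a + 1) E.ℓ

theorem Env.step_iterate_le (E : Env) (lpf : ℕ → ℕ) (j : ℕ) : (E.step lpf)^[j] 0 ≤ E.ℓ := by
  cases j with
  | zero => exact Nat.zero_le _
  | succ j => rw [Function.iterate_succ_apply']; exact min_le_right _ _

/-- Array `16` gets the value of every item: its own number if it is a phrase boundary, and `N`
otherwise. -/
def flagCmd : Cmd :=
  forLoop 70 220 (.ite (#r 104 <ᵉ #r 70) (.store 16 (#r 70) (#r 70)) (.store 16 (#r 70) (#r 105))) ;;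
  65 ≔ 0 ;;
  forLoop 70 221 (minCmd 65 (#r 65 + .mem 15 (#r 65) + 1) (#r 104) ;; .store 16 (#r 65) (#r 65))

@[simp] theorem flagCmd_top : flagCmd.top = 71 := by simp [flagCmd, Cmd.top]

theorem flagCmd_keeps {a : ℕ} (h : a ≠ 16) : flagCmd.keeps a = true := by
  simp [flagCmd, Cmd.keeps, h.symm]

/-- The value `E.N` of a non-boundary is neutral for minima. The `ℓ` jumps need no test for the end
of the reference, because `ℓ` is a fixed point of `Env.step`. -/
theorem flagCmd_runs (hE : E.WF M I) (hs : E.At false M s) (hN : s.reg 220 = E.N)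
    (hN' : s.reg 221 = E.ℓ) (hℓ : s.reg 104 = E.ℓ) (hJ : E.N ≤ J)
    (harr : 21 < M.arrays) (hcells : E.N < M.cells) (hlpf : ∀ q < E.N, s.mem 15 q ≤ E.T.length) :
    Runs M I J flagCmd s fun s' => ∀ q < E.N, s'.mem 16 q ≤ E.N ∧
      (s'.mem 16 q = q ∨ s'.mem 16 q = E.N) ∧
      (s'.mem 16 q = q ↔ E.ℓ < q ∨ ∃ j, 1 ≤ j ∧ j ≤ E.ℓ ∧ (E.step (s.mem 15))^[j] 0 = q) := by
  have hcap := hE.cap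
  have hNn := hE.N_le
  have hnp := hE.n_le_p
  have h2 := hE.two_le_p
  have hlN := hE.ℓ_lt
  refine Runs.seq (Runs.for (Q := fun s' => ∀ q < E.N, s'.mem 16 q = if E.ℓ < q then q else E.N)
    E.N hN (by omega) (by simp [Cmd.top]) (by simp [iters, Expr.isBig]; omega)
    (by omega) (by omega) (fun k s' => ∀ q < k, s'.mem 16 q = if E.ℓ < q then q else E.N)
    (by simp) ?_ ?_) ?_
  · intro k hk s' hr hi hf hm
    have r105 : s'.reg 105 = E.N := by rw [hf _ (by omega), hs.rN]
    have r104 : s'.reg 104 = E.ℓ := by rw [hf _ (by omega), hℓ]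
    have key : ∀ v, v = (if E.ℓ < k then k else E.N) → ∀ q < k + 1,
        ((s'.setMem 16 k v).setReg 70 (k + 1)).mem 16 q = if E.ℓ < q then q else E.N := by
      intro v hv q hq
      simp only [State.setReg_mem, State.setMem_mem, true_and]
      split_ifs with h h' h'
      · subst h; rw [hv, if_pos h']
      · subst h; rw [hv, if_neg h']
      · rw [hi q (by omega), if_pos h']
      · rw [hi q (by omega), if_neg h']
    refine Runs.ite (by simp) ?_ ?_
    · intro h; simp [r104, hr] at h
      exact Runs.store k k (by simp [hr]) (by simp [hr]) (by omega) (by omega)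
        (key _ (by rw [if_pos h]))
    · intro h; simp [r104, hr] at h
      exact Runs.store k E.N (by simp [hr]) (by simp [r105]) (by omega) (by omega)
        (key _ (by rw [if_neg (by omega)]))
  · intro s' hi _ _ _
    exact hi
  intro s₁ h₁ f₁
  have g₁ : ∀ r, 71 ≤ r → s₁.reg r = s.reg r := fun r hr => f₁.reg r (by simp [Cmd.top]; omega)
  have m₁ : ∀ b, b ≠ 16 → s₁.mem b = s.mem b := fun b hb => f₁.mem b (by simp [Cmd.keeps]; omega)
  refine Runs.set 0 (by simp; omega) ?_
  refine Runs.for E.ℓ (by simp [g₁, hN']) (by omega) (by simp [Cmd.top])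
    (by simp [iters, Expr.isBig]; omega) (by omega) (by omega)
    (fun k s' => s'.reg 65 = (E.step (s.mem 15))^[k] 0 ∧ ∀ q < E.N,
      (s'.mem 16 q = q ∧ (E.ℓ < q ∨ ∃ j, 1 ≤ j ∧ j ≤ k ∧ (E.step (s.mem 15))^[j] 0 = q)) ∨
      (s'.mem 16 q = E.N ∧ ¬ (E.ℓ < q ∨ ∃ j, 1 ≤ j ∧ j ≤ k ∧ (E.step (s.mem 15))^[j] 0 = q)))
    ?_ ?_ ?_
  · refine ⟨by simp, fun q hq => ?_⟩
    simp only [State.setReg_mem, h₁ q hq]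
    by_cases h : E.ℓ < q
    · left; simp [h]
    · right; refine ⟨by simp [h], ?_⟩
      rintro (h' | ⟨j, h₁, h₂, -⟩) <;> omega
  · rintro k hk s' hr ⟨h65, hi⟩ hf hm
    have m15 : s'.mem 15 = s.mem 15 := by rw [hm 15 (by simp [Cmd.keeps])]; exact m₁ 15 (by omega)
    have hle := E.step_iterate_le (s.mem 15) k
    have hle' := E.step_iterate_le (s.mem 15) (k + 1)
    have hl := hlpf _ (show (E.step (s.mem 15))^[k] 0 < E.N by omega)
    rw [Function.iterate_succ_apply'] at hle'
    refine Runs.seq (minCmd_runs ((E.step (s.mem 15))^[k] 0 +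
      s.mem 15 ((E.step (s.mem 15))^[k] 0) + 1) E.ℓ ?_ ?_) ?_
    · simp [h65, m15]; omega
    · intro v; simp [hf 104, g₁, hℓ]
    rintro s₂ ⟨r₂, -, m₂⟩ -
    change s₂.reg 65 = E.step (s.mem 15) _ at r₂
    refine Runs.store _ _ ⟨by simp, r₂⟩ ⟨by simp, r₂⟩ (by omega) (by omega) ⟨?_, ?_⟩
    · simp only [State.setReg_reg, State.setMem_reg]
      rw [if_neg (by omega), r₂, Function.iterate_succ_apply']
    · intro q hq
      simp only [State.setReg_mem, State.setMem_mem, true_and, m₂]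
      by_cases h : q = E.step (s.mem 15) ((E.step (s.mem 15))^[k] 0)
      · left
        rw [if_pos h]
        exact ⟨h.symm, Or.inr ⟨k + 1, by omega, le_rfl, by rw [Function.iterate_succ_apply', h]⟩⟩
      · rw [if_neg h]
        have : (∃ j, 1 ≤ j ∧ j ≤ k + 1 ∧ (E.step (s.mem 15))^[j] 0 = q) ↔
            ∃ j, 1 ≤ j ∧ j ≤ k ∧ (E.step (s.mem 15))^[j] 0 = q := by
          constructor
          · rintro ⟨j, h₁, h₂, h₃⟩
            refine ⟨j, h₁, ?_, h₃⟩
            by_contra hc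
            obtain rfl : j = k + 1 := by omega
            rw [Function.iterate_succ_apply'] at h₃
            exact h h₃.symm
          · rintro ⟨j, h₁, h₂, h₃⟩
            exact ⟨j, h₁, by omega, h₃⟩
        rw [this]
        exact hi q hq
  · rintro s' ⟨-, hi⟩ _ _ _ q hq
    rcases hi q hq with ⟨h, h'⟩ | ⟨h, h'⟩
    · exact ⟨by omega, Or.inl h, by simp only [h, h', true_iff]⟩
    · refine ⟨h.le, Or.inr h, ?_⟩
      constructor
      · intro h''; omega
      · intro h''; exact absurd h'' h'

end Programs

end RLZ

namespace RLZ

/-! ## The wavelet tree -/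

/-- The number of `x < a` with `y x` in the `u`-th dyadic interval of length `2 ^ k`. -/
def cnt (y : ℕ → ℕ) (k u : ℕ) : ℕ → ℕ
  | 0 => 0
  | a + 1 => cnt y k u a + if y a / 2 ^ k = u then 1 else 0

/-- The position of `x` on level `k` of the wavelet tree. -/
def posn (y : ℕ → ℕ) (k x : ℕ) : ℕ := y x / 2 ^ k * 2 ^ k + cnt y k (y x / 2 ^ k) x

theorem cnt_eq_card (y : ℕ → ℕ) (k u a : ℕ) :
    cnt y k u a = ((Finset.range a).filter fun x => y x / 2 ^ k = u).card := by
  induction a with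
  | zero => rfl
  | succ a ih =>
    rw [cnt, ih, Finset.range_add_one, Finset.filter_insert]
    split_ifs with h
    · rw [Finset.card_insert_of_notMem (by simp)]
    · rfl

theorem cnt_mono (y : ℕ → ℕ) (k u : ℕ) {a b : ℕ} (h : a ≤ b) : cnt y k u a ≤ cnt y k u b := by
  induction h with
  | refl => exact le_rfl
  | step _ ih => rw [cnt]; omega

/-- `y` is injective and a dyadic interval has `2 ^ k` elements. So on each level every node owns `2
^ k` slots, and slots of different nodes are disjoint. -/
theorem cnt_le {y : ℕ → ℕ} {N : ℕ} (hy : ∀ x < N, ∀ x' < N, y x = y x' → x = x') (k u : ℕ) :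
    cnt y k u N ≤ 2 ^ k := by
  rw [cnt_eq_card]
  have hp : 0 < 2 ^ k := by positivity
  calc _ ≤ (Finset.Ico (u * 2 ^ k) (u * 2 ^ k + 2 ^ k)).card := by
        refine Finset.card_le_card_of_injOn y ?_ ?_
        · intro x hx
          simp only [Finset.coe_filter, Finset.mem_range, Set.mem_ofPred_eq] at hx
          have h1 := Nat.div_add_mod (y x) (2 ^ k)
          have h2 := Nat.mod_lt (y x) hp
          rw [hx.2, mul_comm] at h1
          simp only [Finset.coe_Ico, Set.mem_Ico]
          omega
        · intro x hx x' hx' e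
          simp only [Finset.coe_filter, Finset.mem_range, Set.mem_ofPred_eq] at hx hx'
          exact hy x hx.1 x' hx'.1 e
    _ = 2 ^ k := by simp

theorem cnt_lt {y : ℕ → ℕ} {N : ℕ} (hy : ∀ x < N, ∀ x' < N, y x = y x' → x = x') (k : ℕ) {x : ℕ}
    (hx : x < N) : cnt y k (y x / 2 ^ k) x < 2 ^ k := by
  have h₁ := cnt_le hy k (y x / 2 ^ k)
  have h₂ := cnt_mono y k (y x / 2 ^ k) (show x + 1 ≤ N from hx)
  rw [cnt, if_pos rfl] at h₂
  omega

/-- The node of a point can be read off its position. -/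
theorem posn_div {y : ℕ → ℕ} {N : ℕ} (hy : ∀ x < N, ∀ x' < N, y x = y x' → x = x') (k : ℕ) {x : ℕ}
    (hx : x < N) : posn y k x / 2 ^ k = y x / 2 ^ k := by
  rw [posn, mul_comm, Nat.mul_add_div (by positivity), Nat.div_eq_of_lt (cnt_lt hy k hx), add_zero]

theorem posn_lt {y : ℕ → ℕ} {N D : ℕ} (hy : ∀ x < N, ∀ x' < N, y x = y x' → x = x')
    (hD : ∀ x < N, y x < 2 ^ D) {k x : ℕ} (hk : k ≤ D) (hx : x < N) : posn y k x < 2 ^ D := by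
  have h₁ := posn_div hy k hx
  have h₂ : y x / 2 ^ k < 2 ^ (D - k) := by
    rw [Nat.div_lt_iff_lt_mul (by positivity), ← pow_add, Nat.sub_add_cancel hk]
    exact hD x hx
  rw [← h₁, Nat.div_lt_iff_lt_mul (by positivity), ← pow_add, Nat.sub_add_cancel hk] at h₂
  exact h₂

theorem posn_ne {y : ℕ → ℕ} {N : ℕ} (hy : ∀ x < N, ∀ x' < N, y x = y x' → x = x') (k : ℕ)
    {x x' : ℕ} (h : x < x') (hx : x' < N) : posn y k x ≠ posn y k x' := by
  intro e
  have h₁ := posn_div hy k (show x < N by omega)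
  have h₂ := posn_div hy k hx
  have h₃ : y x / 2 ^ k = y x' / 2 ^ k := by rw [← h₁, ← h₂, e]
  have h₄ := cnt_mono y k (y x' / 2 ^ k) (show x + 1 ≤ x' from h)
  rw [cnt, if_pos h₃] at h₄
  simp only [posn, h₃] at e
  omega

theorem cnt_split (y : ℕ → ℕ) (k u a : ℕ) :
    cnt y (k + 1) u a = cnt y k (2 * u) a + cnt y k (2 * u + 1) a := by
  induction a with
  | zero => rfl
  | succ a ih =>
    have : y a / 2 ^ (k + 1) = y a / 2 ^ k / 2 := by rw [pow_succ, Nat.div_div_eq_div_mul]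
    simp only [cnt, ih, this]
    split_ifs <;> omega

/-- The number of zeros among `b 0, …, b (t - 1)`. -/
def zr (b : ℕ → ℕ) : ℕ → ℕ
  | 0 => 0
  | t + 1 => zr b t + (1 - b t)

theorem zr_le (b : ℕ → ℕ) (t : ℕ) : zr b t ≤ t := by
  induction t with
  | zero => exact le_rfl
  | succ t ih => rw [zr]; omega

/-- The bits of a node, in the order of its points, tell which points go to the right child. So the
zeros between the start of the node and the offset of `a` count the points before `a` in the left
child. -/
theorem zr_cnt {y b : ℕ → ℕ} {N k : ℕ}
    (hb : ∀ x < N, b (posn y (k + 1) x) = y x / 2 ^ k % 2) (u a : ℕ) (ha : a ≤ N) :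
    zr b (u * 2 ^ (k + 1) + cnt y (k + 1) u a) = zr b (u * 2 ^ (k + 1)) + cnt y k (2 * u) a := by
  induction a with
  | zero => simp [cnt]
  | succ a ih =>
    have ih := ih (by omega)
    have e : y a / 2 ^ (k + 1) = y a / 2 ^ k / 2 := by rw [pow_succ, Nat.div_div_eq_div_mul]
    by_cases h : y a / 2 ^ (k + 1) = u
    · have hb := hb a (by omega)
      rw [posn, h] at hb
      simp only [cnt, if_pos h]
      rw [← add_assoc, zr, ih, hb, add_assoc]
      congr 2
      split_ifs <;> omega
    · simp only [cnt, if_neg h, if_neg (show ¬ y a / 2 ^ k = 2 * u by omega)]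
      rw [add_zero, ih, add_zero]

/-- The number with the binary digits `f 0, …, f (n - 1)`. -/
def bitsVal (f : ℕ → ℕ) : ℕ → ℕ
  | 0 => 0
  | n + 1 => bitsVal f n + f n * 2 ^ n

theorem bitsVal_lt {f : ℕ → ℕ} (n : ℕ) (hf : ∀ i < n, f i ≤ 1) : bitsVal f n < 2 ^ n := by
  induction n with
  | zero => simp [bitsVal]
  | succ n ih =>
    have := ih fun i hi => hf i (by omega)
    have := Nat.mul_le_mul_right (2 ^ n) (hf n (by omega))
    rw [bitsVal, pow_succ]; omega

theorem bitsVal_digit {f : ℕ → ℕ} (n : ℕ) (hf : ∀ i < n, f i ≤ 1) {e : ℕ} (he : e < n) :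
    bitsVal f n / 2 ^ e % 2 = f e := by
  induction n with
  | zero => omega
  | succ n ih =>
    rw [bitsVal]
    by_cases h : e = n
    · subst h
      rw [Nat.add_mul_div_right _ _ (by positivity),
        Nat.div_eq_of_lt (bitsVal_lt e fun i hi => hf i (by omega)), zero_add]
      have := hf e (by omega)
      omega
    · obtain ⟨d, rfl⟩ : ∃ d, n = e + 1 + d := ⟨n - e - 1, by omega⟩
      rw [show f (e + 1 + d) * 2 ^ (e + 1 + d) = f (e + 1 + d) * 2 ^ d * 2 * 2 ^ e by ring,
        Nat.add_mul_div_right _ _ (by positivity), Nat.add_mul_mod_self_right]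
      exact ih (fun i hi => hf i (by omega)) (by omega)

/-! ### Minima with `N` as infinity -/

/-- `m` is the minimum of the values in `S`, or `N` if there is none. -/
structure IsMinOf (N : ℕ) (S : ℕ → Prop) (m : ℕ) : Prop where
  le : m ≤ N
  min : ∀ v, S v → m ≤ v
  mem : m = N ∨ S m

theorem IsMinOf.union {N : ℕ} {S S₁ S₂ : ℕ → Prop} {m₁ m₂ : ℕ} (h₁ : IsMinOf N S₁ m₁)
    (h₂ : IsMinOf N S₂ m₂) (h : ∀ v, S v ↔ S₁ v ∨ S₂ v) : IsMinOf N S (Min.min m₁ m₂) := by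
  refine ⟨by have := h₁.le; omega, fun v hv => ?_, ?_⟩
  · rcases (h v).1 hv with hv | hv
    · have := h₁.min v hv; omega
    · have := h₂.min v hv; omega
  · rcases le_total m₁ m₂ with hm | hm
    · rw [min_eq_left hm]
      exact h₁.mem.imp_right fun hv => (h _).2 (Or.inl hv)
    · rw [min_eq_right hm]
      exact h₂.mem.imp_right fun hv => (h _).2 (Or.inr hv)

theorem IsMinOf.empty {N : ℕ} {S : ℕ → Prop} (h : ∀ v, ¬ S v) : IsMinOf N S N :=
  ⟨le_rfl, fun v hv => absurd hv (h v), Or.inl rfl⟩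

/-- A value above `N` is cut off, so unused slots with arbitrary contents do no harm. -/
theorem IsMinOf.singleton {N : ℕ} {S : ℕ → Prop} {m : ℕ} (h : ∀ v, S v ↔ v = m) :
    IsMinOf N S (Min.min m N) := by
  refine ⟨by omega, fun v hv => ?_, ?_⟩
  · have := (h v).1 hv; omega
  · rcases le_total m N with hm | hm
    · right; rw [min_eq_left hm, h]
    · left; omega

/-- The values of `f` on the interval `[a, b)`. -/
def Vals (f : ℕ → ℕ) (a b v : ℕ) : Prop := ∃ t, a ≤ t ∧ t < b ∧ f t = v

theorem Vals.split {f : ℕ → ℕ} {a b c : ℕ} (h₁ : a ≤ b) (h₂ : b ≤ c) (v : ℕ) :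
    Vals f a c v ↔ Vals f a b v ∨ Vals f b c v := by
  constructor
  · rintro ⟨t, h, h', e⟩
    rcases lt_or_ge t b with hb | hb
    · exact Or.inl ⟨t, h, hb, e⟩
    · exact Or.inr ⟨t, hb, h', e⟩
  · rintro (⟨t, h, h', e⟩ | ⟨t, h, h', e⟩)
    · exact ⟨t, h, by omega, e⟩
    · exact ⟨t, by omega, h', e⟩

theorem Vals.single (f : ℕ → ℕ) (a v : ℕ) : Vals f a (a + 1) v ↔ v = f a := by
  constructor
  · rintro ⟨t, h, h', e⟩
    rw [← e, show t = a by omega]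
  · rintro rfl; exact ⟨a, le_rfl, by omega, rfl⟩

theorem IsMinOf.snoc {N : ℕ} {f : ℕ → ℕ} {a b m : ℕ} (h : IsMinOf N (Vals f a b) m) (hab : a ≤ b) :
    IsMinOf N (Vals f a (b + 1)) (Min.min m (f b)) := by
  have := h.union (IsMinOf.singleton (N := N) (Vals.single f b)) (Vals.split hab (by omega))
  have hle := h.le
  rwa [← min_assoc, min_comm (Min.min m (f b)) N, ← min_assoc, min_eq_right hle] at this

end RLZ

namespace RLZ

/-! ## Building the wavelet tree -/

/-- The sizes of a wavelet tree with `N` points, of height `D` and with blocks of length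
`2 ^ β`. -/
structure WSize (M : Machine) (I J N D β : ℕ) : Prop where
  β_le : β ≤ D
  D_lt : D < 2 ^ β
  N_le : N ≤ 2 ^ D
  cells : 8 * 2 ^ D ≤ M.cells
  arrays : 21 < M.arrays
  cap_word : 2 ^ 2 ^ β ≤ M.cap
  cap : 64 * 2 ^ D + 1000 ≤ M.cap
  D_le : D + 2 ≤ I
  B_le : 2 ^ β ≤ I
  J_le : 8 * 2 ^ D ≤ J

/-- The number of cells for a level. -/
def stride (D β : ℕ) : ℕ := 2 * 2 ^ (D - β) + 1

section Sizes

variable {M : Machine} {I J N D β : ℕ}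

theorem WSize.mul_eq (h : WSize M I J N D β) : 2 ^ (D - β) * 2 ^ β = 2 ^ D := by
  rw [← pow_add, Nat.sub_add_cancel h.β_le]

theorem WSize.S_le (h : WSize M I J N D β) : 2 ^ (D - β) ≤ 2 ^ D :=
  Nat.pow_le_pow_right (by omega) (by omega)

/-- This is the linear space bound: `D + 1 ≤ 2 ^ β` levels of `2 * 2 ^ (D - β)` cells make at most
`2 * 2 ^ D` cells, and the extra cell of each level adds at most `2 ^ D`. -/
theorem WSize.row_lt (h : WSize M I J N D β) {k i : ℕ} (hk : k ≤ D) (hi : i < stride D β) :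
    k * stride D β + i < 3 * 2 ^ D := by
  have h₁ : (D + 1) * stride D β ≤ 3 * 2 ^ D := by
    have h₂ := Nat.mul_le_mul_right (2 * 2 ^ (D - β)) h.D_lt
    have h₃ := h.mul_eq
    have h₄ : D < 2 ^ D := Nat.lt_two_pow_self
    calc (D + 1) * stride D β = (D + 1) * (2 * 2 ^ (D - β)) + (D + 1) := by
          rw [stride]; ring
      _ ≤ 2 ^ β * (2 * 2 ^ (D - β)) + 2 ^ D := by
          have : D.succ = D + 1 := rfl
          rw [this] at h₂; omega
      _ = 3 * 2 ^ D := by rw [← h₃]; ring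
  have h₂ := Nat.mul_le_mul_right (stride D β) (Nat.add_le_add_right hk 1)
  rw [add_mul, one_mul] at h₂
  omega

end Sizes

/-- The contents of the arrays of a level of the wavelet tree: the numbers of zeros before the
blocks, the bits of the blocks, and a segment tree for the minima over the blocks. -/
structure Row (q : Bool) (M : Machine) (s : State) (N D β k : ℕ) (bit val : ℕ → ℕ) : Prop where
  bit_le : ∀ t, bit t ≤ 1
  cum : ∀ i ≤ 2 ^ (D - β), rdVal q M s 7 (k * stride D β + i) = zr bit (i * 2 ^ β)
  word : ∀ i ≤ 2 ^ (D - β), rdVal q M s 8 (k * stride D β + i) =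
    bitsVal (fun e => bit (i * 2 ^ β + e)) (2 ^ β)
  seg : ∀ j, β ≤ j → j ≤ D → ∀ t < 2 ^ (D - j), IsMinOf N (Vals val (t * 2 ^ j) ((t + 1) * 2 ^ j))
    (rdVal q M s 9 (k * stride D β + (2 ^ (D - j) + t)))

/-- The registers with the sizes of the wavelet tree. -/
structure WReg (s : State) (N D β : ℕ) : Prop where
  rN : s.reg 105 = N
  rD : s.reg 107 = D
  rβ : s.reg 109 = β
  rB : s.reg 110 = 2 ^ β
  rS : s.reg 111 = 2 ^ (D - β)
  rst : s.reg 112 = stride D β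

theorem WReg.congr {s s' : State} {N D β : ℕ} (h : WReg s N D β)
    (hr : ∀ r, 105 ≤ r → r ≤ 112 → s'.reg r = s.reg r) : WReg s' N D β where
  rN := by rw [hr _ (by omega) (by omega), h.rN]
  rD := by rw [hr _ (by omega) (by omega), h.rD]
  rβ := by rw [hr _ (by omega) (by omega), h.rβ]
  rB := by rw [hr _ (by omega) (by omega), h.rB]
  rS := by rw [hr _ (by omega) (by omega), h.rS]
  rst := by rw [hr _ (by omega) (by omega), h.rst]

/-- The bounds of the long loops. -/
structure BigReg (s : State) (N D β : ℕ) : Prop where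
  rN : s.reg 220 = N
  r2 : s.reg 222 = 2 ^ D
  rS1 : s.reg 223 = 2 ^ (D - β) + 1
  rS : s.reg 224 = 2 ^ (D - β)

theorem BigReg.congr {s s' : State} {N D β : ℕ} (h : BigReg s N D β)
    (hr : ∀ r, 220 ≤ r → s'.reg r = s.reg r) : BigReg s' N D β where
  rN := by rw [hr _ (by omega), h.rN]
  r2 := by rw [hr _ (by omega), h.r2]
  rS1 := by rw [hr _ (by omega), h.rS1]
  rS := by rw [hr _ (by omega), h.rS]

section Programs

variable {M : Machine} {I J N D β : ℕ} {s : State} {Q : State → Prop}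

theorem le_iters_big {I J n r rb : ℕ} (h : n ≤ J) (hr : 220 ≤ rb) :
    n ≤ iters I J (#r r <ᵉ #r rb) := by
  simp [iters, Expr.isBig, hr]; omega

/-- Distributes the points to their positions on the level in register `90`. -/
def spreadCmd : Cmd :=
  fillLoop 70 222 19 0 ;; forLoop 70 220
    (60 ≔ .mem 17 (#r 70) ;; 61 ≔ #r 60 >>ᵉ #r 90 ;; 62 ≔ (#r 61 <<ᵉ #r 90) + .mem 19 (#r 61) ;;
      .store 19 (#r 61) (.mem 19 (#r 61) + 1) ;; .store 20 (#r 62) ((2 * #r 60 >>ᵉ #r 90) % 2) ;;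
      .store 21 (#r 62) (.mem 18 (#r 70)))

@[simp] theorem spreadCmd_top : spreadCmd.top = 71 := by simp [spreadCmd, Cmd.top]

@[simp] theorem spreadCmd_keeps (a : ℕ) :
    spreadCmd.keeps a = (19 != a && (20 != a && 21 != a)) := by
  simp only [spreadCmd, Cmd.keeps, fillLoop_keeps, forLoop_keeps, Bool.true_and, Bool.and_true]
  generalize (19 != a) = u, (20 != a) = v, (21 != a) = w
  cases u <;> cases v <;> cases w <;> rfl

/-- The points come in the order of `x`, and array `19` counts them per node, which yields their
slots. The stored bit is digit `k - 1` of `y`, written so that level `0` is no special case. Slots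
without a point keep old contents, of which only `≤ 1` is claimed for the bits. -/
theorem spreadCmd_runs (hW : WSize M I J N D β) (hb : BigReg s N D β) (k : ℕ) (hk : k ≤ D)
    (hrk : s.reg 90 = k) {y v : ℕ → ℕ} (hy : ∀ x < N, ∀ x' < N, y x = y x' → x = x')
    (hD : ∀ x < N, y x < 2 ^ D) (hv : ∀ x < N, v x ≤ N)
    (h17 : ∀ x < N, s.mem 17 x = y x) (h18 : ∀ x < N, s.mem 18 x = v x)
    (h20 : ∀ t, s.mem 20 t ≤ 1) :
    Runs M I J spreadCmd s fun s' => (∀ t, s'.mem 20 t ≤ 1) ∧ ∀ x < N,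
      s'.mem 20 (posn y k x) = 2 * y x / 2 ^ k % 2 ∧ s'.mem 21 (posn y k x) = v x := by
  have hcap := hW.cap
  have hNl := hW.N_le
  have hJ := hW.J_le
  have hcl := hW.cells
  have harr := hW.arrays
  have hp1 : 1 ≤ 2 ^ D := Nat.one_le_two_pow
  refine Runs.seq (fillLoop_runs (2 ^ D) (fun _ => 0) hb.r2 (by omega)
    (le_iters_big (by omega) (by omega)) (by omega) (by omega) (by omega) (by omega)
    fun k hk s' hr _ _ => by simp; omega) ?_
  intro s₁ h₁ f₁
  have g₁ : ∀ r, 71 ≤ r → s₁.reg r = s.reg r := fun r hr => f₁.reg r (by simp; omega)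
  have m₁ : ∀ b, b ≠ 19 → s₁.mem b = s.mem b := fun b hb => f₁.mem b (by simp; omega)
  refine Runs.for N (by rw [g₁ _ (by omega), hb.rN]) (by omega) (by simp [Cmd.top])
    (le_iters_big (by omega) (by omega)) (by omega) (by omega)
    (fun a s' => (∀ u < 2 ^ D, s'.mem 19 u = cnt y k u a) ∧ (∀ t, s'.mem 20 t ≤ 1) ∧ ∀ x < a,
      s'.mem 20 (posn y k x) = 2 * y x / 2 ^ k % 2 ∧ s'.mem 21 (posn y k x) = v x) ?_ ?_ ?_
  · refine ⟨fun u hu => by simp [h₁ u hu, cnt], fun t => by simp [m₁, h20], by simp⟩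
  · rintro a ha s' hr ⟨i₁, i₂, i₃⟩ hf hm
    have m17 : s'.mem 17 = s.mem 17 := by rw [hm 17 (by simp [Cmd.keeps]), m₁ _ (by omega)]
    have m18 : s'.mem 18 = s.mem 18 := by rw [hm 18 (by simp [Cmd.keeps]), m₁ _ (by omega)]
    have r90 : s'.reg 90 = k := by rw [hf _ (by omega), g₁ _ (by omega), hrk]
    have hya := hD a ha
    have hva := hv a ha
    have hu : y a / 2 ^ k < 2 ^ D := lt_of_le_of_lt (Nat.div_le_self _ _) hya
    have hpos := posn_lt hy hD hk ha
    have hpp : y a / 2 ^ k * 2 ^ k + cnt y k (y a / 2 ^ k) a = posn y k a := rfl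
    have hc := i₁ _ hu
    refine Runs.set (y a) (by simp [hr, m17, h17 a ha]; omega) ?_
    refine Runs.set (y a / 2 ^ k) (by simp [r90]) ?_
    refine Runs.set (posn y k a) (by simp [r90, hc]; omega) ?_
    refine Runs.put (y a / 2 ^ k) (cnt y k (y a / 2 ^ k) a + 1) (by simp) ?_ (by omega) (by omega) ?_
    · simp [hc]; omega
    refine Runs.put (posn y k a) (2 * y a / 2 ^ k % 2) (by simp) ?_ (by omega) (by omega) ?_
    · simp [r90]; omega
    refine Runs.store (posn y k a) (v a) (by simp) ?_ (by omega) (by omega) ?_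
    · simp [hr, m18, h18 a ha]; omega
    refine ⟨fun u hu => ?_, fun t => ?_, fun x hx => ?_⟩
    · simp only [cnt]
      by_cases h : u = y a / 2 ^ k
      · subst h; simp [hc]
      · simp [h, Ne.symm h, i₁ u hu]
    · have := i₂ t
      simp
      split_ifs <;> omega
    · by_cases h : x = a
      · subst h; simp
      · have := posn_ne hy k (show x < a by omega) ha
        simp [this]
        exact i₃ x (by omega)
  · rintro s' ⟨-, i₂, i₃⟩ _ _ _
    exact ⟨i₂, i₃⟩

/-- The row of the level in register `90`. -/
def blocksCmd : Cmd :=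
  85 ≔ #r 90 * #r 112 ;; 66 ≔ 0 ;; forLoop 75 223
    (.store 7 (#r 85 + #r 75) (#r 66) ;; 64 ≔ 0 ;; 65 ≔ #r 105 ;;
      forLoop 70 110 (60 ≔ #r 75 * #r 110 + #r 70 ;; 61 ≔ .mem 20 (#r 60) ;;
        64 ≔ #r 64 + (#r 61 <<ᵉ #r 70) ;; 66 ≔ #r 66 + (1 - #r 61) ;;
        minCmd 65 (#r 65) (.mem 21 (#r 60))) ;;
      .store 8 (#r 85 + #r 75) (#r 64) ;; .store 9 (#r 85 + (#r 111 + #r 75)) (#r 65))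

@[simp] theorem blocksCmd_top : blocksCmd.top = 86 := by simp [blocksCmd, Cmd.top]

@[simp] theorem blocksCmd_keeps (a : ℕ) :
    blocksCmd.keeps a = (7 != a && (8 != a && 9 != a)) := by
  simp [blocksCmd, Cmd.keeps]

/-- The count of zeros runs on from block to block, and the packed bits stay below `2 ^ 2 ^ β`. One
block beyond the end is written, so that counts can be looked up at position `2 ^ D` too. -/
theorem blocksCmd_runs (hW : WSize M I J N D β) (hb : BigReg s N D β) (hw : WReg s N D β)
    (k : ℕ) (hk : k ≤ D) (hrk : s.reg 90 = k) (h20 : ∀ t, s.mem 20 t ≤ 1) :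
    Runs M I J blocksCmd s fun s' => s'.reg 85 = k * stride D β ∧
      (∀ a i, i < k * stride D β → s'.mem a i = s.mem a i) ∧
      ∀ i ≤ 2 ^ (D - β), s'.mem 7 (k * stride D β + i) = zr (s.mem 20) (i * 2 ^ β) ∧
        s'.mem 8 (k * stride D β + i) = bitsVal (fun e => s.mem 20 (i * 2 ^ β + e)) (2 ^ β) ∧
        IsMinOf N (Vals (s.mem 21) (i * 2 ^ β) ((i + 1) * 2 ^ β))
          (s'.mem 9 (k * stride D β + (2 ^ (D - β) + i))) := by
  have hcap := hW.cap
  have hcap' := hW.cap_word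
  have hNl := hW.N_le
  have hJ := hW.J_le
  have hcl := hW.cells
  have harr := hW.arrays
  have hp1 : 1 ≤ 2 ^ D := Nat.one_le_two_pow
  have hS := hW.S_le
  have hSB := hW.mul_eq
  have hBl := hW.B_le
  have hBD : 2 ^ β ≤ 2 ^ D := Nat.pow_le_pow_right (by omega) hW.β_le
  obtain ⟨S, hSe⟩ : ∃ S, S = 2 ^ (D - β) := ⟨_, rfl⟩
  obtain ⟨B, hBe⟩ : ∃ B, B = 2 ^ β := ⟨_, rfl⟩
  have hst : stride D β = 2 * S + 1 := by rw [stride, hSe]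
  obtain ⟨row, hrow⟩ : ∃ row, row = k * stride D β := ⟨_, rfl⟩
  have hrl : ∀ i < 2 * S + 1, row + i < 3 * 2 ^ D := fun i hi => by
    rw [hrow]; exact hW.row_lt hk (by omega)
  have hr0 := hrl 0 (by omega)
  rw [← hSe, ← hBe] at hSB
  rw [← hSe] at hS
  rw [← hBe] at hBl hBD hcap'
  rw [← hSe, ← hBe, ← hrow]
  refine Runs.set row (by simp [hrk, hw.rst, ← hrow]; omega) (Runs.set 0 (by simp; omega) ?_)
  refine Runs.for (S + 1) (by simp [hb.rS1, hSe]) (by omega) (by simp [Cmd.top])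
    (le_iters_big (by omega) (by omega)) (by omega) (by omega)
    (fun n s' => s'.reg 66 = zr (s.mem 20) (n * B) ∧
      (∀ a i, i < row → s'.mem a i = s.mem a i) ∧
      ∀ i < n, s'.mem 7 (row + i) = zr (s.mem 20) (i * B) ∧
        s'.mem 8 (row + i) = bitsVal (fun e => s.mem 20 (i * B + e)) B ∧
        IsMinOf N (Vals (s.mem 21) (i * B) ((i + 1) * B)) (s'.mem 9 (row + (S + i)))) ?_ ?_ ?_
  · simp [zr]
  · rintro n hn s' hr ⟨i₁, i₂, i₃⟩ hf hm
    have hf' : ∀ r, 90 ≤ r → s'.reg r = s.reg r := fun r hr => by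
      rw [hf r (by omega)]; simp only [State.setReg_reg]; rw [if_neg (by omega), if_neg (by omega)]
    have r85 : s'.reg 85 = row := by rw [hf _ (by omega)]; simp
    have m20 : s'.mem 20 = s.mem 20 := hm 20 (by simp [Cmd.keeps])
    have m21 : s'.mem 21 = s.mem 21 := hm 21 (by simp [Cmd.keeps])
    have hnB : n * B ≤ 2 ^ D := by rw [← hSB]; exact Nat.mul_le_mul_right _ (by omega)
    have hz := zr_le (s.mem 20) (n * B)
    have h1 := hrl n (by omega)
    have h2 := hrl (S + n) (by omega)
    refine Runs.put (row + n) (zr (s.mem 20) (n * B)) (by simp [r85, hr]; omega) (by simp [i₁])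
      (by omega) (by omega) ?_
    refine Runs.set 0 (by simp; omega) (Runs.set N (by simp [hf', hw.rN]) ?_)
    refine Runs.seq (Runs.for B (by simp [hf', hw.rB, hBe]) (by omega) (by simp [Cmd.top])
      (le_iters (by omega)) (by omega) (by omega)
      (fun e s₁ => s₁.reg 64 = bitsVal (fun e => s.mem 20 (n * B + e)) e ∧
        s₁.reg 66 = zr (s.mem 20) (n * B + e) ∧
        IsMinOf N (Vals (s.mem 21) (n * B) (n * B + e)) (s₁.reg 65)) ?_ ?_ ?_
      (Q := fun s₁ => s₁.reg 64 = bitsVal (fun e => s.mem 20 (n * B + e)) B ∧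
        s₁.reg 66 = zr (s.mem 20) (n * B + B) ∧
        IsMinOf N (Vals (s.mem 21) (n * B) (n * B + B)) (s₁.reg 65))) ?_
    · simp [bitsVal, i₁]
      exact IsMinOf.empty fun v ⟨t, h, h', _⟩ => by omega
    · rintro e he s₁ hr₁ ⟨c₁, c₂, c₃⟩ hf₁ hm₁
      have n20 : s₁.mem 20 = s.mem 20 := by rw [hm₁ 20 (by simp [Cmd.keeps])]; funext t; simp [m20]
      have n21 : s₁.mem 21 = s.mem 21 := by rw [hm₁ 21 (by simp [Cmd.keeps])]; funext t; simp [m21]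
      have r75 : s₁.reg 75 = n := by rw [hf₁ _ (by omega)]; simp [hr]
      have r110 : s₁.reg 110 = B := by rw [hf₁ _ (by omega)]; simp [hf', hw.rB, hBe]
      have hbt := h20 (n * B + e)
      have hz' := zr_le (s.mem 20) (n * B + e)
      have hbl : bitsVal (fun e => s.mem 20 (n * B + e)) (e + 1) < 2 ^ (e + 1) :=
        bitsVal_lt _ fun i _ => h20 _
      have hpe : 2 ^ (e + 1) ≤ 2 ^ B := Nat.pow_le_pow_right (by omega) he
      rw [bitsVal] at hbl
      have hle := c₃.le
      refine Runs.set (n * B + e) (by simp [r75, r110, hr₁]; omega) ?_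
      refine Runs.set (s.mem 20 (n * B + e)) (by simp [n20]; omega) ?_
      refine Runs.set (bitsVal (fun e => s.mem 20 (n * B + e)) (e + 1)) ?_ ?_
      · simp [c₁, hr₁, bitsVal]; omega
      refine Runs.set (zr (s.mem 20) (n * B + e + 1)) ?_ ?_
      · simp [c₂, zr]; omega
      refine (minCmd_runs (s₁.reg 65) (s.mem 21 (n * B + e)) ?_ ?_).mono ?_
      · simp
      · intro v; simp [n21]; omega
      rintro s₂ ⟨d₁, d₂, -⟩ -
      refine ⟨by simp [d₂], by simp [d₂]; rfl, ?_⟩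
      simp [d₁]
      exact c₃.snoc (by omega)
    · rintro s₁ h _ _ _
      exact h
    rintro s₁ ⟨c₁, c₂, c₃⟩ f₁
    have g₁ : ∀ r, 71 ≤ r → s₁.reg r = s'.reg r := fun r hr => by
      rw [f₁.reg r (by simp [Cmd.top]; omega)]; simp only [State.setReg_reg, State.setMem_reg]
      rw [if_neg (by omega), if_neg (by omega)]
    have m₁ : ∀ a, s₁.mem a = (s'.setMem 7 (row + n) (zr (s.mem 20) (n * B))).mem a := fun a =>
      (f₁.mem a (by simp [Cmd.keeps])).trans rfl
    refine Runs.put (row + n) _ (by simp [g₁, r85, hr]; omega) ⟨by simp, c₁⟩ (by omega) (by omega) ?_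
    refine Runs.store (row + (S + n)) _ ?_ ⟨by simp, rfl⟩ (by omega) (by omega) ?_
    · simp [g₁, r85, hr, hf', hw.rS, ← hSe]; omega
    refine ⟨by simp [c₂, add_mul], fun a i hi => ?_, fun i hi => ?_⟩
    · have h1 : i ≠ row + n := by omega
      have h2 : i ≠ row + (S + n) := by omega
      simp [m₁, h1, h2, i₂ a i hi]
    · by_cases h : i = n
      · subst h
        simp [m₁, add_mul]
        exact c₃
      · have := i₃ i (by omega)
        simp [m₁, h]
        exact this
  · rintro s' ⟨-, i₂, i₃⟩ hr hf hm
    exact ⟨by rw [hf _ (by omega)]; simp, i₂, fun i hi => i₃ i (by omega)⟩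

end Programs

end RLZ

namespace RLZ

/-! ### Segment trees over the blocks, and all levels together -/

theorem Row.congr {q q' : Bool} {M M' : Machine} {s s' : State} {N D β k : ℕ} {bit val : ℕ → ℕ}
    (h : Row q M s N D β k bit val) (he : ∀ a, 7 ≤ a → a ≤ 9 → ∀ i, i < (k + 1) * stride D β →
      rdVal q' M' s' a i = rdVal q M s a i) : Row q' M' s' N D β k bit val := by
  have key : ∀ i, i < stride D β → k * stride D β + i < (k + 1) * stride D β := fun i hi => by
    rw [Nat.succ_mul]; omega
  refine ⟨h.bit_le, fun i hi => ?_, fun i hi => ?_, fun j hj hj' t ht => ?_⟩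
  · rw [he 7 (by omega) (by omega) _ (key _ (by rw [stride]; omega)), h.cum i hi]
  · rw [he 8 (by omega) (by omega) _ (key _ (by rw [stride]; omega)), h.word i hi]
  · have : 2 ^ (D - j) ≤ 2 ^ (D - β) := Nat.pow_le_pow_right (by omega) (by omega)
    rw [he 9 (by omega) (by omega) _ (key _ (by rw [stride]; omega))]
    exact h.seg j hj hj' t ht

section Programs

variable {M : Machine} {I J N D β : ℕ} {s : State} {Q : State → Prop}

/-- The inner nodes of the segment tree of a level. -/
def treeCmd : Cmd := forLoop 70 224
  (60 ≔ #r 111 - 1 - #r 70 ;;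
    minCmd 61 (.mem 9 (#r 85 + 2 * #r 60)) (.mem 9 (#r 85 + (2 * #r 60 + 1))) ;;
    .store 9 (#r 85 + #r 60) (#r 61))

@[simp] theorem treeCmd_top : treeCmd.top = 71 := by simp [treeCmd, Cmd.top]

@[simp] theorem treeCmd_keeps (a : ℕ) : treeCmd.keeps a = (9 != a) := by
  simp [treeCmd, Cmd.keeps]

/-- Heap layout: node `t` of height `j` is in cell `2 ^ (D - j) + t`, its children are in cells `2u`
and `2u + 1` for `u` this cell. Decreasing `u` finds the children ready; cell `0`, written last, is
no node. -/
theorem treeCmd_runs (hW : WSize M I J N D β) (hb : BigReg s N D β) (hw : WReg s N D β)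
    (k : ℕ) (hk : k ≤ D) (h85 : s.reg 85 = k * stride D β) (val : ℕ → ℕ)
    (hleaf : ∀ i ≤ 2 ^ (D - β), IsMinOf N (Vals val (i * 2 ^ β) ((i + 1) * 2 ^ β))
      (s.mem 9 (k * stride D β + (2 ^ (D - β) + i)))) :
    Runs M I J treeCmd s fun s' => (∀ a i, i < k * stride D β → s'.mem a i = s.mem a i) ∧
      ∀ j, β ≤ j → j ≤ D → ∀ t < 2 ^ (D - j), IsMinOf N (Vals val (t * 2 ^ j) ((t + 1) * 2 ^ j))
        (s'.mem 9 (k * stride D β + (2 ^ (D - j) + t))) := by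
  have hcap := hW.cap
  have hNl := hW.N_le
  have hJ := hW.J_le
  have hcl := hW.cells
  have harr := hW.arrays
  have hp1 : 1 ≤ 2 ^ D := Nat.one_le_two_pow
  have hS := hW.S_le
  have hβ := hW.β_le
  have hS1 : 1 ≤ 2 ^ (D - β) := Nat.one_le_two_pow
  have hrl : ∀ i < 2 * 2 ^ (D - β) + 1, k * stride D β + i < 3 * 2 ^ D := fun i hi => 
    hW.row_lt hk (by rw [stride]; omega)
  have hr0 := hrl 0 (by omega)
  refine Runs.for (2 ^ (D - β)) (by simp [hb.rS]) (by omega) (by simp [Cmd.top])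
    (le_iters_big (by omega) (by omega)) (by omega) (by omega)
    (fun n s' => (∀ a i, i < k * stride D β → s'.mem a i = s.mem a i) ∧
      ∀ j, β ≤ j → j ≤ D → ∀ t < 2 ^ (D - j), 2 ^ (D - β) ≤ 2 ^ (D - j) + t + n →
        IsMinOf N (Vals val (t * 2 ^ j) ((t + 1) * 2 ^ j))
        (s'.mem 9 (k * stride D β + (2 ^ (D - j) + t)))) ?_ ?_ ?_
  · refine ⟨fun _ _ _ => rfl, fun j hj hj' t ht h => ?_⟩
    rcases hj.eq_or_lt with rfl | hlt
    · exact hleaf t (by omega)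
    · have : 2 ^ (D - j + 1) ≤ 2 ^ (D - β) := Nat.pow_le_pow_right (by omega) (by omega)
      rw [pow_succ] at this
      omega
  · rintro n hn s' hr ⟨i₁, i₂⟩ hf hm
    have r85 : s'.reg 85 = k * stride D β := by rw [hf _ (by omega), h85]
    have r111 : s'.reg 111 = 2 ^ (D - β) := by rw [hf _ (by omega), hw.rS]
    obtain ⟨u, hu⟩ : ∃ u, u = 2 ^ (D - β) - 1 - n := ⟨_, rfl⟩
    have hru := hrl u (by omega)
    have hr2u := hrl (2 * u + 1) (by omega)
    refine Runs.set u (by simp [hr, r111]; omega) ?_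
    refine Runs.seq (minCmd_runs (s'.mem 9 (k * stride D β + 2 * u))
      (s'.mem 9 (k * stride D β + (2 * u + 1))) ?_ ?_) ?_
    · simp [r85]; omega
    · intro v; simp [r85]; omega
    rintro s₁ ⟨e₁, e₂, e₃⟩ -
    refine Runs.store (k * stride D β + u) _ (by simp [e₂, r85]; omega) ⟨by simp, e₁⟩ (by omega)
      (by omega) ?_
    refine ⟨fun a i hi => ?_, fun j hj hj' t ht h => ?_⟩
    · have : i ≠ k * stride D β + u := by omega
      simp [e₃, this, i₁ a i hi]
    · simp only [State.setReg_mem, State.setMem_mem, true_and, e₃]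
      by_cases hc : 2 ^ (D - j) + t = u
      · rw [if_pos (by omega)]
        -- Not a leaf: leaves occupy cells from `2 ^ (D - β)` on, above `u`.
        obtain ⟨j, rfl⟩ : ∃ i, j = i + 1 := by
          refine ⟨j - 1, ?_⟩
          have : j ≠ β := by rintro rfl; omega
          omega
        have hjβ : β ≤ j := by
          by_contra hcon
          obtain rfl : j + 1 = β := by omega
          omega
        have hp : 2 ^ (D - j) = 2 * 2 ^ (D - (j + 1)) := by
          rw [show D - j = D - (j + 1) + 1 by omega, pow_succ]; ring
        have h₁ := i₂ j hjβ (by omega) (2 * t) (by omega) (by omega)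
        have h₂ := i₂ j hjβ (by omega) (2 * t + 1) (by omega) (by omega)
        rw [show 2 ^ (D - j) + 2 * t = 2 * u by omega] at h₁
        rw [show 2 ^ (D - j) + (2 * t + 1) = 2 * u + 1 by omega] at h₂
        have e₁ : t * 2 ^ (j + 1) = 2 * t * 2 ^ j := by rw [pow_succ]; ring
        have e₂ : (t + 1) * 2 ^ (j + 1) = (2 * t + 1 + 1) * 2 ^ j := by rw [pow_succ]; ring
        rw [e₁, e₂]
        exact h₁.union h₂ (Vals.split (Nat.mul_le_mul_right _ (by omega))
          (Nat.mul_le_mul_right _ (by omega)))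
      · rw [if_neg (by omega)]
        exact i₂ j hj hj' t ht (by omega)
  · rintro s' ⟨i₁, i₂⟩ _ _ _
    exact ⟨i₁, fun j hj hj' t ht => i₂ j hj hj' t ht (by omega)⟩

/-- Builds all levels of the wavelet tree. -/
def levelsCmd : Cmd :=
  91 ≔ #r 107 + 1 ;; forLoop 90 91 (spreadCmd ;; blocksCmd ;; treeCmd)

@[simp] theorem levelsCmd_top : levelsCmd.top = 92 := by simp [levelsCmd, Cmd.top]

@[simp] theorem levelsCmd_keeps {a : ℕ} (h : a < 7) : levelsCmd.keeps a = true := by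
  simp [levelsCmd, Cmd.keeps]; omega

/-- A level writes its row without touching the earlier ones, and reuses the work arrays. `bit` and
`val` record the work arrays as they were on each level, unused slots included. -/
theorem levelsCmd_runs (hW : WSize M I J N D β) (hb : BigReg s N D β) (hw : WReg s N D β)
    {y v : ℕ → ℕ} (hy : ∀ x < N, ∀ x' < N, y x = y x' → x = x')
    (hD : ∀ x < N, y x < 2 ^ D) (hv : ∀ x < N, v x ≤ N)
    (h17 : ∀ x < N, s.mem 17 x = y x) (h18 : ∀ x < N, s.mem 18 x = v x)
    (h20 : ∀ t, s.mem 20 t ≤ 1) :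
    Runs M I J levelsCmd s fun s' => ∃ bit val : ℕ → ℕ → ℕ, ∀ k ≤ D,
      Row false M s' N D β k (bit k) (val k) ∧ ∀ x < N,
        bit k (posn y k x) = 2 * y x / 2 ^ k % 2 ∧ val k (posn y k x) = v x := by
  have hcap := hW.cap
  have hDI := hW.D_le
  have hD2 : D < 2 ^ D := Nat.lt_two_pow_self
  refine Runs.set (D + 1) (by simp [hw.rD]; omega) ?_
  refine Runs.for (D + 1) (by simp) (by omega) (by simp [Cmd.top])
    (le_iters (by omega)) (by omega) (by omega)
    (fun n s' => (∀ t, s'.mem 20 t ≤ 1) ∧ ∃ bit val : ℕ → ℕ → ℕ, ∀ k < n,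
      Row false M s' N D β k (bit k) (val k) ∧ ∀ x < N,
        bit k (posn y k x) = 2 * y x / 2 ^ k % 2 ∧ val k (posn y k x) = v x) ?_ ?_ ?_
  · exact ⟨h20, fun _ _ => 0, fun _ _ => 0, by simp⟩
  · rintro n hn s' hr ⟨i₁, bit, val, i₂⟩ hf hm
    have hf' : ∀ r, 92 ≤ r → s'.reg r = s.reg r := fun r hr => by
      rw [hf r (by omega), State.setReg_reg, if_neg (by omega)]
    have hb' := hb.congr (s' := s') (fun r h => hf' r (by omega))
    have hw' := hw.congr (s' := s') (fun r h h' => hf' r (by omega))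
    have m17 : s'.mem 17 = s.mem 17 := hm 17 (by simp [Cmd.keeps])
    have m18 : s'.mem 18 = s.mem 18 := hm 18 (by simp [Cmd.keeps])
    refine Runs.seq (spreadCmd_runs hW hb' n (by omega) hr hy hD hv (by rw [m17]; exact h17)
      (by rw [m18]; exact h18) i₁) ?_
    rintro s₁ ⟨a₁, a₂⟩ f₁
    have g₁ : ∀ r, 71 ≤ r → s₁.reg r = s'.reg r := fun r hr => f₁.reg r (by simp; omega)
    have hb₁ := hb'.congr (s' := s₁) (fun r h => g₁ r (by omega))
    have hw₁ := hw'.congr (s' := s₁) (fun r h h' => g₁ r (by omega))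
    refine Runs.seq (blocksCmd_runs hW hb₁ hw₁ n (by omega) (by rw [g₁ _ (by omega), hr]) a₁) ?_
    rintro s₂ ⟨r85, b₁, b₂⟩ f₂
    have g₂ : ∀ r, 86 ≤ r → s₂.reg r = s₁.reg r := fun r hr => f₂.reg r (by simp; omega)
    have hb₂ := hb₁.congr (s' := s₂) (fun r h => g₂ r (by omega))
    have hw₂ := hw₁.congr (s' := s₂) (fun r h h' => g₂ r (by omega))
    refine (treeCmd_runs hW hb₂ hw₂ n (by omega) r85 (s₁.mem 21) (fun i hi => (b₂ i hi).2.2)).mono ?_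
    rintro s₃ ⟨c₁, c₂⟩ f₃
    have m₃ : ∀ b, b ≠ 9 → s₃.mem b = s₂.mem b := fun b hb => f₃.mem b (by simp; omega)
    refine ⟨?_, fun k => if k = n then s₁.mem 20 else bit k,
      fun k => if k = n then s₁.mem 21 else val k, fun k hk => ?_⟩
    · have e : s₃.mem 20 = s₁.mem 20 := by
        rw [m₃ _ (by omega), f₂.mem 20 (by simp)]
      simpa [e] using a₁
    · by_cases h : k = n
      · subst h
        simp only [if_true]
        refine ⟨⟨a₁, fun i hi => ?_, fun i hi => ?_, fun j hj hj' t ht => ?_⟩, a₂⟩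
        · have := (b₂ i hi).1
          simpa [rdVal, m₃] using this
        · have := (b₂ i hi).2.1
          simpa [rdVal, m₃] using this
        · have := c₂ j hj hj' t ht
          simpa [rdVal] using this
      · simp only [h, if_false]
        obtain ⟨hrow, hx⟩ := i₂ k (by omega)
        refine ⟨hrow.congr fun a ha ha' i hi => ?_, hx⟩
        have hi' : i < n * stride D β :=
          lt_of_lt_of_le hi (Nat.mul_le_mul_right _ (by omega))
        simp only [rdVal, Bool.false_eq_true, if_false, State.setReg_mem]
        rw [c₁ a i hi', b₁ a i hi', f₁.mem a (by simp; omega)]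
  · rintro s' ⟨-, bit, val, h⟩ _ _ _
    exact ⟨bit, val, fun k hk => h k (by omega)⟩

end Programs

end RLZ

namespace RLZ

/-! ## Querying the wavelet tree -/

/-- The wavelet tree of the points `(x, y x)` with values `v x`, as read-only input. -/
structure Tree (M : Machine) (I N D β : ℕ) (y v : ℕ → ℕ) (bit val : ℕ → ℕ → ℕ) : Prop where
  size : ∃ (M₀ : Machine) (J : ℕ), WSize M₀ I J N D β ∧ M₀.cap = M.cap
  inj : ∀ x < N, ∀ x' < N, y x = y x' → x = x'
  lt : ∀ x < N, y x < N
  val_le : ∀ x < N, v x ≤ N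
  row : ∀ k ≤ D, ∀ s, Row true M s N D β k (bit k) (val k)
  bit_eq : ∀ k ≤ D, ∀ x < N, bit k (posn y k x) = 2 * y x / 2 ^ k % 2
  val_eq : ∀ k ≤ D, ∀ x < N, val k (posn y k x) = v x
  point : ∀ x < N, ∀ s, rdVal true M s 6 (y x) = v x
  ok : ∀ a, 6 ≤ a → a ≤ 9 → ∀ i < 8 * 2 ^ D, RdOk true M a i

theorem WReg.setReg {s : State} {N D β : ℕ} (h : WReg s N D β) {r v : ℕ} (hr : r < 105) :
    WReg (s.setReg r v) N D β :=
  h.congr fun r' _ _ => by rw [State.setReg_reg, if_neg (by omega)]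

/-- The count grows by at most one at a time, so each intermediate value is attained, at a point of
the node. Thus every position between two offsets in a node holds a point. -/
theorem exists_of_cnt {y : ℕ → ℕ} {k u a b c : ℕ} (hab : a ≤ b) (h : cnt y k u a ≤ c)
    (h' : c < cnt y k u b) : ∃ x, a ≤ x ∧ x < b ∧ y x / 2 ^ k = u ∧ cnt y k u x = c := by
  induction hab with
  | refl => omega
  | @step b hab ih =>
    rw [cnt] at h'
    by_cases hc : c < cnt y k u b
    · obtain ⟨x, h₁, h₂, h₃⟩ := ih hc
      exact ⟨x, h₁, by omega, h₃⟩
    · split_ifs at h' with hu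
      · exact ⟨b, hab, by omega, hu, by omega⟩
      · omega

section Programs

variable {M : Machine} {I J N D β : ℕ} {s : State} {Q : State → Prop}
variable {y v : ℕ → ℕ} {bit val : ℕ → ℕ → ℕ}

/-- `register 1 :=` the number of zeros before position `register 7` on level `register 6`. -/
def zerosCmd : Cmd :=
  5 ≔ #r 6 * #r 112 + #r 7 / #r 110 ;; 3 ≔ #r 7 % #r 110 ;; 4 ≔ rd true 8 (#r 5) ;;
  1 ≔ rd true 7 (#r 5) ;; forLoop 2 3 (1 ≔ #r 1 + (1 - (#r 4 >>ᵉ #r 2) % 2))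

@[simp] theorem zerosCmd_top : zerosCmd.top = 6 := by simp [zerosCmd, Cmd.top]

@[simp] theorem zerosCmd_keeps (a : ℕ) : zerosCmd.keeps a = true := by simp [zerosCmd, Cmd.keeps]

theorem Tree.row_addr (hT : Tree M I N D β y v bit val) {k t : ℕ} (hk : k ≤ D) (ht : t ≤ 2 ^ D) :
    t / 2 ^ β ≤ 2 ^ (D - β) ∧ k * stride D β + t / 2 ^ β < 3 * 2 ^ D := by
  obtain ⟨M₀, J₀, hW, hc⟩ := hT.size
  have h : t / 2 ^ β ≤ 2 ^ (D - β) := by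
    rw [← Nat.lt_succ_iff, Nat.div_lt_iff_lt_mul (by positivity), Nat.succ_mul, hW.mul_eq]
    have : 0 < 2 ^ β := by positivity
    omega
  exact ⟨h, hW.row_lt hk (by rw [stride]; omega)⟩

theorem Tree.bits (hT : Tree M I N D β y v bit val) {k t : ℕ} (hk : k ≤ D) (ht : t ≤ 2 ^ D) {e : ℕ}
    (he : e < 2 ^ β) (s : State) :
    rdVal true M s 8 (k * stride D β + t / 2 ^ β) / 2 ^ e % 2 = bit k (t / 2 ^ β * 2 ^ β + e) := by
  rw [(hT.row k hk s).word _ (hT.row_addr hk ht).1]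
  exact bitsVal_digit (f := fun e => bit k (t / 2 ^ β * 2 ^ β + e)) _
    (fun i _ => (hT.row k hk s).bit_le _) he

/-- The sampled count at the start of the block, plus the zeros among the first `t % 2 ^ β` bits of
its word. -/
theorem zerosCmd_runs (hT : Tree M I N D β y v bit val) (hw : WReg s N D β) (k t : ℕ)
    (h6 : s.reg 6 = k) (h7 : s.reg 7 = t) (hk : k ≤ D) (ht : t ≤ 2 ^ D) :
    Runs M I J zerosCmd s fun s' => s'.reg 1 = zr (bit k) t := by
  obtain ⟨M₀, J₀, hW, hc⟩ := hT.size
  have hcap := hW.cap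
  have hBl := hW.B_le
  have hBD : 2 ^ β ≤ 2 ^ D := Nat.pow_le_pow_right (by omega) hW.β_le
  obtain ⟨ha, ha'⟩ := hT.row_addr hk ht
  have hrow := hT.row k hk s
  have hcum := hrow.cum _ ha
  have hmod : t % 2 ^ β < 2 ^ β := Nat.mod_lt _ (by positivity)
  have hdm := Nat.div_add_mod t (2 ^ β)
  have hra := Nat.le_add_right (k * stride D β) (t / 2 ^ β)
  have ok8 := hT.ok 8 (by omega) (by omega) (k * stride D β + t / 2 ^ β) (by omega)
  have ok7 := hT.ok 7 (by omega) (by omega) (k * stride D β + t / 2 ^ β) (by omega)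
  refine Runs.set (k * stride D β + t / 2 ^ β) (by simp [h6, h7, hw.rst, hw.rB]; omega) ?_
  refine Runs.set (t % 2 ^ β) (by simp [h7, hw.rB]) ?_
  refine Runs.set (rdVal true M s 8 (k * stride D β + t / 2 ^ β))
    ⟨by simp [ok8], by simp⟩ ?_
  refine Runs.set (zr (bit k) (t / 2 ^ β * 2 ^ β)) 
    ⟨by simp [ok7], by simp [hcum]⟩ ?_
  refine Runs.for (t % 2 ^ β) (by simp) (by omega) (by simp [Cmd.top]) (le_iters (by omega))
    (by omega) (by omega) (fun e s' => s'.reg 1 = zr (bit k) (t / 2 ^ β * 2 ^ β + e)) (by simp) ?_ ?_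
  · intro e he s' hr hi hf hm
    have h4 : s'.reg 4 = rdVal true M s 8 (k * stride D β + t / 2 ^ β) := by
      rw [hf _ (by omega)]; simp
    have hb := hT.bits hk ht (show e < 2 ^ β by omega) s
    have hl := hrow.bit_le (t / 2 ^ β * 2 ^ β + e)
    have hz := zr_le (bit k) (t / 2 ^ β * 2 ^ β + e)
    rw [mul_comm] at hdm
    refine Runs.assign (zr (bit k) (t / 2 ^ β * 2 ^ β + (e + 1))) ?_ (by simp)
    rw [← add_assoc, zr]
    simp [h4, hr, hi, hb]
    omega
  · intro s' hi _ _ _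
    rw [hi]; congr 1; rw [mul_comm]; exact hdm

/-- Descends to the node `register 11` on level `register 10`, keeping track of the offset in
register `12`. -/
def stepCmd : Cmd :=
  6 ≔ #r 10 + 1 ;; 7 ≔ (#r 11 / 2) <<ᵉ #r 6 ;; zerosCmd ;; 8 ≔ #r 1 ;; 7 ≔ #r 7 + #r 12 ;;
  zerosCmd ;; 9 ≔ #r 1 - #r 8 ;; .ite (#r 11 % 2) (12 ≔ #r 12 - #r 9) (12 ≔ #r 9)

@[simp] theorem stepCmd_top : stepCmd.top = 13 := by simp [stepCmd, Cmd.top]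

@[simp] theorem stepCmd_keeps (a : ℕ) : stepCmd.keeps a = true := by simp [stepCmd, Cmd.keeps]

theorem Tree.node_le (hT : Tree M I N D β y v bit val) {k u a : ℕ} (hk : k ≤ D)
    (hu : u < 2 ^ (D - k)) (ha : a ≤ N) : u * 2 ^ k + cnt y k u a ≤ 2 ^ D := by
  have h₁ := cnt_le hT.inj k u
  have h₂ := cnt_mono y k u ha
  have h₃ := Nat.mul_le_mul_right (2 ^ k) hu
  rw [Nat.succ_mul, ← pow_add, Nat.sub_add_cancel hk] at h₃
  omega

/-- `zr_cnt` gives the offset in the left child as a difference of two counts of zeros; by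
`cnt_split` the offset in the right child is the rest. -/
theorem stepCmd_runs (hT : Tree M I N D β y v bit val) (hw : WReg s N D β) (k u a : ℕ)
    (h10 : s.reg 10 = k) (h11 : s.reg 11 = u) (h12 : s.reg 12 = cnt y (k + 1) (u / 2) a)
    (hk : k < D) (hu : u < 2 ^ (D - k)) (ha : a ≤ N) :
    Runs M I J stepCmd s fun s' => s'.reg 12 = cnt y k u a ∧ s'.reg 11 = u := by
  obtain ⟨M₀, J₀, hW, hc⟩ := hT.size
  have hcap := hW.cap
  have hu2 : u / 2 < 2 ^ (D - (k + 1)) := by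
    have : 2 ^ (D - k) = 2 * 2 ^ (D - (k + 1)) := by
      rw [show D - k = D - (k + 1) + 1 by omega, pow_succ]; ring
    omega
  have hD2 : D < 2 ^ D := Nat.lt_two_pow_self
  have hle := hT.node_le (show k + 1 ≤ D from hk) hu2 ha
  have hsp := cnt_split y k (u / 2) a
  have hz := zr_cnt (b := bit (k + 1)) (N := N) (y := y) (k := k) (fun x hx => by
    rw [hT.bit_eq _ hk x hx, pow_succ, mul_comm 2, Nat.mul_div_mul_right _ _ (by omega)])
    (u / 2) a ha
  refine Runs.set (k + 1) (by simp [h10]; omega) ?_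
  refine Runs.set (u / 2 * 2 ^ (k + 1)) (by simp [h11]; omega) ?_
  have hw := (hw.setReg (r := 6) (v := k + 1) (by omega)).setReg (r := 7)
    (v := u / 2 * 2 ^ (k + 1)) (by omega)
  refine Runs.seq (zerosCmd_runs hT hw (k + 1) (u / 2 * 2 ^ (k + 1)) (by simp) (by simp) hk (by omega)) ?_
  intro s₁ r₁ f₁
  have g₁ : ∀ r, 6 ≤ r → s₁.reg r = ((s.setReg 6 (k + 1)).setReg 7 (u / 2 * 2 ^ (k + 1))).reg r :=
    fun r hr => f₁.reg r (by simpa using hr)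
  refine Runs.set _ ⟨by simp, r₁⟩ ?_
  refine Runs.set (u / 2 * 2 ^ (k + 1) + cnt y (k + 1) (u / 2) a) ?_ ?_
  · simp [g₁, h12]; omega
  have hw := hw.congr (s' := (s₁.setReg 8 (zr (bit (k + 1)) (u / 2 * 2 ^ (k + 1)))).setReg 7
    (u / 2 * 2 ^ (k + 1) + cnt y (k + 1) (u / 2) a)) fun r h h' => by
      simp only [State.setReg_reg]
      rw [if_neg (by omega), if_neg (by omega), g₁ _ (by omega)]
      simp
  refine Runs.seq (zerosCmd_runs hT hw (k + 1)
    (u / 2 * 2 ^ (k + 1) + cnt y (k + 1) (u / 2) a) (by simp [g₁]) (by simp) hk (by omega)) ?_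
  intro s₂ r₂ f₂
  have g₂ : ∀ r, 10 ≤ r → s₂.reg r = s.reg r := fun r hr => by
    rw [f₂.reg r (by simp; omega)]; simp only [State.setReg_reg]
    rw [if_neg (by omega), if_neg (by omega), g₁ _ (by omega)]
    simp only [State.setReg_reg]
    rw [if_neg (by omega), if_neg (by omega)]
  have e8 : s₂.reg 8 = zr (bit (k + 1)) (u / 2 * 2 ^ (k + 1)) := by
    rw [f₂.reg 8 (by simp)]; simp
  rw [hz] at r₂
  have hzl := zr_le (bit (k + 1)) (u / 2 * 2 ^ (k + 1) + cnt y (k + 1) (u / 2) a)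
  rw [hz] at hzl
  refine Runs.set (cnt y k (2 * (u / 2)) a) (by simp [r₂, e8]; omega) ?_
  refine Runs.ite (by simp; omega) ?_ ?_
  · intro h; simp [g₂, h11] at h
    refine Runs.assign (cnt y k u a) ?_ (by simp [g₂, h11])
    have : 2 * (u / 2) + 1 = u := by omega
    rw [this] at hsp
    simp [g₂, h12]; omega
  · intro h; simp [g₂, h11] at h
    have : 2 * (u / 2) = u := by omega
    exact Runs.assign (cnt y k u a) (by simp [this]) (by simp [g₂, h11])

/-- `register 12 :=` the number of points before `register 18` in node `register 17` on level
`register 16`. -/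
def descCmd : Cmd :=
  14 ≔ #r 107 - #r 16 ;; 12 ≔ #r 18 ;; forLoop 13 14
    (10 ≔ #r 107 - 1 - #r 13 ;; 11 ≔ #r 17 >>ᵉ (#r 10 - #r 16) ;; stepCmd)

@[simp] theorem descCmd_top : descCmd.top = 15 := by simp [descCmd, Cmd.top]

@[simp] theorem descCmd_keeps (a : ℕ) : descCmd.keeps a = true := by simp [descCmd, Cmd.keeps]

theorem descCmd_runs (hT : Tree M I N D β y v bit val) (hw : WReg s N D β) (j u a : ℕ)
    (h16 : s.reg 16 = j) (h17 : s.reg 17 = u) (h18 : s.reg 18 = a)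
    (hj : j ≤ D) (hu : u < 2 ^ (D - j)) (ha : a ≤ N) :
    Runs M I J descCmd s fun s' => s'.reg 12 = cnt y j u a := by
  obtain ⟨M₀, J₀, hW, hc⟩ := hT.size
  have hcap := hW.cap
  have hDI := hW.D_le
  have hNl := hW.N_le
  have hD2 : D < 2 ^ D := Nat.lt_two_pow_self
  -- The root contains all points, so the offset there is `a` itself.
  have hbase : cnt y D 0 a = a := by
    clear h18
    induction a with
    | zero => rfl
    | succ a ih =>
      have := hT.lt a (by omega)
      rw [cnt, ih (by omega), if_pos (Nat.div_eq_of_lt (by omega))]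
  refine Runs.set (D - j) (by simp [h16, hw.rD]; omega) (Runs.set a (by simp [h18]) ?_)
  refine Runs.for (D - j) (by simp) (by omega) (by simp [Cmd.top]) (le_iters (by omega))
    (by omega) (by omega) (fun i s' => s'.reg 12 = cnt y (D - i) (u / 2 ^ (D - i - j)) a) ?_ ?_ ?_
  · simp [Nat.div_eq_of_lt hu, hbase]
  · intro i hi s' hr hinv hf hm
    have hf' : ∀ r, 15 ≤ r → s'.reg r = s.reg r := fun r hr => by
      rw [hf r (by omega)]; simp only [State.setReg_reg]; rw [if_neg (by omega), if_neg (by omega)]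
    have hw' := hw.congr (s' := s') fun r h h' => hf' r (by omega)
    refine Runs.set (D - 1 - i) (by simp [hf', hw.rD, hr]; omega) ?_
    refine Runs.set (u / 2 ^ (D - 1 - i - j)) (by simp [hf', h16, h17]; omega) ?_
    have hw' := (hw'.setReg (r := 10) (v := D - 1 - i) (by omega)).setReg (r := 11)
      (v := u / 2 ^ (D - 1 - i - j)) (by omega)
    refine (stepCmd_runs hT hw' (D - 1 - i) (u / 2 ^ (D - 1 - i - j)) a (by simp) (by simp) ?_
      (by omega) ?_ ha).mono ?_
    · simp only [State.setReg_reg]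
      norm_num
      rw [hinv, Nat.div_div_eq_div_mul, ← pow_succ]
      congr 2 <;> try omega
      congr 1; omega
    · rw [Nat.div_lt_iff_lt_mul (by positivity), ← pow_add]
      convert hu using 2; omega
    · rintro s'' ⟨h, -⟩ -
      rw [show D - 1 - i = D - (i + 1) by omega] at h
      simp [h]
  · intro s' h _ _ _
    rw [h]
    simp [show D - (D - j) = j by omega]

/-- `register 12 :=` the value of the point at position `register 16` on level `register 15`. -/
def accessCmd : Cmd :=
  11 ≔ #r 16 >>ᵉ #r 15 ;; 12 ≔ #r 16 - (#r 11 <<ᵉ #r 15) ;; forLoop 13 15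
    (10 ≔ #r 15 - 1 - #r 13 ;; 6 ≔ #r 10 + 1 ;; 7 ≔ (#r 11 <<ᵉ #r 6) + #r 12 ;;
      5 ≔ #r 6 * #r 112 + #r 7 / #r 110 ;;
      11 ≔ 2 * #r 11 + (rd true 8 (#r 5) >>ᵉ (#r 7 % #r 110)) % 2 ;; stepCmd) ;;
  12 ≔ rd true 6 (#r 11)

@[simp] theorem accessCmd_top : accessCmd.top = 14 := by simp [accessCmd, Cmd.top]

@[simp] theorem accessCmd_keeps (a : ℕ) : accessCmd.keeps a = true := by
  simp [accessCmd, Cmd.keeps]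

/-- The bit at the position of a point names its child, so the descent recovers the digits of `y x`
one by one. At the bottom array `6`, ordered by `y`, has the value; thus values are stored once and
not on every level. -/
theorem accessCmd_runs (hT : Tree M I N D β y v bit val) (hw : WReg s N D β) (k x : ℕ)
    (h15 : s.reg 15 = k) (h16 : s.reg 16 = posn y k x) (hk : k ≤ D) (hx : x < N) :
    Runs M I J accessCmd s fun s' => s'.reg 12 = v x := by
  obtain ⟨M₀, J₀, hW, hc⟩ := hT.size
  have hcap := hW.cap
  have hDI := hW.D_le
  have hNl := hW.N_le
  have hD2 : D < 2 ^ D := Nat.lt_two_pow_self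
  have hyx := hT.lt x hx
  have hdiv := posn_div hT.inj k hx
  have hpos := posn_lt hT.inj (fun x hx => (hT.lt x hx).trans_le hNl) hk hx
  have hp : posn y k x = y x / 2 ^ k * 2 ^ k + cnt y k (y x / 2 ^ k) x := rfl
  refine Runs.set (y x / 2 ^ k) (by simp [h15, h16, hdiv]) ?_
  refine Runs.set (cnt y k (y x / 2 ^ k) x) (by simp [h15, h16]; omega) ?_
  refine Runs.seq (Runs.for k (by simp [h15]) (by omega) (by simp [Cmd.top]) (le_iters (by omega))
    (by omega) (by omega) (fun i s' => s'.reg 11 = y x / 2 ^ (k - i) ∧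
      s'.reg 12 = cnt y (k - i) (y x / 2 ^ (k - i)) x) (by simp) ?_ ?_
    (Q := fun s' => s'.reg 11 = y x)) ?_
  · rintro i hi s' hr ⟨i₁, i₂⟩ hf hm
    have hf' : ∀ r, 14 ≤ r → s'.reg r = s.reg r := fun r hr => by
      rw [hf r (by omega)]; simp only [State.setReg_reg]; rw [if_neg (by omega), if_neg (by omega)]
    have hw' := hw.congr (s' := s') fun r h h' => hf' r (by omega)
    obtain ⟨m, hm⟩ : ∃ m, k - i = m + 1 := ⟨k - i - 1, by omega⟩
    rw [hm] at i₁ i₂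
    have hpm := posn_lt hT.inj (fun x hx => (hT.lt x hx).trans_le hNl) (show m + 1 ≤ D by omega) hx
    have hpm' : y x / 2 ^ (m + 1) * 2 ^ (m + 1) + cnt y (m + 1) (y x / 2 ^ (m + 1)) x =
      posn y (m + 1) x := rfl
    have hra := hT.row_addr (show m + 1 ≤ D by omega) hpm.le
    have hok := hT.ok 8 (by omega) (by omega) ((m + 1) * stride D β + posn y (m + 1) x / 2 ^ β)
      (by omega)
    have hbit := hT.bits (show m + 1 ≤ D by omega) hpm.le
      (Nat.mod_lt (posn y (m + 1) x) (show 0 < 2 ^ β by positivity)) s'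
    rw [mul_comm (_ / _), Nat.div_add_mod, hT.bit_eq _ (by omega) x hx, pow_succ, mul_comm 2,
      Nat.mul_div_mul_right _ _ (by omega)] at hbit
    have hd2 : y x / 2 ^ m = 2 * (y x / 2 ^ (m + 1)) + y x / 2 ^ m % 2 := by
      rw [pow_succ, ← Nat.div_div_eq_div_mul]; omega
    have hdl : y x / 2 ^ m ≤ y x := Nat.div_le_self _ _
    refine Runs.set m (by simp [hf', h15, hr]; omega) ?_
    refine Runs.set (m + 1) (by simp; omega) ?_
    refine Runs.set (posn y (m + 1) x) (by simp [i₁, i₂]; omega) ?_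
    refine Runs.set ((m + 1) * stride D β + posn y (m + 1) x / 2 ^ β) ?_ ?_
    · have := Nat.le_add_right ((m + 1) * stride D β) (posn y (m + 1) x / 2 ^ β)
      simp [hf', hw.rst, hw.rB]; omega
    refine Runs.set (y x / 2 ^ m) ?_ ?_
    · constructor
      · simp [hf', hw.rB, hok, i₁, hbit]; omega
      · simp [hf', hw.rB, i₁, hbit]; omega
    refine (stepCmd_runs hT (hw'.congr ?_) m (y x / 2 ^ m) x (by simp) (by simp) ?_
      (by omega) ?_ hx.le).mono ?_
    · intro r h h'
      simp only [State.setReg_reg]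
      rw [if_neg (by omega), if_neg (by omega), if_neg (by omega), if_neg (by omega),
        if_neg (by omega)]
    · simp [i₂, pow_succ, ← Nat.div_div_eq_div_mul]
    · rw [Nat.div_lt_iff_lt_mul (by positivity), ← pow_add, Nat.sub_add_cancel (by omega)]
      omega
    · rintro s'' ⟨h, h'⟩ -
      simp [h, h', show k - (i + 1) = m by omega]
  · rintro s' ⟨i₁, -⟩ _ _ _
    simpa using i₁
  · intro s₁ r₁ f₁
    exact Runs.assign (v x) ⟨by simp [r₁, hT.ok 6 (by omega) (by omega) (y x) (by omega)],
      by simp [r₁]; exact hT.point x hx _⟩ (by simp)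

end Programs

end RLZ

namespace RLZ

/-! ### Range minima by dyadic decomposition -/

section Programs

variable {M : Machine} {I J N D β : ℕ} {s : State} {Q : State → Prop}
variable {y v : ℕ → ℕ} {bit val : ℕ → ℕ → ℕ}

/-- Decomposes the interval from `register b` to `register (b + 1)` into dyadic intervals, and
visits each of them with its height in `register (b + 3)` and its index in `register (b + 2)`. -/
def dyadicLoop (b : ℕ) (visit : Cmd) : Cmd :=
  b + 4 ≔ #r 107 + 1 ;; forLoop (b + 3) (b + 4)
    (.ite (#r b <ᵉ #r (b + 1))
      (.ite (#r b % 2) (b + 2 ≔ #r b ;; visit ;; b ≔ #r b + 1) .skip ;;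
        .ite (#r (b + 1) % 2) (b + 1 ≔ #r (b + 1) - 1 ;; b + 2 ≔ #r (b + 1) ;; visit) .skip)
      .skip ;;
      b ≔ #r b / 2 ;; b + 1 ≔ #r (b + 1) / 2)

theorem dyadicLoop_top {b : ℕ} {visit : Cmd} (h : visit.top ≤ b) :
    (dyadicLoop b visit).top = b + 5 := by
  simp [dyadicLoop, Cmd.top]; omega

@[simp] theorem dyadicLoop_keeps (b a : ℕ) (visit : Cmd) :
    (dyadicLoop b visit).keeps a = visit.keeps a := by
  simp [dyadicLoop, Cmd.keeps]

/-- At each height an odd left or right end splits off one dyadic interval, after which both ends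
are even and are halved. Invariant: the visited values `S` and those between the two ends make up
the whole range. `G` is any family that is additive in the interval, which serves both for positions
on a level and for second coordinates. -/
theorem dyadicLoop_runs {b rm l r : ℕ} {visit : Cmd} (hD : s.reg 107 = D) (hDI : D + 2 ≤ I)
    (hcap : 64 * 2 ^ D + 1000 ≤ M.cap) (hb : b < 100) (hv : visit.top ≤ b) (hrm : rm < b)
    (hk : ∀ a, visit.keeps a = true) (hl : s.reg b = l) (hr : s.reg (b + 1) = r) (hlr : l ≤ r)
    (hrD : r ≤ 2 ^ D) (hm : s.reg rm = N) (G : ℕ → ℕ → ℕ → Prop)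
    (hG : ∀ a b c, a ≤ b → b ≤ c → ∀ v, G a c v ↔ G a b v ∨ G b c v) (hG0 : ∀ a v, ¬ G a a v)
    (hvisit : ∀ j ≤ D, ∀ t, l ≤ t * 2 ^ j → (t + 1) * 2 ^ j ≤ r → ∀ s', s'.reg (b + 3) = j →
      s'.reg (b + 2) = t → (∀ r', b + 5 ≤ r' → s'.reg r' = s.reg r') → s'.mem = s.mem →
      s'.reg rm ≤ N → Runs M I J visit s' fun s'' => ∃ w, IsMinOf N (G (t * 2 ^ j) ((t + 1) * 2 ^ j)) w ∧
        s''.reg rm = min (s'.reg rm) w) :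
    Runs M I J (dyadicLoop b visit) s fun s' => IsMinOf N (G l r) (s'.reg rm) := by
  have hD2 : D < 2 ^ D := Nat.lt_two_pow_self
  refine Runs.set (D + 1) (by simp [hD]; omega) ?_
  refine Runs.for (D + 1) (by simp) (by omega) ?_ (le_iters (by omega)) (by omega) (by omega)
    (fun j s' => ∃ l' r' S, s'.reg b = l' ∧ s'.reg (b + 1) = r' ∧ l' ≤ r' ∧ r' * 2 ^ j ≤ 2 ^ D ∧
      (l' < r' → l ≤ l' * 2 ^ j ∧ r' * 2 ^ j ≤ r) ∧ IsMinOf N S (s'.reg rm) ∧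
      ∀ v, G l r v ↔ S v ∨ G (l' * 2 ^ j) (r' * 2 ^ j) v) ?_ ?_ ?_
  · simp [Cmd.top]; omega
  · refine ⟨l, r, fun _ => False, ?_, ?_, hlr, by simpa, by simp, ?_, by simp⟩
    · simp only [State.setReg_reg]; rw [if_neg (by omega), if_neg (by omega), hl]
    · simp only [State.setReg_reg]; rw [if_neg (by omega), if_neg (by omega), hr]
    · simp only [State.setReg_reg]; rw [if_neg (by omega), if_neg (by omega), hm]
      exact IsMinOf.empty fun _ h => h
  · rintro j hj s' hrj ⟨l', r', S, el, er, hlr', hrD', hin, hS, hcov⟩ hf hmem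
    have hmem' : s'.mem = s.mem := by
      funext a; rw [hmem a (by simp [Cmd.keeps, hk])]; rfl
    have hf' : ∀ r', b + 5 ≤ r' → s'.reg r' = s.reg r' := fun r' h => by
      rw [hf r' (by omega)]; simp only [State.setReg_reg]
      rw [if_neg (by omega)]
    have hpj : 1 ≤ 2 ^ j := Nat.one_le_two_pow
    have hrb : r' ≤ 2 ^ D := (Nat.le_mul_of_pos_right r' (by omega)).trans hrD'
    have hpp : 2 ^ (j + 1) = 2 * 2 ^ j := by rw [pow_succ]; ring
    have hkv : ∀ s₁ : State, s₁.mem = s'.mem → (∀ r', b + 3 ≤ r' → s₁.reg r' = s'.reg r') →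
        s₁.mem = s.mem ∧ s₁.reg (b + 3) = j ∧ ∀ r', b + 5 ≤ r' → s₁.reg r' = s.reg r' :=
      fun s₁ h₁ h₂ => ⟨h₁.trans hmem', by rw [h₂ _ le_rfl, hrj],
        fun r' h => by rw [h₂ _ (by omega), hf' _ h]⟩
    refine Runs.seq (Q' := fun s₁ => ∃ l' r' S, s₁.reg b = l' ∧ s₁.reg (b + 1) = r' ∧ l' ≤ r' ∧
      r' * 2 ^ j ≤ 2 ^ D ∧ (l' < r' → l ≤ l' * 2 ^ j ∧ r' * 2 ^ j ≤ r) ∧ IsMinOf N S (s₁.reg rm) ∧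
      (∀ v, G l r v ↔ S v ∨ G (l' * 2 ^ j) (r' * 2 ^ j) v) ∧ (l' < r' → l' % 2 = 0 ∧ r' % 2 = 0))
      ?_ ?_
    · refine Runs.ite (by simp) ?_ ?_
      · intro hc
        simp [el, er] at hc
        refine Runs.seq (Q' := fun s₁ => ∃ l' r' S, s₁.reg b = l' ∧ s₁.reg (b + 1) = r' ∧ l' ≤ r' ∧
          r' * 2 ^ j ≤ 2 ^ D ∧ (l' < r' → l ≤ l' * 2 ^ j ∧ r' * 2 ^ j ≤ r) ∧
          IsMinOf N S (s₁.reg rm) ∧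
          (∀ v, G l r v ↔ S v ∨ G (l' * 2 ^ j) (r' * 2 ^ j) v) ∧ l' % 2 = 0) ?_ ?_
        · refine Runs.ite (by simp; omega) ?_ ?_
          · intro ho
            simp [el] at ho
            obtain ⟨hin₁, hin₂⟩ := hin hc
            have hle : (l' + 1) * 2 ^ j ≤ r' * 2 ^ j := Nat.mul_le_mul_right _ hc
            refine Runs.set l' (by simp [el]) ?_
            obtain ⟨k₁, k₂, k₃⟩ := hkv (s'.setReg (b + 2) l') rfl fun r' h => by
              rw [State.setReg_reg, if_neg (by omega)]
            refine Runs.seq (hvisit j (by omega) l' hin₁ (hle.trans hin₂) _ k₂ (by simp) k₃ k₁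
              (by rw [State.setReg_reg, if_neg (by omega)]; exact hS.le)) ?_
            rintro s₁ ⟨w, hw₁, hw₂⟩ f₁
            have g₁ : ∀ r, b ≤ r → r ≠ b + 2 → s₁.reg r = s'.reg r := fun r h h' => by
              rw [f₁.reg r (by omega), State.setReg_reg, if_neg h']
            refine Runs.assign (l' + 1) ?_ ?_
            · simp [g₁ b le_rfl (by omega), el]; omega
            refine ⟨l' + 1, r', fun v => S v ∨ G (l' * 2 ^ j) ((l' + 1) * 2 ^ j) v, by simp, ?_, hc, hrD', fun h => ⟨?_, hin₂⟩, ?_, ?_, by omega⟩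
            · rw [State.setReg_reg, if_neg (by omega), g₁ _ (by omega) (by omega), er]
            · rw [Nat.succ_mul]; omega
            · rw [State.setReg_reg, if_neg (by omega), hw₂, State.setReg_reg, if_neg (by omega)]
              exact hS.union hw₁ fun v => Iff.rfl
            · intro v
              rw [hcov, hG (l' * 2 ^ j) ((l' + 1) * 2 ^ j) (r' * 2 ^ j)
                (Nat.mul_le_mul_right _ (by omega)) hle, or_assoc]
          · intro ho
            simp [el] at ho
            exact Runs.skip ⟨l', r', S, el, er, hlr', hrD', hin, hS, hcov, ho⟩
        · rintro s₁ ⟨l', r', S, el, er, hlr', hrD', hin, hS, hcov, hev⟩ f₁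
          have hrb : r' ≤ 2 ^ D := (Nat.le_mul_of_pos_right r' (by omega)).trans hrD'
          refine Runs.ite (by simp; omega) ?_ ?_
          · intro ho
            simp [er] at ho
            have hc : l' < r' := by
              rcases hlr'.eq_or_lt with h | h
              · omega
              · exact h
            obtain ⟨hin₁, hin₂⟩ := hin hc
            obtain ⟨t, rfl⟩ : ∃ t, r' = t + 1 := ⟨r' - 1, by omega⟩
            have hle : l' * 2 ^ j ≤ t * 2 ^ j := Nat.mul_le_mul_right _ (by omega)
            have hle' : t * 2 ^ j ≤ (t + 1) * 2 ^ j := Nat.mul_le_mul_right _ (by omega)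
            refine Runs.set t (by simp [er]; omega) (Runs.set t (by simp) ?_)
            obtain ⟨k₁, k₂, k₃⟩ := hkv ((s₁.setReg (b + 1) t).setReg (b + 2) t)
              (funext fun a => f₁.mem a (by simp [Cmd.keeps, hk])) fun r' h => by
                rw [State.setReg_reg, if_neg (by omega), State.setReg_reg, if_neg (by omega)]
                exact f₁.reg _ (by simp [Cmd.top]; omega)
            refine (hvisit j (by omega) t (by omega) (by omega) _ k₂ (by simp) k₃ k₁ (by
              rw [State.setReg_reg, if_neg (by omega), State.setReg_reg, if_neg (by omega)]
              exact hS.le)).mono ?_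
            rintro s₂ ⟨w, hw₁, hw₂⟩ f₂
            have g₂ : ∀ r, b ≤ r → s₂.reg r = ((s₁.setReg (b + 1) t).setReg (b + 2) t).reg r :=
              fun r h => f₂.reg r (by omega)
            refine ⟨l', t, fun v => S v ∨ G (t * 2 ^ j) ((t + 1) * 2 ^ j) v, ?_, ?_, by omega, by omega, fun h => ⟨hin₁, by omega⟩, ?_, ?_,
              fun _ => ⟨hev, by omega⟩⟩
            · rw [g₂ _ le_rfl, State.setReg_reg, if_neg (by omega), State.setReg_reg,
                if_neg (by omega), el]
            · rw [g₂ _ (by omega), State.setReg_reg, if_neg (by omega), State.setReg_reg,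
                if_pos rfl]
            · rw [hw₂, State.setReg_reg, if_neg (by omega), State.setReg_reg, if_neg (by omega)]
              exact hS.union hw₁ fun v => Iff.rfl
            · intro v
              rw [hcov, hG _ _ _ hle hle', or_assoc, or_comm (a := G (l' * 2 ^ j) (t * 2 ^ j) v)]
          · intro ho
            simp [er] at ho
            exact Runs.skip ⟨l', r', S, el, er, hlr', hrD', hin, hS, hcov, fun _ => ⟨hev, ho⟩⟩
      · intro hc
        simp [el, er] at hc
        exact Runs.skip ⟨l', r', S, el, er, hlr', hrD', hin, hS, hcov, fun h => by omega⟩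
    · rintro s₁ ⟨l', r', S, el, er, hlr', hrD', hin, hS, hcov, hev⟩ f₁
      refine Runs.set (l' / 2) (by simp [el]; omega) (Runs.assign (r' / 2) (by simp [er]; omega) ?_)
      refine ⟨l' / 2, r' / 2, S, ?_, ?_, by omega, ?_, ?_, ?_, ?_⟩
      · simp
      · simp
      · have := Nat.mul_le_mul_right (2 ^ j) (Nat.div_mul_le_self r' 2)
        rw [hpp, ← mul_assoc]; omega
      · intro h
        obtain ⟨e₁, e₂⟩ := hev (by omega)
        obtain ⟨h₁, h₂⟩ := hin (by omega)
        rw [hpp, ← mul_assoc, ← mul_assoc, show l' / 2 * 2 = l' by omega,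
          show r' / 2 * 2 = r' by omega]
        exact ⟨h₁, h₂⟩
      · simp only [State.setReg_reg]
        rw [if_neg (by omega), if_neg (by omega), if_neg (by omega)]
        exact hS
      · intro v
        rw [hcov]
        rcases hlr'.eq_or_lt with h | h
        · subst h
          simp [hG0]
        · obtain ⟨e₁, e₂⟩ := hev h
          rw [hpp, ← mul_assoc, ← mul_assoc, show l' / 2 * 2 = l' by omega,
            show r' / 2 * 2 = r' by omega]
  · rintro s' ⟨l', r', S, -, -, hlr', hrD', -, hS, hcov⟩ _ _ _
    -- After the round of height `D` a nonzero right end would exceed `2 ^ D`.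
    have hr0 : r' = 0 := by
      by_contra h
      have : 2 ^ (D + 1) ≤ r' * 2 ^ (D + 1) := Nat.le_mul_of_pos_left _ (by omega)
      rw [pow_succ] at this hrD'
      have : 0 < 2 ^ D := by positivity
      omega
    obtain rfl : l' = 0 := by omega
    subst hr0
    have : S = G l r := by
      funext v; simp [hcov, hG0]
    rwa [← this]

/-- Takes the minimum over a dyadic interval of positions on level `register 29`. -/
def rowVisit : Cmd :=
  .ite (#r 27 <ᵉ #r 109)
    (22 ≔ 1 <<ᵉ #r 27 ;; forLoop 21 22
      (15 ≔ #r 29 ;; 16 ≔ (#r 26 <<ᵉ #r 27) + #r 21 ;; accessCmd ;; minCmd 20 (#r 20) (#r 12)))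
    (minCmd 20 (#r 20) (rd true 9 (#r 29 * #r 112 + ((1 <<ᵉ (#r 107 - #r 27)) + #r 26))))

@[simp] theorem rowVisit_top : rowVisit.top = 23 := by simp [rowVisit, Cmd.top]

@[simp] theorem rowVisit_keeps (a : ℕ) : rowVisit.keeps a = true := by simp [rowVisit, Cmd.keeps]

/-- From height `β` on, a node of the segment tree has the minimum. Below it there are fewer than `2
^ β` positions, whose values are accessed one at a time; `hpt` ensures that they hold points. -/
theorem rowVisit_runs (hT : Tree M I N D β y v bit val) (hw : WReg s N D β) {k j t : ℕ}
    (h29 : s.reg 29 = k) (h27 : s.reg 27 = j) (h26 : s.reg 26 = t)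
    (h20 : s.reg 20 ≤ N) (hk : k ≤ D) (hj : j ≤ D)
    (ht : (t + 1) * 2 ^ j ≤ 2 ^ D)
    (hpt : ∀ i, t * 2 ^ j ≤ i → i < (t + 1) * 2 ^ j → ∃ x < N, posn y k x = i) :
    Runs M I J rowVisit s fun s' =>
      ∃ m, IsMinOf N (Vals (val k) (t * 2 ^ j) ((t + 1) * 2 ^ j)) m ∧
        s'.reg 20 = min (s.reg 20) m := by
  obtain ⟨M₀, J₀, hW, hc⟩ := hT.size
  have hcap := hW.cap
  have hBl := hW.B_le
  have hDI := hW.D_le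
  have hNl := hW.N_le
  have hD2 : D < 2 ^ D := Nat.lt_two_pow_self
  have hsucc : (t + 1) * 2 ^ j = t * 2 ^ j + 2 ^ j := by ring
  refine Runs.ite (by simp) ?_ ?_
  · intro hlt
    simp [h27, hw.rβ] at hlt
    have hpj : 2 ^ j ≤ 2 ^ β := Nat.pow_le_pow_right (by omega) hlt.le
    refine Runs.set (2 ^ j) (by simp [h27]; omega) ?_
    refine Runs.for (2 ^ j) (by simp) (by omega) (by simp [Cmd.top]) (le_iters (by omega))
      (by omega) (by omega) (fun n s' => ∃ m, IsMinOf N (Vals (val k) (t * 2 ^ j) (t * 2 ^ j + n)) m ∧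
        s'.reg 20 = min (s.reg 20) m) ?_ ?_ ?_
    · refine ⟨N, IsMinOf.empty fun v ⟨t, h, h', _⟩ => by omega, ?_⟩
      rw [State.setReg_reg, if_neg (by omega), State.setReg_reg, if_neg (by omega), min_eq_left h20]
    · rintro n hn s' hr ⟨m, hm, hreg⟩ hf hmem
      have hf' : ∀ r, 23 ≤ r → s'.reg r = s.reg r := fun r hr => by
        rw [hf r (by omega), State.setReg_reg, if_neg (by omega)]
      have hw' := hw.congr (s' := s') fun r h h' => hf' r (by omega)
      obtain ⟨x, hx, hpx⟩ := hpt (t * 2 ^ j + n) (by omega) (by omega)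
      refine Runs.set k (by simp [hf', h29]) ?_
      refine Runs.set (t * 2 ^ j + n) (by simp [hf', h26, h27, hr]; omega) ?_
      refine Runs.seq (accessCmd_runs hT ((hw'.setReg (by omega)).setReg (by omega)) k x (by simp)
        (by simp [hpx]) hk hx) ?_
      intro s₁ r₁ f₁
      have e20 : s₁.reg 20 = min (s.reg 20) m := by
        rw [f₁.reg _ (by simp)]; simp [hreg]
      refine (minCmd_runs (min (s.reg 20) m) (v x) (by simp [e20]) (fun _ => by simp [r₁])).mono ?_
      rintro s₂ ⟨r₂, -, -⟩ -
      refine ⟨_, hm.snoc (by omega), ?_⟩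
      rw [← hpx, hT.val_eq k hk x hx]
      simp [r₂, min_assoc]
    · rintro s' ⟨m, hm, hreg⟩ _ _ _
      rw [hsucc]
      exact ⟨m, hm, hreg⟩
  · intro hge
    simp [h27, hw.rβ] at hge
    have htD : t < 2 ^ (D - j) := by
      by_contra hcon
      have h₁ := Nat.mul_le_mul_right (2 ^ j) (show 2 ^ (D - j) + 1 ≤ t + 1 by omega)
      rw [add_mul, ← pow_add, Nat.sub_add_cancel hj] at h₁
      have : 0 < 2 ^ j := by positivity
      omega
    have hpp : 2 ^ (D - j) ≤ 2 ^ (D - β) := Nat.pow_le_pow_right (by omega) (by omega)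
    have hS := hW.S_le
    have hrl := hW.row_lt hk (show 2 ^ (D - j) + t < stride D β by rw [stride]; omega)
    have hok := hT.ok 9 (by omega) (by omega) (k * stride D β + (2 ^ (D - j) + t)) (by omega)
    have hseg := (hT.row k hk s).seg j hge hj t htD
    refine (minCmd_runs (s.reg 20) (rdVal true M s 9 (k * stride D β + (2 ^ (D - j) + t)))
      (by simp) (fun _ => ?_)).mono ?_
    · have := Nat.le_add_right (k * stride D β) (2 ^ (D - j) + t)
      simp [h26, h27, h29, hw.rD, hw.rst, hok]; omega
    · rintro s' ⟨h, -, -⟩ -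
      exact ⟨_, hseg, h⟩

/-- `register 20 :=` the minimum of the values at the positions from `register 24` to
`register 25` of level `register 29`. -/
def rowMinCmd : Cmd := 20 ≔ #r 105 ;; dyadicLoop 24 rowVisit

@[simp] theorem rowMinCmd_top : rowMinCmd.top = 29 := by
  simp [rowMinCmd, Cmd.top, dyadicLoop_top]

@[simp] theorem rowMinCmd_keeps (a : ℕ) : rowMinCmd.keeps a = true := by
  simp [rowMinCmd, Cmd.keeps]

theorem rowMinCmd_runs (hT : Tree M I N D β y v bit val) (hw : WReg s N D β) {k l r : ℕ}
    (h29 : s.reg 29 = k) (h24 : s.reg 24 = l) (h25 : s.reg 25 = r) (hk : k ≤ D) (hlr : l ≤ r)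
    (hr : r ≤ 2 ^ D) (hpt : ∀ i, l ≤ i → i < r → ∃ x < N, posn y k x = i) :
    Runs M I J rowMinCmd s fun s' => IsMinOf N (Vals (val k) l r) (s'.reg 20) := by
  obtain ⟨M₀, J₀, hW, hc⟩ := hT.size
  have hcap := hW.cap
  refine Runs.set N (by simp [hw.rN]) ?_
  have hw := hw.setReg (r := 20) (v := N) (by omega)
  refine dyadicLoop_runs hw.rD hW.D_le (by omega) (by omega) (by simp) (by omega) (by simp)
    (by simp [h24]) (by simp [h25]) hlr hr (by simp) (Vals (val k))
    (fun a b c h h' v => Vals.split h h' v) (fun a v ⟨t, h, h', _⟩ => by omega) ?_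
  intro j hj t hl hr' s' e₁ e₂ hf hm h20
  exact rowVisit_runs hT (hw.congr fun r h h' => hf r (by omega)) (k := k)
    (by rw [hf _ (by omega)]; simp [h29]) e₁ e₂ h20 hk hj (by omega)
    fun i h h' => hpt i (by omega) (by omega)

/-! ### Minima over rectangles -/

/-- The values of the points in the rectangle `[a₁, a₂) × [c₁, c₂)`. -/
def Rect (y v : ℕ → ℕ) (a₁ a₂ c₁ c₂ w : ℕ) : Prop :=
  ∃ x, a₁ ≤ x ∧ x < a₂ ∧ c₁ ≤ y x ∧ y x < c₂ ∧ v x = w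

/-- Takes the minimum over a node of the wavelet tree. -/
def nodeVisit : Cmd :=
  16 ≔ #r 47 ;; 17 ≔ #r 46 ;; 18 ≔ #r 49 ;; descCmd ;; 41 ≔ #r 12 ;; 18 ≔ #r 50 ;; descCmd ;;
  29 ≔ #r 47 ;; 25 ≔ (#r 46 <<ᵉ #r 47) + #r 12 ;; 24 ≔ (#r 46 <<ᵉ #r 47) + #r 41 ;; rowMinCmd ;;
  minCmd 40 (#r 40) (#r 20)

@[simp] theorem nodeVisit_top : nodeVisit.top = 42 := by simp [nodeVisit, Cmd.top]

@[simp] theorem nodeVisit_keeps (a : ℕ) : nodeVisit.keeps a = true := by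
  simp [nodeVisit, Cmd.keeps]

/-- Within a node the points are ordered by first coordinate, so those in `[a₁, a₂)` occupy
consecutive slots. The minimum over a dyadic strip becomes a range minimum on one level. -/
theorem nodeVisit_runs (hT : Tree M I N D β y v bit val) (hw : WReg s N D β) {j u a₁ a₂ : ℕ}
    (h47 : s.reg 47 = j) (h46 : s.reg 46 = u) (h49 : s.reg 49 = a₁) (h50 : s.reg 50 = a₂)
    (hj : j ≤ D) (hu : u < 2 ^ (D - j)) (h₁ : a₁ ≤ a₂) (h₂ : a₂ ≤ N) :
    Runs M I J nodeVisit s fun s' =>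
      ∃ m, IsMinOf N (Rect y v a₁ a₂ (u * 2 ^ j) ((u + 1) * 2 ^ j)) m ∧
        s'.reg 40 = min (s.reg 40) m := by
  obtain ⟨M₀, J₀, hW, hc⟩ := hT.size
  have hcap := hW.cap
  have hn₁ := hT.node_le hj hu (h₁.trans h₂)
  have hn₂ := hT.node_le hj hu h₂
  have hmono := cnt_mono y j u h₁
  refine Runs.set j (by simp [h47]) (Runs.set u (by simp [h46]) (Runs.set a₁ (by simp [h49]) ?_))
  have hw := ((hw.setReg (r := 16) (v := j) (by omega)).setReg (r := 17) (v := u)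
    (by omega)).setReg (r := 18) (v := a₁) (by omega)
  refine Runs.seq (descCmd_runs hT hw j u a₁ (by simp) (by simp) (by simp) hj hu (by omega)) ?_
  intro s₁ r₁ f₁
  have g₁ : ∀ r, 15 ≤ r → s₁.reg r = (((s.setReg 16 j).setReg 17 u).setReg 18 a₁).reg r :=
    fun r hr => f₁.reg r (by simpa using hr)
  refine Runs.set (cnt y j u a₁) (by simp [r₁]) (Runs.set a₂ (by simp [g₁, h50]) ?_)
  have hw := ((hw.congr (s' := s₁) fun r h h' => g₁ r (by omega)).setReg (r := 41)
    (v := cnt y j u a₁) (by omega)).setReg (r := 18) (v := a₂) (by omega)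
  refine Runs.seq (descCmd_runs hT hw j u a₂ (by simp [g₁]) (by simp [g₁]) (by simp) hj hu h₂) ?_
  intro s₂ r₂ f₂
  have g₂ : ∀ r, 15 ≤ r → s₂.reg r = ((s₁.setReg 41 (cnt y j u a₁)).setReg 18 a₂).reg r :=
    fun r hr => f₂.reg r (by simpa using hr)
  refine Runs.set j (by simp [g₂, g₁, h47]) ?_
  refine Runs.set (u * 2 ^ j + cnt y j u a₂) (by simp [g₂, g₁, h46, h47, r₂]; omega) ?_
  refine Runs.set (u * 2 ^ j + cnt y j u a₁) (by simp [g₂, g₁, h46, h47]; omega) ?_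
  have hw := (((hw.congr (s' := s₂) fun r h h' => g₂ r (by omega)).setReg (r := 29)
    (v := j) (by omega)).setReg (r := 25) (v := u * 2 ^ j + cnt y j u a₂) (by omega)).setReg
    (r := 24) (v := u * 2 ^ j + cnt y j u a₁) (by omega)
  have hpts : ∀ i, u * 2 ^ j + cnt y j u a₁ ≤ i → i < u * 2 ^ j + cnt y j u a₂ →
      ∃ x, a₁ ≤ x ∧ x < a₂ ∧ y x / 2 ^ j = u ∧ posn y j x = i := by
    intro i h h'
    obtain ⟨x, e₁, e₂, e₃, e₄⟩ := exists_of_cnt (y := y) (k := j) (u := u) (c := i - u * 2 ^ j) h₁ (by omega) (by omega)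
    exact ⟨x, e₁, e₂, e₃, by rw [posn, e₃, e₄]; omega⟩
  refine Runs.seq (rowMinCmd_runs hT hw (k := j) (l := u * 2 ^ j + cnt y j u a₁)
    (r := u * 2 ^ j + cnt y j u a₂) (by simp) (by simp) (by simp) hj (by omega) hn₂
    fun i h h' => ?_) ?_
  · obtain ⟨x, e₁, e₂, e₃, e₄⟩ := hpts i h h'
    exact ⟨x, by omega, e₄⟩
  intro s₃ r₃ f₃
  have g₃ : s₃.reg 40 = s.reg 40 := by
    rw [f₃.reg _ (by simp)]; simp [g₂, g₁]
  refine (minCmd_runs (s.reg 40) (s₃.reg 20) (by simp [g₃]) (fun _ => by simp)).mono ?_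
  rintro s₄ ⟨r₄, -, -⟩ -
  refine ⟨_, ?_, r₄⟩
  -- The values in the strip are exactly the values in that range of slots.
  convert r₃ using 1
  funext w
  apply propext
  constructor
  · rintro ⟨x, e₁, e₂, e₃, e₄, e₅⟩
    have hd : y x / 2 ^ j = u := by
      rw [Nat.div_eq_iff (by positivity)]
      rw [add_mul, one_mul] at e₄
      omega
    refine ⟨posn y j x, ?_, ?_, by rw [hT.val_eq j hj x (by omega), e₅]⟩
    · rw [posn, hd]
      have := cnt_mono y j u e₁
      omega
    · rw [posn, hd]
      have := cnt_mono y j u (show x + 1 ≤ a₂ from e₂)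
      rw [cnt, if_pos hd] at this
      omega
  · rintro ⟨i, h, h', e⟩
    obtain ⟨x, e₁, e₂, e₃, e₄⟩ := hpts i h h'
    have hd := Nat.div_add_mod (y x) (2 ^ j)
    have hm := Nat.mod_lt (y x) (show 0 < 2 ^ j by positivity)
    rw [e₃, mul_comm] at hd
    refine ⟨x, e₁, e₂, by omega, by rw [add_mul, one_mul]; omega, ?_⟩
    rw [← e, ← e₄, hT.val_eq j hj x (by omega)]

/-- `register 40 :=` the minimum of the values of the points with first coordinate from
`register 49` to `register 50` and second coordinate from `register 44` to `register 45`. -/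
def rectMinCmd : Cmd := 40 ≔ #r 105 ;; dyadicLoop 44 nodeVisit

@[simp] theorem rectMinCmd_top : rectMinCmd.top = 49 := by
  simp [rectMinCmd, Cmd.top, dyadicLoop_top]

/-- The interval of second coordinates is cut into dyadic strips, each of them a node of the wavelet
tree. -/
theorem rectMinCmd_runs (hT : Tree M I N D β y v bit val) (hw : WReg s N D β) {a₁ a₂ c₁ c₂ : ℕ}
    (h49 : s.reg 49 = a₁) (h50 : s.reg 50 = a₂) (h44 : s.reg 44 = c₁) (h45 : s.reg 45 = c₂)
    (ha : a₁ ≤ a₂) (ha' : a₂ ≤ N) (hc : c₁ ≤ c₂) (hc' : c₂ ≤ N) :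
    Runs M I J rectMinCmd s fun s' => IsMinOf N (Rect y v a₁ a₂ c₁ c₂) (s'.reg 40) := by
  obtain ⟨M₀, J₀, hW, hcp⟩ := hT.size
  have hcap := hW.cap
  have hNl := hW.N_le
  refine Runs.set N (by simp [hw.rN]) ?_
  have hw := hw.setReg (r := 40) (v := N) (by omega)
  refine dyadicLoop_runs hw.rD hW.D_le (by omega) (by omega) (by simp) (by omega) (by simp)
    (by simp [h44]) (by simp [h45]) hc (by omega) (by simp) (fun c₁ c₂ => Rect y v a₁ a₂ c₁ c₂)
    ?_ ?_ ?_
  · intro a b c h h' w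
    constructor
    · rintro ⟨x, e₁, e₂, e₃, e₄, e₅⟩
      rcases lt_or_ge (y x) b with hb | hb
      · exact Or.inl ⟨x, e₁, e₂, e₃, hb, e₅⟩
      · exact Or.inr ⟨x, e₁, e₂, hb, e₄, e₅⟩
    · rintro (⟨x, e₁, e₂, e₃, e₄, e₅⟩ | ⟨x, e₁, e₂, e₃, e₄, e₅⟩)
      · exact ⟨x, e₁, e₂, e₃, by omega, e₅⟩
      · exact ⟨x, e₁, e₂, by omega, e₄, e₅⟩
  · rintro a w ⟨x, e₁, e₂, e₃, e₄, e₅⟩; omega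
  · intro j hj t hl hr' s' e₁ e₂ hf hm _
    refine nodeVisit_runs hT (hw.congr fun r h h' => hf r (by omega)) e₁ e₂
      (by rw [hf _ (by omega)]; simp [h49]) (by rw [hf _ (by omega)]; simp [h50]) hj ?_ ha ha'
    by_contra hcon
    have h₁ := Nat.mul_le_mul_right (2 ^ j) (show 2 ^ (D - j) + 1 ≤ t + 1 by omega)
    rw [add_mul, ← pow_add, Nat.sub_add_cancel hj] at h₁
    have : 0 < 2 ^ j := by positivity
    omega

end Programs

end RLZ

namespace RLZ

/-! ## Searching for the parts of the pattern -/

/-- The part of the pattern that is searched for in the direction `d` has this length. -/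
def patLen (P : List ℕ) (i d : ℕ) : ℕ := if d = 0 then P.length - i else i

/-- The character of the pattern after `l` steps from the split in the direction `d`. -/
def patChar (P : List ℕ) (i d l : ℕ) : ℕ := P.getD (i + l - d * (2 * l + 1)) 0

/-- The hash of the `len` characters of the pattern next to the split in the direction `d`. -/
def Env.patHash (E : Env) (P : List ℕ) (i d len : ℕ) : ℕ :=
  if d = 0 then krHash E.p E.x ((P.drop i).take len)
  else krHash E.p E.x ((P.take i).drop (i - len))

/-- The length of the longest common prefix of an item and a part of the pattern, according to the
hashes. -/
def Env.patLcp (E : Env) (P : List ℕ) (i d b : ℕ) : ℕ :=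
  bsAux (fun len => decide (E.fh d b len = E.patHash P i d len))
    (min (E.room d b) (patLen P i d)) (E.K + 1) 0

/-- The item at `b` is smaller than the part of the pattern; `tie` decides the case that the
pattern is a prefix. -/
def Env.below (E : Env) (P : List ℕ) (i d : ℕ) (tie : Bool) (b : ℕ) : Bool :=
  if E.patLcp P i d b = patLen P i d then tie
  else if E.patLcp P i d b = E.room d b then true
  else decide (E.fh d (adv d b (E.patLcp P i d b)) 1 < patChar P i d (E.patLcp P i d b))

/-- The number of items in the sorted array `A` below the part of the pattern. -/
def Env.patRank (E : Env) (P : List ℕ) (i d : ℕ) (tie : Bool) (A : ℕ → ℕ) : ℕ :=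
  bsAux (fun c => E.below P i d tie (E.pos (A (c - 1)))) E.N (E.K + 1) 0

theorem length_krPrefixHashes (p x : ℕ) (U : List ℕ) :
    (krPrefixHashes p x U).length = U.length + 1 := by simp [krPrefixHashes]

theorem getD_krPrefixHashes (p x : ℕ) (U : List ℕ) {j : ℕ} (hj : j ≤ U.length) :
    (krPrefixHashes p x U).getD j 0 = krHash p x (U.take j) := by
  rw [List.getD_eq_getElem _ _ (by rw [length_krPrefixHashes]; omega)]
  simp [krPrefixHashes]

/-- The pattern as read-only input. -/
structure PatIn (M : Machine) (P : List ℕ) (i p x : ℕ) : Prop where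
  i_le : i ≤ P.length
  in0 : ∃ h₁ h₂, M.input 0 = [P.length, i, h₁, h₂]
  in1 : M.input 1 = P
  in2 : M.input 2 = krPrefixHashes p x (P.take i)
  in3 : M.input 3 = krPrefixHashes p x (P.drop i)

section Programs

variable {E : Env} {M : Machine} {I J : ℕ} {s : State} {Q : State → Prop} {P : List ℕ} {i : ℕ}

/-- `register 39 :=` the hash of the `register 40` characters next to the split. -/
def patHashCmd : Cmd :=
  .ite (#r 106) (14 ≔ #r 40 ;; powCmd ;; 39 ≔ (.input 2 (#r 115) +
    (#r 100 - .input 2 (#r 115 - #r 40)) * #r 10) % #r 100) (39 ≔ .input 3 (#r 40))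

@[simp] theorem patHashCmd_top : patHashCmd.top = 40 := by simp [patHashCmd, Cmd.top]

@[simp] theorem patHashCmd_keeps (a : ℕ) : patHashCmd.keeps a = true := by
  simp [patHashCmd, Cmd.keeps]

/-- To the right of the split the hash is an input. To the left the characters form a suffix of
`P[1..i]`, whose hash comes from two prefix hashes and a power. -/
theorem patHashCmd_runs (hE : E.WF M I) (hs : E.At true M s) (hP : PatIn M P i E.p E.x)
    (hPn : P.length ≤ E.T.length) {d len : ℕ} (hd : s.reg 106 = d) (hd' : d ≤ 1) (hi : s.reg 115 = i) (hl : s.reg 40 = len)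
    (hlen : len ≤ patLen P i d) (hln : len ≤ E.T.length) :
    Runs M I J patHashCmd s fun s' => s'.reg 39 = E.patHash P i d len := by
  have hcap := hE.cap
  have h2 := hE.two_le_p
  have hil := hP.i_le
  have hnp := hE.n_le_p
  refine Runs.ite (by simp) ?_ ?_
  · intro h
    simp [hd] at h
    obtain rfl : d = 1 := by omega
    simp [patLen] at hlen
    refine Runs.set len (by simp [hl]) ?_
    have hs := hs.setReg (r := 14) (v := len) (by omega)
    refine Runs.seq (powCmd_runs (Q := fun s' => s'.reg 10 = E.x ^ len % E.p) hE hs len (by simp)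
      hln fun _ h => h) ?_
    intro s₁ r₁ f₁
    have g₁ : ∀ r, 15 ≤ r → s₁.reg r = s.reg r := fun r hr => by
      rw [f₁.reg r (by simp; omega), State.setReg_reg, if_neg (by omega)]
    have hlT : (P.take i).length = i := by simp [hil]
    have hk := krHash_sub (p := E.p) (x := E.x) (by omega) (T := P.take i)
      (show i - len ≤ i by omega) (by omega)
    have e₁ : i - (i - len) = len := by omega
    have e₂ : (P.take i).take i = P.take i := by simp
    rw [sub, e₁, e₂] at hk
    have v₁ := getD_krPrefixHashes E.p E.x (P.take i) (j := i) (by omega)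
    have v₂ := getD_krPrefixHashes E.p E.x (P.take i) (j := i - len) (by omega)
    have l₁ := length_krPrefixHashes E.p E.x (P.take i)
    rw [e₂] at v₁
    have b₁ := krHash_lt (p := E.p) (x := E.x) (by omega) (P.take i)
    have b₂ := krHash_lt (p := E.p) (x := E.x) (by omega) ((P.take i).take (i - len))
    have b₃ : E.x ^ len % E.p < E.p := Nat.mod_lt _ (by omega)
    have b₄ := Nat.mul_le_mul (show E.p - krHash E.p E.x ((P.take i).take (i - len)) ≤ E.p by omega)
      b₃.le
    refine Runs.assign (E.patHash P i 1 len) ⟨?_, ?_⟩ (by simp)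
    · simp only [Expr.add_def, Expr.mod_def, Expr.mul_def, Expr.sub_def, Expr.Ok, Expr.val,
        BinOp.Safe, BinOp.sem, hP.in2, l₁, hlT, g₁ 115 (by omega), g₁ 40 (by omega),
        g₁ 100 (by omega), hi, hl, v₁, v₂, r₁]
      have := hs.rp
      simp at this
      rw [this]
      refine ⟨⟨⟨trivial, by omega⟩, ⟨⟨trivial, ⟨⟨trivial, trivial, by omega, by omega⟩, by omega⟩,
        by omega, by omega⟩, trivial, by omega⟩, by omega⟩, trivial, trivial⟩
    · simp only [Expr.add_def, Expr.mod_def, Expr.mul_def, Expr.sub_def, Expr.val,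
        BinOp.sem, hP.in2, g₁ 115 (by omega), g₁ 40 (by omega),
        g₁ 100 (by omega), hi, hl, v₁, v₂, r₁]
      have := hs.rp
      simp at this
      rw [this, Env.patHash, if_neg (by omega), hk]
  · intro h
    simp [hd] at h
    subst h
    simp [patLen] at hlen
    have hlT : (P.drop i).length = P.length - i := by simp
    have v₁ := getD_krPrefixHashes E.p E.x (P.drop i) (j := len) (by omega)
    have l₁ := length_krPrefixHashes E.p E.x (P.drop i)
    refine Runs.assign (E.patHash P i 0 len) ⟨?_, ?_⟩ (by simp)
    · simp only [Expr.Ok, Expr.val, hP.in3, hl, l₁, hlT]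
      exact ⟨trivial, by omega⟩
    · simp only [Expr.val, hP.in3, hl, v₁, Env.patHash, if_true]

/-- `register 57 :=` the truth value of the comparison of the item at `register 58` with the part
of the pattern, of length `register 117`. -/
def patCmpCmd : Cmd :=
  54 ≔ roomE 58 ;; .ite (#r 54 <ᵉ #r 117) (53 ≔ #r 54) (53 ≔ #r 117) ;;
  bsCmd 50 (41 ≔ #r 58 ;; 42 ≔ #r 51 ;; fragCmd true ;; 45 ≔ #r 31 ;; 40 ≔ #r 51 ;; patHashCmd)
    (#r 45 =ᵉ #r 39) ;;
  .ite (#r 50 =ᵉ #r 117) (57 ≔ #r 118) (.ite (#r 50 =ᵉ #r 54) (57 ≔ 1)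
    (41 ≔ advE 58 50 ;; 42 ≔ 1 ;; fragCmd true ;;
      57 ≔ #r 31 <ᵉ .input 1 (#r 115 + #r 50 - #r 106 * (2 * #r 50 + 1))))

@[simp] theorem patCmpCmd_top : patCmpCmd.top = 58 := by simp [patCmpCmd, Cmd.top]

@[simp] theorem patCmpCmd_keeps (a : ℕ) : patCmpCmd.keeps a = true := by
  simp [patCmpCmd, Cmd.keeps]

theorem patCmpCmd_runs (hE : E.WF M I) (hs : E.At true M s) (hP : PatIn M P i E.p E.x)
    (hPn : P.length ≤ E.T.length) {d b : ℕ} {tie : Bool} (hd : s.reg 106 = d) (hd' : d ≤ 1)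
    (hi : s.reg 115 = i) (hL : s.reg 117 = patLen P i d)
    (ht : s.reg 118 = if tie = true then 1 else 0) (hb : s.reg 58 = b) (hb' : b ≤ E.T.length) :
    Runs M I J patCmpCmd s fun s' =>
      s'.reg 57 = if E.below P i d tie b = true then 1 else 0 := by
  have hcap := hE.cap
  have h2 := hE.two_le_p
  have hil := hP.i_le
  have hnp := hE.n_le_p
  have hroom := E.room_le (d := d) hb'
  have hLl : patLen P i d ≤ P.length := by unfold patLen; split_ifs <;> omega
  refine Runs.set _ (roomE_ev hE hs hd hd' hb hb') ?_
  have hs := hs.setReg (r := 54) (v := E.room d b) (by omega)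
  refine Runs.seq (Q' := fun s' => s'.reg 53 = min (E.room d b) (patLen P i d))
    (Runs.ite (by simp) ?_ ?_) ?_
  · intro h; simp [hL] at h
    exact Runs.assign (E.room d b) (by simp) (by simp; omega)
  · intro h; simp [hL] at h
    exact Runs.assign (patLen P i d) (by simp [hL]) (by simp; omega)
  intro s₁ r₁ f₁
  have hs₁ := hs.frame f₁ (by simp [Cmd.top]) (by simp [Cmd.keeps])
  have g : ∀ r, 54 ≤ r → s₁.reg r = (s.setReg 54 (E.room d b)).reg r :=
    fun r hr => f₁.reg r (by simpa [Cmd.top] using hr)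
  refine Runs.seq (bsCmd_runs (Q := fun s' => s'.reg 50 = E.patLcp P i d b) (E := E) hE hs₁.rK
    (by omega) (by simp [Cmd.top]) (by simp [Cmd.keeps]) _ r₁ (by omega) _ ?_ fun _ h => h) ?_
  · intro c _ hc s' hr hf hm
    have hs' := hs₁.congr (s' := s') (fun r h _ => hf r (by omega)) (fun a _ => by rw [hm])
    have k₁ : s'.reg 58 = b := by rw [hf _ (by omega), g _ (by omega)]; simp [hb]
    have k₂ : s'.reg 106 = d := by rw [hf _ (by omega), g _ (by omega)]; simp [hd]
    have k₃ : s'.reg 115 = i := by rw [hf _ (by omega), g _ (by omega)]; simp [hi]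
    refine Runs.set b (by simp [k₁]) (Runs.set c (by simp [hr]) ?_)
    have hs' := (hs'.setReg (r := 41) (v := b) (by omega)).setReg (r := 42) (v := c) (by omega)
    refine Runs.seq (fragCmd_at hE hs' d (by simp [k₂]) hd' (by simp [hb']) (by simp; omega)) ?_
    rintro s₂ ⟨r₂, hs₂, f₂, -⟩ -
    simp at r₂
    refine Runs.set (E.fh d b c) (by simp [r₂]) (Runs.set c (by simp [f₂, hr]) ?_)
    have hs₂ := (hs₂.setReg (r := 45) (v := E.fh d b c) (by omega)).setReg (r := 40) (v := c)
      (by omega)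
    refine (patHashCmd_runs hE hs₂ hP hPn (d := d) (len := c) (by simp [f₂, k₂]) hd' (by simp [f₂, k₃])
      (by simp) (by omega) (by omega)).mono ?_
    intro s₃ r₃ f₃
    have : s₃.reg 45 = E.fh d b c := by rw [f₃.reg _ (by simp)]; simp
    simp [r₃, this]
  intro s₂ r₂ f₂
  have f₂' : ∀ r, 53 ≤ r → s₂.reg r = s₁.reg r := fun r hr => f₂.reg r (by simpa [Cmd.top] using hr)
  have hs₂ := hs₁.congr (s' := s₂) (fun r h _ => f₂' r (by omega))
    (fun a _ => f₂.mem a (by simp [Cmd.keeps]))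
  have k₁ : s₂.reg 54 = E.room d b := by rw [f₂' _ (by omega), g _ (by omega)]; simp
  have k₂ : s₂.reg 117 = patLen P i d := by rw [f₂' _ (by omega), g _ (by omega)]; simp [hL]
  have k₃ : s₂.reg 58 = b := by rw [f₂' _ (by omega), g _ (by omega)]; simp [hb]
  have k₄ : s₂.reg 118 = if tie = true then 1 else 0 := by
    rw [f₂' _ (by omega), g _ (by omega)]; simp [ht]
  have k₅ : s₂.reg 106 = d := by rw [f₂' _ (by omega), g _ (by omega)]; simp [hd]
  have k₆ : s₂.reg 115 = i := by rw [f₂' _ (by omega), g _ (by omega)]; simp [hi]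
  have hle : E.patLcp P i d b ≤ min (E.room d b) (patLen P i d) := bsAux_le _ _ (Nat.zero_le _)
  refine Runs.ite (by simp) ?_ ?_
  · intro h; simp [r₂, k₂] at h
    exact Runs.assign _ ⟨by simp, rfl⟩ (by simp [k₄, Env.below, h])
  · intro h; simp [r₂, k₂] at h
    refine Runs.ite (by simp) ?_ ?_
    · intro h'; simp [r₂, k₁] at h'
      have hbel : E.below P i d tie b = true := by rw [Env.below, if_neg h, if_pos h']
      exact Runs.assign 1 (by simp; omega) (by simp [hbel])
    · intro h'; simp [r₂, k₁] at h'
      obtain ⟨a₁, a₂, -⟩ := E.adv_spec hd' hb' (show E.patLcp P i d b < E.room d b by omega)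
      refine Runs.set _ (advE_ev hE k₅ hd' k₃ hb' r₂ (by omega)) (Runs.set 1 (by simp; omega) ?_)
      have hs₂ := (hs₂.setReg (r := 41) (v := adv d b (E.patLcp P i d b)) (by omega)).setReg
        (r := 42) (v := 1) (by omega)
      refine Runs.seq (fragCmd_at hE hs₂ d (by simp [k₅]) hd' (by simp [a₁]) (by simp [a₂])) ?_
      rintro s₃ ⟨r₃, -, f₃, -⟩ -
      simp at r₃
      have e₁ : s₃.reg 50 = E.patLcp P i d b := by rw [f₃ _ (by omega)]; simp [r₂]
      have e₂ : s₃.reg 106 = d := by rw [f₃ _ (by omega)]; simp [k₅]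
      have e₃ : s₃.reg 115 = i := by rw [f₃ _ (by omega)]; simp [k₆]
      have hlt : E.patLcp P i d b < patLen P i d := by omega
      refine Runs.assign (if E.below P i d tie b = true then 1 else 0) ⟨?_, ?_⟩ (by simp)
      · have : d = 0 ∨ d = 1 := by omega
        rcases this with rfl | rfl <;> simp [patLen] at hlt <;>
          simp [e₁, e₂, e₃, hP.in1] <;> omega
      · rw [Env.below, if_neg h, if_neg h']
        simp only [decide_eq_true_eq, Expr.val, BinOp.sem, hP.in1,
          Expr.add_def, Expr.sub_def, Expr.mul_def, Expr.ofNat_def, e₁, e₂, e₃, r₃, patChar]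
        simp

/-- `register 60 :=` the number of items below the part of the pattern. -/
def patRankCmd : Cmd :=
  63 ≔ #r 105 ;; bsCmd 60
    (.ite (#r 106) (58 ≔ rd true 1 (rd true 5 (#r 61 - 1))) (58 ≔ rd true 1 (rd true 4 (#r 61 - 1))) ;;
      patCmpCmd) (#r 57)

@[simp] theorem patRankCmd_top : patRankCmd.top = 64 := by simp [patRankCmd, Cmd.top]

@[simp] theorem patRankCmd_keeps (a : ℕ) : patRankCmd.keeps a = true := by
  simp [patRankCmd, Cmd.keeps]

theorem patRankCmd_runs (hE : E.WF M I) (hs : E.At true M s) (hP : PatIn M P i E.p E.x)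
    (hPn : P.length ≤ E.T.length) {d : ℕ} {tie : Bool} {A : ℕ → ℕ} (hd : s.reg 106 = d)
    (hd' : d ≤ 1) (hi : s.reg 115 = i) (hL : s.reg 117 = patLen P i d)
    (ht : s.reg 118 = if tie = true then 1 else 0) (hA : Holds true M s (4 + d) E.N A)
    (hA' : ∀ r < E.N, A r < E.N) :
    Runs M I J patRankCmd s fun s' => s'.reg 60 = E.patRank P i d tie A := by
  have hcap := hE.cap
  have h2 := hE.two_le_p
  have hnp := hE.n_le_p
  have hN := hE.N_le
  refine Runs.set E.N (by simp [hs.rN]) ?_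
  have hs := hs.setReg (r := 63) (v := E.N) (by omega)
  refine bsCmd_runs (E := E) hE hs.rK (by omega) (by simp [Cmd.top]) (by simp [Cmd.keeps]) E.N
    (by simp) hN _ ?_ fun _ h => h
  intro c hc hc' s' hr hf hm
  have hs' := hs.congr (s' := s') (fun r h _ => hf r (by omega)) (fun a _ => by rw [hm])
  have k₁ : s'.reg 106 = d := by rw [hf _ (by omega)]; simp [hd]
  have k₂ : s'.reg 115 = i := by rw [hf _ (by omega)]; simp [hi]
  have k₃ : s'.reg 117 = patLen P i d := by rw [hf _ (by omega)]; simp [hL]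
  have k₄ : s'.reg 118 = if tie = true then 1 else 0 := by rw [hf _ (by omega)]; simp [ht]
  have hA := hA.congr (s' := s') (by rw [hm]; rfl)
  have hc₁ : c - 1 < E.N := by omega
  have p₁ := hs'.hpos.ok (hA' _ hc₁)
  have p₂ := hs'.hpos.val (hA' _ hc₁)
  have q₁ := hA.ok hc₁
  have q₂ := hA.val hc₁
  refine Runs.seq (Q' := fun s₁ => s₁ = s'.setReg 58 (E.pos (A (c - 1)))) (Runs.ite (by simp) ?_ ?_) ?_
  · intro h
    simp [k₁] at h
    obtain rfl : d = 1 := by omega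
    exact Runs.assign _ ⟨by simp [hr, q₁, q₂, p₁]; omega, by simp [hr, q₂, p₂]⟩ rfl
  · intro h
    simp [k₁] at h
    subst h
    exact Runs.assign _ ⟨by simp [hr, q₁, q₂, p₁]; omega, by simp [hr, q₂, p₂]⟩ rfl
  rintro _ rfl -
  refine (patCmpCmd_runs hE (hs'.setReg (by omega)) hP hPn (d := d) (tie := tie) (by simp [k₁]) hd'
    (by simp [k₂]) (by simp [k₃]) (by simp [k₄]) (b := E.pos (A (c - 1))) (by simp)
    (hE.pos_le _)).mono ?_
  intro s₁ h _
  simp [h]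

end Programs

end RLZ

namespace RLZ

/-! ## The query program -/

/-- The parameters of the index. -/
def Env.params (E : Env) (D β : ℕ) : List ℕ :=
  [E.p, E.x, E.T.length, 2 ^ E.K, E.N, D, β, 2 ^ β, 2 ^ (D - β), stride D β]

/-- The complete index as read-only input. -/
structure Index (E : Env) (M : Machine) (I D β : ℕ) (A : ℕ → ℕ → ℕ) (y v : ℕ → ℕ)
    (bit val : ℕ → ℕ → ℕ) : Prop where
  params : Holds true M State.init 0 10 fun k => (E.params D β).getD k 0
  hpos : Holds true M State.init 1 E.N E.pos
  hh : Holds true M State.init 2 E.N fun i => E.ph (E.pos i)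
  hsrc : Holds true M State.init 3 E.N E.src
  ranks : ∀ d ≤ 1, Holds true M State.init (4 + d) E.N (A d) ∧ ∀ r < E.N, A d r < E.N
  tree : Tree M I E.N D β y v bit val

/-- The pairs of ranks that a query asks for, made increasing. -/
def Env.patLo (E : Env) (P : List ℕ) (i d : ℕ) (A : ℕ → ℕ → ℕ) : ℕ :=
  min (E.patRank P i d false (A d)) (E.patRank P i d true (A d))

def Env.patHi (E : Env) (P : List ℕ) (i d : ℕ) (A : ℕ → ℕ → ℕ) : ℕ :=
  E.patRank P i d true (A d)

/-- The answer for the boundary item `w`. -/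
def Env.answer (E : Env) (i w : ℕ) : ℕ :=
  if w < E.N then if i < E.pos w + 1 then E.pos w + 1 - i else 0 else 0

theorem WReg.congr_of_ne {s s' : State} {N D β : ℕ} (h : WReg s N D β)
    (hr : ∀ r, 105 ≤ r → r ≤ 112 → r ≠ 106 → s'.reg r = s.reg r) : WReg s' N D β where
  rN := by rw [hr _ (by omega) (by omega) (by omega), h.rN]
  rD := by rw [hr _ (by omega) (by omega) (by omega), h.rD]
  rβ := by rw [hr _ (by omega) (by omega) (by omega), h.rβ]
  rB := by rw [hr _ (by omega) (by omega) (by omega), h.rB]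
  rS := by rw [hr _ (by omega) (by omega) (by omega), h.rS]
  rst := by rw [hr _ (by omega) (by omega) (by omega), h.rst]

theorem Holds.query {M : Machine} {s s' : State} {a n : ℕ} {f : ℕ → ℕ}
    (h : Holds true M s a n f) : Holds true M s' a n f := fun i hi => by
  have := h i hi
  simpa [rdVal, RdOk] using this

section Programs

variable {E : Env} {M : Machine} {I J D β : ℕ} {s : State} {Q : State → Prop} {P : List ℕ} {i : ℕ}
variable {A : ℕ → ℕ → ℕ} {y v : ℕ → ℕ} {bit val : ℕ → ℕ → ℕ}

/-- Loads the parameters of the index and the split point. -/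
def loadCmd : Cmd :=
  100 ≔ rd true 0 0 ;; 101 ≔ rd true 0 1 ;; 102 ≔ rd true 0 2 ;; 103 ≔ rd true 0 3 ;;
  105 ≔ rd true 0 4 ;; 107 ≔ rd true 0 5 ;; 109 ≔ rd true 0 6 ;; 110 ≔ rd true 0 7 ;;
  111 ≔ rd true 0 8 ;; 112 ≔ rd true 0 9 ;; 115 ≔ .input 0 1

theorem loadCmd_runs (hE : E.WF M I) (hX : Index E M I D β A y v bit val)
    (hP : PatIn M P i E.p E.x) :
    Runs M I J loadCmd s fun s' => E.At true M s' ∧ WReg s' E.N D β ∧ s'.reg 115 = i := by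
  have hcap := hE.cap
  obtain ⟨h₁, h₂, hin⟩ := hP.in0
  have key : ∀ (s : State) k, k < 10 →
      (rd true 0 (.const k)).Ev M s ((E.params D β).getD k 0) := fun s k hk => by
    have := hX.params.query (s' := s)
    exact ⟨by simp [this.ok hk]; omega, by simp [this.val hk]⟩
  refine Runs.set _ (key _ 0 (by omega)) (Runs.set _ (key _ 1 (by omega)) (Runs.set _
    (key _ 2 (by omega)) (Runs.set _ (key _ 3 (by omega)) (Runs.set _ (key _ 4 (by omega))
    (Runs.set _ (key _ 5 (by omega)) (Runs.set _ (key _ 6 (by omega)) (Runs.set _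
    (key _ 7 (by omega)) (Runs.set _ (key _ 8 (by omega)) (Runs.set _ (key _ 9 (by omega))
    (Runs.assign i (by simp [hin]; omega) ?_))))))))))
  refine ⟨⟨?_, ?_, ?_, ?_, ?_, hX.hpos.query, hX.hh.query, hX.hsrc.query⟩, ⟨?_, ?_, ?_, ?_, ?_, ?_⟩,
    ?_⟩ <;> simp [Env.params]

/-- The two ranks for the direction in register `106`, in the registers `o` and `o + 1`. -/
def patRanksCmd (o : ℕ) : Cmd :=
  118 ≔ 1 ;; patRankCmd ;; o + 1 ≔ #r 60 ;; 118 ≔ 0 ;; patRankCmd ;; minCmd o (#r 60) (#r (o + 1))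

/-- The minimum with the upper rank keeps the interval well formed even if collisions put the two
ranks in the wrong order. -/
theorem patRanksCmd_runs (hE : E.WF M I) (hs : E.At true M s)
    (hX : Index E M I D β A y v bit val) (hP : PatIn M P i E.p E.x)
    (hPn : P.length ≤ E.T.length) {d o : ℕ} (hd : s.reg 106 = d)
    (hd' : d ≤ 1) (hi : s.reg 115 = i) (hL : s.reg 117 = patLen P i d) (ho : 64 ≤ o) (ho' : o < 98) :
    Runs M I J (patRanksCmd o) s fun s' => s'.reg o = E.patLo P i d A ∧
      s'.reg (o + 1) = E.patHi P i d A ∧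
      ∀ r, 64 ≤ r → r ≠ o → r ≠ o + 1 → r ≠ 118 → s'.reg r = s.reg r := by
  have hcap := hE.cap
  obtain ⟨hA, hA'⟩ := hX.ranks d hd'
  refine Runs.set 1 (by simp; omega) ?_
  have hs := hs.congr (s' := s.setReg 118 1) (fun r h h' => by simp; omega) fun _ _ => rfl
  refine Runs.seq (patRankCmd_runs hE hs hP hPn (tie := true) (by simp [hd]) hd' (by simp [hi])
    (by simp [hL]) (by simp) hA.query hA') ?_
  intro s₁ r₁ f₁
  have g₁ : ∀ r, 64 ≤ r → s₁.reg r = (s.setReg 118 1).reg r := fun r hr =>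
    f₁.reg r (by simpa using hr)
  refine Runs.set (E.patHi P i d A) (by simp [r₁, Env.patHi]) (Runs.set 0 (by simp; omega) ?_)
  have hs₁ := (hs.frame f₁ (by simp) (by simp)).setReg (r := o + 1) (v := E.patHi P i d A) (by omega)
  have hs₁ := hs₁.congr (s' := (s₁.setReg (o + 1) (E.patHi P i d A)).setReg 118 0)
    (fun r h h' => by rw [State.setReg_reg, if_neg (by omega)]) fun _ _ => rfl
  have k : ∀ r, 64 ≤ r → r ≠ o + 1 → r ≠ 118 →
      ((s₁.setReg (o + 1) (E.patHi P i d A)).setReg 118 0).reg r = s.reg r := fun r h h' h'' => by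
    simp only [State.setReg_reg]
    rw [if_neg (by omega), if_neg (by omega), g₁ _ h, State.setReg_reg, if_neg (by omega)]
  refine Runs.seq (patRankCmd_runs hE hs₁ hP hPn (tie := false)
    (by rw [k _ (by omega) (by omega) (by omega), hd]) hd'
    (by rw [k _ (by omega) (by omega) (by omega), hi])
    (by rw [k _ (by omega) (by omega) (by omega), hL]) (by simp) hA.query hA') ?_
  intro s₂ r₂ f₂
  have g₂ : ∀ r, 64 ≤ r → s₂.reg r =
    ((s₁.setReg (o + 1) (E.patHi P i d A)).setReg 118 0).reg r := fun r hr =>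
    f₂.reg r (by simpa using hr)
  have e₁ : s₂.reg (o + 1) = E.patHi P i d A := by
    rw [g₂ _ (by omega), State.setReg_reg, if_neg (by omega), State.setReg_reg, if_pos rfl]
  refine (minCmd_runs (E.patRank P i d false (A d)) (E.patHi P i d A) (by simp [r₂]) (fun v => ?_)).mono ?_
  · simp [e₁]
  rintro s₃ ⟨r₃, k₃, -⟩ -
  refine ⟨by rw [r₃]; rfl, by rw [k₃ _ (by omega), e₁], fun r h h₁ h₂ h₃ => ?_⟩
  rw [k₃ _ (by omega), g₂ _ h, k _ h h₂ h₃]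

/-- The query program. -/
def query : Cmd :=
  loadCmd ;; .ite (#r 102 <ᵉ .input 0 0) (0 ≔ 0)
    (106 ≔ 0 ;; 117 ≔ .input 0 0 - #r 115 ;; patRanksCmd 70 ;;
      106 ≔ 1 ;; 117 ≔ #r 115 ;; patRanksCmd 72 ;;
      44 ≔ #r 70 ;; 45 ≔ #r 71 ;; 49 ≔ #r 72 ;; 50 ≔ #r 73 ;; rectMinCmd ;;
      .ite (#r 40 <ᵉ #r 105) (1 ≔ rd true 1 (#r 40) + 1 ;;
        .ite (#r 115 <ᵉ #r 1) (0 ≔ #r 1 - #r 115) (0 ≔ 0)) (0 ≔ 0))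

/-- The rectangle is the one that the hashes define, so this holds for every base. Patterns longer
than the text are rejected first, which bounds all later lengths by that of the text. -/
theorem query_runs (hE : E.WF M I) (hX : Index E M I D β A y v bit val)
    (hP : PatIn M P i E.p E.x) :
    Runs M I J query s fun s' => ∃ w, s'.reg 0 = (if E.T.length < P.length then 0 else E.answer i w) ∧
      IsMinOf E.N (Rect y v (E.patLo P i 1 A) (E.patHi P i 1 A) (E.patLo P i 0 A)
        (E.patHi P i 0 A)) w := by
  have hcap := hE.cap
  have hil := hP.i_le
  have hnp := hE.n_le_p
  obtain ⟨h₁, h₂, hin⟩ := hP.in0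
  have hlo : ∀ d, E.patLo P i d A ≤ E.patHi P i d A := fun d => min_le_right _ _
  have hhi : ∀ d, E.patHi P i d A ≤ E.N := fun d => bsAux_le _ _ (Nat.zero_le _)
  refine Runs.seq (loadCmd_runs hE hX hP) ?_
  rintro s₁ ⟨hs, hw, h115⟩ -
  refine Runs.ite (by simp [hin]; omega) ?_ ?_
  · intro h
    simp [hin, hs.rn] at h
    refine Runs.assign 0 (by simp; omega) ?_
    -- Nothing is computed in this branch, but the statement asks for some minimum.
    obtain ⟨w, hw⟩ : ∃ w, IsMinOf E.N (Rect y v (E.patLo P i 1 A) (E.patHi P i 1 A)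
        (E.patLo P i 0 A) (E.patHi P i 0 A)) w := by
      classical
      by_cases hex : ∃ w, w ≤ E.N ∧ Rect y v (E.patLo P i 1 A) (E.patHi P i 1 A)
        (E.patLo P i 0 A) (E.patHi P i 0 A) w
      · exact ⟨Nat.find hex, (Nat.find_spec hex).1, fun v hv => by
          by_cases hvN : v ≤ E.N
          · exact Nat.find_min' hex ⟨hvN, hv⟩
          · exact (Nat.find_spec hex).1.trans (by omega), Or.inr (Nat.find_spec hex).2⟩
      · refine ⟨E.N, le_rfl, fun v hv => ?_, Or.inl rfl⟩
        by_contra hc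
        exact hex ⟨v, by omega, hv⟩
    exact ⟨w, by simp [h], hw⟩
  · intro h
    simp [hin, hs.rn] at h
    refine Runs.set 0 (by simp; omega) (Runs.set (patLen P i 0) ?_ ?_)
    · simp [hin, h115, patLen]; omega
    have k : ∀ r, r ≠ 106 → r ≠ 117 →
        ((s₁.setReg 106 0).setReg 117 (patLen P i 0)).reg r = s₁.reg r := fun r h h' => by
      simp [h, h']
    have hs' := hs.congr (s' := (s₁.setReg 106 0).setReg 117 (patLen P i 0))
      (fun r h h' => k r (by omega) (by omega)) fun _ _ => rfl
    refine Runs.seq (patRanksCmd_runs hE hs' hX hP h (d := 0) (o := 70) (by simp) (by omega)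
      (by simp [h115]) (by simp) (by omega) (by omega)) ?_
    rintro s₂ ⟨e₁, e₂, g₂⟩ f₂
    have k₂ : ∀ r, 74 ≤ r → r ≠ 106 → r ≠ 117 → r ≠ 118 → s₂.reg r = s₁.reg r :=
      fun r h h₁ h₂ h₃ => by rw [g₂ r (by omega) (by omega) (by omega) h₃, k r h₁ h₂]
    refine Runs.set 1 (by simp; omega) (Runs.set i (by simp [k₂, h115]) ?_)
    have hs₂ := hs.congr (s' := (s₂.setReg 106 1).setReg 117 i) (fun r h h' => by
      simp only [State.setReg_reg]; rw [if_neg (by omega), if_neg (by omega),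
        k₂ r (by omega) (by omega) (by omega) (by omega)])
      fun a _ => f₂.mem a (by simp [patRanksCmd, Cmd.keeps])
    refine Runs.seq (patRanksCmd_runs hE hs₂ hX hP h (d := 1) (o := 72) (by simp) (by omega)
      (by simp [k₂, h115]) (by simp [patLen]) (by omega) (by omega)) ?_
    rintro s₃ ⟨e₃, e₄, g₃⟩ f₃
    have k₃ : ∀ r, 74 ≤ r → r ≠ 106 → r ≠ 117 → r ≠ 118 → s₃.reg r = s₁.reg r :=
      fun r h h₁ h₂ h₃ => by
        rw [g₃ r (by omega) (by omega) (by omega) h₃]; simp [h₁, h₂, k₂ r h h₁ h₂ h₃]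
    have e₅ : s₃.reg 70 = E.patLo P i 0 A := by rw [g₃ _ (by omega) (by omega) (by omega) (by omega)]; simp [e₁]
    have e₆ : s₃.reg 71 = E.patHi P i 0 A := by rw [g₃ _ (by omega) (by omega) (by omega) (by omega)]; simp [e₂]
    refine Runs.set (E.patLo P i 0 A) (by simp [e₅]) (Runs.set (E.patHi P i 0 A) (by simp [e₆])
      (Runs.set (E.patLo P i 1 A) (by simp [e₃]) (Runs.set (E.patHi P i 1 A) (by simp [e₄]) ?_)))
    have hw₃ := ((((hw.congr_of_ne (s' := s₃) fun r h h' h6 =>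
      k₃ r (by omega) h6 (by omega) (by omega)).setReg (r := 44)
        (v := E.patLo P i 0 A) (by omega)).setReg (r := 45)
        (v := E.patHi P i 0 A) (by omega)).setReg (r := 49)
        (v := E.patLo P i 1 A) (by omega)).setReg (r := 50)
        (v := E.patHi P i 1 A) (by omega)
    refine Runs.seq (rectMinCmd_runs hX.tree hw₃ (a₁ := E.patLo P i 1 A) (a₂ := E.patHi P i 1 A)
      (c₁ := E.patLo P i 0 A) (c₂ := E.patHi P i 0 A) (by simp) (by simp) (by simp) (by simp)
      (hlo 1) (hhi 1) (hlo 0) (hhi 0)) ?_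
    intro s₄ r₄ f₄
    have g₄ : ∀ r, 74 ≤ r → r ≠ 106 → r ≠ 117 → r ≠ 118 → s₄.reg r = s₁.reg r :=
      fun r h h₁ h₂ h₃ => by
        rw [f₄.reg r (by simp; omega)]; simp only [State.setReg_reg]
        rw [if_neg (by omega), if_neg (by omega), if_neg (by omega), if_neg (by omega), k₃ r h h₁ h₂ h₃]
    have q₁ : s₄.reg 105 = E.N := by rw [g₄ _ (by omega) (by omega) (by omega) (by omega), hs.rN]
    have q₂ : s₄.reg 115 = i := by rw [g₄ _ (by omega) (by omega) (by omega) (by omega), h115]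
    refine Runs.mono (Q' := fun s' => s'.reg 0 = E.answer i (s₄.reg 40)) ?_ fun s' h' _ =>
      ⟨s₄.reg 40, by rw [if_neg (by omega), h'], r₄⟩
    refine Runs.ite (by simp) ?_ ?_
    · intro hlt
      simp [q₁] at hlt
      have p₁ := (hX.hpos.query (s' := s₄)).ok hlt
      have p₂ := (hX.hpos.query (s' := s₄)).val hlt
      have p₃ := hE.pos_le (s₄.reg 40)
      refine Runs.set (E.pos (s₄.reg 40) + 1) (by simp [p₁, p₂]; omega) ?_
      refine Runs.ite (by simp) ?_ ?_
      · intro hi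
        simp [q₂] at hi
        refine Runs.assign (E.pos (s₄.reg 40) + 1 - i) (by simp [q₂]; omega) ?_
        simp [Env.answer, hlt]; omega
      · intro hi
        simp [q₂] at hi
        refine Runs.assign 0 (by simp; omega) ?_
        simp [Env.answer, hlt]; omega
    · intro hge
      simp [q₁] at hge
      refine Runs.assign 0 (by simp; omega) ?_
      simp [Env.answer, hge]

end Programs

end RLZ

namespace RLZ

/-! ## Reading the parse -/

/-- The reference and the parse as read-only input. -/
structure BuildIn (E : Env) (M : Machine) (z : ℕ) : Prop where
  N_eq : E.N = E.ℓ + z + 1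
  K_min : ∀ k < E.K, 2 ^ k < E.T.length + 1
  in0 : M.input 0 = [E.ℓ, z, E.p, E.x]
  ref : ∀ k < E.ℓ, k < (M.input 1).length ∧ (M.input 1).getD k 0 < E.p ∧
    E.ph (k + 1) = (E.ph k * E.x + (M.input 1).getD k 0) % E.p
  len : ∀ k < z, k < (M.input 2).length ∧
    E.pos (E.ℓ + k + 1) = E.pos (E.ℓ + k) + (M.input 2).getD k 0
  source : ∀ k < z, k < (M.input 3).length ∧ (M.input 3).getD k 0 = E.src (E.ℓ + k) + 1
  src_lt : ∀ q < E.ℓ, E.src q = q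
  src_last : E.src (E.ℓ + z) = 0

section Programs

variable {E : Env} {M : Machine} {I J z : ℕ} {s : State} {Q : State → Prop}

/-- `register r := 2 ^ k` and `register o := k` for the least `k` with `bound ≤ 2 ^ k` -/
def clogCmd (r o : ℕ) (bound : Expr) : Cmd :=
  r ≔ 1 ;; o ≔ 0 ;; .while (#r r <ᵉ bound) (r ≔ #r r * 2 ;; o ≔ #r o + 1)

@[simp] theorem clogCmd_keeps (r o a : ℕ) (e : Expr) : (clogCmd r o e).keeps a = true := by
  simp [clogCmd, Cmd.keeps]

theorem clogCmd_runs {r o b k : ℕ} {e : Expr} (hro : r ≠ o)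
    (he : ∀ s', (∀ r', r' ≠ r → r' ≠ o → s'.reg r' = s.reg r') → e.Ev M s' b)
    (hk : b ≤ 2 ^ k) (hmin : ∀ j < k, 2 ^ j < b) (hkI : k ≤ I) (hcap : 2 * b + 2 ≤ M.cap) :
    Runs M I J (clogCmd r o e) s fun s' => s'.reg r = 2 ^ k ∧ s'.reg o = k ∧
      (∀ r', r' ≠ r → r' ≠ o → s'.reg r' = s.reg r') ∧ s'.mem = s.mem := by
  refine Runs.set 1 (by simp; omega) (Runs.set 0 (by simp; omega) ?_)
  refine Runs.while k (le_iters hkI) (fun j s' => s'.reg r = 2 ^ j ∧ s'.reg o = j ∧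
      (∀ r', r' ≠ r → r' ≠ o → s'.reg r' = s.reg r') ∧ s'.mem = s.mem) ?_ ?_ ?_
  · exact ⟨by simp [hro], by simp, fun r' h h' => by simp [h, h'], rfl⟩
  · rintro j hj s' ⟨h₁, h₂, h₃, h₄⟩ -
    obtain ⟨ho, hv⟩ := he s' h₃
    have hlt := hmin j hj
    have hj2 : j < 2 ^ j := Nat.lt_two_pow_self
    refine ⟨by simp [ho], by simp [hv, h₁, hlt], ?_⟩
    refine Runs.set (2 ^ (j + 1)) (by simp [h₁, pow_succ]; omega) ?_
    refine Runs.assign (j + 1) (by simp [h₂, hro.symm]; omega) ?_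
    exact ⟨by simp [hro], by simp, fun r' h h' => by simp [h, h', h₃], by simp [h₄]⟩
  · rintro s' ⟨h₁, h₂, h₃, h₄⟩ -
    obtain ⟨ho, hv⟩ := he s' h₃
    exact ⟨by simp [ho], by simp [hv, h₁]; omega, h₁, h₂, h₃, h₄⟩

/-- Reads the parameters. -/
def initCmd : Cmd :=
  104 ≔ .input 0 0 ;; 119 ≔ .input 0 1 ;; 100 ≔ .input 0 2 ;; 101 ≔ .input 0 3 ;;
  105 ≔ #r 104 + #r 119 + 1 ;; 220 ≔ #r 105 ;; 221 ≔ #r 104 ;; 225 ≔ #r 119 ;;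
  60 ≔ #r 104 ;; forLoop 70 225 (60 ≔ #r 60 + .input 2 (#r 70)) ;; 102 ≔ #r 60 ;;
  clogCmd 103 108 (#r 102 + 1)

/-- The registers with the parameters. -/
structure BuildReg (E : Env) (z : ℕ) (s : State) : Prop where
  rp : s.reg 100 = E.p
  rx : s.reg 101 = E.x
  rn : s.reg 102 = E.T.length
  rK : s.reg 103 = 2 ^ E.K
  rℓ : s.reg 104 = E.ℓ
  rN : s.reg 105 = E.N
  bN : s.reg 220 = E.N
  bℓ : s.reg 221 = E.ℓ
  bz : s.reg 225 = z

theorem BuildReg.congr {s s' : State} (h : BuildReg E z s)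
    (hr : ∀ r, (100 ≤ r ∧ r ≤ 105 ∨ 220 ≤ r) → s'.reg r = s.reg r) : BuildReg E z s' where
  rp := by rw [hr _ (by omega), h.rp]
  rx := by rw [hr _ (by omega), h.rx]
  rn := by rw [hr _ (by omega), h.rn]
  rK := by rw [hr _ (by omega), h.rK]
  rℓ := by rw [hr _ (by omega), h.rℓ]
  rN := by rw [hr _ (by omega), h.rN]
  bN := by rw [hr _ (by omega), h.bN]
  bℓ := by rw [hr _ (by omega), h.bℓ]
  bz := by rw [hr _ (by omega), h.bz]

theorem initCmd_runs (hE : E.WF M I) (hB : BuildIn E M z) (hJ : E.N ≤ J) :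
    Runs M I J initCmd s fun s' => BuildReg E z s' ∧ s'.mem = s.mem := by
  have hcap := hE.cap
  have hKI := hE.K_lt
  have hN := hE.N_le
  have hNe := hB.N_eq
  have hnp := hE.n_le_p
  have hx := hE.x_lt
  refine Runs.set E.ℓ (by simp [hB.in0]; omega) (Runs.set z (by simp [hB.in0]; omega)
    (Runs.set E.p (by simp [hB.in0]; omega) (Runs.set E.x (by simp [hB.in0]; omega)
    (Runs.set E.N (by simp; omega) (Runs.set E.N (by simp) (Runs.set E.ℓ (by simp) (Runs.set z
    (by simp) (Runs.set E.ℓ (by simp) ?_))))))))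
  refine Runs.seq (Runs.for z (by simp) (by omega) (by simp [Cmd.top])
    (le_iters_big (by omega) (by omega)) (by omega) (by omega)
    (fun k s' => s'.reg 60 = E.pos (E.ℓ + k)) (by simp [hE.pos_of_le]) ?_ ?_
    (Q := fun s' => s'.reg 60 = E.T.length)) ?_
  · intro k hk s' hr hi _ _
    obtain ⟨h₁, h₂⟩ := hB.len k hk
    have := hE.pos_le (E.ℓ + k + 1)
    refine Runs.assign (E.pos (E.ℓ + k + 1)) ?_ (by simp [add_assoc])
    rw [h₂] at this ⊢
    simp only [Expr.add_def, Expr.Ev, Expr.Ok, Expr.val, BinOp.sem, BinOp.Safe, hr, hi]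
    exact ⟨⟨trivial, ⟨trivial, h₁⟩, by omega⟩, trivial⟩
  · intro s' hi _ _ _
    rw [hi, ← hE.pos_last, hNe]; rfl
  intro s₁ r₁ f₁
  refine Runs.set E.T.length (by simp [r₁]) ?_
  refine (clogCmd_runs (b := E.T.length + 1) (k := E.K) (by omega) (fun s' h => ?_) hE.n_lt hB.K_min
    (by omega) (by omega)).mono ?_
  · have := h 102 (by omega) (by omega)
    simp [this]; omega
  · rintro s₂ ⟨h₁, h₂, h₃, h₄⟩ -
    have g : ∀ r, 100 ≤ r → r ≠ 102 → r ≠ 103 → r ≠ 108 → s₂.reg r = _ := fun r h h' h'' h''' => by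
      rw [h₃ r h'' h''', State.setReg_reg, if_neg h', f₁.reg r (by simp [Cmd.top]; omega)]
    refine ⟨⟨?_, ?_, ?_, h₁, ?_, ?_, ?_, ?_, ?_⟩, ?_⟩
    · rw [g _ (by omega) (by omega) (by omega) (by omega)]; simp
    · rw [g _ (by omega) (by omega) (by omega) (by omega)]; simp
    · rw [h₃ _ (by omega) (by omega)]; simp
    · rw [g _ (by omega) (by omega) (by omega) (by omega)]; simp
    · rw [g _ (by omega) (by omega) (by omega) (by omega)]; simp
    · rw [g _ (by omega) (by omega) (by omega) (by omega)]; simp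
    · rw [g _ (by omega) (by omega) (by omega) (by omega)]; simp
    · rw [g _ (by omega) (by omega) (by omega) (by omega)]; simp
    · rw [h₄]; funext a; rw [State.setReg_mem, f₁.mem a (by simp [Cmd.keeps])]; rfl

/-- The first `m` items are complete, apart from their sources from `k` on, which are `0`. -/
structure ItemsTo (E : Env) (s : State) (m k : ℕ) : Prop where
  pos : ∀ i ≤ m, s.mem 1 i = E.pos i
  hash : ∀ i ≤ m, s.mem 2 i = E.ph (E.pos i)
  src : ∀ i < k, s.mem 3 i = E.src i
  zero : ∀ i, k ≤ i → s.mem 3 i = 0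

theorem ItemsTo.of_mem {s s' : State} {m k : ℕ} (h : ItemsTo E s m k)
    (hm : ∀ a ≤ 3, s'.mem a = s.mem a) : ItemsTo E s' m k := by
  refine ⟨?_, ?_, ?_, ?_⟩
  · rw [hm 1 (by omega)]; exact h.pos
  · rw [hm 2 (by omega)]; exact h.hash
  · rw [hm 3 (by omega)]; exact h.src
  · rw [hm 3 (by omega)]; exact h.zero

theorem ItemsTo.next {s s' : State} {m : ℕ} (h : ItemsTo E s m m)
    (h₁ : ∀ i, s'.mem 1 i = if i = m + 1 then E.pos (m + 1) else s.mem 1 i)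
    (h₂ : ∀ i, s'.mem 2 i = if i = m + 1 then E.ph (E.pos (m + 1)) else s.mem 2 i)
    (h₃ : ∀ i, s'.mem 3 i = if i = m then E.src m else s.mem 3 i) : ItemsTo E s' (m + 1) (m + 1) := by
  refine ⟨fun i hi => ?_, fun i hi => ?_, fun i hi => ?_, fun i hi => ?_⟩
  · rw [h₁]; split_ifs with e
    · rw [e]
    · exact h.pos i (by omega)
  · rw [h₂]; split_ifs with e
    · rw [e]
    · exact h.hash i (by omega)
  · rw [h₃]; split_ifs with e
    · rw [e]
    · exact h.src i (by omega)
  · rw [h₃, if_neg (by omega)]; exact h.zero i (by omega)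

/-- The items of the reference. -/
def refCmd : Cmd :=
  60 ≔ 0 ;; forLoop 70 221 (.store 3 (#r 70) (#r 70) ;;
    60 ≔ (#r 60 * #r 101 + .input 1 (#r 70)) % #r 100 ;; .store 1 (#r 70 + 1) (#r 70 + 1) ;;
    .store 2 (#r 70 + 1) (#r 60))

@[simp] theorem refCmd_top : refCmd.top = 71 := by simp [refCmd, Cmd.top]

theorem refCmd_keeps {a : ℕ} (h : a = 0 ∨ 3 < a) : refCmd.keeps a = true := by
  simp [refCmd, Cmd.keeps]; omega

/-- Item `0` and its hash are never written: both are `0`, the initial contents of the memory. -/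
theorem refCmd_runs (hE : E.WF M I) (hB : BuildIn E M z) (hJ : E.N ≤ J) (hs : BuildReg E z s)
    (h0 : ∀ a ≤ 3, ∀ i, s.mem a i = 0) (harr : 21 < M.arrays) (hcells : E.N < M.cells) :
    Runs M I J refCmd s fun s' => ItemsTo E s' E.ℓ E.ℓ ∧ s'.reg 60 = E.ph E.ℓ := by
  have hcap := hE.cap
  have hN := hE.N_le
  have hNe := hB.N_eq
  have hnp := hE.n_le_p
  have hx := hE.x_lt
  have e0 : E.ph 0 = 0 := rfl
  refine Runs.set 0 (by simp; omega) ?_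
  refine Runs.for E.ℓ (by simp [hs.bℓ]) (by omega) (by simp [Cmd.top])
    (le_iters_big (by omega) (by omega)) (by omega) (by omega)
    (fun k s' => ItemsTo E s' k k ∧ s'.reg 60 = E.ph k) ?_ ?_ fun s' h _ _ _ => h
  · refine ⟨⟨fun i hi => ?_, fun i hi => ?_, by simp, fun i _ => by simp [h0]⟩, by simp [e0]⟩
    · obtain rfl : i = 0 := by omega
      simp [h0, hE.pos_of_le]
    · obtain rfl : i = 0 := by omega
      simp [h0, hE.pos_of_le, e0]
  · rintro k hk s' hr ⟨hi, h60⟩ hf _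
    obtain ⟨b₁, b₂, b₃⟩ := hB.ref k hk
    have l₁ := Env.ph_lt hE k
    have l₂ := Nat.mul_le_mul l₁.le hx.le
    have r100 : s'.reg 100 = E.p := by rw [hf _ (by omega)]; simp [hs.rp]
    have r101 : s'.reg 101 = E.x := by rw [hf _ (by omega)]; simp [hs.rx]
    refine Runs.put k k (by simp [hr]) (by simp [hr]) (by omega) (by omega) ?_
    refine Runs.set (E.ph (k + 1)) ?_ ?_
    · rw [b₃]
      simp only [Expr.add_def, Expr.mul_def, Expr.mod_def, Expr.Ev, Expr.Ok, Expr.val, BinOp.sem,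
        BinOp.Safe, State.setMem_reg, hr, h60, r100, r101]
      exact ⟨⟨⟨⟨trivial, trivial, by omega⟩, ⟨trivial, b₁⟩, by omega⟩, trivial, trivial⟩, trivial⟩
    refine Runs.put (k + 1) (k + 1) (by simp [hr]; omega) (by simp [hr]; omega) (by omega)
      (by omega) ?_
    refine Runs.store (k + 1) (E.ph (k + 1)) (by simp [hr]; omega) (by simp) (by omega)
      (by omega) ?_
    refine ⟨hi.next (fun i => ?_) (fun i => ?_) fun i => ?_, by simp⟩
    · simp [hE.pos_of_le (k + 1) (by omega)]
    · simp [hE.pos_of_le (k + 1) (by omega)]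
    · simp [hB.src_lt k hk]

/-- The items of the parse. -/
def phrasesCmd : Cmd :=
  61 ≔ #r 104 ;; forLoop 70 225
    (62 ≔ .input 2 (#r 70) ;; 63 ≔ .input 3 (#r 70) - 1 ;; 14 ≔ #r 62 ;; powCmd ;;
      .store 3 (#r 104 + #r 70) (#r 63) ;;
      60 ≔ ((#r 60 + (#r 100 - .mem 2 (#r 63))) * #r 10 + .mem 2 (#r 63 + #r 62)) % #r 100 ;;
      61 ≔ #r 61 + #r 62 ;; .store 1 (#r 104 + #r 70 + 1) (#r 61) ;;
      .store 2 (#r 104 + #r 70 + 1) (#r 60))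

@[simp] theorem phrasesCmd_top : phrasesCmd.top = 71 := by simp [phrasesCmd, Cmd.top]

theorem phrasesCmd_keeps {a : ℕ} (h : a = 0 ∨ 3 < a) : phrasesCmd.keeps a = true := by
  simp [phrasesCmd, Cmd.keeps]; omega

/-- The source of a phrase lies in the reference, whose hashes are complete, so a phrase costs one
powering whatever its length. The last item has the source `0`, which is again the initial contents.
-/
theorem phrasesCmd_runs (hE : E.WF M I) (hB : BuildIn E M z) (hJ : E.N ≤ J) (hs : BuildReg E z s)
    (hi : ItemsTo E s E.ℓ E.ℓ) (h60 : s.reg 60 = E.ph E.ℓ) (harr : 21 < M.arrays)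
    (hcells : E.N < M.cells) :
    Runs M I J phrasesCmd s fun s' => E.At false M s' := by
  have hcap := hE.cap
  have hN := hE.N_le
  have hNe := hB.N_eq
  have hnp := hE.n_le_p
  have hx := hE.x_lt
  have h2 := hE.two_le_p
  refine Runs.set E.ℓ (by simp [hs.rℓ]) ?_
  refine Runs.for z (by simp [hs.bz]) (by omega) (by simp [Cmd.top])
    (le_iters_big (by omega) (by omega)) (by omega) (by omega)
    (fun k s' => ItemsTo E s' (E.ℓ + k) (E.ℓ + k) ∧ s'.reg 60 = E.ph (E.pos (E.ℓ + k)) ∧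
      s'.reg 61 = E.pos (E.ℓ + k)) ?_ ?_ ?_
  · refine ⟨hi.of_mem fun a _ => rfl, by simp [hE.pos_of_le, h60], by simp [hE.pos_of_le]⟩
  · rintro k hk s' hr ⟨hi, h60, h61⟩ hf _
    obtain ⟨b₁, b₂⟩ := hB.len k hk
    obtain ⟨b₃, b₄⟩ := hB.source k hk
    have hq := hE.pos_lt (E.ℓ + k) (E.ℓ + k + 1) (by omega) (by omega)
    have hq' := hE.pos_le (E.ℓ + k + 1)
    obtain ⟨c₁, c₂⟩ := hE.src_eq (E.ℓ + k) (E.pos (E.ℓ + k + 1)) (by omega) hq.le hq' fun _ => le_rfl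
    have hf' : ∀ r, 100 ≤ r → s'.reg r = s.reg r := fun r hr => by
      rw [hf _ (by omega), State.setReg_reg, if_neg (by omega)]
    rw [b₂] at c₁ c₂ hq hq'
    generalize hL : (M.input 2).getD k 0 = L at b₂ c₁ c₂ hq hq'
    generalize hS : E.src (E.ℓ + k) = S at b₄ c₁ c₂
    generalize hP : E.pos (E.ℓ + k) = A at *
    rw [Nat.add_sub_cancel_left] at c₁ c₂
    have hash := krHash_take_of_sub_eq (p := E.p) (x := E.x) (by omega) hq' rfl c₂
    change E.ph (A + L) = ((E.ph A + (E.p - E.ph S)) * (E.x ^ L % E.p) + E.ph (S + L)) % E.p at hash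
    have v₁ : s'.mem 2 S = E.ph S := by
      rw [hi.hash S (by omega), hE.pos_of_le S (by omega)]
    have v₂ : s'.mem 2 (S + L) = E.ph (S + L) := by
      rw [hi.hash (S + L) (by omega), hE.pos_of_le (S + L) (by omega)]
    refine Runs.set L ?_ (Runs.set S ?_ (Runs.set L (by simp) ?_))
    · simp only [Expr.Ev, Expr.Ok, Expr.val, hr]
      exact ⟨⟨trivial, b₁⟩, hL⟩
    · simp only [Expr.Ev, Expr.Ok, Expr.val, hr, Expr.sub_def, BinOp.sem, BinOp.Safe,
        State.setReg_reg, if_neg (show ¬ 70 = 62 by omega), Expr.ofNat_def, b₄]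
      exact ⟨⟨⟨trivial, b₃⟩, by omega, by omega, by omega⟩, by omega⟩
    refine Runs.seq (powCmd_runs_of_reg (E := E) (Q := fun s' => s'.reg 10 = E.x ^ L % E.p) hE
      (by simp [hf', hs.rp]) (by simp [hf', hs.rx]) (by simp [hf', hs.rK]) L (by simp) (by omega)
      fun _ h => h) ?_
    intro s₁ r₁ f₁
    have g : ∀ r, 15 ≤ r → s₁.reg r = (((s'.setReg 62 L).setReg 63 S).setReg 14 L).reg r :=
      fun r hr => f₁.reg r (by simp; omega)
    have m : ∀ a, s₁.mem a = s'.mem a := fun a => f₁.mem a (by simp)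
    have l₁ := Env.ph_lt hE A
    have l₂ := Env.ph_lt hE S
    have l₃ := Env.ph_lt hE (S + L)
    have l₄ : E.x ^ L % E.p < E.p := Nat.mod_lt _ (by omega)
    have l₅ := Nat.mul_le_mul (show E.ph A + (E.p - E.ph S) ≤ 2 * E.p by omega) l₄.le
    rw [Nat.mul_assoc] at l₅
    have hSk : ¬ (S = E.ℓ + k + 1) := by omega
    refine Runs.put (E.ℓ + k) S (by simp [g, hf', hs.rℓ, hr]; omega) (by simp [g]) (by omega)
      (by omega) ?_
    refine Runs.set (E.ph (A + L)) ?_ (Runs.set (A + L) (by simp [g, h61]; omega) ?_)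
    · rw [hash]
      simp [g, r₁, h60, hf', hs.rp, m, v₁, v₂]
      omega
    refine Runs.put (E.ℓ + k + 1) (A + L) (by simp [g, hf', hs.rℓ, hr]; omega) (by simp) (by omega)
      (by omega) ?_
    refine Runs.store (E.ℓ + k + 1) (E.ph (A + L)) (by simp [g, hf', hs.rℓ, hr]; omega) (by simp)
      (by omega) (by omega) ?_
    refine ⟨hi.next (fun i => ?_) (fun i => ?_) fun i => ?_, ?_, ?_⟩
    · simp [m, b₂]
    · simp [m, b₂]
    · simp [m, hS]
    · simp [← add_assoc, b₂]
    · simp [← add_assoc, b₂]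
  · rintro s' ⟨hi, -, -⟩ hr hf _
    have hf' : ∀ r, 100 ≤ r → s'.reg r = s.reg r := fun r hr => by
      rw [hf _ (by omega), State.setReg_reg, if_neg (by omega)]
    refine ⟨by rw [hf' _ (by omega), hs.rp], by rw [hf' _ (by omega), hs.rx],
      by rw [hf' _ (by omega), hs.rn], by rw [hf' _ (by omega), hs.rK],
      by rw [hf' _ (by omega), hs.rN], fun i h => ⟨?_, ?_⟩, fun i h => ⟨?_, ?_⟩,
      fun i h => ⟨?_, ?_⟩⟩
    · simp [RdOk]; omega
    · simpa [rdVal] using hi.pos i (by omega)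
    · simp [RdOk]; omega
    · simpa [rdVal] using hi.hash i (by omega)
    · simp [RdOk]; omega
    · simp only [rdVal, Bool.false_eq_true, if_false]
      by_cases h' : i < E.ℓ + z
      · exact hi.src i h'
      · obtain rfl : i = E.ℓ + z := by omega
        rw [hi.zero _ le_rfl, hB.src_last]

end Programs

end RLZ

namespace RLZ

/-! ## The construction -/

/-- The sorted arrays of the items, the ranks, the longest previous factors, and the values. -/
structure Tables (E : Env) (A : ℕ → ℕ → ℕ) (rk lpf fl : ℕ → ℕ) : Prop where
  perm : ∀ d ≤ 1, (cells (A d) E.N).Perm (List.range E.N)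
  sorted : ∀ d ≤ 1, (∀ a b c, E.itemLe d a b = true → E.itemLe d b c = true →
    E.itemLe d a c = true) → (∀ a b, (E.itemLe d a b || E.itemLe d b a) = true) →
    (cells (A d) E.N).Pairwise fun a b => E.itemLe d a b = true
  rank : PermOn E.N (A 0) rk
  isLpf : ∀ q < E.N, E.IsLpf rk q (lpf q)
  val : ∀ q < E.N, fl q ≤ E.N ∧ (fl q = q ∨ fl q = E.N) ∧
    (fl q = q ↔ E.ℓ < q ∨ ∃ j, 1 ≤ j ∧ j ≤ E.ℓ ∧ (E.step lpf)^[j] 0 = q)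

section Programs

variable {E : Env} {M : Machine} {I J z : ℕ} {s : State} {Q : State → Prop}

/-- Sorts the items and computes the points of the wavelet tree. -/
def tablesCmd : Cmd :=
  106 ≔ 0 ;; sortCmd 4 ;; rankCmd ;; linkCmd ;; lpfCmd ;; flagCmd ;; 106 ≔ 1 ;; sortCmd 5 ;;
  fillLoop 70 220 17 (.mem 12 (.mem 5 (#r 70))) ;; fillLoop 70 220 18 (.mem 16 (.mem 5 (#r 70))) ;;
  fillLoop 70 220 6 (.mem 16 (.mem 4 (#r 70)))

theorem tablesCmd_keeps {a : ℕ} (h : a < 4 ∨ 18 < a) : tablesCmd.keeps a = true := by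
  simp [tablesCmd, Cmd.keeps]
  rw [linkCmd_keeps (by omega) (by omega), lpfCmd_keeps (by omega), flagCmd_keeps (by omega)]
  simp; omega

/-- Arrays `17` and `18` list second coordinates and values in the order of the first coordinate.
Array `6` lists the values by second coordinate, as needed at the bottom of the wavelet tree. -/
theorem tablesCmd_runs (hE : E.WF M I) (hJ : E.N ≤ J) (hs : E.At false M s)
    (hb : BuildReg E z s) (harr : 21 < M.arrays) (hcells : E.N < M.cells) :
    Runs M I J tablesCmd s fun s' =>
      (∃ rk lpf fl, Tables E (fun d => s'.mem (4 + d)) rk lpf fl ∧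
        ∀ x < E.N, s'.mem 17 x = rk (s'.mem 5 x) ∧ s'.mem 18 x = fl (s'.mem 5 x) ∧
          s'.mem 6 x = fl (s'.mem 4 x)) ∧
      ∀ r, 100 ≤ r → r ≠ 106 → s'.reg r = s.reg r := by
  have hcap := hE.cap
  have hN := hE.N_le
  have hnp := hE.n_le_p
  refine Runs.set 0 (by simp; omega) ?_
  have hs₀ := hs.congr (s' := s.setReg 106 0) (fun r h h' => by simp; omega) fun _ _ => rfl
  refine Runs.seq (sortCmd_runs hE hs₀ 4 0 (by omega) (by omega) (by simp) (by omega)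
    (by simp [hb.bN]) hJ (by omega) (by omega) (by omega)) ?_
  rintro s₁ ⟨p₀, q₀⟩ f₁
  obtain ⟨rk, hrk⟩ := exists_rank p₀
  have g₁ : ∀ r, 100 ≤ r → s₁.reg r = (s.setReg 106 0).reg r := fun r hr =>
    f₁.reg r (by simp; omega)
  have hs₁ := hs₀.congr (s' := s₁) (fun r h h' => g₁ r (by omega)) fun a ha =>
    f₁.mem a (by simp; omega)
  refine Runs.seq (rankCmd_runs hE (by rw [g₁ _ (by omega)]; simp [hb.bN]) hJ harr hcells hrk) ?_
  intro s₂ h₂ f₂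
  have g₂ : ∀ r, 100 ≤ r → s₂.reg r = (s.setReg 106 0).reg r := fun r hr => by
    rw [f₂.reg r (by simp; omega), g₁ r hr]
  have hs₂ := hs₁.congr (s' := s₂) (fun r h h' => f₂.reg r (by simp; omega)) fun a ha =>
    f₂.mem a (by simp; omega)
  have e₂ : s₂.mem 4 = s₁.mem 4 := f₂.mem 4 (by simp)
  refine Runs.seq (linkCmd_runs hE hs₂ (by rw [g₂ _ (by omega)]; simp [hb.bN]) hJ harr hcells
    (rk := rk) (by rw [e₂]; exact hrk)) ?_
  intro s₃ h₃ f₃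
  have g₃ : ∀ r, 100 ≤ r → s₃.reg r = (s.setReg 106 0).reg r := fun r hr => by
    rw [f₃.reg r (by simp; omega), g₂ r hr]
  have m₃ : ∀ a, a ≠ 13 → a ≠ 14 → s₃.mem a = s₂.mem a := fun a h h' =>
    f₃.mem a (linkCmd_keeps h h')
  have hs₃ := hs₂.congr (s' := s₃) (fun r h h' => f₃.reg r (by simp; omega)) fun a ha =>
    m₃ a (by omega) (by omega)
  refine Runs.seq (lpfCmd_runs hE hs₃ (by rw [g₃ _ (by omega)]; simp [hb.bN]) hJ
    (by rw [g₃ _ (by omega)]; simp) harr hcells hrk h₃) ?_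
  intro s₄ h₄ f₄
  have g₄ : ∀ r, 100 ≤ r → s₄.reg r = (s.setReg 106 0).reg r := fun r hr => by
    rw [f₄.reg r (by simp; omega), g₃ r hr]
  have m₄ : ∀ a, a < 13 → s₄.mem a = s₂.mem a := fun a h => by
    rw [f₄.mem a (lpfCmd_keeps (by omega)), m₃ a (by omega) (by omega)]
  have hs₄ := hs₂.congr (s' := s₄) (fun r h h' => by rw [g₄ _ h, g₂ _ h]) fun a ha =>
    m₄ a (by omega)
  have hlpf : ∀ q < E.N, s₄.mem 15 q ≤ E.T.length := fun q hq => by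
    obtain ⟨a, b, -, -, e⟩ := h₄ q hq
    rw [e]
    exact max_le (E.near_le hE.pos_le _ _) (E.near_le hE.pos_le _ _)
  refine Runs.seq (flagCmd_runs hE hs₄ (by rw [g₄ _ (by omega)]; simp [hb.bN])
    (by rw [g₄ _ (by omega)]; simp [hb.bℓ]) (by rw [g₄ _ (by omega)]; simp [hb.rℓ]) hJ harr hcells
    hlpf) ?_
  intro s₅ h₅ f₅
  have g₅ : ∀ r, 100 ≤ r → s₅.reg r = (s.setReg 106 0).reg r := fun r hr => by
    rw [f₅.reg r (by simp; omega), g₄ r hr]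
  have m₅ : ∀ a, a < 13 → s₅.mem a = s₂.mem a := fun a h => by
    rw [f₅.mem a (flagCmd_keeps (by omega)), m₄ a h]
  have hs₅ := hs₂.congr (s' := s₅.setReg 106 1) (fun r h h' => by
    rw [State.setReg_reg, if_neg (by omega), g₅ _ h, g₂ _ h]) fun a ha => m₅ a (by omega)
  refine Runs.set 1 (by simp; omega) ?_
  refine Runs.seq (sortCmd_runs hE hs₅ 5 1 (by omega) (by omega) (by simp) (by omega)
    (by simp [g₅, hb.bN]) hJ (by omega) (by omega) (by omega)) ?_
  rintro s₆ ⟨p₁, q₁⟩ f₆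
  have g₆ : ∀ r, 100 ≤ r → r ≠ 106 → s₆.reg r = s.reg r := fun r hr h => by
    rw [f₆.reg r (by simp; omega), State.setReg_reg, if_neg h, g₅ r hr, State.setReg_reg, if_neg h]
  have m₆ : ∀ a, a ≠ 5 → a ≠ 10 → a ≠ 11 → s₆.mem a = s₅.mem a := fun a h h' h'' =>
    f₆.mem a (by simp; omega)
  have e12 : ∀ q < E.N, s₆.mem 12 q = rk q := fun q hq => by
    rw [m₆ _ (by omega) (by omega) (by omega), m₅ _ (by omega), h₂ q hq]
  have e4 : s₆.mem 4 = s₁.mem 4 := by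
    rw [m₆ _ (by omega) (by omega) (by omega), m₅ _ (by omega), e₂]
  obtain ⟨rk₁, hrk₁⟩ := exists_rank p₁
  have lit : ∀ r, E.N ≤ iters I J (#r r <ᵉ #r 220) := fun r => le_iters_big hJ (by omega)
  have hT : Tables E (fun d => s₆.mem (4 + d)) rk (s₄.mem 15) (s₆.mem 16) := by
    refine ⟨fun d hd => ?_, fun d hd => ?_, ?_, h₄, fun q hq => ?_⟩
    · have : d = 0 ∨ d = 1 := by omega
      rcases this with rfl | rfl
      · simpa [e4] using p₀
      · exact p₁
    · have : d = 0 ∨ d = 1 := by omega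
      rcases this with rfl | rfl
      · simpa [e4] using q₀
      · exact q₁
    · simpa [e4] using hrk
    · rw [m₆ _ (by omega) (by omega) (by omega)]; exact h₅ q hq
  refine Runs.seq (fillLoop_runs E.N (fun x => rk (s₆.mem 5 x)) (by rw [g₆ _ (by omega) (by omega), hb.bN])
    (by omega) (lit _) (by omega) (by omega) (by omega) (by omega) fun x hx s' hr hf hm => ?_) ?_
  · have hl := hrk₁.lt x hx
    simp [hr, hm, e12 _ hl]; omega
  intro s₇ h₇ f₇
  have m₇ : ∀ a, a ≠ 17 → s₇.mem a = s₆.mem a := fun a h => f₇.mem a (by simp; omega)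
  have g₇ : ∀ r, 100 ≤ r → r ≠ 106 → s₇.reg r = s.reg r := fun r hr h => by
    rw [f₇.reg r (by simp; omega), g₆ r hr h]
  refine Runs.seq (fillLoop_runs E.N (fun x => s₆.mem 16 (s₆.mem 5 x))
    (by rw [g₇ _ (by omega) (by omega), hb.bN])
    (by omega) (lit _) (by omega) (by omega) (by omega) (by omega) fun x hx s' hr hf hm => ?_) ?_
  · have hl := hrk₁.lt x hx
    simp [hr, hm, m₇]; omega
  intro s₈ h₈ f₈
  have m₈ : ∀ a, a ≠ 17 → a ≠ 18 → s₈.mem a = s₆.mem a := fun a h h' => by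
    rw [f₈.mem a (by simp; omega), m₇ a h]
  have g₈ : ∀ r, 100 ≤ r → r ≠ 106 → s₈.reg r = s.reg r := fun r hr h => by
    rw [f₈.reg r (by simp; omega), g₇ r hr h]
  refine (fillLoop_runs E.N (fun x => s₆.mem 16 (s₆.mem 4 x))
    (by rw [g₈ _ (by omega) (by omega), hb.bN])
    (by omega) (lit _) (by omega) (by omega) (by omega) (by omega) fun x hx s' hr hf hm => ?_).mono ?_
  · have hl := hrk.lt x hx
    rw [← e4] at hl
    simp [hr, hm, m₈]; omega
  intro s₉ h₉ f₉
  have m₉ : ∀ a, a ≠ 6 → s₉.mem a = s₈.mem a := fun a h => f₉.mem a (by simp; omega)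
  refine ⟨⟨rk, s₄.mem 15, s₆.mem 16, ?_, fun x hx => ⟨?_, ?_, ?_⟩⟩, fun r hr h => ?_⟩
  · have : ∀ d ≤ 1, s₉.mem (4 + d) = s₆.mem (4 + d) := fun d hd => by
      rw [m₉ _ (by omega), m₈ _ (by omega) (by omega)]
    refine ⟨fun d hd => ?_, fun d hd => ?_, ?_, hT.isLpf, hT.val⟩
    · simp only [this d hd]; exact hT.perm d hd
    · simp only [this d hd]; exact hT.sorted d hd
    · simp only [this 0 (by omega)]; exact hT.rank
  · rw [m₉ 17 (by omega), m₉ 5 (by omega), m₈ 5 (by omega) (by omega), f₈.mem 17 (by simp), h₇ x hx]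
  · rw [m₉ 18 (by omega), m₉ 5 (by omega), m₈ 5 (by omega) (by omega), h₈ x hx]
  · rw [h₉ x hx, m₉ 4 (by omega), m₈ 4 (by omega) (by omega)]
  · rw [f₉.reg r (by simp; omega), g₈ r hr h]

/-- The sizes of the wavelet tree. -/
def sizesCmd : Cmd :=
  clogCmd 60 107 (#r 105) ;; 222 ≔ #r 60 ;; clogCmd 110 109 (#r 107 + 1) ;;
  111 ≔ 1 <<ᵉ (#r 107 - #r 109) ;; 112 ≔ 2 * #r 111 + 1 ;; 223 ≔ #r 111 + 1 ;; 224 ≔ #r 111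

@[simp] theorem sizesCmd_keeps (a : ℕ) : sizesCmd.keeps a = true := by simp [sizesCmd, Cmd.keeps]

theorem sizesCmd_runs {N D β : ℕ} (hW : WSize M I J N D β) (hN : s.reg 105 = N)
    (hN' : s.reg 220 = N) (hD : ∀ k < D, 2 ^ k < N) (hβ : ∀ k < β, 2 ^ k < D + 1) :
    Runs M I J sizesCmd s fun s' => WReg s' N D β ∧ BigReg s' N D β ∧
      ∀ r, 100 ≤ r → r < 107 → s'.reg r = s.reg r := by
  have hcap := hW.cap
  have hNl := hW.N_le
  have hDI := hW.D_le
  have hβD := hW.β_le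
  have hS := hW.S_le
  have hD2 : D < 2 ^ D := Nat.lt_two_pow_self
  refine Runs.seq (clogCmd_runs (b := N) (k := D) (by omega) (fun s' h => ?_) hNl hD (by omega)
    (by omega)) ?_
  · have := h 105 (by omega) (by omega)
    simp [this, hN]
  rintro s₁ ⟨r₁, r₂, g₁, -⟩ -
  refine Runs.set (2 ^ D) (by simp [r₁]) ?_
  refine Runs.seq (clogCmd_runs (b := D + 1) (k := β) (by omega) (fun s' h => ?_) hW.D_lt hβ
    (by omega) (by omega)) ?_
  · have := h 107 (by omega) (by omega)
    simp [this, r₂]; omega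
  rintro s₂ ⟨k₁, k₂, g₂, -⟩ -
  have e107 : s₂.reg 107 = D := by rw [g₂ _ (by omega) (by omega)]; simp [r₂]
  have g : ∀ r, r ≠ 60 → r ≠ 107 → r ≠ 109 → r ≠ 110 → r ≠ 222 → s₂.reg r = s.reg r :=
    fun r h h' h'' h''' h4 => by
      rw [g₂ r h''' h'', State.setReg_reg, if_neg h4, g₁ r h h']
  refine Runs.set (2 ^ (D - β)) (by simp [e107, k₂]; omega) (Runs.set (stride D β)
    (by simp [stride]; omega) (Runs.set (2 ^ (D - β) + 1) (by simp; omega)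
    (Runs.assign (2 ^ (D - β)) (by simp) ?_)))
  refine ⟨⟨?_, ?_, ?_, ?_, ?_, ?_⟩, ⟨?_, ?_, ?_, ?_⟩, fun r h h' => ?_⟩
  · simp [g, hN]
  · simp [e107]
  · simp [k₂]
  · simp [k₁]
  · simp
  · simp
  · simp [g, hN']
  · simp only [State.setReg_reg]; norm_num; rw [g₂ _ (by omega) (by omega)]; simp
  · simp
  · simp
  · simp only [State.setReg_reg]
    rw [if_neg (by omega), if_neg (by omega), if_neg (by omega), if_neg (by omega),
      g r (by omega) (by omega) (by omega) (by omega) (by omega)]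

/-- Stores the parameters. -/
def paramsCmd : Cmd :=
  .store 0 0 (#r 100) ;; .store 0 1 (#r 101) ;; .store 0 2 (#r 102) ;; .store 0 3 (#r 103) ;;
  .store 0 4 (#r 105) ;; .store 0 5 (#r 107) ;; .store 0 6 (#r 109) ;; .store 0 7 (#r 110) ;;
  .store 0 8 (#r 111) ;; .store 0 9 (#r 112)

theorem paramsCmd_keeps {a : ℕ} (h : a ≠ 0) : paramsCmd.keeps a = true := by
  simp [paramsCmd, Cmd.keeps, h.symm]

theorem paramsCmd_runs {D β : ℕ} (hs : E.At false M s) (hw : WReg s E.N D β)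
    (hcap : 10 < M.cap) (harr : 0 < M.arrays) (hcells : 10 ≤ M.cells) :
    Runs M I J paramsCmd s fun s' => ∀ k < 10, s'.mem 0 k = (E.params D β).getD k 0 := by
  refine Runs.put 0 E.p (by simp; omega) (by simp [hs.rp]) harr (by omega) ?_
  refine Runs.put 1 E.x (by simp; omega) (by simp [hs.rx]) harr (by omega) ?_
  refine Runs.put 2 E.T.length (by simp; omega) (by simp [hs.rn]) harr (by omega) ?_
  refine Runs.put 3 (2 ^ E.K) (by simp; omega) (by simp [hs.rK]) harr (by omega) ?_
  refine Runs.put 4 E.N (by simp; omega) (by simp [hs.rN]) harr (by omega) ?_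
  refine Runs.put 5 D (by simp; omega) (by simp [hw.rD]) harr (by omega) ?_
  refine Runs.put 6 β (by simp; omega) (by simp [hw.rβ]) harr (by omega) ?_
  refine Runs.put 7 (2 ^ β) (by simp; omega) (by simp [hw.rB]) harr (by omega) ?_
  refine Runs.put 8 (2 ^ (D - β)) (by simp; omega) (by simp [hw.rS]) harr (by omega) ?_
  refine Runs.store 9 (stride D β) (by simp; omega) (by simp [hw.rst]) harr (by omega) ?_
  intro k hk
  interval_cases k <;> simp [Env.params]

/-- The construction program. -/
def build : Cmd :=
  initCmd ;; refCmd ;; phrasesCmd ;; tablesCmd ;; sizesCmd ;; levelsCmd ;; paramsCmd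

/-- The contents of the memory after the construction. -/
structure Done (E : Env) (M : Machine) (s : State) (D β : ℕ) (rk lpf fl : ℕ → ℕ)
    (bit val : ℕ → ℕ → ℕ) : Prop where
  params : ∀ k < 10, s.mem 0 k = (E.params D β).getD k 0
  hpos : ∀ i < E.N, s.mem 1 i = E.pos i
  hh : ∀ i < E.N, s.mem 2 i = E.ph (E.pos i)
  hsrc : ∀ i < E.N, s.mem 3 i = E.src i
  tables : Tables E (fun d => s.mem (4 + d)) rk lpf fl
  point : ∀ i < E.N, s.mem 6 i = fl (s.mem 4 i)
  row : ∀ k ≤ D, Row false M s E.N D β k (bit k) (val k) ∧ ∀ x < E.N,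
    bit k (posn (fun x => rk (s.mem 5 x)) k x) = 2 * rk (s.mem 5 x) / 2 ^ k % 2 ∧
      val k (posn (fun x => rk (s.mem 5 x)) k x) = fl (s.mem 5 x)

theorem build_runs {D β : ℕ} (hE : E.WF M I) (hB : BuildIn E M z) (hW : WSize M I J E.N D β)
    (hD : ∀ k < D, 2 ^ k < E.N) (hβ : ∀ k < β, 2 ^ k < D + 1) (h0 : ∀ a i, s.mem a i = 0)
    (hcells : E.N + 10 < M.cells) :
    Runs M I J build s fun s' => ∃ rk lpf fl bit val, Done E M s' D β rk lpf fl bit val := by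
  have hJ : E.N ≤ J := by have := hW.N_le; have := hW.J_le; omega
  have harr := hW.arrays
  have hcap := hE.cap
  have h2 := hE.two_le_p
  refine Runs.seq (initCmd_runs hE hB hJ) ?_
  rintro s₁ ⟨b₁, m₁⟩ -
  refine Runs.seq (refCmd_runs hE hB hJ b₁ (fun a _ i => by rw [m₁, h0]) harr (by omega)) ?_
  rintro s₂ ⟨i₂, h₂⟩ f₂
  have b₂ := b₁.congr (s' := s₂) fun r hr => f₂.reg r (by simp; omega)
  refine Runs.seq (phrasesCmd_runs hE hB hJ b₂ i₂ h₂ harr (by omega)) ?_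
  intro s₃ a₃ f₃
  have b₃ := b₂.congr (s' := s₃) fun r hr => f₃.reg r (by simp; omega)
  refine Runs.seq (tablesCmd_runs hE hJ a₃ b₃ harr (by omega)) ?_
  rintro s₄ ⟨⟨rk, lpf, fl, hT, hx⟩, g₄⟩ f₄
  have a₄ := a₃.congr (s' := s₄) (fun r h h' => g₄ r h (by omega)) fun a ha =>
    f₄.mem a (tablesCmd_keeps (by omega))
  -- The bit array is still in its initial state, which starts the invariant of the levels.
  have m20 : ∀ t, s₄.mem 20 t ≤ 1 := fun t => by
    rw [f₄.mem 20 (tablesCmd_keeps (by omega)), f₃.mem 20 (phrasesCmd_keeps (by omega)),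
      f₂.mem 20 (refCmd_keeps (by omega)), m₁, h0]
    omega
  refine Runs.seq (sizesCmd_runs hW a₄.rN (by rw [g₄ _ (by omega) (by omega), b₃.bN]) hD hβ) ?_
  rintro s₅ ⟨w₅, c₅, g₅⟩ f₅
  have m₅ : ∀ a, s₅.mem a = s₄.mem a := fun a => f₅.mem a (by simp)
  have a₅ := a₄.congr (s' := s₅) (fun r h h' => g₅ r h (by omega)) fun a _ => m₅ a
  obtain ⟨rk₁, hrk₁⟩ := exists_rank (hT.perm 1 le_rfl)
  have hlt : ∀ x < E.N, s₄.mem 5 x < E.N := hrk₁.lt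
  have hinj : ∀ x < E.N, ∀ x' < E.N, rk (s₄.mem 5 x) = rk (s₄.mem 5 x') → x = x' := by
    intro x hx x' hx' e
    have e' := hT.rank.inj (hlt x hx) (hlt x' hx') e
    have e₁ : rk₁ (s₄.mem 5 x) = x := hrk₁.rk_a x hx
    have e₂ : rk₁ (s₄.mem 5 x') = x' := hrk₁.rk_a x' hx'
    rw [← e₁, ← e₂, e']
  refine Runs.seq (levelsCmd_runs hW c₅ w₅ (y := fun x => rk (s₄.mem 5 x))
    (v := fun x => fl (s₄.mem 5 x)) hinj
    (fun x hx => (hT.rank.rk_lt _ (hlt x hx)).trans_le hW.N_le)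
    (fun x hx => (hT.val _ (hlt x hx)).1) (fun x h => by rw [m₅, (hx x h).1])
    (fun x h => by rw [m₅, (hx x h).2.1]) (fun t => by rw [m₅]; exact m20 t)) ?_
  rintro s₆ ⟨bit, val, hrow⟩ f₆
  have m₆ : ∀ a < 7, s₆.mem a = s₄.mem a := fun a h => by
    rw [f₆.mem a (levelsCmd_keeps h), m₅]
  have g₆ : ∀ r, 92 ≤ r → s₆.reg r = s₅.reg r := fun r hr => f₆.reg r (by simp; omega)
  have a₆ := a₅.congr (s' := s₆) (fun r h h' => g₆ r (by omega)) fun a ha => by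
    rw [m₆ a (by omega), m₅]
  have w₆ := w₅.congr (s' := s₆) fun r h h' => g₆ r (by omega)
  refine (paramsCmd_runs a₆ w₆ (by omega) (by omega) (by omega)).mono ?_
  intro s₇ p₇ f₇
  have m₇ : ∀ a, a ≠ 0 → s₇.mem a = s₆.mem a := fun a h => f₇.mem a (paramsCmd_keeps h)
  refine ⟨rk, lpf, fl, bit, val, p₇, fun i hi => ?_, fun i hi => ?_, fun i hi => ?_, ?_,
    fun i hi => ?_, fun k hk => ?_⟩
  · rw [m₇ 1 (by omega)]
    simpa [rdVal] using a₆.hpos.val hi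
  · rw [m₇ 2 (by omega)]
    simpa [rdVal] using a₆.hh.val hi
  · rw [m₇ 3 (by omega)]
    simpa [rdVal] using a₆.hsrc.val hi
  · have : ∀ d ≤ 1, s₇.mem (4 + d) = s₄.mem (4 + d) := fun d hd => by
      rw [m₇ _ (by omega), m₆ _ (by omega)]
    refine ⟨fun d hd => ?_, fun d hd => ?_, ?_, hT.isLpf, hT.val⟩
    · simp only [this d hd]; exact hT.perm d hd
    · simp only [this d hd]; exact hT.sorted d hd
    · simp only [this 0 (by omega)]; exact hT.rank
  · rw [m₇ 6 (by omega), m₇ 4 (by omega), m₆ 6 (by omega), m₆ 4 (by omega), (hx i hi).2.2]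
  · obtain ⟨h₁, h₂⟩ := hrow k hk
    rw [m₇ 5 (by omega), m₆ 5 (by omega)]
    refine ⟨h₁.congr fun a h h' i _ => ?_, h₂⟩
    simp [rdVal, m₇ a (by omega)]

end Programs

end RLZ

namespace RLZ

/-! ## The items of a parse -/

/-- The length of the first `k` phrases. -/
def phraseSum (Z : List (ℕ × ℕ)) (k : ℕ) : ℕ := ((Z.take k).map Prod.fst).sum

@[simp] theorem phraseSum_zero (Z : List (ℕ × ℕ)) : phraseSum Z 0 = 0 := by simp [phraseSum]

theorem phraseSum_cons (a : ℕ × ℕ) (Z : List (ℕ × ℕ)) (k : ℕ) :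
    phraseSum (a :: Z) (k + 1) = a.1 + phraseSum Z k := by simp [phraseSum]

theorem phraseSum_succ (Z : List (ℕ × ℕ)) {k : ℕ} (hk : k < Z.length) :
    phraseSum Z (k + 1) = phraseSum Z k + Z[k].1 := by
  rw [phraseSum, phraseSum, List.take_succ_eq_append_getElem hk]
  simp only [List.map_append, List.sum_append, List.map_cons, List.map_nil, List.sum_cons,
    List.sum_nil, add_zero]

theorem phraseSum_of_le (Z : List (ℕ × ℕ)) {k : ℕ} (hk : Z.length ≤ k) :
    phraseSum Z k = phraseSum Z Z.length := by
  simp [phraseSum, List.take_of_length_le hk]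

theorem OccursAt.sub_eq {V U : List ℕ} {s : ℕ} (h : OccursAt V U s) :
    s - 1 + U.length ≤ V.length ∧ sub V (s - 1) (s - 1 + U.length) = U := by
  obtain ⟨h₁, h₂, h₃⟩ := h
  refine ⟨by omega, ?_⟩
  rw [factor, show s + U.length - 1 = s - 1 + U.length by omega] at h₃
  exact h₃

/-- What the items need: the phrases are nonempty copies of pieces of `R`, and together they have
the length of `S`. -/
theorem IsRLZParse.phrases {R S : List ℕ} {Z : List (ℕ × ℕ)} (h : IsRLZParse R S Z) :
    phraseSum Z Z.length = S.length ∧ ∀ k (hk : k < Z.length), 1 ≤ Z[k].1 ∧ 1 ≤ Z[k].2 ∧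
      Z[k].2 - 1 + Z[k].1 ≤ R.length ∧
      sub R (Z[k].2 - 1) (Z[k].2 - 1 + Z[k].1) = (S.drop (phraseSum Z k)).take Z[k].1 := by
  induction Z generalizing S with
  | nil => simp [IsRLZParse] at h; simp [h, phraseSum]
  | cons a Z ih =>
    obtain ⟨len, ps⟩ := a
    obtain ⟨h₁, h₂, h₃, -, h₅⟩ := h
    obtain ⟨i₁, i₂⟩ := ih h₅
    have hl : (S.take len).length = len := by simp [h₂]
    have ho := OccursAt.sub_eq (h₃.1 : OccursAt R (S.take len) ps)
    rw [hl] at ho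
    refine ⟨?_, fun k hk => ?_⟩
    · rw [List.length_cons, phraseSum_cons, i₁, List.length_drop]; dsimp only; omega
    · cases k with
      | zero => exact ⟨h₁, (h₃.1 : OccursAt R (S.take len) ps).1, ho.1, by simpa using ho.2⟩
      | succ k =>
        obtain ⟨j₁, j₂, j₃, j₄⟩ := i₂ k (by simpa using hk)
        refine ⟨j₁, j₂, j₃, ?_⟩
        rw [phraseSum_cons, ← List.drop_drop]
        exact j₄

/-- Phrases are nonempty, so there are at most `S.length` of them. This bounds the number of items
by the text length plus one. -/
theorem IsRLZParse.length_le {R S : List ℕ} {Z : List (ℕ × ℕ)} (h : IsRLZParse R S Z) :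
    R.length + Z.length ≤ (R ++ S).length := by
  obtain ⟨hsum, hph⟩ := h.phrases
  have : ∀ k ≤ Z.length, k ≤ phraseSum Z k := fun k => by
    induction k with
    | zero => simp
    | succ k ih =>
      intro hk
      have := ih (by omega)
      have := (hph k hk).1
      rw [phraseSum_succ Z hk]; omega
  have := this _ le_rfl
  rw [List.length_append]
  omega

/-- `S` consists of pieces of `R`, so a bound on the characters of `R` is one on those of the text.
-/
theorem IsRLZParse.mem {R S : List ℕ} {Z : List (ℕ × ℕ)} (h : IsRLZParse R S Z) {c : ℕ}
    (hc : c ∈ S) : c ∈ R := by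
  induction Z generalizing S with
  | nil => simp [IsRLZParse] at h; simp [h] at hc
  | cons a Z ih =>
    obtain ⟨len, ps⟩ := a
    obtain ⟨h₁, h₂, h₃, -, h₅⟩ := h
    rw [← List.take_append_drop len S, List.mem_append] at hc
    rcases hc with hc | hc
    · rw [← (OccursAt.sub_eq (h₃.1 : OccursAt R (S.take len) ps)).2] at hc
      exact List.mem_of_mem_take (List.mem_of_mem_drop hc)
    · exact ih h₅ hc

/-- The items of the parse `Z` of `S` with respect to `R`. -/
def parseEnv (R S : List ℕ) (Z : List (ℕ × ℕ)) (p x : ℕ) : Env where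
  T := R ++ S
  p := p
  x := x
  ℓ := R.length
  N := R.length + Z.length + 1
  K := Nat.clog 2 ((R ++ S).length + 1)
  pos q := min q R.length + phraseSum Z (q - R.length)
  src q := if q < R.length then q else (Z.getD (q - R.length) (0, 1)).2 - 1

theorem sub_append_left {R S : List ℕ} {a c : ℕ} (h : c ≤ R.length) :
    sub (R ++ S) a c = sub R a c := by
  rw [sub, sub, List.take_append_of_le_length h]

theorem sub_append_right {R S : List ℕ} (a t : ℕ) :
    sub (R ++ S) (R.length + a) (R.length + a + t) = (S.drop a).take t := by
  rw [sub, add_assoc, List.take_length_add_append, List.drop_length_add_append, List.drop_take]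
  simp

theorem take_sub_self (T : List ℕ) {a t u : ℕ} (h : t ≤ u) :
    (sub T a (a + u)).take t = sub T a (a + t) := by
  rw [sub, sub, List.take_drop, List.take_take]
  congr 2; omega

theorem sub_self (T : List ℕ) (a : ℕ) : sub T a a = [] := by
  simp [sub]

section

variable {R S : List ℕ} {Z : List (ℕ × ℕ)} {p x : ℕ}

theorem parseEnv_pos_le (h : IsRLZParse R S Z) (q : ℕ) :
    (parseEnv R S Z p x).pos q ≤ (R ++ S).length := by
  have hmono : ∀ a b, phraseSum Z a ≤ phraseSum Z (a + b) := fun a b => by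
    induction b with
    | zero => exact le_rfl
    | succ b ih =>
      rw [← add_assoc]
      by_cases hb : a + b < Z.length
      · rw [phraseSum_succ Z hb]; omega
      · rw [phraseSum_of_le Z (show Z.length ≤ a + b + 1 by omega),
          ← phraseSum_of_le Z (show Z.length ≤ a + b by omega)]
        exact ih
  have hs : phraseSum Z (q - R.length) ≤ S.length := by
    rw [← h.phrases.1]
    rcases le_total (q - R.length) Z.length with hq | hq
    · obtain ⟨d, hd⟩ := Nat.exists_eq_add_of_le hq
      rw [hd]; exact hmono _ _
    · rw [phraseSum_of_le Z hq]
  simp only [parseEnv, List.length_append]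
  omega

theorem parseEnv_pos_add (k : ℕ) :
    (parseEnv R S Z p x).pos (R.length + k) = R.length + phraseSum Z k := by
  simp [parseEnv]

theorem parseEnv_pos_of_le {q : ℕ} (hq : q ≤ R.length) : (parseEnv R S Z p x).pos q = q := by
  simp [parseEnv, hq]

theorem parseEnv_src_add {k : ℕ} (hk : k < Z.length) :
    (parseEnv R S Z p x).src (R.length + k) = Z[k].2 - 1 := by
  simp [parseEnv, hk]

theorem parseEnv_pos_lt (h : IsRLZParse R S Z) (q r : ℕ) (hqr : q < r)
    (hr : r < R.length + Z.length + 1) :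
    (parseEnv R S Z p x).pos q < (parseEnv R S Z p x).pos r := by
  have step : ∀ q, q + 1 < R.length + Z.length + 1 →
      (parseEnv R S Z p x).pos q < (parseEnv R S Z p x).pos (q + 1) := by
    intro q hq
    by_cases hqR : q < R.length
    · rw [parseEnv_pos_of_le hqR.le, parseEnv_pos_of_le hqR]; omega
    · obtain ⟨k, rfl⟩ := Nat.exists_eq_add_of_le (not_lt.1 hqR)
      have hk : k < Z.length := by omega
      rw [add_assoc, parseEnv_pos_add, parseEnv_pos_add, phraseSum_succ Z hk]
      have := (h.phrases.2 k hk).1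
      omega
  induction r with
  | zero => omega
  | succ r ih =>
    rcases Nat.lt_succ_iff_lt_or_eq.1 hqr with h' | rfl
    · exact (ih h' (by omega)).trans (step r hr)
    · exact step q hr

/-- For the source equation there are three kinds of items: one inside the reference is its own
source, the start of a phrase has the stored position, and the last item is followed by the empty
string only. -/
theorem parseEnv_wf (h : IsRLZParse R S Z) (hR : R ≠ []) (hp : 2 ≤ p) (hx : x < p)
    (hn : (R ++ S).length ≤ p) {M : Machine} {I : ℕ}
    (hcap : 1000 * (p * p) + 1000 * p + 1000 ≤ M.cap)
    (hI : Nat.clog 2 ((R ++ S).length + 1) + 3 ≤ I) : (parseEnv R S Z p x).WF M I := by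
  obtain ⟨hsum, hph⟩ := h.phrases
  have hRl : 1 ≤ R.length := List.length_pos_iff.2 hR
  have hzS := h.length_le
  rw [List.length_append] at hzS
  refine ⟨hp, hx, hn, hcap, Nat.le_pow_clog (by omega) _, ?_, hI, ?_, ?_, parseEnv_pos_le h,
    fun q hq => parseEnv_pos_of_le hq, ?_, parseEnv_pos_lt h, ?_⟩
  · have hlt := Nat.pow_pred_clog_lt_self (b := 2) (by omega) (x := (R ++ S).length + 1)
      (by simp; omega)
    have hpos : 0 < Nat.clog 2 ((R ++ S).length + 1) := Nat.clog_pos (by omega) (by simp; omega)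
    have : 2 ^ Nat.clog 2 ((R ++ S).length + 1) =
        2 * 2 ^ (Nat.clog 2 ((R ++ S).length + 1)).pred := by
      rw [← pow_succ']; congr 1; exact (Nat.succ_pred_eq_of_pos hpos).symm
    change 2 ^ Nat.clog 2 ((R ++ S).length + 1) ≤ 8 * p
    omega
  · simp only [parseEnv]; omega
  · simp only [parseEnv, List.length_append]; omega
  · change (parseEnv R S Z p x).pos (R.length + Z.length) = (R ++ S).length
    rw [parseEnv_pos_add, hsum, List.length_append]
  · intro q j hq hj hjn hnext
    change q < R.length + Z.length + 1 at hq
    change q + 1 < R.length + Z.length + 1 → _ at hnext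
    change j ≤ (R ++ S).length at hjn
    change _ ≤ R.length ∧ sub (R ++ S) _ j = sub (R ++ S) _ _
    by_cases hqR : q < R.length
    · have e : (parseEnv R S Z p x).src q = q := by simp [parseEnv, hqR]
      have hnext := hnext (by omega)
      rw [parseEnv_pos_of_le (by omega)] at hj hnext
      rw [parseEnv_pos_of_le (by omega), e]
      exact ⟨by omega, by congr 1; omega⟩
    · obtain ⟨k, rfl⟩ := Nat.exists_eq_add_of_le (not_lt.1 hqR)
      rw [parseEnv_pos_add] at hj ⊢
      by_cases hk : k < Z.length
      · obtain ⟨h₁, h₂, h₃, h₄⟩ := hph k hk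
        have hnext := hnext (by omega)
        rw [add_assoc, parseEnv_pos_add, phraseSum_succ Z hk] at hnext
        rw [parseEnv_src_add hk]
        obtain ⟨t, ht⟩ : ∃ t, t = j - (R.length + phraseSum Z k) := ⟨_, rfl⟩
        have htl : t ≤ Z[k].1 := by omega
        rw [← ht, show j = R.length + phraseSum Z k + t by omega]
        refine ⟨by omega, ?_⟩
        rw [sub_append_right, sub_append_left (by omega), ← take_sub_self R htl, h₄,
          List.take_take, min_eq_left htl]
      · obtain rfl : k = Z.length := by omega
        have e : (parseEnv R S Z p x).src (R.length + Z.length) = 0 := by simp [parseEnv]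
        rw [List.length_append] at hjn
        rw [hsum] at hj ⊢
        rw [e, show j = R.length + S.length by omega, Nat.sub_self]
        exact ⟨by omega, by rw [sub_self, sub_self]⟩

theorem parseEnv_buildIn (h : IsRLZParse R S Z) (hR : ∀ c ∈ R, c < p) {M : Machine}
    (hM : M.input = buildInput R Z p x) : BuildIn (parseEnv R S Z p x) M Z.length := by
  obtain ⟨hsum, hph⟩ := h.phrases
  refine ⟨rfl, fun k hk => ?_, by rw [hM]; rfl, fun k hk => ?_, fun k hk => ?_, fun k hk => ?_,
    fun q hq => ?_, ?_⟩
  · exact Nat.pow_lt_of_lt_clog hk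
  · have hk : k < R.length := hk
    have e : (M.input 1).getD k 0 = R[k] := by simp [hM, buildInput, hk]
    refine ⟨by simpa [hM, buildInput] using hk, ?_, ?_⟩
    · rw [e]; exact hR _ (List.getElem_mem hk)
    · rw [e]
      change krHash p x ((R ++ S).take (k + 1)) = _
      rw [List.take_succ_eq_append_getElem (by simp; omega), krHash_concat,
        List.getElem_append_left hk]
      rfl
  · have e : (M.input 2).getD k 0 = Z[k].1 := by simp [hM, buildInput, hk]
    refine ⟨by simpa [hM, buildInput] using hk, ?_⟩
    rw [e]
    change (parseEnv R S Z p x).pos (R.length + k + 1) = (parseEnv R S Z p x).pos (R.length + k) + _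
    rw [add_assoc, parseEnv_pos_add, parseEnv_pos_add, phraseSum_succ Z hk]; omega
  · have e : (M.input 3).getD k 0 = Z[k].2 := by simp [hM, buildInput, hk]
    refine ⟨by simpa [hM, buildInput] using hk, ?_⟩
    rw [e]
    change _ = (parseEnv R S Z p x).src (R.length + k) + 1
    rw [parseEnv_src_add hk]
    have := (hph k hk).2.1
    omega
  · have hq : q < R.length := hq
    simp [parseEnv, hq]
  · simp [parseEnv]

end

theorem Env.WF.congr {E : Env} {M M' : Machine} {I : ℕ} (h : E.WF M I) (hc : M'.cap = M.cap) :
    E.WF M' I :=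
  { h with cap := by rw [hc]; exact h.cap }

/-- The memory of the construction, as read-only input of a query. -/
theorem Done.index {E : Env} {M M' : Machine} {I J D β : ℕ} {s : State} {rk lpf fl : ℕ → ℕ}
    {bit val : ℕ → ℕ → ℕ} (h : Done E M s D β rk lpf fl bit val) (hW : WSize M I J E.N D β)
    (hcap : M'.cap = M.cap) (hin : ∀ a, M'.input (a + 4) = s.dump M a) (h10 : 10 ≤ M.cells)
    (hN : E.N ≤ M.cells) :
    Index E M' I D β (fun d => s.mem (4 + d)) (fun x => rk (s.mem 5 x)) (fun x => fl (s.mem 5 x))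
      bit val := by
  have harr := hW.arrays
  have hcells := hW.cells
  have len : ∀ a < 22, (M'.input (a + 4)).length = M.cells := fun a ha => by
    rw [hin, State.dump, if_pos (by omega)]; simp
  have ok : ∀ a < 22, ∀ i < M.cells, RdOk true M' a i := fun a ha i hi => by
    simp only [RdOk, if_true, len a ha, hi]
  have rv : ∀ a < 22, ∀ i < M.cells, ∀ s', rdVal true M' s' a i = s.mem a i := fun a ha i hi s' => by
    simp only [rdVal, if_true, hin, State.dump, if_pos (show a < M.arrays by omega)]
    simp [hi]
  have hT := h.tables
  obtain ⟨rk₁, hrk₁⟩ := exists_rank (hT.perm 1 le_rfl)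
  obtain ⟨rk₀, hrk₀⟩ := exists_rank (hT.perm 0 (by omega))
  have hlt : ∀ x < E.N, s.mem 5 x < E.N := hrk₁.lt
  refine ⟨fun i hi => ⟨ok _ (by omega) _ (by omega), by rw [rv _ (by omega) _ (by omega), h.params i hi]⟩,
    fun i hi => ⟨ok _ (by omega) _ (by omega), by rw [rv _ (by omega) _ (by omega), h.hpos i hi]⟩,
    fun i hi => ⟨ok _ (by omega) _ (by omega), by rw [rv _ (by omega) _ (by omega), h.hh i hi]⟩,
    fun i hi => ⟨ok _ (by omega) _ (by omega), by rw [rv _ (by omega) _ (by omega), h.hsrc i hi]⟩,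
    fun d hd => ⟨fun i hi => ⟨ok _ (by omega) _ (by omega), by rw [rv _ (by omega) _ (by omega)]⟩, ?_⟩,
    ⟨⟨M, J, hW, hcap.symm⟩, ?_, ?_, ?_, ?_, ?_, ?_, ?_, ?_⟩⟩
  · have : d = 0 ∨ d = 1 := by omega
    rcases this with rfl | rfl
    · exact hrk₀.lt
    · exact hrk₁.lt
  · intro x hx x' hx' e
    have e' := hT.rank.inj (hlt x hx) (hlt x' hx') e
    have e₁ : rk₁ (s.mem 5 x) = x := hrk₁.rk_a x hx
    have e₂ : rk₁ (s.mem 5 x') = x' := hrk₁.rk_a x' hx'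
    rw [← e₁, ← e₂, e']
  · exact fun x hx => hT.rank.rk_lt _ (hlt x hx)
  · exact fun x hx => (hT.val _ (hlt x hx)).1
  · intro k hk s'
    refine (h.row k hk).1.congr fun a ha ha' i hi => ?_
    have hi' : i < M.cells := by
      rcases Nat.eq_zero_or_pos (stride D β) with h0 | h0
      · rw [h0] at hi; omega
      · have := hW.row_lt (k := k) (i := stride D β - 1) hk (by omega)
        rw [Nat.succ_mul] at hi
        omega
    rw [rv a (by omega) i hi']
    simp [rdVal]
  · exact fun k hk x hx => ((h.row k hk).2 x hx).1
  · exact fun k hk x hx => ((h.row k hk).2 x hx).2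
  · intro x hx s'
    have hr := hT.rank.rk_lt _ (hlt x hx)
    have e : s.mem 4 (rk (s.mem 5 x)) = s.mem 5 x := hT.rank.a_rk _ (hlt x hx)
    rw [rv 6 (by omega) _ (by omega), h.point _ hr, e]
  · exact fun a ha ha' i hi => ok a (by omega) i (by omega)

end RLZ

namespace RLZ

/-! ## Longest common prefixes and the lexicographic order -/

/-- The length of the longest common prefix. -/
def lcpLen : List ℕ → List ℕ → ℕ
  | a :: U, b :: V => if a = b then lcpLen U V + 1 else 0
  | _, _ => 0

theorem le_lcpLen {U V : List ℕ} {k : ℕ} :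
    k ≤ lcpLen U V ↔ k ≤ U.length ∧ k ≤ V.length ∧ U.take k = V.take k := by
  induction U generalizing V k with
  | nil => cases k <;> simp [lcpLen]
  | cons a U ih =>
    cases V with
    | nil => cases k <;> simp [lcpLen]
    | cons b V =>
      cases k with
      | zero => simp
      | succ k =>
        simp only [lcpLen, List.length_cons, List.take_succ_cons, List.cons.injEq]
        split_ifs with h
        · simp [h, ih]
        · simp [h]

theorem lcpLen_le (U V : List ℕ) : lcpLen U V ≤ min U.length V.length := by
  have := le_lcpLen.1 (le_refl (lcpLen U V))
  omega

theorem lcpLen_comm (U V : List ℕ) : lcpLen U V = lcpLen V U := by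
  have key : ∀ U V : List ℕ, lcpLen U V ≤ lcpLen V U := fun U V => by
    obtain ⟨h₁, h₂, h₃⟩ := le_lcpLen.1 (le_refl (lcpLen U V))
    exact le_lcpLen.2 ⟨h₂, h₁, h₃.symm⟩
  exact le_antisymm (key U V) (key V U)

theorem nil_lexLe (U : List ℕ) : [] ≤ U := not_lt.1 (List.not_lt_nil U)

theorem not_cons_lexLe_nil (a : ℕ) (U : List ℕ) : ¬ a :: U ≤ [] :=
  not_le.2 (List.nil_lt_cons a U)

theorem cons_lexLe_cons {a b : ℕ} {U V : List ℕ} : a :: U ≤ b :: V ↔ a < b ∨ a = b ∧ U ≤ V := by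
  rw [← not_lt, ← not_lt (a := V), List.cons_lt_cons_iff]
  by_cases h : V < U <;> simp [h] <;> omega

/-- The first difference decides. The default of `getD` plays no role: where the characters matter,
both strings are longer than the common prefix. -/
theorem le_iff_lcpLen (U V : List ℕ) : U ≤ V ↔ lcpLen U V = U.length ∨
    lcpLen U V ≠ V.length ∧ U.getD (lcpLen U V) 0 < V.getD (lcpLen U V) 0 := by
  induction U generalizing V with
  | nil => simp [lcpLen, nil_lexLe]
  | cons a U ih =>
    cases V with
    | nil => simp [lcpLen, not_cons_lexLe_nil]
    | cons b V =>
      rw [cons_lexLe_cons]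
      simp only [lcpLen, List.length_cons]
      split_ifs with h
      · simp [h, ih]
      · simp [h]

theorem prefix_iff_lcpLen (Q U : List ℕ) : Q <+: U ↔ lcpLen U Q = Q.length := by
  have h := lcpLen_le U Q
  constructor
  · rintro ⟨W, rfl⟩
    have : Q.length ≤ lcpLen (Q ++ W) Q := le_lcpLen.2 (by simp)
    omega
  · intro e
    obtain ⟨h₁, h₂, h₃⟩ := le_lcpLen.1 (le_refl (lcpLen U Q))
    rw [e, List.take_length] at h₃
    rw [← h₃]
    exact List.take_prefix _ _

/-- A string between two others in lexicographic order shares their common prefix. -/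
theorem lcpLen_le_left {U V W : List ℕ} (h₁ : U ≤ V) (h₂ : V ≤ W) : lcpLen U W ≤ lcpLen U V := by
  induction U generalizing V W with
  | nil => simp [lcpLen]
  | cons a U ih =>
    cases V with
    | nil => exact absurd h₁ (not_cons_lexLe_nil _ _)
    | cons b V =>
      cases W with
      | nil => exact absurd h₂ (not_cons_lexLe_nil _ _)
      | cons c W =>
        rw [cons_lexLe_cons] at h₁ h₂
        simp only [lcpLen]
        by_cases hac : a = c
        · have hab : a = b := by omega
          subst hac; subst hab
          simp only [lt_self_iff_false, false_or, true_and] at h₁ h₂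
          simp [ih h₁ h₂]
        · simp [hac]

theorem lcpLen_le_right {U V W : List ℕ} (h₁ : U ≤ V) (h₂ : V ≤ W) : lcpLen U W ≤ lcpLen V W := by
  induction U generalizing V W with
  | nil => simp [lcpLen]
  | cons a U ih =>
    cases V with
    | nil => exact absurd h₁ (not_cons_lexLe_nil _ _)
    | cons b V =>
      cases W with
      | nil => exact absurd h₂ (not_cons_lexLe_nil _ _)
      | cons c W =>
        rw [cons_lexLe_cons] at h₁ h₂
        simp only [lcpLen]
        by_cases hac : a = c
        · have hab : a = b := by omega
          subst hac; subst hab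
          simp only [lt_self_iff_false, false_or, true_and] at h₁ h₂
          simp [ih h₁ h₂]
        · simp [hac]

/-- The strings that begin with `Q` form an interval with least element `Q`. -/
theorem prefix_of_le_of_le {Q U V : List ℕ} (h₁ : Q ≤ U) (h₂ : U ≤ V) (h : Q <+: V) : Q <+: U := by
  rw [prefix_iff_lcpLen, lcpLen_comm] at h ⊢
  have := lcpLen_le_left h₁ h₂
  have := lcpLen_le Q U
  omega

/-- Binary search for the boundary of a set that is closed downwards. -/
theorem exists_bound_of_antitone {g : ℕ → Prop} (N : ℕ) (h : ∀ a b, a < b → b < N → g b → g a) :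
    ∃ m ≤ N, ∀ c < N, g c ↔ c < m := by
  induction N with
  | zero => exact ⟨0, le_rfl, fun c hc => absurd hc (by omega)⟩
  | succ N ih =>
    by_cases hN : g N
    · refine ⟨N + 1, le_rfl, fun c hc => ⟨fun _ => hc, fun _ => ?_⟩⟩
      rcases Nat.lt_succ_iff_lt_or_eq.1 hc with h' | rfl
      · exact h c N h' (by omega) hN
      · exact hN
    · obtain ⟨m, hm, hg⟩ := ih fun a b hab hb => h a b hab (by omega)
      refine ⟨m, by omega, fun c hc => ?_⟩
      rcases Nat.lt_succ_iff_lt_or_eq.1 hc with h' | rfl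
      · exact hg c h'
      · exact ⟨fun h => absurd h hN, fun h => by omega⟩

/-! ## Comparisons without collisions -/

/-- The text read from the position `b` in the direction `d`. -/
def Env.str (E : Env) (d b : ℕ) : List ℕ := if d = 0 then E.T.drop b else (E.T.take b).reverse

/-- The part of the pattern that is searched for in the direction `d`. -/
def patStr (P : List ℕ) (i d : ℕ) : List ℕ := if d = 0 then P.drop i else (P.take i).reverse

/-- The hash of a string that has been read in the direction `d`. -/
def dirHash (p x d : ℕ) (U : List ℕ) : ℕ := krHash p x (if d = 0 then U else U.reverse)

/-- Prefixes of `U` and `V` of the same length are equal if their hashes are. -/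
def NoColl (p x d : ℕ) (U V : List ℕ) : Prop :=
  ∀ len, len ≤ U.length → len ≤ V.length →
    dirHash p x d (U.take len) = dirHash p x d (V.take len) → U.take len = V.take len

/-- Without collisions the test by hashes is equality of prefixes, which is monotone in the length.
-/
theorem NoColl.bsAux_eq {p x d : ℕ} {U V : List ℕ} (h : NoColl p x d U V) {k : ℕ}
    (hk : min U.length V.length < 2 ^ k) {f : ℕ → Bool}
    (hf : ∀ len, len ≤ U.length → len ≤ V.length →
      (f len = true ↔ dirHash p x d (U.take len) = dirHash p x d (V.take len))) :
    bsAux f (min U.length V.length) k 0 = lcpLen U V := by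
  have hl := lcpLen_le U V
  refine RLZ.bsAux_eq k 0 hl (fun c _ hc => ?_) (Nat.zero_le _) (by omega)
  rw [hf c (by omega) (by omega), le_lcpLen]
  exact ⟨fun e => ⟨by omega, by omega, h c (by omega) (by omega) e⟩, fun e => by rw [e.2.2]⟩

variable {E : Env} {d b : ℕ}

theorem Env.length_str (hd : d ≤ 1) (hb : b ≤ E.T.length) : (E.str d b).length = E.room d b := by
  have : d = 0 ∨ d = 1 := by omega
  rcases this with rfl | rfl <;> simp [Env.str, Env.room, hb]

theorem length_patStr {P : List ℕ} {i : ℕ} (hd : d ≤ 1) (hi : i ≤ P.length) :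
    (patStr P i d).length = patLen P i d := by
  have : d = 0 ∨ d = 1 := by omega
  rcases this with rfl | rfl <;> simp [patStr, patLen, hi]

theorem reverse_take_reverse_take (T : List ℕ) {b len : ℕ} (hb : b ≤ T.length) (hl : len ≤ b) :
    ((T.take b).reverse.take len).reverse = (T.take b).drop (b - len) := by
  rw [List.take_reverse, List.reverse_reverse]
  simp [hb]

/-- Hashes read the text from left to right in both directions; `dirHash` undoes the reversal in
`Env.str`. -/
theorem Env.fh_eq (hd : d ≤ 1) (hb : b ≤ E.T.length) {len : ℕ} (hl : len ≤ E.room d b) :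
    E.fh d b len = dirHash E.p E.x d ((E.str d b).take len) := by
  have : d = 0 ∨ d = 1 := by omega
  rcases this with rfl | rfl
  · simp only [Env.fh, Env.sh, dirHash, Env.str, if_true, sub, zero_mul, Nat.sub_zero]
    rw [List.drop_take]; simp
  · simp only [Env.room, one_ne_zero, if_false] at hl
    simp only [Env.fh, Env.sh, dirHash, Env.str, one_ne_zero, if_false, sub, one_mul,
      reverse_take_reverse_take _ hb hl]
    rw [Nat.sub_add_cancel hl]

theorem Env.patHash_eq {P : List ℕ} {i : ℕ} (hd : d ≤ 1) (hi : i ≤ P.length) {len : ℕ}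
    (hl : len ≤ patLen P i d) :
    E.patHash P i d len = dirHash E.p E.x d ((patStr P i d).take len) := by
  have : d = 0 ∨ d = 1 := by omega
  rcases this with rfl | rfl
  · simp [Env.patHash, dirHash, patStr]
  · simp only [patLen, one_ne_zero, if_false] at hl
    simp only [Env.patHash, dirHash, patStr, one_ne_zero, if_false,
      reverse_take_reverse_take _ hi hl]

theorem Env.lcp_eq (hd : d ≤ 1) {b' : ℕ} (hb : b ≤ E.T.length) (hb' : b' ≤ E.T.length)
    (hK : E.T.length + 1 ≤ 2 ^ E.K) (h : NoColl E.p E.x d (E.str d b) (E.str d b')) :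
    E.lcp d b b' = lcpLen (E.str d b) (E.str d b') := by
  have e := E.length_str hd hb
  have e' := E.length_str hd hb'
  have hr := E.room_le (d := d) hb
  rw [Env.lcp, ← e, ← e']
  refine h.bsAux_eq (by rw [pow_succ]; omega) fun len h₁ h₂ => ?_
  rw [decide_eq_true_iff, E.fh_eq hd hb (by omega), E.fh_eq hd hb' (by omega)]

/-- A single character below `p` is its own hash, so comparing hashes of length `1` compares
characters, for every base. -/
theorem Env.fh_one (hd : d ≤ 1) (hb : b ≤ E.T.length) {l : ℕ} (hl : l < E.room d b)
    (hc : ∀ c ∈ E.T, c < E.p) : E.fh d (adv d b l) 1 = (E.str d b).getD l 0 := by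
  have one : ∀ j < E.T.length, krHash E.p E.x (sub E.T j (j + 1)) = E.T.getD j 0 := fun j hj => by
    have : sub E.T j (j + 1) = [E.T[j]] := by
      rw [sub, List.drop_take]; simp [List.take_one, hj]
    rw [this, List.getD_eq_getElem _ _ hj]
    simp [krHash, Nat.mod_eq_of_lt (hc _ (List.getElem_mem hj))]
  have : d = 0 ∨ d = 1 := by omega
  rcases this with rfl | rfl
  · simp only [Env.room, if_true] at hl
    simp only [Env.fh, Env.sh, adv, zero_mul, mul_zero, Nat.sub_zero]
    rw [one _ (by omega)]
    simp [Env.str, List.getD_eq_getElem?_getD]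
  · simp only [Env.room, one_ne_zero, if_false] at hl
    simp only [Env.fh, Env.sh, adv, mul_one, one_mul]
    rw [show b + l - 2 * l - 1 = b - 1 - l by omega, one _ (by omega),
      List.getD_eq_getElem _ _ (by omega), List.getD_eq_getElem _ _ (by simp [Env.str]; omega)]
    simp [Env.str, List.getElem_reverse, hb]

theorem Env.le_iff (hd : d ≤ 1) {b' : ℕ} (hb : b ≤ E.T.length) (hb' : b' ≤ E.T.length)
    (hK : E.T.length + 1 ≤ 2 ^ E.K) (hc : ∀ c ∈ E.T, c < E.p)
    (h : NoColl E.p E.x d (E.str d b) (E.str d b')) :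
    E.le d b b' = true ↔ E.str d b ≤ E.str d b' := by
  have e := E.length_str hd hb
  have e' := E.length_str hd hb'
  have hl := lcpLen_le (E.str d b) (E.str d b')
  rw [Env.le, E.lcp_eq hd hb hb' hK h, le_iff_lcpLen, ← e, ← e']
  split_ifs with h₁ h₂
  · simp [h₁]
  · simp [h₁]; exact fun h => absurd h₂ h
  · rw [E.fh_one hd hb (by omega) hc, E.fh_one hd hb' (by omega) hc]
    simp [h₁, h₂]

theorem getD_patStr {P : List ℕ} {i l : ℕ} (hd : d ≤ 1) (hi : i ≤ P.length) (hl : l < patLen P i d) :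
    (patStr P i d).getD l 0 = patChar P i d l := by
  have : d = 0 ∨ d = 1 := by omega
  rcases this with rfl | rfl
  · simp [patStr, patChar, List.getD_eq_getElem?_getD]
  · simp only [patLen, one_ne_zero, if_false] at hl
    rw [patChar, List.getD_eq_getElem _ _ (by simp [patStr]; omega),
      List.getD_eq_getElem _ _ (by omega)]
    simp only [patStr, one_ne_zero, if_false, List.getElem_reverse, List.getElem_take]
    congr 1
    simp [hi]; omega

theorem Env.below_iff {P : List ℕ} {i : ℕ} (hd : d ≤ 1) (hb : b ≤ E.T.length) (hi : i ≤ P.length)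
    (hK : E.T.length + 1 ≤ 2 ^ E.K) (hc : ∀ c ∈ E.T, c < E.p)
    (h : NoColl E.p E.x d (E.str d b) (patStr P i d)) (tie : Bool) :
    E.below P i d tie b = true ↔
      (patStr P i d <+: E.str d b ∧ tie = true) ∨ ¬ patStr P i d ≤ E.str d b := by
  have e := E.length_str hd hb
  have e' := length_patStr (P := P) hd hi
  have hr := E.room_le (d := d) hb
  have hl := lcpLen_le (E.str d b) (patStr P i d)
  have hlcp : E.patLcp P i d b = lcpLen (E.str d b) (patStr P i d) := by
    rw [Env.patLcp, ← e, ← e']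
    refine h.bsAux_eq (by rw [pow_succ]; omega) fun len h₁ h₂ => ?_
    rw [decide_eq_true_iff, E.fh_eq hd hb (by omega), E.patHash_eq hd hi (by omega)]
  rw [Env.below, hlcp, prefix_iff_lcpLen, le_iff_lcpLen, lcpLen_comm (patStr P i d), ← e, ← e']
  split_ifs with h₁ h₂
  · simp [h₁]
  · simp [h₁]; exact fun h => absurd h₂ h
  · rw [E.fh_one hd hb (by omega) hc, ← getD_patStr hd hi (by omega)]
    -- At the end of the common prefix the characters differ, so `<` is the negation of the reverse
    -- `<`.
    have hne : (E.str d b).getD (lcpLen (E.str d b) (patStr P i d)) 0 ≠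
        (patStr P i d).getD (lcpLen (E.str d b) (patStr P i d)) 0 := by
      intro e₁
      have := (le_lcpLen (U := E.str d b) (V := patStr P i d)).1 le_rfl
      have : lcpLen (E.str d b) (patStr P i d) + 1 ≤ lcpLen (E.str d b) (patStr P i d) := by
        rw [le_lcpLen]
        refine ⟨by omega, by omega, ?_⟩
        rw [List.take_succ_eq_append_getElem (by omega), List.take_succ_eq_append_getElem (by omega),
          this.2.2]
        rw [List.getD_eq_getElem _ _ (by omega), List.getD_eq_getElem _ _ (by omega)] at e₁
        rw [e₁]
      omega
    simp only [h₁, h₂, false_and, false_or, ne_eq, not_false_eq_true, true_and, not_lt,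
      decide_eq_true_eq]
    omega

end RLZ

namespace RLZ

/-! ## The sorted items, and the phrases of the reference -/

/-- Hash values identify the strings that the index compares. -/
structure Clean (E : Env) (P : List ℕ) (i : ℕ) : Prop where
  two_pow : E.T.length + 1 ≤ 2 ^ E.K
  char_lt : ∀ c ∈ E.T, c < E.p
  pos_le : ∀ q, E.pos q ≤ E.T.length
  items : ∀ d ≤ 1, ∀ a ≤ E.T.length, ∀ b ≤ E.T.length, NoColl E.p E.x d (E.str d a) (E.str d b)
  pat : ∀ d ≤ 1, ∀ a ≤ E.T.length, NoColl E.p E.x d (E.str d a) (patStr P i d)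

variable {E : Env} {P : List ℕ} {i d : ℕ}

theorem Clean.itemLe_iff (h : Clean E P i) (hd : d ≤ 1) (a b : ℕ) :
    E.itemLe d a b = true ↔ E.str d (E.pos a) ≤ E.str d (E.pos b) :=
  E.le_iff hd (h.pos_le a) (h.pos_le b) h.two_pow h.char_lt
    (h.items d hd _ (h.pos_le a) _ (h.pos_le b))

variable {A : ℕ → ℕ → ℕ} {rk lpf fl : ℕ → ℕ}

/-- On a clean base the comparison of items is a total preorder, which discharges the premises of
`Tables.sorted`. -/
theorem Clean.sorted (h : Clean E P i) (hT : Tables E A rk lpf fl) (hd : d ≤ 1) {r r' : ℕ}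
    (hr : r ≤ r') (hr' : r' < E.N) :
    E.str d (E.pos (A d r)) ≤ E.str d (E.pos (A d r')) := by
  rcases hr.lt_or_eq with hlt | rfl
  · have hs := hT.sorted d hd
      (fun a b c h₁ h₂ => by
        rw [h.itemLe_iff hd] at *
        exact h₁.trans h₂)
      (fun a b => by
        rw [Bool.or_eq_true, h.itemLe_iff hd, h.itemLe_iff hd]
        exact le_total _ _)
    rw [List.pairwise_iff_getElem] at hs
    have := hs r r' (by simp [cells]; omega) (by simp [cells]; omega) hlt
    rw [h.itemLe_iff hd] at this
    simpa [cells] using this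
  · exact le_rfl

theorem Clean.str_le_of_rank (h : Clean E P i) (hT : Tables E A rk lpf fl) {a b : ℕ}
    (ha : a < E.N) (hb : b < E.N) (hab : rk a ≤ rk b) :
    E.str 0 (E.pos a) ≤ E.str 0 (E.pos b) := by
  have := h.sorted hT (d := 0) (by omega) hab (hT.rank.rk_lt b hb)
  rwa [hT.rank.a_rk a ha, hT.rank.a_rk b hb] at this

/-- A farther item on the same side shares no more with `q` than the neighbour on that side, so one
of the two neighbours attains the longest match. -/
theorem Clean.le_lpf_iff (h : Clean E P i) (hT : Tables E A rk lpf fl) {q len : ℕ} (hq : q < E.N)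
    (hlen : 1 ≤ len) : len ≤ lpf q ↔
      ∃ s < q, len ≤ lcpLen (E.T.drop (E.pos q)) (E.T.drop (E.pos s)) := by
  obtain ⟨pv, nx, hpv, hnx, hv⟩ := hT.isLpf q hq
  simp only [IsNext] at hpv
  have hnear : ∀ r, r < E.N → E.near q r = lcpLen (E.str 0 (E.pos q)) (E.str 0 (E.pos r)) :=
    fun r hr => by
      rw [Env.near, if_pos hr, E.lcp_eq (by omega) (h.pos_le q) (h.pos_le r) h.two_pow
        (h.items 0 (by omega) _ (h.pos_le q) _ (h.pos_le r))]
  change _ ↔ ∃ s < q, len ≤ lcpLen (E.str 0 (E.pos q)) (E.str 0 (E.pos s))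
  constructor
  · intro hl
    rw [hv, le_max_iff] at hl
    rcases hl with hl | hl
    -- A missing neighbour counts as a match of length `0`, which `1 ≤ len` excludes.
    · rcases hpv with ⟨rfl, -⟩ | ⟨h₁, h₂, -⟩
      · simp [Env.near] at hl; omega
      · rw [hnear _ (by omega)] at hl
        exact ⟨pv, lt_of_le_of_ne (by omega) (by rintro rfl; simp at h₂), hl⟩
    · rcases hnx with ⟨rfl, -⟩ | ⟨h₁, h₂, -⟩
      · simp [Env.near] at hl; omega
      · rw [hnear _ (by omega)] at hl
        exact ⟨nx, lt_of_le_of_ne (by omega) (by rintro rfl; simp at h₂), hl⟩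
  · rintro ⟨s, hs, hl⟩
    rw [hv, le_max_iff]
    have hrs := hT.rank.rk_lt s (by omega)
    have hrq := hT.rank.rk_lt q hq
    rcases Nat.lt_trichotomy (rk q) (rk s) with hlt | heq | hlt
    · right
      rcases hnx with ⟨-, h₁⟩ | ⟨h₁, h₂, h₃⟩
      · exact absurd hlt (h₁ s (by omega))
      · rw [hnear _ (by omega)]
        exact hl.trans (lcpLen_le_left (h.str_le_of_rank hT hq (by omega) h₂.le)
          (h.str_le_of_rank hT (by omega) (by omega) (h₃ s (by omega) hlt)))
    · exact absurd (hT.rank.inj hq (by omega) heq) (by omega)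
    · left
      rcases hpv with ⟨-, h₁⟩ | ⟨h₁, h₂, h₃⟩
      · have := h₁ s (by omega); omega
      · have h₃ := h₃ s (by omega) (by omega)
        have := hT.rank.rk_lt pv (by omega)
        rw [hnear _ (by omega), lcpLen_comm]
        rw [lcpLen_comm] at hl
        exact hl.trans (lcpLen_le_right (h.str_le_of_rank hT (by omega) (by omega) (by omega))
          (h.str_le_of_rank hT (by omega) hq (by omega)))

/-- An occurrence inside `R[1..j-1]` is one that starts earlier, possibly overlapping. Suffixes of
the whole text may stand for those of `R`, as the compared pieces end within `R`. -/
theorem occurs_factor_iff {R S : List ℕ} {q j : ℕ} (hq : q < j) (hj : j ≤ R.length) :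
    Occurs (factor R 1 (j - 1)) (factor R (q + 1) j) ↔
      ∃ s < q, j - q ≤ lcpLen ((R ++ S).drop q) ((R ++ S).drop s) := by
  have hU : (factor R (q + 1) j).length = j - q := by simp [factor, hj]
  have hV : (factor R 1 (j - 1)).length = j - 1 := by simp [factor]; omega
  have key : ∀ s < q, (j - q ≤ lcpLen ((R ++ S).drop q) ((R ++ S).drop s) ↔
      sub R s (s + (j - q)) = sub R q j) := by
    intro s hs
    rw [le_lcpLen, List.length_drop, List.length_drop, List.length_append]
    have e : ∀ a, a ≤ q → ((R ++ S).drop a).take (j - q) = sub R a (a + (j - q)) := by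
      intro a ha
      rw [← sub_append_left (S := S) (by omega), sub, List.drop_take]
      congr 1; omega
    rw [e q le_rfl, e s hs.le, show q + (j - q) = j by omega]
    exact ⟨fun h => h.2.2.symm, fun h => ⟨by omega, by omega, h.symm⟩⟩
  have hfac : ∀ s, s < q → factor (factor R 1 (j - 1)) (s + 1) (s + 1 + (j - q) - 1) =
      sub R s (s + (j - q)) := by
    intro s hs
    simp only [factor, sub, Nat.sub_self, List.drop_zero, Nat.add_sub_cancel, List.take_take]
    congr 2; omega
  constructor
  · rintro ⟨s, h₁, h₂, h₃⟩
    rw [hU] at h₂ h₃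
    rw [hV] at h₂
    obtain ⟨s, rfl⟩ := Nat.exists_eq_add_of_le' h₁
    refine ⟨s, by omega, ?_⟩
    rw [key s (by omega), ← hfac s (by omega), h₃]
    rfl
  · rintro ⟨s, hs, hl⟩
    refine ⟨s + 1, by omega, by omega, ?_⟩
    rw [hU, hfac s hs, (key s hs).1 hl]
    rfl

/-- The phrase that starts after `q` characters ends at the next step. -/
theorem isLZ77Phrase_iff {R : List ℕ} {q j L : ℕ} (hq : q < R.length)
    (hL : ∀ j, q < j → j ≤ R.length →
      (Occurs (factor R 1 (j - 1)) (factor R (q + 1) j) ↔ j - q ≤ L)) :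
    IsLZ77Phrase R (q + 1) j ↔ j = min (q + L + 1) R.length := by
  constructor
  · rintro ⟨-, h₁, h₂, h₃, h₄⟩
    have h₅ : j ≤ q + L + 1 := by
      -- A phrase of length one has no nonempty proper prefix to test.
      by_cases hj : q + 1 < j
      · have := (hL (j - 1) (by omega) (by omega)).1 (h₃ hj)
        omega
      · omega
    rcases h₄ with h₄ | h₄
    · rw [hL j (by omega) h₂] at h₄
      omega
    · omega
  · intro hj
    refine ⟨by omega, by omega, by omega, fun h => ?_, ?_⟩
    · exact (hL (j - 1) (by omega) (by omega)).2 (by omega)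
    · by_cases hjR : j = R.length
      · exact Or.inr hjR
      · left
        rw [hL j (by omega) (by omega)]
        omega

/-- The ends of the phrases of the reference are the iterates of the step. -/
theorem lz77End_iff {R : List ℕ} {f : ℕ → ℕ} (hR : R ≠ [])
    (hlt : ∀ q, q < R.length → q < f q) (hend : f R.length = R.length)
    (hf : ∀ q j, q < R.length → (IsLZ77Phrase R (q + 1) j ↔ j = f q)) (b : ℕ) :
    LZ77End R b ↔ ∃ j, 1 ≤ j ∧ j ≤ R.length ∧ f^[j] 0 = b := by
  have hRl : 1 ≤ R.length := List.length_pos_iff.2 hR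
  have hle : ∀ q, q < R.length → f q ≤ R.length := fun q hq => ((hf q _ hq).2 rfl).2.2.1
  have hstart : ∀ a, LZ77Start R a → ∃ m, f^[m] 0 + 1 = a := by
    intro a ha
    induction ha with
    | first => exact ⟨0, rfl⟩
    | @next a j hs hp ih =>
      obtain ⟨m, rfl⟩ := ih
      have hl : f^[m] 0 < R.length := by have := hp.2.1; have := hp.2.2.1; omega
      refine ⟨m + 1, ?_⟩
      rw [Function.iterate_succ_apply', ← (hf _ _ hl).1 hp]
  have hle' : ∀ m, f^[m] 0 ≤ R.length := fun m => by
    induction m with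
    | zero => simp
    | succ m ih =>
      rw [Function.iterate_succ_apply']
      rcases ih.lt_or_eq with h | h
      · exact hle _ h
      · rw [h, hend]
  -- Each jump before the end advances, so `R.length` jumps suffice.
  have hm : ∀ m, f^[m] 0 < R.length → m ≤ f^[m] 0 := by
    intro m
    induction m with
    | zero => intro _; omega
    | succ m ih =>
      intro hl
      rw [Function.iterate_succ_apply'] at hl ⊢
      by_cases hl' : f^[m] 0 < R.length
      · have := ih hl'; have := hlt _ hl'; omega
      · have := hle' m
        rw [show f^[m] 0 = R.length by omega, hend] at hl
        omega
  constructor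
  · rintro ⟨a, ha, hp⟩
    obtain ⟨m, rfl⟩ := hstart a ha
    have hl : f^[m] 0 < R.length := by have := hp.2.1; have := hp.2.2.1; omega
    refine ⟨m + 1, by omega, by have := hm m hl; omega, ?_⟩
    rw [Function.iterate_succ_apply', ← (hf _ _ hl).1 hp]
  · rintro ⟨j, hj, -, rfl⟩
    obtain ⟨j, rfl⟩ := Nat.exists_eq_add_of_le' hj
    clear hj
    have hnext : ∀ q, LZ77Start R (q + 1) → q < R.length → LZ77End R (f q) := fun q hs hq =>
      ⟨q + 1, hs, (hf q _ hq).2 rfl⟩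
    induction j with
    | zero => exact hnext 0 .first (by omega)
    | succ j ih =>
      obtain ⟨a, hs, hp⟩ := ih
      rw [Function.iterate_succ_apply']
      rcases hp.2.2.1.lt_or_eq with h | h
      · exact hnext _ (.next hs hp) h
      -- At the end of `R` further jumps repeat the last boundary.
      · rw [h] at hp ⊢
        rw [hend]
        exact ⟨a, hs, hp⟩

end RLZ

namespace RLZ

/-! ## Correctness of the answer -/

theorem occursAt_succ_iff {T P : List ℕ} {s : ℕ} :
    OccursAt T P (s + 1) ↔ s ≤ T.length ∧ P <+: T.drop s := by
  have e : factor T (s + 1) (s + 1 + P.length - 1) = (T.drop s).take P.length := by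
    rw [factor, List.drop_take]; congr 1; omega
  rw [OccursAt, e]
  constructor
  · rintro ⟨-, h₂, h₃⟩
    exact ⟨by omega, h₃ ▸ List.take_prefix _ _⟩
  · rintro ⟨h₁, h₂⟩
    have := h₂.length_le
    rw [List.length_drop] at this
    exact ⟨by omega, by omega, (List.prefix_iff_eq_take.1 h₂).symm⟩

/-- Both sides say that `P` lies in `T` with its split point at `b`; `i ≤ b` guards the truncated
subtraction. -/
theorem split_iff {T P : List ℕ} {i b : ℕ} (hi : i ≤ P.length) (hb : b ≤ T.length) :
    (P.take i <:+ T.take b ∧ P.drop i <+: T.drop b) ↔ i ≤ b ∧ P <+: T.drop (b - i) := by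
  constructor
  · rintro ⟨⟨X, hX⟩, W, hW⟩
    have hl := congrArg List.length hX
    simp only [List.length_append, List.length_take, min_eq_left hi, min_eq_left hb] at hl
    refine ⟨by omega, W, ?_⟩
    have hT : T = X ++ (P ++ W) := by
      conv_lhs => rw [← List.take_append_drop b T, ← hX, ← hW]
      rw [List.append_assoc, ← List.append_assoc (P.take i), List.take_append_drop]
    rw [hT, List.drop_left' (by omega)]
  · rintro ⟨hib, W, hW⟩
    have hT : T = (T.take (b - i) ++ P.take i) ++ (P.drop i ++ W) := by
      rw [List.append_assoc, ← List.append_assoc (P.take i), List.take_append_drop, hW,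
        List.take_append_drop]
    have hl : (T.take (b - i) ++ P.take i).length = b := by
      rw [List.length_append, List.length_take, List.length_take]; omega
    have h₁ : T.take b = T.take (b - i) ++ P.take i := by
      conv_lhs => rw [hT]
      rw [List.take_left' hl]
    have h₂ : T.drop b = P.drop i ++ W := by
      conv_lhs => rw [hT]
      rw [List.drop_left' hl]
    exact ⟨⟨_, h₁.symm⟩, ⟨_, h₂.symm⟩⟩

variable {E : Env} {P : List ℕ} {i : ℕ} {A : ℕ → ℕ → ℕ} {rk lpf fl : ℕ → ℕ}

/-- In the sorted array `Env.below` holds exactly on an initial segment, whose length the binary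
search finds. A candidate length `c` is tested at its last entry, `c - 1`. -/
theorem Clean.lt_patRank_iff (h : Clean E P i) (hT : Tables E A rk lpf fl)
    (hN : E.N ≤ E.T.length + 1) (hi : i ≤ P.length) {d : ℕ} (hd : d ≤ 1) (tie : Bool) {r : ℕ}
    (hr : r < E.N) : r < E.patRank P i d tie (A d) ↔
      (patStr P i d <+: E.str d (E.pos (A d r)) ∧ tie = true) ∨
        ¬ patStr P i d ≤ E.str d (E.pos (A d r)) := by
  have hb : ∀ r, E.below P i d tie (E.pos (A d r)) = true ↔ _ := fun r =>
    E.below_iff hd (h.pos_le _) hi h.two_pow h.char_lt (h.pat d hd _ (h.pos_le _)) tie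
  obtain ⟨m, hm, hg⟩ := exists_bound_of_antitone
    (g := fun r => E.below P i d tie (E.pos (A d r)) = true) E.N (by
      intro a b hab hbN hgb
      have hs := h.sorted hT hd hab.le hbN
      rw [hb] at hgb ⊢
      by_cases hle : patStr P i d ≤ E.str d (E.pos (A d a))
      · rcases hgb with ⟨h₁, h₂⟩ | h₁
        · exact Or.inl ⟨prefix_of_le_of_le hle hs h₁, h₂⟩
        · exact absurd (hle.trans hs) h₁
      · exact Or.inr hle)
  have he : E.patRank P i d tie (A d) = m := by
    have := h.two_pow
    refine bsAux_eq _ _ hm (fun c hc hcN => ?_) (Nat.zero_le _) (by rw [pow_succ]; omega)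
    rw [hg (c - 1) (by omega)]
    omega
  rw [he, ← hg r hr, hb]

/-- With `tie = false` the smaller items are counted, with `tie = true` also those that begin with
the pattern; the items in between are the matches. -/
theorem Clean.mem_range_iff (h : Clean E P i) (hT : Tables E A rk lpf fl)
    (hN : E.N ≤ E.T.length + 1) (hi : i ≤ P.length) {d : ℕ} (hd : d ≤ 1) {r : ℕ} (hr : r < E.N) :
    E.patLo P i d A ≤ r ∧ r < E.patHi P i d A ↔ patStr P i d <+: E.str d (E.pos (A d r)) := by
  have h₁ := h.lt_patRank_iff hT hN hi hd true hr
  have h₂ := h.lt_patRank_iff hT hN hi hd false hr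
  simp only [and_true, Bool.false_eq_true, and_false, false_or] at h₁ h₂
  rw [Env.patLo, Env.patHi]
  constructor
  · rintro ⟨h₃, h₄⟩
    have : ¬ r < E.patRank P i d false (A d) := by omega
    rw [h₂] at this
    exact (h₁.1 h₄).resolve_right this
  · intro hp
    have hle : patStr P i d ≤ E.str d (E.pos (A d r)) := by
      rw [le_iff_lcpLen, lcpLen_comm]; exact Or.inl ((prefix_iff_lcpLen _ _).1 hp)
    have h₃ := h₁.2 (Or.inl hp)
    have : ¬ r < E.patRank P i d false (A d) := by rw [h₂]; exact not_not.2 hle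
    exact ⟨by omega, h₃⟩

/-- An interval of first coordinates expresses the match to the left of the split, one of second
coordinates the match to the right. -/
theorem Clean.rect_iff (h : Clean E P i) (hT : Tables E A rk lpf fl)
    (hN : E.N ≤ E.T.length + 1) (hi : i ≤ P.length) (w : ℕ) :
    Rect (fun x => rk (A 1 x)) (fun x => fl (A 1 x)) (E.patLo P i 1 A) (E.patHi P i 1 A)
      (E.patLo P i 0 A) (E.patHi P i 0 A) w ↔
    ∃ q < E.N, i ≤ E.pos q ∧ P <+: E.T.drop (E.pos q - i) ∧ fl q = w := by
  have hst : ∀ q, (patStr P i 1 <+: E.str 1 (E.pos q) ∧ patStr P i 0 <+: E.str 0 (E.pos q)) ↔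
      i ≤ E.pos q ∧ P <+: E.T.drop (E.pos q - i) := by
    intro q
    rw [← split_iff hi (h.pos_le q)]
    simp [patStr, Env.str, List.reverse_prefix]
  obtain ⟨rk₁, h₁⟩ := exists_rank (hT.perm 1 le_rfl)
  constructor
  · rintro ⟨x, a₁, a₂, c₁, c₂, rfl⟩
    have hx : x < E.N := a₂.trans_le (bsAux_le _ _ (Nat.zero_le _))
    have hq := h₁.lt x hx
    have h₂ := (h.mem_range_iff hT hN hi le_rfl hx).1 ⟨a₁, a₂⟩
    have h₃ := (h.mem_range_iff hT hN hi (d := 0) (by omega) (hT.rank.rk_lt _ hq)).1 ⟨c₁, c₂⟩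
    rw [hT.rank.a_rk _ hq] at h₃
    have := (hst _).1 ⟨h₂, h₃⟩
    exact ⟨A 1 x, hq, this.1, this.2, rfl⟩
  · rintro ⟨q, hq, hib, hP, rfl⟩
    have h₂ := (hst q).2 ⟨hib, hP⟩
    have e : A 1 (rk₁ q) = q := h₁.a_rk q hq
    have h₃ := (h.mem_range_iff hT hN hi le_rfl (h₁.rk_lt q hq)).2 (by rw [e]; exact h₂.1)
    have h₄ := (h.mem_range_iff hT hN hi (d := 0) (by omega) (hT.rank.rk_lt q hq)).2
      (by rw [hT.rank.a_rk q hq]; exact h₂.2)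
    exact ⟨rk₁ q, h₃.1, h₃.2, by simpa only [e] using h₄.1, by simpa only [e] using h₄.2, by simp only [e]⟩

variable {R S : List ℕ} {Z : List (ℕ × ℕ)} {p x : ℕ}

/-- Boundaries inside the reference are iterates of `Env.step`, identified by `lz77End_iff`; all
items beyond `ℓ` end RLZ phrases. -/
theorem Clean.isBoundary_iff (h : IsRLZParse R S Z) (hR : R ≠ [])
    (hC : Clean (parseEnv R S Z p x) P i) (hT : Tables (parseEnv R S Z p x) A rk lpf fl) (b : ℕ) :
    IsBoundary R Z b ↔ ∃ q < (parseEnv R S Z p x).N, fl q = q ∧ (parseEnv R S Z p x).pos q = b := by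
  set E := parseEnv R S Z p x with hE
  have hN : E.N = R.length + Z.length + 1 := rfl
  have hl : E.ℓ = R.length := rfl
  have hend : LZ77End R b ↔ ∃ j, 1 ≤ j ∧ j ≤ R.length ∧ (E.step lpf)^[j] 0 = b := by
    refine lz77End_iff hR (fun q hq => ?_) ?_ (fun q j hq => ?_) b
    · rw [Env.step, hl]; omega
    · rw [Env.step, hl]; omega
    · rw [Env.step, hl]
      refine isLZ77Phrase_iff hq fun j hj hjR => ?_
      rw [occurs_factor_iff (S := S) hj hjR, hC.le_lpf_iff hT (by omega) (by omega)]
      have hp : ∀ a ≤ R.length, E.pos a = a := fun a ha => parseEnv_pos_of_le ha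
      constructor <;> rintro ⟨s, hs, h'⟩ <;> refine ⟨s, hs, ?_⟩
      · rw [hp _ hq.le, hp _ (by omega)]; exact h'
      · rw [hp _ hq.le, hp _ (by omega)] at h'; exact h'
  rw [IsBoundary, hend]
  constructor
  · rintro (⟨j, h₁, h₂, rfl⟩ | ⟨k, h₁, h₂, rfl⟩)
    · have := E.step_iterate_le lpf j
      exact ⟨_, by omega, (hT.val _ (by omega)).2.2.2 (Or.inr ⟨j, h₁, h₂, rfl⟩),
        parseEnv_pos_of_le this⟩
    · exact ⟨R.length + k, by omega, (hT.val _ (by omega)).2.2.2 (Or.inl (by omega)),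
        parseEnv_pos_add k⟩
  · rintro ⟨q, hq, hfl, rfl⟩
    rcases (hT.val q hq).2.2.1 hfl with h' | ⟨j, h₁, h₂, rfl⟩
    · obtain ⟨k, rfl⟩ := Nat.exists_eq_add_of_le (hl ▸ h'.le)
      exact Or.inr ⟨k, by omega, by omega, parseEnv_pos_add k⟩
    · exact Or.inl ⟨j, h₁, h₂, (parseEnv_pos_of_le (E.step_iterate_le lpf j)).symm⟩

/-- Occurrences start at `pos q - i + 1` and `pos` increases, so the least boundary item gives the
leftmost one. A minimum of `E.N` means that there is no boundary among the matches. -/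
theorem Clean.isAnswer (h : IsRLZParse R S Z) (hR : R ≠ []) (hi : i ≤ P.length)
    (hN : (parseEnv R S Z p x).N ≤ (R ++ S).length + 1)
    (hC : Clean (parseEnv R S Z p x) P i) (hT : Tables (parseEnv R S Z p x) A rk lpf fl) {w : ℕ}
    (hw : IsMinOf (parseEnv R S Z p x).N (Rect (fun x => rk (A 1 x)) (fun x => fl (A 1 x))
      ((parseEnv R S Z p x).patLo P i 1 A) ((parseEnv R S Z p x).patHi P i 1 A)
      ((parseEnv R S Z p x).patLo P i 0 A) ((parseEnv R S Z p x).patHi P i 0 A)) w) :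
    IsAnswer R S Z P i ((parseEnv R S Z p x).answer i w) := by
  set E := parseEnv R S Z p x with hE
  have hrect := hC.rect_iff hT hN hi
  have hsplit : ∀ s, SplitOccursAt R S Z P i s ↔ ∃ q < E.N, fl q = q ∧ i ≤ E.pos q ∧
      P <+: E.T.drop (E.pos q - i) ∧ s = E.pos q - i + 1 := by
    intro s
    rw [SplitOccursAt, hC.isBoundary_iff h hR hT]
    constructor
    · rintro ⟨ho, q, hq, hfl, hb⟩
      obtain ⟨s, rfl⟩ := Nat.exists_eq_add_of_le' ho.1
      have e : E.pos q - i = s := by rw [← hE] at hb; omega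
      exact ⟨q, hq, hfl, by rw [← hE] at hb; omega, by rw [e]; exact (occursAt_succ_iff.1 ho).2, by rw [e]⟩
    · rintro ⟨q, hq, hfl, hib, hP, rfl⟩
      have := hC.pos_le q
      exact ⟨occursAt_succ_iff.2 ⟨by change _ ≤ E.T.length; omega, hP⟩, q, hq, hfl, by rw [← hE]; omega⟩
  have hmin : ∀ q < E.N, fl q = q → i ≤ E.pos q → P <+: E.T.drop (E.pos q - i) → w ≤ q :=
    fun q hq hfl hib hP => hw.min q ((hrect q).2 ⟨q, hq, hib, hP, hfl⟩)
  rw [Env.answer]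
  split_ifs with hwN hiw
  · right
    obtain ⟨q, hq, hib, hP, hfl⟩ := (hrect w).1 (hw.mem.resolve_left (by omega))
    -- A value other than `E.N` is the number of its own item.
    obtain rfl : w = q := by have := (hT.val q hq).2.1; omega
    refine ⟨(hsplit _).2 ⟨w, hq, hfl, hib, hP, by omega⟩, fun s hs => ?_⟩
    obtain ⟨q', hq', hfl', hib', hP', rfl⟩ := (hsplit s).1 hs
    have hle := hmin q' hq' hfl' hib' hP'
    have : E.pos w ≤ E.pos q' := by
      rcases hle.lt_or_eq with hlt | rfl
      · exact (parseEnv_pos_lt h w q' hlt hq').le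
      · exact le_rfl
    omega
  · obtain ⟨q, hq, hib, hP, hfl⟩ := (hrect w).1 (hw.mem.resolve_left (by omega))
    obtain rfl : w = q := by have := (hT.val q hq).2.1; omega
    omega
  · refine Or.inl ⟨rfl, fun s hs => ?_⟩
    obtain ⟨q', hq', hfl', hib', hP', rfl⟩ := (hsplit s).1 hs
    have := hmin q' hq' hfl' hib' hP'
    omega

theorem isAnswer_zero_of_length_lt (hP : (R ++ S).length < P.length) : IsAnswer R S Z P i 0 :=
  Or.inl ⟨rfl, fun s hs => by have := hs.1.1; have := hs.1.2.1; omega⟩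

end RLZ

namespace RLZ

/-! ## The number of bases with collisions -/

open Polynomial in
/-- The hash of a string as a polynomial in the base. -/
noncomputable def hashPoly (p : ℕ) (U : List ℕ) : (ZMod p)[X] :=
  U.foldl (fun h c => h * X + C (c : ZMod p)) 0

open Polynomial in
theorem hashPoly_concat (p : ℕ) (U : List ℕ) (c : ℕ) :
    hashPoly p (U ++ [c]) = hashPoly p U * X + C (c : ZMod p) := by
  simp [hashPoly]

theorem eval_hashPoly (p x : ℕ) (U : List ℕ) :
    (hashPoly p U).eval (x : ZMod p) = (krHash p x U : ZMod p) := by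
  induction U using List.reverseRecOn with
  | nil => simp [hashPoly, krHash]
  | append_singleton U c ih =>
    rw [hashPoly_concat, krHash_concat]
    simp [ih]

theorem natDegree_hashPoly_le (p : ℕ) (U : List ℕ) : (hashPoly p U).natDegree ≤ U.length := by
  induction U using List.reverseRecOn with
  | nil => simp [hashPoly]
  | append_singleton U c ih =>
    rw [hashPoly_concat, List.length_append, List.length_singleton]
    refine Polynomial.natDegree_add_le_of_degree_le ?_ (by simp)
    exact Polynomial.natDegree_mul_le.trans
      (add_le_add ih Polynomial.natDegree_X_le)

/-- The constant coefficient gives the last character, and cancelling `X` gives the rest. -/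
theorem hashPoly_injective {p : ℕ} {U V : List ℕ} (hl : U.length = V.length)
    (hU : ∀ c ∈ U, c < p) (hV : ∀ c ∈ V, c < p) (h : hashPoly p U = hashPoly p V) : U = V := by
  induction U using List.reverseRecOn generalizing V with
  | nil => exact (List.length_eq_zero_iff.1 hl.symm).symm
  | append_singleton U c ih =>
    induction V using List.reverseRecOn with
    | nil => simp at hl
    | append_singleton V c' _ =>
      rw [hashPoly_concat, hashPoly_concat] at h
      have h₀ := congrArg (fun f => Polynomial.coeff f 0) h
      simp at h₀
      have hcc : c = c' := (natCast_eq_iff_of_lt (hU c (by simp)) (hV c' (by simp))).1 h₀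
      subst hcc
      have hX := add_right_cancel h
      have : hashPoly p U = hashPoly p V := by
        ext n
        simpa using congrArg (fun f => Polynomial.coeff f (n + 1)) hX
      rw [ih (by simpa using hl) (fun a ha => hU a (by simp [ha])) (fun a ha => hV a (by simp [ha]))
        this]

/-- Colliding bases are roots of the difference of the two hash polynomials, which is nonzero of
degree at most the common length. -/
theorem card_collisions_le {p : ℕ} (hp : p.Prime) {U V : List ℕ} (hl : U.length = V.length)
    (hU : ∀ c ∈ U, c < p) (hV : ∀ c ∈ V, c < p) (hne : U ≠ V) :
    ((Finset.range p).filter fun x => krHash p x U = krHash p x V).card ≤ U.length := by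
  have := Fact.mk hp
  have h0 : hashPoly p U - hashPoly p V ≠ 0 := fun h =>
    hne (hashPoly_injective hl hU hV (sub_eq_zero.1 h))
  have hdeg : (hashPoly p U - hashPoly p V).natDegree ≤ U.length :=
    (Polynomial.natDegree_sub_le _ _).trans
      (max_le (natDegree_hashPoly_le p U) (hl ▸ natDegree_hashPoly_le p V))
  refine le_trans (Finset.card_le_card_of_injOn
    (t := (hashPoly p U - hashPoly p V).roots.toFinset) (fun x => (x : ZMod p)) ?_ ?_)
    ((Multiset.toFinset_card_le _).trans ((Polynomial.card_roots' _).trans hdeg))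
  · intro x hx
    simp only [Finset.coe_filter, Finset.mem_range, Set.mem_ofPred_eq] at hx
    simp only [Finset.mem_coe, Multiset.mem_toFinset, Polynomial.mem_roots h0,
      Polynomial.IsRoot, Polynomial.eval_sub, eval_hashPoly, hx.2, _root_.sub_self]
  · intro x hx y hy e
    simp only [Finset.coe_filter, Finset.mem_range, Set.mem_ofPred_eq] at hx hy
    exact (natCast_eq_iff_of_lt hx.1 hy.1).1 e

theorem card_dirHash_collisions_le {p : ℕ} (hp : p.Prime) (d : ℕ) {U V : List ℕ}
    (hl : U.length = V.length) (hU : ∀ c ∈ U, c < p) (hV : ∀ c ∈ V, c < p) (hne : U ≠ V) :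
    ((Finset.range p).filter fun x => dirHash p x d U = dirHash p x d V).card ≤ U.length := by
  by_cases hd : d = 0
  · simp only [dirHash, hd, if_true]
    exact card_collisions_le hp hl hU hV hne
  · simp only [dirHash, hd, if_false]
    have := card_collisions_le hp (U := U.reverse) (V := V.reverse) (by simpa using hl)
      (by simpa using hU) (by simpa using hV) (by simpa using hne)
    simpa using this

/-- Among the prefixes of `m` strings of length at most `n`, at most `2 m² (n + 1) n` bases have
collisions. -/
theorem card_bad_le {p : ℕ} (hp : p.Prime) (F : ℕ → ℕ → List ℕ) (m n : ℕ)
    (hF : ∀ d a, ∀ c ∈ F d a, c < p) (hn : ∀ d a, (F d a).length ≤ n) :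
    {x | x < p ∧ ¬ ∀ d < 2, ∀ a < m, ∀ b < m, NoColl p x d (F d a) (F d b)}.ncard ≤
      2 * m * m * (n + 1) * n := by
  classical
  set B : Finset ℕ := (Finset.range 2 ×ˢ Finset.range m ×ˢ Finset.range m ×ˢ
      Finset.range (n + 1)).biUnion fun t => (Finset.range p).filter fun x =>
        t.2.2.2 ≤ (F t.1 t.2.1).length ∧ t.2.2.2 ≤ (F t.1 t.2.2.1).length ∧
        (F t.1 t.2.1).take t.2.2.2 ≠ (F t.1 t.2.2.1).take t.2.2.2 ∧
        dirHash p x t.1 ((F t.1 t.2.1).take t.2.2.2) =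
          dirHash p x t.1 ((F t.1 t.2.2.1).take t.2.2.2) with hB
  have hsub : {x | x < p ∧ ¬ ∀ d < 2, ∀ a < m, ∀ b < m, NoColl p x d (F d a) (F d b)} ⊆
      (B : Set ℕ) := by
    rintro x ⟨hx, hbad⟩
    simp only [NoColl] at hbad
    push Not at hbad
    obtain ⟨d, hd, a, ha, b, hb, len, h₁, h₂, h₃, h₄⟩ := hbad
    rw [Finset.mem_coe, hB, Finset.mem_biUnion]
    have := hn d a
    refine ⟨(d, a, b, len), by simp; omega, ?_⟩
    rw [Finset.mem_filter]
    exact ⟨Finset.mem_range.2 hx, h₁, h₂, h₄, h₃⟩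
  refine (Set.ncard_le_ncard hsub B.finite_toSet).trans ?_
  rw [Set.ncard_coe_finset]
  refine (Finset.card_biUnion_le_card_mul _ _ n fun t _ => ?_).trans ?_
  · by_cases hc : t.2.2.2 ≤ (F t.1 t.2.1).length ∧ t.2.2.2 ≤ (F t.1 t.2.2.1).length ∧
        (F t.1 t.2.1).take t.2.2.2 ≠ (F t.1 t.2.2.1).take t.2.2.2
    · have hle := card_dirHash_collisions_le hp t.1
        (U := (F t.1 t.2.1).take t.2.2.2) (V := (F t.1 t.2.2.1).take t.2.2.2)
        (by simp [hc.1, hc.2.1]) (fun c h => hF _ _ c (List.mem_of_mem_take h))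
        (fun c h => hF _ _ c (List.mem_of_mem_take h)) hc.2.2
      have := hn t.1 t.2.1
      refine (Finset.card_le_card fun x hx => ?_).trans (hle.trans ?_)
      · rw [Finset.mem_filter] at hx ⊢
        exact ⟨hx.1, hx.2.2.2.2⟩
      · rw [List.length_take]; omega
    · rw [Finset.filter_false_of_mem fun x _ h => hc ⟨h.1, h.2.1, h.2.2.1⟩]
      simp
  · simp only [Finset.card_product, Finset.card_range]
    apply le_of_eq; ring

variable {R S : List ℕ} {Z : List (ℕ × ℕ)} {p : ℕ}

/-- The pattern joins the `n + 1` strings of the text as string number `n + 1`. None of these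
strings depends on the base, so `parseEnv R S Z p 0` may serve for all. -/
theorem ncard_not_clean_le (h : IsRLZParse R S Z) (hp : p.Prime) (hR : ∀ c ∈ R, c < p)
    {P : List ℕ} {i : ℕ} (hP : ∀ c ∈ P, c < p) (hPn : P.length ≤ (R ++ S).length) :
    {x | x < p ∧ ¬ Clean (parseEnv R S Z p x) P i}.ncard ≤
      2 * ((R ++ S).length + 2) * ((R ++ S).length + 2) * ((R ++ S).length + 1) *
        (R ++ S).length := by
  set n := (R ++ S).length with hn
  set F : ℕ → ℕ → List ℕ := fun d a =>
    if a ≤ n then (parseEnv R S Z p 0).str d a else patStr P i d with hF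
  have hT : ∀ c ∈ R ++ S, c < p := fun c hc => by
    rcases List.mem_append.1 hc with hc | hc
    · exact hR c hc
    · exact hR c (h.mem hc)
  refine le_trans (Set.ncard_le_ncard ?_ ((Set.finite_lt_nat p).subset fun x hx => hx.1))
    (card_bad_le hp F (n + 2) n ?_ ?_)
  · rintro x ⟨hx, hbad⟩
    refine ⟨hx, fun hgood => hbad ⟨Nat.le_pow_clog (by omega) _, hT, parseEnv_pos_le h, ?_, ?_⟩⟩
    · intro d hd a ha b hb
      have := hgood d (by omega) a (by change a ≤ n at ha; omega) b (by change b ≤ n at hb; omega)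
      simp only [hF, show a ≤ n from ha, show b ≤ n from hb, if_true] at this
      exact this
    · intro d hd a ha
      have := hgood d (by omega) a (by change a ≤ n at ha; omega) (n + 1) (by omega)
      simp only [hF, show a ≤ n from ha, show ¬ n + 1 ≤ n by omega, if_true, if_false] at this
      exact this
  · intro d a c hc
    simp only [hF] at hc
    split_ifs at hc
    · simp only [Env.str] at hc
      split_ifs at hc
      · exact hT c (List.mem_of_mem_drop hc)
      · exact hT c (List.mem_of_mem_take (List.mem_reverse.1 hc))
    · simp only [patStr] at hc
      split_ifs at hc
      · exact hP c (List.mem_of_mem_drop hc)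
      · exact hP c (List.mem_of_mem_take (List.mem_reverse.1 hc))
  · intro d a
    have e : (parseEnv R S Z p 0).T.length = n := rfl
    simp only [hF]
    split_ifs
    · simp only [Env.str]
      split_ifs <;> simp <;> omega
    · simp only [patStr]
      split_ifs <;> simp <;> omega

end RLZ

namespace RLZ

/-! ## Time bounds -/

theorem forLoop_bigDepth (r rb : ℕ) (body : Cmd) :
    (forLoop r rb body).bigDepth = body.bigDepth + if 220 ≤ rb then 1 else 0 := by
  by_cases h : 220 ≤ rb <;> simp [forLoop, Cmd.bigDepth, Expr.isBig, h]

theorem halvingLoop_bigDepth (r : ℕ) (body : Cmd) : (halvingLoop r body).bigDepth = body.bigDepth := by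
  simp [halvingLoop, Cmd.bigDepth, Expr.isBig]

theorem fillLoop_bigDepth (r rb a : ℕ) (e : Expr) :
    (fillLoop r rb a e).bigDepth = if 220 ≤ rb then 1 else 0 := by
  simp [fillLoop, forLoop_bigDepth, Cmd.bigDepth]

theorem minCmd_bigDepth (r : ℕ) (e₁ e₂ : Expr) : (minCmd r e₁ e₂).bigDepth = 0 := by
  simp [minCmd, Cmd.bigDepth]

theorem powCmd_bigDepth : powCmd.bigDepth = 0 := by
  simp [powCmd, Cmd.bigDepth, halvingLoop_bigDepth]

theorem bsCmd_bigDepth (r : ℕ) (probe : Cmd) (flag : Expr) :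
    (bsCmd r probe flag).bigDepth = probe.bigDepth := by
  simp [bsCmd, Cmd.bigDepth, halvingLoop_bigDepth]

theorem prefixCmd_bigDepth (q : Bool) : (prefixCmd q).bigDepth = 0 := by
  simp [prefixCmd, Cmd.bigDepth, bsCmd_bigDepth, powCmd_bigDepth]

theorem subCmd_bigDepth (q : Bool) : (subCmd q).bigDepth = 0 := by
  simp [subCmd, Cmd.bigDepth, prefixCmd_bigDepth, powCmd_bigDepth]

theorem twoFrags_bigDepth (q : Bool) (b₁ b₂ l : Expr) : (twoFrags q b₁ b₂ l).bigDepth = 0 := by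
  simp [twoFrags, fragCmd, Cmd.bigDepth, subCmd_bigDepth]

theorem cmpCmd_bigDepth (q : Bool) : (cmpCmd q).bigDepth = 0 := by
  simp [cmpCmd, Cmd.bigDepth, bsCmd_bigDepth, twoFrags_bigDepth]

theorem sortCmd_bigDepth (a : ℕ) : (sortCmd a).bigDepth = 1 := by
  simp [sortCmd, mergeCmd, Cmd.bigDepth, fillLoop_bigDepth, forLoop_bigDepth, minCmd_bigDepth,
    cmpCmd_bigDepth, Expr.isBig]

theorem tablesCmd_bigDepth : tablesCmd.bigDepth = 1 := by
  simp [tablesCmd, rankCmd, linkCmd, lpfCmd, flagCmd, nearCmd, Cmd.bigDepth, fillLoop_bigDepth,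
    forLoop_bigDepth, minCmd_bigDepth, cmpCmd_bigDepth, sortCmd_bigDepth]

theorem levelsCmd_bigDepth : levelsCmd.bigDepth = 1 := by
  simp [levelsCmd, spreadCmd, blocksCmd, treeCmd, Cmd.bigDepth, fillLoop_bigDepth,
    forLoop_bigDepth, minCmd_bigDepth]

theorem build_bigDepth : build.bigDepth = 1 := by
  simp [build, initCmd, refCmd, phrasesCmd, sizesCmd, paramsCmd, clogCmd, Cmd.bigDepth,
    Expr.isBig, forLoop_bigDepth, tablesCmd_bigDepth, levelsCmd_bigDepth, powCmd_bigDepth]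

/-- A constant that bounds the sizes of both programs. -/
theorem exists_const : ∃ C, 64 ≤ C ∧
    (∀ I L m, 1 ≤ L → 1 ≤ m → I ≤ 4 * m → ∀ J ≤ 32 * L,
      build.costB I J ≤ L * (C * m ^ C)) ∧
    ∀ I m, 1 ≤ m → I ≤ 4 * m → query.costB I I ≤ C * m ^ C := by
  have hb := build_bigDepth
  have hcb : ∀ I J, _ := fun I J => Cmd.costB_le (I := I) (J := J) build
  have hcq : ∀ I, _ := fun I => Cmd.costB_le (I := I) (J := I) query
  simp only [hb, pow_one, max_self] at hcb hcq
  generalize build.size = sb at *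
  generalize build.depth = db at *
  generalize query.size = sq at *
  generalize query.depth = dq at *
  generalize query.bigDepth = bq at *
  -- `5` comes from `I + 1 ≤ 5m` and `37` from `4m + 32L + 1 ≤ 37mL`. The sum dominates the factors
  -- and the exponents at once; `64` is for memory and word length.
  refine ⟨64 + 37 * sb * 5 ^ db + (db + 1) + sq * 5 ^ (dq + bq) + (dq + bq), by omega, ?_, ?_⟩
  · intro I L m hL hm hI J hJ
    refine (hcb I J).trans ?_
    have h₁ : I + 1 ≤ 5 * m := by omega
    have h₂ : max I J + 1 ≤ 37 * (m * L) := by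
      have : m ≤ m * L := Nat.le_mul_of_pos_right _ hL
      have : L ≤ m * L := Nat.le_mul_of_pos_left _ hm
      omega
    calc sb * ((I + 1) ^ db * (max I J + 1))
        ≤ sb * ((5 * m) ^ db * (37 * (m * L))) := by gcongr
      _ = L * (37 * sb * 5 ^ db * m ^ (db + 1)) := by rw [mul_pow, pow_succ]; ring
      _ ≤ _ := Nat.mul_le_mul_left _
          (Nat.mul_le_mul (by omega) (Nat.pow_le_pow_right hm (by omega)))
  · intro I m hm hI
    refine (hcq I).trans ?_
    have h₁ : I + 1 ≤ 5 * m := by omega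
    calc sq * ((I + 1) ^ dq * (I + 1) ^ bq)
        = sq * (I + 1) ^ (dq + bq) := by rw [pow_add]
      _ ≤ sq * (5 * m) ^ (dq + bq) := by gcongr
      _ = sq * 5 ^ (dq + bq) * m ^ (dq + bq) := by rw [mul_pow]; ring
      _ ≤ _ := Nat.mul_le_mul (by omega) (Nat.pow_le_pow_right hm (by omega))

/-- The parameters of the wavelet tree. -/
theorem exists_sizes {N n p C w : ℕ} {M : Machine} (hN : 2 ≤ N) (hNn : N ≤ n + 1) (hnp : n ≤ p)
    (hp : 2 ≤ p) (hC : 64 ≤ C) (hw : p ^ C ≤ 2 ^ w) (hMw : M.w = w) (harr : M.arrays = 22)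
    (hcells : M.cells = C * (N - 1)) :
    ∃ D β, WSize M (4 * (Nat.log 2 n + 1)) (8 * 2 ^ D) N D β ∧ 8 * 2 ^ D ≤ 32 * (N - 1) ∧
      (∀ k < D, 2 ^ k < N) ∧ (∀ k < β, 2 ^ k < D + 1) ∧ N + 10 < M.cells ∧
      1000 * (p * p) + 1000 * p + 1000 ≤ M.cap ∧
      Nat.clog 2 (n + 1) + 3 ≤ 4 * (Nat.log 2 n + 1) := by
  have half : ∀ a, 2 ≤ a → 2 ^ Nat.clog 2 a < 2 * a := fun a ha => by
    have h₁ := Nat.pow_pred_clog_lt_self (b := 2) (by omega) (show 1 < a by omega)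
    have h₂ : 0 < Nat.clog 2 a := Nat.clog_pos (by omega) (by omega)
    rw [← Nat.succ_pred_eq_of_pos h₂, pow_succ]
    omega
  have hK : Nat.clog 2 (n + 1) ≤ Nat.log 2 n + 1 :=
    Nat.clog_le_of_le_pow (Nat.lt_pow_succ_log_self (by omega) n)
  have hcells' : 64 * (N - 1) ≤ M.cells := by rw [hcells]; exact Nat.mul_le_mul_right _ hC
  -- Twelve of the factors `p ≥ 2` pay for the constant `4096`, and two remain for products of
  -- residues.
  have hcap : p ^ 14 ≤ M.cap := by
    rw [Machine.cap_eq, hMw]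
    exact (Nat.pow_le_pow_right (by omega) (by omega)).trans hw
  have hcap' : 4096 * (p * p) ≤ M.cap := by
    refine le_trans ?_ hcap
    calc 4096 * (p * p) = 2 ^ 12 * (p * p) := by norm_num
      _ ≤ p ^ 12 * (p * p) := Nat.mul_le_mul_right _ (Nat.pow_le_pow_left hp 12)
      _ = p ^ 14 := by ring
  have hpp : 2 * p ≤ p * p := Nat.mul_le_mul_right _ hp
  obtain ⟨D, hD⟩ : ∃ D, D = Nat.clog 2 N := ⟨_, rfl⟩
  obtain ⟨β, hβ⟩ : ∃ β, β = Nat.clog 2 (D + 1) := ⟨_, rfl⟩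
  have hD1 : 1 ≤ D := hD ▸ Nat.clog_pos (by omega) (by omega)
  have hDN : 2 ^ D < 2 * N := hD ▸ half N hN
  have hβD : 2 ^ β < 2 * (D + 1) := hβ ▸ half (D + 1) (by omega)
  have hDl : D ≤ Nat.log 2 n + 1 := by
    rw [hD]; exact (Nat.clog_mono_right 2 hNn).trans hK
  refine ⟨D, β, ⟨?_, ?_, ?_, by omega, by omega, ?_, ?_, by omega, by omega, le_rfl⟩, by omega,
    fun k hk => Nat.pow_lt_of_lt_clog (hD ▸ hk), fun k hk => Nat.pow_lt_of_lt_clog (hβ ▸ hk),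
    by omega, by omega, by omega⟩
  · rw [hβ]; exact Nat.clog_le_of_le_pow Nat.lt_two_pow_self
  · have := Nat.le_pow_clog (b := 2) (by omega) (D + 1)
    rw [← hβ] at this; omega
  · rw [hD]; exact Nat.le_pow_clog (by omega) N
  -- A block has fewer than `2 (D + 1)` bits, so its word has a value polynomial in `N`.
  · calc 2 ^ 2 ^ β ≤ 2 ^ (2 * D + 1) := Nat.pow_le_pow_right (by omega) (by omega)
      _ = 2 * (2 ^ D * 2 ^ D) := by rw [pow_succ, two_mul, pow_add]; ring
      _ ≤ 2 * ((4 * p) * (4 * p)) := by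
        have : 2 ^ D ≤ 4 * p := by omega
        gcongr
      _ = 32 * (p * p) := by ring
      _ ≤ M.cap := by omega
  · omega

end RLZ

/-! ### Assembling the index, its time bounds and the error bound -/

theorem lemma1 :
    ∃ (k C : ℕ) (build query : RLZ.Cmd),
      -- text `T = R ++ S` with reference `R`, and the parse `Z` of `S` with respect to `R`
      ∀ (R S : List ℕ) (Z : List (ℕ × ℕ)), R ≠ [] → RLZ.IsRLZParse R S Z →
      -- prime modulus of the hash function, and word length
      ∀ (p w : ℕ), p.Prime → (R ++ S).length ≤ p → (∀ c ∈ R, c < p) → p ^ C ≤ 2 ^ w →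
      ∃ index : ℕ → ℕ → List ℕ,
        -- construction, for every base `x` of the hash function
        (∀ x < p, ∃ t ≤ (R.length + Z.length) * RLZ.polylog C (R ++ S).length,
          RLZ.Builds ⟨w, RLZ.buildInput R Z p x, k, C * (R.length + Z.length)⟩
            build t (index x)) ∧
        -- queries
        ∀ (P : List ℕ) (i : ℕ), i ≤ P.length → P.length < 2 ^ w → (∀ c ∈ P, c < p) →
          ∃ out : ℕ → ℕ,
            (∀ x < p, ∃ t ≤ RLZ.polylog C (R ++ S).length,
              RLZ.Returns ⟨w, RLZ.queryInput (index x) P i p x, k,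
                RLZ.polylog C (R ++ S).length⟩ query t (out x)) ∧
            {x | x < p ∧ ¬ RLZ.IsAnswer R S Z P i (out x)}.ncard ≤
              C * (R ++ S).length ^ C := by
  obtain ⟨C, hC, hbuild, hquery⟩ := RLZ.exists_const
  refine ⟨22, C, RLZ.build, RLZ.query, fun R S Z hR hZ p w hp hnp hRp hw => ?_⟩
  have hRl : 1 ≤ R.length := List.length_pos_iff.2 hR
  have hp2 := hp.two_le
  have hzS : R.length + Z.length ≤ (R ++ S).length := hZ.length_le
  have h1n : 1 ≤ (R ++ S).length := by omega
  set n := (R ++ S).length with hn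
  obtain ⟨D, β, hW₀, hJ, hD, hβ, hcells, hcap, hI⟩ := RLZ.exists_sizes
    (M := ⟨w, fun _ => [], 22, C * (R.length + Z.length)⟩) (N := R.length + Z.length + 1)
    (by omega) (Nat.succ_le_succ hzS) hnp hp2 hC hw rfl rfl rfl
  have hW : ∀ x, RLZ.WSize ⟨w, RLZ.buildInput R Z p x, 22, C * (R.length + Z.length)⟩
      (4 * (Nat.log 2 n + 1)) (8 * 2 ^ D) (RLZ.parseEnv R S Z p x).N D β := fun x => { hW₀ with }
  have hWF : ∀ x < p, (RLZ.parseEnv R S Z p x).WF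
      ⟨w, RLZ.buildInput R Z p x, 22, C * (R.length + Z.length)⟩ (4 * (Nat.log 2 n + 1)) :=
    fun x hx => RLZ.parseEnv_wf hZ hR hp2 hx hnp hcap hI
  -- A final state is chosen for every `x`, with a dummy for `x ≥ p`, so that the index becomes a
  -- function of the base.
  have hruns : ∀ x, ∃ s, x < p → (∃ t ≤ (R.length + Z.length) * RLZ.polylog C n,
      RLZ.Exec ⟨w, RLZ.buildInput R Z p x, 22, C * (R.length + Z.length)⟩ RLZ.build RLZ.State.init
        t s) ∧ ∃ rk lpf fl bit val, RLZ.Done (RLZ.parseEnv R S Z p x)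
          ⟨w, RLZ.buildInput R Z p x, 22, C * (R.length + Z.length)⟩ s D β rk lpf fl bit val := by
    intro x
    by_cases hx : x < p
    · obtain ⟨t, s, he, ht, hd⟩ := RLZ.build_runs (hWF x hx)
        (RLZ.parseEnv_buildIn hZ hRp rfl) (hW x) hD hβ (s := RLZ.State.init) (fun _ _ => rfl) hcells
      exact ⟨s, fun _ => ⟨⟨t, ht.trans (hbuild _ _ _ (by omega) (by omega) le_rfl _ hJ), he⟩, hd⟩⟩
    · exact ⟨RLZ.State.init, fun h => absurd h hx⟩
  choose s hs using hruns
  refine ⟨fun x => (s x).dump ⟨w, RLZ.buildInput R Z p x, 22, C * (R.length + Z.length)⟩,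
    fun x hx => ?_, fun P i hi _ hP => ?_⟩
  · obtain ⟨⟨t, ht, he⟩, -⟩ := hs x hx
    exact ⟨t, ht, s x, he, rfl⟩
  · have hq : ∀ x, ∃ o, x < p → (∃ t ≤ RLZ.polylog C n, RLZ.Returns ⟨w, RLZ.queryInput
        ((s x).dump ⟨w, RLZ.buildInput R Z p x, 22, C * (R.length + Z.length)⟩) P i p x, 22,
          RLZ.polylog C n⟩ RLZ.query t o) ∧
        (RLZ.IsAnswer R S Z P i o ∨
          P.length ≤ n ∧ ¬ RLZ.Clean (RLZ.parseEnv R S Z p x) P i) := by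
      intro x
      by_cases hx : x < p
      · obtain ⟨-, rk, lpf, fl, bit, val, hd⟩ := hs x hx
        have hE := (hWF x hx).congr (M' := ⟨w, RLZ.queryInput
          ((s x).dump ⟨w, RLZ.buildInput R Z p x, 22, C * (R.length + Z.length)⟩) P i p x, 22,
          RLZ.polylog C n⟩) rfl
        -- With `J` equal to `I`, no loop of the query gets more than logarithmically many
        -- iterations.
        obtain ⟨t, s', he, ht, m, hm, hmin⟩ := RLZ.query_runs (J := 4 * (Nat.log 2 n + 1))
          (s := RLZ.State.init) hE
          (hd.index (hW x) rfl (fun _ => rfl) (by dsimp only at hcells ⊢; omega)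
            (by change R.length + Z.length + 1 ≤ _; dsimp only at hcells ⊢; omega))
          (P := P) (i := i) ⟨hi, ⟨_, _, rfl⟩, rfl, rfl, rfl⟩
        refine ⟨s'.reg 0, fun _ => ⟨⟨t, ht.trans (hquery _ _ (by omega) le_rfl), s', he, rfl⟩, ?_⟩⟩
        rw [hm]
        split_ifs with hPn
        · exact Or.inl (RLZ.isAnswer_zero_of_length_lt hPn)
        · by_cases hc : RLZ.Clean (RLZ.parseEnv R S Z p x) P i
          · exact Or.inl (hc.isAnswer hZ hR hi hE.N_le hd.tables hmin)
          · exact Or.inr ⟨not_lt.1 hPn, hc⟩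
      · exact ⟨0, fun h => absurd h hx⟩
    choose o ho using hq
    refine ⟨o, fun x hx => (ho x hx).1, ?_⟩
    by_cases hPn : P.length ≤ n
    · have hsub : {x | x < p ∧ ¬ RLZ.IsAnswer R S Z P i (o x)} ⊆
          {x | x < p ∧ ¬ RLZ.Clean (RLZ.parseEnv R S Z p x) P i} := fun x hx =>
        ⟨hx.1, ((ho x hx.1).2.resolve_left hx.2).2⟩
      refine (Set.ncard_le_ncard hsub ((Set.finite_lt_nat p).subset fun x hx => hx.1)).trans
        ((RLZ.ncard_not_clean_le hZ hp hRp hP hPn).trans ?_)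
      rw [← hn]
      calc 2 * (n + 2) * (n + 2) * (n + 1) * n
          ≤ 2 * (3 * n) * (3 * n) * (2 * n) * n := by gcongr <;> omega
        _ = 36 * n ^ 4 := by ring
        _ ≤ C * n ^ C := by
          gcongr
          · omega
          · omega
    -- A pattern longer than the text is answered correctly for every base.
    · have : {x | x < p ∧ ¬ RLZ.IsAnswer R S Z P i (o x)} = ∅ := by
        ext x
        refine ⟨fun hx => ?_, fun hx => hx.elim⟩
        exact absurd ((ho x hx.1).2.resolve_left hx.2).1 hPn
      rw [this]; simp
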